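/- **Setting.** $\mathcal Q$ is the universal UHF algebra with its unique tracial state $\tau_{\mathcal Q}$. Let $B$ be a separable unital C*-algebra with a recursive subhomogeneous decomposition $[B_l,X_l,\Omega_l,r_l,\varphi_l]_{l=1}^R$. That is: $X_l$ is a compact metrizable space, $\Omega_l\subset X_l$ is closed, $r_l\ge 1$, $\Omega_1=\emptyset$, $B_1=C(X_1)\otimes M_{r_1}$, each $\varphi_l:B_l\to C(\Omega_{l+1})\otimes M_{r_{l+1}}$ is a unital $*$-homomorphism, $B_{l+1}$ is the pullback of $\varphi_l$ and of the restriction map $C(X_{l+1})\otimes M_{r_{l+1}}\to C(\Omega_{l+1})\otimes M_{r_{l+1}}$, and $B_R=B$. Projections can be lifted along the decomposition if, for all $N$ and $l<R$, every projection in $B_l\otimes M_N$ lifts to a projection in $B_{l+1}\otimes M_N$. Let $\mathcal F$ be a finite set of positive elements of the unit ball of $B$ and let $\eta>0$. A *weighted $(\mathcal F,\eta)$-excisor* $(E,\rho,\sigma,\kappa)$ consists of a finite-dimensional C*-algebra $E=\bigoplus_{l=1}^R E_l$, a unital $*$-homomorphism $\rho=\bigoplus_l\rho_l:B\to E$, an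 isometric completely positive order zero map $\sigma:E\to B\otimes\mathcal Q$ with $\|\sigma(1_E)(b\otimes 1)-\sigma\rho(b)\|<\eta$ for $b\in\mathcal F$, and a unital $*$-homomorphism $\kappa:E\to\mathcal Q$. It is *compatible* with the decomposition if each $\rho_l$ factorizes as $B\to B_l\to C(\check X_l)\otimes M_{r_l}\to E_l$ for some compact $\check X_l\subset X_l\setminus\Omega_l$, where the first two maps are the canonical quotient map and restriction. Members of a family $(E_j,\rho_j,\sigma_j,\kappa_j)_j$ are *pairwise orthogonal* if there are pairwise orthogonal projections $q_j\in\mathcal Q$ with $\sigma_j(E_j)\subset B\otimes q_j\mathcal Q q_j$. An *$(\mathcal F,\eta)$-bridge* is a finite sequence of compatible weighted $(\mathcal F,\eta)$-excisors such that $\|\kappa\rho(b)-\kappa'\rho'(b)\|<\eta$ for all $b\in\mathcal F$ and any two consecutive members $(E,\rho,\sigma,\kappa)$, $(E',\rho',\sigma',\kappa')$; we write $\sim_{(\mathcal F,\eta)}$ for the relation that such a bridge exists between two excisors. For $x\in X_l$ write the evaluation $\mathrm{ev}_x:B\to M_{r_l}$ as $B\xrightarrow{\rho_x}E_x\hookrightarrow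 M_{r_l}$ with $\rho_x$ surjective, and let $\kappa_x:E_x\to\mathcal Q$ be the restriction of a unital embedding $M_{r_l}\to\mathcal Q$. The decomposition is *$(\mathcal F,\eta)$-connected* if for all $l$ and all $x,y\in X_l$, any (compatible) weighted $(\mathcal F,\eta)$-excisors of the form $(E_x,\rho_x,\sigma_x,\kappa_x)$ and $(E_y,\rho_y,\sigma_y,\kappa_y)$ satisfy $(E_x,\rho_x,\sigma_x,\kappa_x)\sim_{(\mathcal F,\eta)}(E_y,\rho_y,\sigma_y,\kappa_y)$. **Lemma.** Suppose that the decomposition is $(\mathcal F,\eta)$-connected, that projections can be lifted along it, and that $X_l\setminus\Omega_l\ne\emptyset$ for all $l$. Let $n\ge1$ and let $\tau^{(0)},\dots,\tau^{(n-1)}$ be faithful tracial states on $B$ inducing the same map $K_0(B)\to\mathbb R$. Then there are integers $0=K_0<K_1<\dots<K_{n-1}=K$ and pairwise orthogonal compatible weighted $(\mathcal F,\eta)$-excisors $(Q_j,\rho_j,\sigma_j,\kappa_j)$, $j\in\{0,\dots,K\}$, such that $$\|\kappa_j\rho_j(b)-\kappa_{j+1}\rho_{j+1}(b)\|<\eta\quad\text{for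 } b\in\mathcal F,\ 0\le j<K$$ (so that they form $(\mathcal F,\eta)$-bridges from the $K_m$-th to the $K_{m+1}$-th excisor for $0\le m<n-1$), and such that for every $m\in\{0,\dots,n-1\}$ and every projection $q\in Q_{K_m}$ $$(\tau^{(m)}\otimes\tau_{\mathcal Q})\,\sigma_{K_m}(q)\ \ge\ \frac1{n+1}\,\tau_{\mathcal Q}\,\kappa_{K_m}(q).$$ -/

import Mathlib

open scoped ComplexOrder Matrix
open Filter Topology

universe u v w

noncomputable section

/-- The Hilbert space `ℓ²(ℕ)`. -/
abbrev EllTwo : Type := lp (fun _ : ℕ => ℂ) 2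

namespace EllTwo

/-- The standard orthonormal basis of `ℓ²(ℕ)`. -/
def e (k : ℕ) : EllTwo := lp.single 2 k (1 : ℂ)

theorem inner_e (k : ℕ) (x : EllTwo) : inner ℂ (e k) x = x k := by
  simp [e, lp.inner_single_left]

theorem e_apply (k i : ℕ) : e k i = if i = k then 1 else 0 := by
  rw [e, lp.single_apply, Pi.single_apply]

theorem orthonormal_e : Orthonormal ℂ e := by
  rw [orthonormal_iff_ite]
  intro i j
  rw [inner_e, e_apply]

/-- The isometry of `ℓ²(ℕ)` with `e k ↦ e (f k)`, for an injective `f : ℕ → ℕ`. -/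
def isom (f : ℕ → ℕ) (hf : Function.Injective f) : EllTwo →L[ℂ] EllTwo :=
  ((orthonormal_e.comp f hf).orthogonalFamily).linearIsometry.toContinuousLinearMap

theorem isom_e (f : ℕ → ℕ) (hf : Function.Injective f) (k : ℕ) : isom f hf (e k) = e (f k) := by
  simp [isom, e]

theorem ext_e {S T : EllTwo →L[ℂ] EllTwo} (h : ∀ k, S (e k) = T (e k)) : S = T := by
  refine lp.ext_continuousLinearMap (by norm_num) fun k => ?_
  refine ContinuousLinearMap.ext_ring ?_
  simpa [e] using h k

theorem ext_coef {S T : EllTwo →L[ℂ] EllTwo} (h : ∀ i k, S (e k) i = T (e k) i) : S = T :=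
  ext_e fun k => lp.ext (funext fun i => h i k)

/-- The unilateral shift; only used to analyse the trace below. -/
def shift : EllTwo →L[ℂ] EllTwo := isom (fun k => k + 1) (add_left_injective 1)

theorem shift_pow_e (m k : ℕ) : (shift ^ m) (e k) = e (k + m) := by
  induction m generalizing k with
  | zero => simp
  | succ m ih =>
    rw [pow_succ, mul_apply_eq_comp, shift, isom_e, ← shift, ih]
    congr 1
    omega

theorem mul_add_injective {m : ℕ} (i : Fin m) : Function.Injective fun q : ℕ => m * q + i := by
  intro a b h
  have hm : 0 < m := i.pos
  have h' : m * a = m * b := by simpa using h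
  exact Nat.eq_of_mul_eq_mul_left hm h'

/-- The isometry `e q ↦ e (m * q + i)`. -/
def blockIsom {m : ℕ} (i : Fin m) : EllTwo →L[ℂ] EllTwo :=
  isom (fun q => m * q + i) (mul_add_injective i)

/-- The `(i, j)`-th matrix unit of size `m`, acting periodically on `ℓ²(ℕ)`:
`e (m * q + j) ↦ e (m * q + i)` for all `q`, and `e k ↦ 0` if `k` is not `j` modulo `m`.
For fixed `m` these span a unital copy of the matrix algebra `M_m`, which is contained in the copy
of `M_n` whenever `m` divides `n` (as `a ↦ a ⊕ ⋯ ⊕ a`). -/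
def matrixUnit {m : ℕ} (i j : Fin m) : EllTwo →L[ℂ] EllTwo :=
  blockIsom i * star (blockIsom j)

theorem shift_pow_mul_blockIsom {m : ℕ} (i : Fin m) :
    shift ^ m * blockIsom i = blockIsom i * shift := by
  refine ext_e fun k => ?_
  rw [mul_apply_eq_comp, mul_apply_eq_comp, blockIsom, isom_e, shift_pow_e,
    shift, isom_e, isom_e]
  congr 1
  ring

theorem coef_star (T : EllTwo →L[ℂ] EllTwo) (i k : ℕ) :
    (star T) (e k) i = starRingEnd ℂ (T (e i) k) := by
  rw [← inner_e, ContinuousLinearMap.star_eq_adjoint, ContinuousLinearMap.adjoint_inner_right,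
    ← inner_e, inner_conj_symm]

theorem star_shift_e_zero : star shift (e 0) = 0 := by
  refine lp.ext (funext fun i => ?_)
  rw [coef_star, shift, isom_e, e_apply]
  simp

theorem star_shift_e_succ (k : ℕ) : star shift (e (k + 1)) = e k := by
  refine lp.ext (funext fun i => ?_)
  rw [coef_star, shift, isom_e, e_apply, e_apply]
  by_cases h : i = k
  · simp [h]
  · simp [h, Ne.symm h]

theorem star_shift_pow_mul_blockIsom {m : ℕ} (i : Fin m) :
    star shift ^ m * blockIsom i = blockIsom i * star shift := by
  refine ext_e fun k => ?_
  rw [mul_apply_eq_comp, mul_apply_eq_comp]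
  rw [← star_pow]
  cases k with
  | zero =>
    rw [star_shift_e_zero, map_zero, blockIsom, isom_e]
    refine lp.ext (funext fun a => ?_)
    rw [coef_star, shift_pow_e, e_apply, if_neg (by have := i.2; omega)]
    simp
  | succ k =>
    rw [star_shift_e_succ, blockIsom, isom_e, isom_e]
    refine lp.ext (funext fun a => ?_)
    rw [coef_star, shift_pow_e, e_apply, e_apply]
    have h : (m * (k + 1) + (i : ℕ) = a + m) ↔ (a = m * k + i) := by
      rw [mul_add]; omega
    by_cases h' : a = m * k + i
    · rw [if_pos h', if_pos (h.2 h')]; simp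
    · rw [if_neg h', if_neg (mt h.1 h')]; simp

/-- The operators of the form `a ⊕ a ⊕ ⋯` with `a` of size `m` commute with the `m`-th power of
the shift and with its adjoint. -/
theorem matrixUnit_commute {m : ℕ} (i j : Fin m) :
    Commute (shift ^ m) (matrixUnit i j) ∧ Commute (star shift ^ m) (matrixUnit i j) := by
  have h1 := shift_pow_mul_blockIsom i
  have h2 := star_shift_pow_mul_blockIsom i
  have h3 := congrArg star (shift_pow_mul_blockIsom j)
  have h4 := congrArg star (star_shift_pow_mul_blockIsom j)
  simp only [star_mul, star_pow, star_star] at h3 h4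
  constructor
  · rw [commute_iff_eq, matrixUnit, ← mul_assoc, h1, mul_assoc, ← h4, mul_assoc]
  · rw [commute_iff_eq, matrixUnit, ← mul_assoc, h2, mul_assoc, ← h3, mul_assoc]

/-- All finite-stage elements: the union over `m ≥ 1` of the copies of `M_m`. -/
def matrixUnits : Set (EllTwo →L[ℂ] EllTwo) := {T | ∃ (m : ℕ) (i j : Fin m), T = matrixUnit i j}

theorem exists_commute {T : EllTwo →L[ℂ] EllTwo} (hT : T ∈ StarAlgebra.adjoin ℂ matrixUnits) :
    ∃ m : ℕ, 0 < m ∧ Commute (shift ^ m) T ∧ Commute (star shift ^ m) T := by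
  have aux : ∀ {S T : EllTwo →L[ℂ] EllTwo},
      (∃ m : ℕ, 0 < m ∧ Commute (shift ^ m) S ∧ Commute (star shift ^ m) S) →
      (∃ m : ℕ, 0 < m ∧ Commute (shift ^ m) T ∧ Commute (star shift ^ m) T) →
      ∃ m : ℕ, 0 < m ∧ (Commute (shift ^ m) S ∧ Commute (star shift ^ m) S) ∧
        (Commute (shift ^ m) T ∧ Commute (star shift ^ m) T) := by
    rintro S T ⟨a, ha, h1, h2⟩ ⟨b, hb, h3, h4⟩
    refine ⟨a * b, Nat.mul_pos ha hb, ⟨?_, ?_⟩, ?_, ?_⟩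
    · rw [pow_mul]; exact h1.pow_left b
    · rw [pow_mul]; exact h2.pow_left b
    · rw [mul_comm, pow_mul]; exact h3.pow_left a
    · rw [mul_comm, pow_mul]; exact h4.pow_left a
  induction hT using StarAlgebra.adjoin_induction with
  | mem x hx =>
    obtain ⟨m, i, j, rfl⟩ := hx
    exact ⟨m, i.pos, matrixUnit_commute i j⟩
  | algebraMap r =>
    exact ⟨1, one_pos, (Algebra.commutes r _).symm, (Algebra.commutes r _).symm⟩
  | add x y _ _ hx hy =>
    obtain ⟨m, hm, h1, h2⟩ := aux hx hy
    exact ⟨m, hm, h1.1.add_right h2.1, h1.2.add_right h2.2⟩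
  | mul x y _ _ hx hy =>
    obtain ⟨m, hm, h1, h2⟩ := aux hx hy
    exact ⟨m, hm, h1.1.mul_right h2.1, h1.2.mul_right h2.2⟩
  | star x _ hx =>
    obtain ⟨m, hm, h1, h2⟩ := hx
    refine ⟨m, hm, ?_, ?_⟩
    · have := h2.star_star
      simpa using this
    · have := h1.star_star
      simpa using this

/-- The diagonal of a finite-stage element is periodic. -/
theorem exists_periodic {T : EllTwo →L[ℂ] EllTwo} (hT : T ∈ StarAlgebra.adjoin ℂ matrixUnits) :
    ∃ m : ℕ, 0 < m ∧ ∀ k, T (e (k + m)) (k + m) = T (e k) k := by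
  obtain ⟨m, hm, h1, -⟩ := exists_commute hT
  refine ⟨m, hm, fun k => ?_⟩
  have h : T (e (k + m)) = (shift ^ m) (T (e k)) := by
    rw [← shift_pow_e, ← mul_apply_eq_comp, ← h1.eq, mul_apply_eq_comp]
  have h' : star (shift ^ m) ((shift ^ m) (T (e k))) = T (e k) := by
    have : star (shift ^ m) * shift ^ m = 1 := by
      refine ext_coef fun a b => ?_
      rw [mul_apply_eq_comp, shift_pow_e, coef_star, shift_pow_e, e_apply,
        one_apply_eq_self, e_apply]
      by_cases h : a = b
      · simp [h]
      · rw [if_neg (by omega), if_neg h]; simp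
    rw [← mul_apply_eq_comp, this, one_apply_eq_self]
  rw [← inner_e (k + m), h, ← shift_pow_e, ← ContinuousLinearMap.adjoint_inner_right,
    ← ContinuousLinearMap.star_eq_adjoint, h', inner_e]

/-- The normalised trace of the compression of `T` to the span of `e 0, …, e (n! - 1)`. -/
def avg (n : ℕ) (T : EllTwo →L[ℂ] EllTwo) : ℂ :=
  ((n.factorial : ℂ))⁻¹ * ∑ k ∈ Finset.range n.factorial, T (e k) k

theorem avg_add (n : ℕ) (S T : EllTwo →L[ℂ] EllTwo) : avg n (S + T) = avg n S + avg n T := by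
  simp [avg, Finset.sum_add_distrib, mul_add]

theorem avg_smul (n : ℕ) (c : ℂ) (T : EllTwo →L[ℂ] EllTwo) : avg n (c • T) = c * avg n T := by
  simp [avg, ← Finset.mul_sum]
  ring

theorem norm_avg_le (n : ℕ) (T : EllTwo →L[ℂ] EllTwo) : ‖avg n T‖ ≤ ‖T‖ := by
  have h : ∀ k, ‖T (e k) k‖ ≤ ‖T‖ := fun k => by
    have h1 : ‖e k‖ = 1 := orthonormal_e.1 k
    calc ‖T (e k) k‖ ≤ ‖T (e k)‖ := lp.norm_apply_le_norm (by norm_num) _ _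
      _ ≤ ‖T‖ * ‖e k‖ := T.le_opNorm _
      _ = ‖T‖ := by rw [h1, mul_one]
  have hn : (0 : ℝ) < n.factorial := by exact_mod_cast n.factorial_pos
  rw [avg, norm_mul, norm_inv, Complex.norm_natCast]
  calc (n.factorial : ℝ)⁻¹ * ‖∑ k ∈ Finset.range n.factorial, T (e k) k‖
      ≤ (n.factorial : ℝ)⁻¹ * (n.factorial * ‖T‖) := by
        gcongr
        refine (norm_sum_le _ _).trans ((Finset.sum_le_sum fun k _ => h k).trans ?_)
        simp
    _ = ‖T‖ := by field_simp

theorem avg_eventually_const {T : EllTwo →L[ℂ] EllTwo}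
    (hT : T ∈ StarAlgebra.adjoin ℂ matrixUnits) : ∃ N, ∀ n ≥ N, avg n T = avg N T := by
  obtain ⟨m, hm, hper⟩ := exists_periodic hT
  have hsum : ∀ c : ℕ, ∑ k ∈ Finset.range (m * c), T (e k) k =
      c * ∑ k ∈ Finset.range m, T (e k) k := by
    intro c
    induction c with
    | zero => simp
    | succ c ih =>
      have hp : ∀ k, T (e (m * c + k)) (m * c + k) = T (e k) k := by
        intro k
        clear ih
        induction c with
        | zero => simp
        | succ c ih => rw [show m * (c + 1) + k = (m * c + k) + m by ring, hper, ih]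
      rw [mul_add, mul_one, Finset.sum_range_add, ih, Finset.sum_congr rfl fun k _ => hp k]
      push_cast
      ring
  have key : ∀ n ≥ m, avg n T = (m : ℂ)⁻¹ * ∑ k ∈ Finset.range m, T (e k) k := by
    intro n hn
    obtain ⟨c, hc⟩ := Nat.dvd_factorial hm hn
    have hc0 : (c : ℂ) ≠ 0 := by
      rintro h
      have : c = 0 := by exact_mod_cast h
      subst this
      exact n.factorial_ne_zero (by simpa using hc)
    have hm0 : (m : ℂ) ≠ 0 := by exact_mod_cast hm.ne'
    rw [avg, hc, hsum]
    push_cast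
    field_simp
  exact ⟨m, fun n hn => by rw [key n hn, key m le_rfl]⟩

theorem cauchySeq_avg {T : EllTwo →L[ℂ] EllTwo}
    (hT : T ∈ (StarAlgebra.adjoin ℂ matrixUnits).topologicalClosure) :
    CauchySeq fun n => avg n T := by
  rw [Metric.cauchySeq_iff']
  intro ε hε
  obtain ⟨S, hS, hd⟩ := Metric.mem_closure_iff.1 hT (ε / 3) (by positivity)
  obtain ⟨N, hN⟩ := avg_eventually_const hS
  refine ⟨N, fun n hn => ?_⟩
  have hb : ∀ n, ‖avg n T - avg n S‖ < ε / 3 := fun n => by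
    have : avg n T - avg n S = avg n (T - S) := by
      rw [sub_eq_add_neg T S, avg_add, ← neg_one_smul ℂ S, avg_smul]
      ring
    rw [this]
    refine (norm_avg_le _ _).trans_lt ?_
    rwa [dist_eq_norm] at hd
  have h1 := hb n
  have h2 := hb N
  rw [dist_eq_norm]
  have h3 : avg n T - avg N T = (avg n T - avg n S) - (avg N T - avg N S) := by
    rw [hN n hn]; ring
  rw [h3]
  exact (norm_sub_le _ _).trans_lt (by linarith)

end EllTwo

/-- The universal UHF algebra `𝒬`, as a concrete unital C⋆-algebra of operators on `ℓ²(ℕ)`: the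
norm closure of the increasing union (over `m ≥ 1`, ordered by divisibility) of the matrix
algebras `M_m` acting block-diagonally as `a ⊕ a ⊕ ⋯`. -/
def uhfSubalgebra : StarSubalgebra ℂ (EllTwo →L[ℂ] EllTwo) :=
  (StarAlgebra.adjoin ℂ EllTwo.matrixUnits).topologicalClosure

/-- The universal UHF algebra `𝒬` as a type. -/
def UHF : Type := uhfSubalgebra

namespace UHF

instance : CStarAlgebra UHF :=
  StarSubalgebra.cstarAlgebra uhfSubalgebra
    (h_closed := StarSubalgebra.isClosed_topologicalClosure _)

instance : PartialOrder UHF := CStarAlgebra.spectralOrder UHF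

instance : StarOrderedRing UHF := CStarAlgebra.spectralOrderedRing UHF

/-- The inclusion of `𝒬` into the bounded operators on `ℓ²(ℕ)`. -/
def incl : UHF →⋆ₐ[ℂ] (EllTwo →L[ℂ] EllTwo) := uhfSubalgebra.subtype

theorem norm_incl (a : UHF) : ‖incl a‖ = ‖a‖ := rfl

theorem tendsto_avg (a : UHF) :
    Tendsto (fun n => EllTwo.avg n (incl a)) atTop
      (𝓝 (limUnder atTop fun n => EllTwo.avg n (incl a))) :=
  (EllTwo.cauchySeq_avg a.2).tendsto_limUnder

/-- The unique tracial state `τ_𝒬` of `𝒬`: the limit of the normalised traces of the upper left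
corners of size `n!`. On the copy of `M_m` in `𝒬` it is the normalised trace of `M_m`. -/
def trace : UHF →L[ℂ] ℂ :=
  LinearMap.mkContinuous
    { toFun := fun a => limUnder atTop fun n => EllTwo.avg n (incl a)
      map_add' := fun a b => by
        refine tendsto_nhds_unique (tendsto_avg (a + b)) ?_
        simpa only [map_add, EllTwo.avg_add] using (tendsto_avg a).add (tendsto_avg b)
      map_smul' := fun c a => by
        refine tendsto_nhds_unique (tendsto_avg (c • a)) ?_
        simpa only [map_smul, EllTwo.avg_smul, RingHom.id_apply, smul_eq_mul] using
          (tendsto_avg a).const_mul c }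
    1 fun a => by
      rw [one_mul]
      exact le_of_tendsto' (tendsto_avg a).norm fun n => EllTwo.norm_avg_le n (incl a)

end UHF

/-! ### Maps between C⋆-algebras -/

/-- Positivity of an element of a C⋆-algebra: self-adjoint with non-negative spectrum. -/
def IsPositiveElement {A : Type*} [CStarAlgebra A] (a : A) : Prop :=
  letI := CStarAlgebra.spectralOrder A
  0 ≤ a

/-- Complete positivity of a linear map between C⋆-algebras, for their canonical orders. -/
def IsCompletelyPositive {A₁ A₂ : Type*} [CStarAlgebra A₁] [CStarAlgebra A₂]
    (σ : A₁ →ₗ[ℂ] A₂) : Prop :=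
  letI := CStarAlgebra.spectralOrder A₁
  letI := CStarAlgebra.spectralOrder A₂
  haveI := CStarAlgebra.spectralOrderedRing A₁
  haveI := CStarAlgebra.spectralOrderedRing A₂
  ∃ Φ : CompletelyPositiveMap A₁ A₂, Φ.toLinearMap = σ

/-- A map has order zero if it preserves orthogonality of positive elements. -/
def IsOrderZero {A₁ A₂ : Type*} [CStarAlgebra A₁] [CStarAlgebra A₂] (σ : A₁ →ₗ[ℂ] A₂) : Prop :=
  ∀ a b : A₁, IsPositiveElement a → IsPositiveElement b → a * b = 0 → σ a * σ b = 0

/-! ### Tracial states and `K₀` -/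

/-- A tracial state on a unital C⋆-algebra. -/
structure TracialState (B : Type*) [CStarAlgebra B] extends B →ₗ[ℂ] ℂ where
  nonneg' : ∀ b : B, 0 ≤ toFun (star b * b)
  map_one' : toFun 1 = 1
  tracial' : ∀ a b : B, toFun (a * b) = toFun (b * a)

namespace TracialState

variable {B : Type*} [CStarAlgebra B]

instance : CoeFun (TracialState B) (fun _ => B → ℂ) := ⟨fun τ => τ.toLinearMap⟩

/-- A tracial state is faithful if it does not vanish on nonzero positive elements. -/
def Faithful (τ : TracialState B) : Prop := ∀ b : B, τ (star b * b) = 0 → b = 0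

end TracialState

/-- Projections in the matrix algebras `M_n(B)`, `n ∈ ℕ`. -/
structure MatrixProjection (B : Type*) [CStarAlgebra B] where
  size : ℕ
  val : Matrix (Fin size) (Fin size) B
  isStarProjection : IsStarProjection val

namespace MatrixProjection

variable {B : Type*} [CStarAlgebra B]

/-- The block-diagonal sum `p ⊕ q`. -/
def directSum (p q : MatrixProjection B) : MatrixProjection B where
  size := p.size + q.size
  val := (Matrix.fromBlocks p.val 0 0 q.val).submatrix finSumFinEquiv.symm finSumFinEquiv.symm
  isStarProjection := by
    have hp := p.isStarProjection
    have hq := q.isStarProjection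
    constructor
    · rw [IsIdempotentElem, Matrix.submatrix_mul_equiv, Matrix.fromBlocks_multiply]
      simp [hp.isIdempotentElem.eq, hq.isIdempotentElem.eq]
    · rw [IsSelfAdjoint, Matrix.star_eq_conjTranspose, Matrix.conjTranspose_submatrix,
        Matrix.fromBlocks_conjTranspose]
      have h1 : p.valᴴ = p.val := hp.isSelfAdjoint
      have h2 : q.valᴴ = q.val := hq.isSelfAdjoint
      simp [h1, h2]

/-- Murray–von Neumann equivalence (via rectangular matrices). -/
def Equivalent (p q : MatrixProjection B) : Prop :=
  ∃ v : Matrix (Fin q.size) (Fin p.size) B, vᴴ * v = p.val ∧ v * vᴴ = q.val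

end MatrixProjection

/-- The relations `[p ⊕ q] = [p] + [q]`, and `[p] = [q]` for Murray–von Neumann equivalent `p, q`,
defining `K₀`. -/
def kZeroRelations (B : Type*) [CStarAlgebra B] :
    AddSubgroup (FreeAbelianGroup (MatrixProjection B)) :=
  AddSubgroup.closure
    ({z | ∃ p q : MatrixProjection B, z = FreeAbelianGroup.of (p.directSum q) -
        (FreeAbelianGroup.of p + FreeAbelianGroup.of q)} ∪
      {z | ∃ p q : MatrixProjection B, p.Equivalent q ∧
        z = FreeAbelianGroup.of p - FreeAbelianGroup.of q})

/-- The group `K₀(B)` of a unital C⋆-algebra, i.e. the Grothendieck group of the monoid of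
Murray–von Neumann classes of projections in matrix algebras over `B`, presented by generators
and relations. -/
abbrev KZero (B : Type*) [CStarAlgebra B] : Type _ :=
  FreeAbelianGroup (MatrixProjection B) ⧸ kZeroRelations B

namespace TracialState

variable {B : Type*} [CStarAlgebra B]

/-- The value `(τ ⊗ Tr)(p)` on a projection over `B`. -/
def evalProjection (τ : TracialState B) (p : MatrixProjection B) : ℝ :=
  (∑ i, τ (p.val i i)).re

theorem evalProjection_directSum (τ : TracialState B) (p q : MatrixProjection B) :
    τ.evalProjection (p.directSum q) = τ.evalProjection p + τ.evalProjection q := by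
  simp only [evalProjection, ← Complex.add_re]
  congr 1
  change ∑ i : Fin (p.size + q.size), τ ((p.directSum q).val i i) = _
  rw [← finSumFinEquiv.sum_comp, Fintype.sum_sum_type]
  simp [MatrixProjection.directSum]

theorem evalProjection_equivalent (τ : TracialState B) {p q : MatrixProjection B}
    (h : p.Equivalent q) : τ.evalProjection p = τ.evalProjection q := by
  obtain ⟨v, hp, hq⟩ := h
  simp only [evalProjection, ← hp, ← hq, Matrix.mul_apply, Matrix.conjTranspose_apply, map_sum]
  rw [Finset.sum_comm]
  congr 1
  exact Finset.sum_congr rfl fun i _ => Finset.sum_congr rfl fun j _ => τ.tracial' _ _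

/-- The homomorphism `τ_* : K₀(B) → ℝ` induced by a tracial state. -/
def kZeroMap (τ : TracialState B) : KZero B →+ ℝ :=
  QuotientAddGroup.lift (kZeroRelations B) (FreeAbelianGroup.lift τ.evalProjection) (by
    rw [kZeroRelations, AddSubgroup.closure_le]
    rintro z (⟨p, q, rfl⟩ | ⟨p, q, h, rfl⟩)
    · simp [evalProjection_directSum]
    · simp [evalProjection_equivalent τ h])

end TracialState

/-! ### Recursive subhomogeneous decompositions -/

/-- Matrices of size `r` over a C⋆-algebra, with their C⋆-structure. -/
abbrev Mat (r : ℕ) (A : Type*) : Type _ := CStarMatrix (Fin r) (Fin r) A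

set_option linter.checkUnivs false in
/-- A recursive subhomogeneous decomposition `[B_l, X_l, Ω_l, r_l, φ_l]` with `depth + 1` stages
of a unital C⋆-algebra `B`, with compact metrizable base spaces. The stages are indexed from `0`
to `depth`. The fields `toPrev` and `toFun` are the two projections of the pullback
`B_{l+1} = B_l ⊕_{C(Ω_{l+1}, M_r)} C(X_{l+1}, M_r)` (and `toFun 0` is the identification of the
first stage with `C(X_0, M_r)`); `ψ l` is the canonical quotient map `B → B_l`, which is the
identification of `B` with the last stage for `l = depth`. -/
structure RSHDecomposition (B : Type u) [CStarAlgebra B] where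
  depth : ℕ
  X : Fin (depth + 1) → Type v
  [topX : ∀ l, TopologicalSpace (X l)]
  [compactX : ∀ l, CompactSpace (X l)]
  [metrizableX : ∀ l, TopologicalSpace.MetrizableSpace (X l)]
  Ω : ∀ l, Set (X l)
  isClosed_Ω : ∀ l, IsClosed (Ω l)
  Ω_zero : Ω 0 = ∅
  r : Fin (depth + 1) → ℕ
  r_pos : ∀ l, 0 < r l
  Stage : Fin (depth + 1) → Type w
  [cstarStage : ∀ l, CStarAlgebra (Stage l)]
  φ : ∀ l : Fin depth, Stage l.castSucc →⋆ₐ[ℂ] C(Ω l.succ, Mat (r l.succ) ℂ)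
  toPrev : ∀ l : Fin depth, Stage l.succ →⋆ₐ[ℂ] Stage l.castSucc
  toFun : ∀ l, Stage l →⋆ₐ[ℂ] C(X l, Mat (r l) ℂ)
  toFun_zero_bijective : Function.Bijective (toFun 0)
  pullback_comm : ∀ (l : Fin depth) (b : Stage l.succ),
    φ l (toPrev l b) = (toFun l.succ b).restrict (Ω l.succ)
  pullback_existsUnique : ∀ (l : Fin depth) (a : Stage l.castSucc)
    (f : C(X l.succ, Mat (r l.succ) ℂ)), φ l a = f.restrict (Ω l.succ) →
      ∃! b : Stage l.succ, toPrev l b = a ∧ toFun l.succ b = f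
  ψ : ∀ l, B →⋆ₐ[ℂ] Stage l
  ψ_last_bijective : Function.Bijective (ψ (Fin.last depth))
  toPrev_ψ : ∀ (l : Fin depth) (b : B), toPrev l (ψ l.succ b) = ψ l.castSucc b

namespace RSHDecomposition

attribute [instance] topX compactX metrizableX cstarStage

variable {B : Type u} [CStarAlgebra B] (D : RSHDecomposition.{u, v, w} B)

/-- Projections can be lifted along the decomposition: every projection in `M_N(B_l)` lifts to a
projection in `M_N(B_{l+1})`. -/
def ProjectionsLift : Prop :=
  ∀ (N : ℕ) (l : Fin D.depth) (p : Matrix (Fin N) (Fin N) (D.Stage l.castSucc)),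
    IsStarProjection p → ∃ p' : Matrix (Fin N) (Fin N) (D.Stage l.succ),
      IsStarProjection p' ∧ p'.map (D.toPrev l) = p

/-- The component `B → C(X_l, M_{r_l})` of the canonical embedding
`ι_B : B ↪ ⨁_l C(X_l, M_{r_l})`. -/
def component (l : Fin (D.depth + 1)) : B →⋆ₐ[ℂ] C(D.X l, Mat (D.r l) ℂ) :=
  (D.toFun l).comp (D.ψ l)

/-- The canonical embedding `ι_B : B ↪ ⨁_l C(X_l, M_{r_l})`. -/
def embedding : B →⋆ₐ[ℂ] ∀ l, C(D.X l, Mat (D.r l) ℂ) where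
  toFun b l := D.component l b
  map_one' := funext fun l => (D.component l).map_one'
  map_mul' a b := funext fun l => (D.component l).map_mul' a b
  map_zero' := funext fun l => (D.component l).map_zero'
  map_add' a b := funext fun l => (D.component l).map_add' a b
  commutes' c := funext fun l => (D.component l).commutes' c
  map_star' a := funext fun l => (D.component l).map_star' a

theorem embedding_injective : Function.Injective D.embedding := by
  intro a b h
  have hc : ∀ l, D.toFun l (D.ψ l a) = D.toFun l (D.ψ l b) := fun l => congrFun h l
  have key : ∀ l, D.ψ l a = D.ψ l b := by
    intro l
    induction l using Fin.induction with
    | zero => exact D.toFun_zero_bijective.1 (hc 0)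
    | succ l ih =>
      obtain ⟨c, -, hu⟩ := D.pullback_existsUnique l (D.toPrev l (D.ψ l.succ a))
        (D.toFun l.succ (D.ψ l.succ a)) (D.pullback_comm l _)
      rw [hu _ ⟨rfl, rfl⟩]
      refine (hu _ ⟨?_, (hc _).symm⟩).symm
      rw [D.toPrev_ψ, D.toPrev_ψ, ih]
  exact D.ψ_last_bijective.1 (key _)

theorem isometry_embedding : Isometry D.embedding :=
  AddMonoidHomClass.isometry_of_norm _
    (NonUnitalStarAlgHom.norm_map D.embedding D.embedding_injective)

/-- Evaluation of (the image of) an element of `B` at a point of `X_l`, `B → M_{r_l}`. -/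
def eval (l : Fin (D.depth + 1)) (x : D.X l) : B →⋆ₐ[ℂ] Mat (D.r l) ℂ where
  toFun b := D.component l b x
  map_one' := congrArg (fun f => f x) (D.component l).map_one'
  map_mul' a b := congrArg (fun f => f x) ((D.component l).map_mul' a b)
  map_zero' := congrArg (fun f => f x) (D.component l).map_zero'
  map_add' a b := congrArg (fun f => f x) ((D.component l).map_add' a b)
  commutes' c := congrArg (fun f => f x) ((D.component l).commutes' c)
  map_star' a := congrArg (fun f => f x) ((D.component l).map_star' a)

end RSHDecomposition

/-! ### The tensor product `B ⊗ 𝒬` -/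

/-- The entrywise application of a bounded linear map. -/
def Mat.mapL (r : ℕ) {A₁ A₂ : Type*} [CStarAlgebra A₁] [PartialOrder A₁] [StarOrderedRing A₁]
    [CStarAlgebra A₂] [PartialOrder A₂] [StarOrderedRing A₂] (L : A₁ →L[ℂ] A₂) :
    Mat r A₁ →L[ℂ] Mat r A₂ where
  toLinearMap := CStarMatrix.mapₗ L.toLinearMap
  cont := Continuous.matrix_map (A := fun M : Matrix (Fin r) (Fin r) A₁ => M) continuous_id
    L.continuous

namespace RSHDecomposition

variable {B : Type u} [CStarAlgebra B] (D : RSHDecomposition.{u, v, w} B)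

/-- The C⋆-algebra `(⨁_l C(X_l, M_{r_l})) ⊗ 𝒬 = ⨁_l C(X_l, M_{r_l}(𝒬))`. -/
abbrev Ambient : Type v := ∀ l, C(D.X l, Mat (D.r l) UHF)

/-- The elementary tensor `ι_B(b) ⊗ q`, with entries `ι_B(b)_{ij} • q`. -/
def elem (b : B) (q : UHF) : D.Ambient := fun l =>
  (Mat.mapL (D.r l) (ContinuousLinearMap.toSpanSingleton ℂ q)).compLeftContinuous ℂ (D.X l)
    (D.component l b)

theorem elem_apply (b : B) (q : UHF) (l : Fin (D.depth + 1)) (x : D.X l) (i j : Fin (D.r l)) :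
    D.elem b q l x i j = (D.component l b x i j) • q := rfl

theorem elem_mul (a b : B) (p q : UHF) : D.elem a p * D.elem b q = D.elem (a * b) (p * q) := by
  funext l
  ext x i j : 2
  have h : (D.elem a p * D.elem b q) l x i j =
      ∑ k, D.elem a p l x i k * D.elem b q l x k j := rfl
  have h' : D.component l (a * b) x i j =
      ∑ k, D.component l a x i k * D.component l b x k j := by
    rw [map_mul]; rfl
  rw [h, elem_apply, h', Finset.sum_smul]
  refine Finset.sum_congr rfl fun k _ => ?_
  rw [elem_apply, elem_apply, smul_mul_smul_comm]

theorem elem_star (b : B) (q : UHF) : star (D.elem b q) = D.elem (star b) (star q) := by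
  funext l
  ext x i j : 2
  have h : (star (D.elem b q)) l x i j = star (D.elem b q l x j i) := rfl
  have h' : D.component l (star b) x i j = star (D.component l b x j i) := by
    rw [map_star]; rfl
  rw [h, elem_apply, elem_apply, h', star_smul]

theorem elem_algebraMap (c : ℂ) :
    D.elem (algebraMap ℂ B c) 1 = algebraMap ℂ D.Ambient c := by
  funext l
  ext x i j : 2
  have h : (algebraMap ℂ D.Ambient c) l x i j = if i = j then algebraMap ℂ UHF c else 0 := rfl
  have h' : D.component l (algebraMap ℂ B c) x i j = if i = j then c else 0 := by
    rw [AlgHomClass.commutes]; rfl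
  rw [h, elem_apply, h']
  split_ifs
  · rw [Algebra.algebraMap_eq_smul_one]
  · rw [zero_smul]

/-- The algebraic tensor product `B ⊙ 𝒬`, inside `⨁_l C(X_l, M_{r_l}(𝒬))`. -/
def algTensor : StarSubalgebra ℂ D.Ambient where
  carrier := Submodule.span ℂ {t | ∃ b q, t = D.elem b q}
  add_mem' := Submodule.add_mem _
  mul_mem' {s t} hs ht := by
    refine Submodule.span_induction₂ (p := fun s t _ _ =>
      s * t ∈ Submodule.span ℂ {t | ∃ b q, t = D.elem b q}) ?_ ?_ ?_ ?_ ?_ ?_ ?_ hs ht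
    · rintro _ _ ⟨a, p, rfl⟩ ⟨b, q, rfl⟩
      exact Submodule.subset_span ⟨_, _, D.elem_mul a b p q⟩
    · intro y _; simp
    · intro x _; simp
    · intro x y z _ _ _ h1 h2; rw [add_mul]; exact Submodule.add_mem _ h1 h2
    · intro x y z _ _ _ h1 h2; rw [mul_add]; exact Submodule.add_mem _ h1 h2
    · intro c x y _ _ h; rw [smul_mul_assoc]; exact Submodule.smul_mem _ c h
    · intro c x y _ _ h; rw [mul_smul_comm]; exact Submodule.smul_mem _ c h
  algebraMap_mem' c := Submodule.subset_span ⟨_, _, (D.elem_algebraMap c).symm⟩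
  star_mem' {t} ht := by
    refine Submodule.span_induction (p := fun t _ =>
      star t ∈ Submodule.span ℂ {t | ∃ b q, t = D.elem b q}) ?_ ?_ ?_ ?_ ht
    · rintro _ ⟨b, q, rfl⟩
      exact Submodule.subset_span ⟨_, _, D.elem_star b q⟩
    · simp
    · intro x y _ _ h1 h2; rw [star_add]; exact Submodule.add_mem _ h1 h2
    · intro c x _ h; rw [star_smul]; exact Submodule.smul_mem _ _ h

/-- The C⋆-tensor product `B ⊗ 𝒬`: the closure of `B ⊙ 𝒬` in `⨁_l C(X_l, M_{r_l}(𝒬))`. This is the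
spatial tensor product for the embedding `ι_B`, hence, `𝒬` being nuclear, the C⋆-tensor product. -/
def Tensor : Type v := D.algTensor.topologicalClosure

instance : CStarAlgebra D.Tensor :=
  StarSubalgebra.cstarAlgebra D.algTensor.topologicalClosure
    (h_closed := StarSubalgebra.isClosed_topologicalClosure _)

/-- The elementary tensor `b ⊗ q`. -/
def tmul (b : B) (q : UHF) : D.Tensor :=
  ⟨D.elem b q, StarSubalgebra.le_topologicalClosure _ (Submodule.subset_span ⟨b, q, rfl⟩)⟩

/-- The inclusion of `B ⊗ 𝒬` into `⨁_l C(X_l, M_{r_l}(𝒬))`. -/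
def tensorIncl : D.Tensor →⋆ₐ[ℂ] D.Ambient := D.algTensor.topologicalClosure.subtype

/-- Application of the trace `τ_𝒬` in all entries. -/
def ambientSlice : D.Ambient →L[ℂ] ∀ l, C(D.X l, Mat (D.r l) ℂ) :=
  ContinuousLinearMap.pi fun l =>
    ((Mat.mapL (D.r l) UHF.trace).compLeftContinuous ℂ (D.X l)).comp
      (ContinuousLinearMap.proj l)

theorem ambientSlice_elem (b : B) (q : UHF) :
    D.ambientSlice (D.elem b q) = D.embedding (UHF.trace q • b) := by
  funext l
  ext x i j : 2
  have h : D.ambientSlice (D.elem b q) l x i j = UHF.trace (D.elem b q l x i j) := rfl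
  have h' : D.embedding (UHF.trace q • b) l x i j = UHF.trace q * D.component l b x i j := by
    rw [map_smul]; rfl
  rw [h, h', elem_apply, map_smul, smul_eq_mul, mul_comm]

theorem exists_slice (t : D.Tensor) :
    ∃ b : B, D.embedding b = D.ambientSlice (D.tensorIncl t) := by
  have hrange : IsClosed (Set.range D.embedding) :=
    (D.isometry_embedding.isUniformInducing.isComplete_range).isClosed
  have hclosed : IsClosed (D.ambientSlice ⁻¹' Set.range D.embedding) :=
    hrange.preimage D.ambientSlice.continuous
  have hsub : (D.algTensor : Set D.Ambient) ⊆ D.ambientSlice ⁻¹' Set.range D.embedding := by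
    intro t ht
    refine Submodule.span_induction (p := fun t _ =>
      D.ambientSlice t ∈ Set.range D.embedding) ?_ ?_ ?_ ?_ ht
    · rintro _ ⟨b, q, rfl⟩
      exact ⟨_, (D.ambientSlice_elem b q).symm⟩
    · exact ⟨0, by rw [map_zero, map_zero]⟩
    · rintro x y _ _ ⟨a, ha⟩ ⟨b, hb⟩
      exact ⟨a + b, by rw [map_add, map_add, ha, hb]⟩
    · rintro c x _ ⟨a, ha⟩
      exact ⟨c • a, by rw [map_smul, map_smul, ha]⟩
  exact closure_minimal hsub hclosed t.2

/-- The slice map `id_B ⊗ τ_𝒬 : B ⊗ 𝒬 → B`. -/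
def slice (t : D.Tensor) : B := (D.exists_slice t).choose

theorem embedding_slice (t : D.Tensor) :
    D.embedding (D.slice t) = D.ambientSlice (D.tensorIncl t) := (D.exists_slice t).choose_spec

theorem slice_tmul (b : B) (q : UHF) : D.slice (D.tmul b q) = UHF.trace q • b := by
  refine D.embedding_injective ?_
  rw [embedding_slice, ← ambientSlice_elem]
  rfl

/-- The functional `τ ⊗ τ_𝒬 = τ ∘ (id_B ⊗ τ_𝒬)` on `B ⊗ 𝒬`. -/
def tensorTrace (τ : TracialState B) : D.Tensor →ₗ[ℂ] ℂ where
  toFun t := τ (D.slice t)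
  map_add' s t := by
    rw [← map_add]
    congr 1
    refine D.embedding_injective ?_
    rw [map_add, embedding_slice, embedding_slice, embedding_slice, map_add, map_add]
  map_smul' c t := by
    rw [RingHom.id_apply, ← map_smul]
    congr 1
    refine D.embedding_injective ?_
    rw [map_smul, embedding_slice, embedding_slice, map_smul, map_smul]

theorem tensorTrace_tmul (τ : TracialState B) (b : B) (q : UHF) :
    D.tensorTrace τ (D.tmul b q) = τ b * UHF.trace q := by
  change τ (D.slice (D.tmul b q)) = _
  rw [slice_tmul, map_smul, smul_eq_mul, mul_comm]

/-- The hereditary subalgebra `B ⊗ q𝒬q` of `B ⊗ 𝒬`. -/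
def corner (q : UHF) : Set D.Tensor :=
  closure (Submodule.span ℂ {t | ∃ b y, t = D.tmul b (q * y * q)} : Set D.Tensor)

end RSHDecomposition

/-! ### Excisors and bridges -/

/-- An `(F, η)`-excisor `(E, ρ, σ)` for `B`, with `E = ⨁_l E_l` and `ρ = ⨁_l ρ_l`. -/
structure Excisor {B : Type u} [CStarAlgebra B] (D : RSHDecomposition.{u, v, w} B)
    (F : Finset B) (η : ℝ) where
  E : Fin (D.depth + 1) → Type
  [cstarE : ∀ l, CStarAlgebra (E l)]
  [finiteDimensionalE : ∀ l, FiniteDimensional ℂ (E l)]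
  ρ : ∀ l, B →⋆ₐ[ℂ] E l
  σ : (∀ l, E l) →ₗ[ℂ] D.Tensor
  norm_σ : ∀ a, ‖σ a‖ = ‖a‖
  completelyPositive_σ : IsCompletelyPositive σ
  orderZero_σ : IsOrderZero σ
  approx : ∀ b ∈ F, ‖σ 1 * D.tmul b 1 - σ (fun l => ρ l b)‖ < η

attribute [instance] Excisor.cstarE Excisor.finiteDimensionalE

/-- A weighted `(F, η)`-excisor `(E, ρ, σ, κ)`. -/
structure WeightedExcisor {B : Type u} [CStarAlgebra B] (D : RSHDecomposition.{u, v, w} B)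
    (F : Finset B) (η : ℝ) extends Excisor D F η where
  κ : (∀ l, E l) →⋆ₐ[ℂ] UHF

/-- Compatibility with the decomposition: each `ρ_l` factorizes as `B → B_l → C(Y, M_{r_l}) → E_l`
for a compact subset `Y` of `X_l ∖ Ω_l`. -/
def Excisor.Compatible {B : Type u} [CStarAlgebra B] {D : RSHDecomposition.{u, v, w} B}
    {F : Finset B} {η : ℝ} (e : Excisor D F η) : Prop :=
  ∀ l, ∃ Y : Set (D.X l), IsCompact Y ∧ Y ⊆ (D.Ω l)ᶜ ∧
    ∃ ρ' : C(Y, Mat (D.r l) ℂ) →⋆ₐ[ℂ] e.E l, ∀ b, e.ρ l b = ρ' ((D.component l b).restrict Y)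

namespace WeightedExcisor

variable {B : Type u} [CStarAlgebra B] {D : RSHDecomposition.{u, v, w} B} {F : Finset B} {η : ℝ}

/-- The composition `κ ∘ ρ : B → 𝒬`, with `ρ = ⨁_l ρ_l`. -/
def κρ (e : WeightedExcisor D F η) (b : B) : UHF := e.κ fun l => e.ρ l b

/-- The condition on consecutive members of an `(F, η)`-bridge. -/
def Close (e f : WeightedExcisor D F η) : Prop := ∀ b ∈ F, ‖e.κρ b - f.κρ b‖ < η

/-- The relation `e ∼ f`: there is an `(F, η)`-bridge, compatible with the decomposition, of some
length `K ≥ 1` from `e` to `f`. -/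
def Bridged (e f : WeightedExcisor D F η) : Prop :=
  ∃ (K : ℕ) (g : ℕ → WeightedExcisor D F η), 0 < K ∧ g 0 = e ∧ g K = f ∧
    (∀ j ≤ K, (g j).Compatible) ∧ ∀ j < K, (g j).Close (g (j + 1))

/-- Pairwise orthogonality: there are pairwise orthogonal projections `q_j ∈ 𝒬` with
`σ_j(E_j) ⊆ B ⊗ q_j 𝒬 q_j`. -/
def PairwiseOrthogonal {ι : Type*} (e : ι → WeightedExcisor D F η) : Prop :=
  ∃ q : ι → UHF, (∀ j, IsStarProjection (q j)) ∧ (Pairwise fun i j => q i * q j = 0) ∧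
    ∀ j a, (e j).σ a ∈ D.corner (q j)

/-- `(E, ρ, κ)` is the triple `(E_x, ρ_x, κ_x)` of the point `x ∈ X_l`: evaluation at `x`
factorizes as `B → E_x ↪ M_{r_l}` with `ρ` surjective (so that `E_x` is the sum of the distinct
irreducible representations of `B` contained in the evaluation at `x`), and `κ` is the
restriction to `E_x` of a unital embedding `M_{r_l} → 𝒬`. -/
def IsAtPoint (e : WeightedExcisor D F η) (l : Fin (D.depth + 1)) (x : D.X l) : Prop :=
  Function.Surjective (fun (b : B) (k : Fin (D.depth + 1)) => e.ρ k b) ∧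
    ∃ (i : (∀ k, e.E k) →⋆ₐ[ℂ] Mat (D.r l) ℂ) (j : Mat (D.r l) ℂ →⋆ₐ[ℂ] UHF),
      Function.Injective i ∧ (∀ b, i (fun k => e.ρ k b) = D.eval l x b) ∧ ∀ a, e.κ a = j (i a)

end WeightedExcisor

/-- The decomposition is `(F, η)`-connected: the (compatible) weighted excisors at any two points of
the same base space `X_l` are connected by an `(F, η)`-bridge. -/
def RSHDecomposition.Connected {B : Type u} [CStarAlgebra B] (D : RSHDecomposition.{u, v, w} B)
    (F : Finset B) (η : ℝ) : Prop :=
  ∀ (l : Fin (D.depth + 1)) (x y : D.X l) (e f : WeightedExcisor D F η),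
    e.Compatible → f.Compatible → e.IsAtPoint l x → f.IsAtPoint l y → e.Bridged f

end

noncomputable section


namespace EllTwo

theorem blockIsom_e {m : ℕ} (i : Fin m) (q : ℕ) : blockIsom i (e q) = e (m * q + i) := by
  rw [blockIsom, isom_e]

theorem star_blockIsom_mul {m : ℕ} (i j : Fin m) :
    star (blockIsom i) * blockIsom j = if i = j then 1 else 0 := by
  refine ext_coef fun a b => ?_
  have hm : 0 < m := i.pos
  rw [mul_apply_eq_comp, blockIsom_e, coef_star, blockIsom_e, e_apply]
  have h : (m * b + (j : ℕ) = m * a + i) ↔ (a = b ∧ i = j) := by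
    constructor
    · intro h
      have h1 := congrArg (· % m) h
      have h2 := congrArg (· / m) h
      simp only [Nat.mul_add_mod, Nat.mod_eq_of_lt i.2, Nat.mod_eq_of_lt j.2] at h1
      rw [Nat.mul_add_div hm, Nat.mul_add_div hm, Nat.div_eq_of_lt i.2,
        Nat.div_eq_of_lt j.2] at h2
      exact ⟨by omega, Fin.ext h1.symm⟩
    · rintro ⟨rfl, rfl⟩; rfl
  by_cases hij : i = j
  · by_cases hab : a = b
    · rw [if_pos (h.2 ⟨hab, hij⟩), if_pos hij, one_apply_eq_self, e_apply, if_pos hab]; simp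
    · rw [if_neg (fun h' => hab (h.1 h').1), if_pos hij, one_apply_eq_self, e_apply, if_neg hab]
      simp
  · rw [if_neg (fun h' => hij (h.1 h').2), if_neg hij]; simp

theorem sum_blockIsom_mul_star {m : ℕ} (hm : 0 < m) :
    ∑ i : Fin m, blockIsom i * star (blockIsom i) = 1 := by
  refine ext_e fun k => ?_
  have hk : e k = blockIsom (⟨k % m, Nat.mod_lt k hm⟩ : Fin m) (e (k / m)) := by
    rw [blockIsom_e]; congr 1; exact (Nat.div_add_mod k m).symm
  rw [hk, ← mul_apply_eq_comp, Finset.sum_mul, one_apply_eq_self]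
  congr 1
  rw [Finset.sum_eq_single (⟨k % m, Nat.mod_lt k hm⟩ : Fin m)]
  · rw [mul_assoc, star_blockIsom_mul, if_pos rfl, mul_one]
  · intro b _ hb
    rw [mul_assoc, star_blockIsom_mul, if_neg hb, mul_zero]
  · simp

theorem blockIsom_mul {r k : ℕ} (a : Fin r) (t : Fin k) :
    blockIsom a * blockIsom t = blockIsom (finProdFinEquiv (t, a)) := by
  refine ext_e fun q => ?_
  rw [mul_apply_eq_comp, blockIsom_e, blockIsom_e, blockIsom_e]
  congr 1
  simp only [finProdFinEquiv_apply_val]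
  ring

/-- The periodic operator on `ℓ²(ℕ)` given by a rectangular matrix. -/
def ofRect {r s : ℕ} (V : Matrix (Fin r) (Fin s) ℂ) : EllTwo →L[ℂ] EllTwo :=
  ∑ a, ∑ b, V a b • (blockIsom a * star (blockIsom b))

theorem ofRect_add {r s : ℕ} (V W : Matrix (Fin r) (Fin s) ℂ) :
    ofRect (V + W) = ofRect V + ofRect W := by
  simp [ofRect, add_smul, Finset.sum_add_distrib]

theorem ofRect_zero {r s : ℕ} : ofRect (0 : Matrix (Fin r) (Fin s) ℂ) = 0 := by
  simp [ofRect]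

theorem ofRect_smul {r s : ℕ} (c : ℂ) (V : Matrix (Fin r) (Fin s) ℂ) :
    ofRect (c • V) = c • ofRect V := by
  simp [ofRect, Finset.smul_sum, smul_smul]

theorem ofRect_mul {r s t : ℕ} (V : Matrix (Fin r) (Fin s) ℂ) (W : Matrix (Fin s) (Fin t) ℂ) :
    ofRect (V * W) = ofRect V * ofRect W := by
  have h : ∀ (a : Fin r) (b c : Fin s) (d : Fin t),
      (V a b • (blockIsom a * star (blockIsom b))) * (W c d • (blockIsom c * star (blockIsom d))) =
      if b = c then (V a b * W c d) • (blockIsom a * star (blockIsom d)) else 0 := by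
    intro a b c d
    rw [smul_mul_smul_comm, mul_assoc (blockIsom a), ← mul_assoc (star (blockIsom b)),
      star_blockIsom_mul]
    split_ifs with hbc
    · rw [one_mul]
    · rw [zero_mul, mul_zero, smul_zero]
  have h' : ∀ (a : Fin r) (b : Fin s), (V a b • (blockIsom a * star (blockIsom b))) *
      (∑ c, ∑ d, W c d • (blockIsom c * star (blockIsom d))) =
      ∑ d, (V a b * W b d) • (blockIsom a * star (blockIsom d)) := by
    intro a b
    simp only [Finset.mul_sum, h]
    rw [Finset.sum_eq_single b]
    · simp
    · intro c _ hc
      simp [Ne.symm hc]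
    · simp
  simp only [ofRect, Finset.sum_mul, h', Matrix.mul_apply, Finset.sum_smul]
  exact Finset.sum_congr rfl fun a _ => Finset.sum_comm

theorem star_ofRect {r s : ℕ} (V : Matrix (Fin r) (Fin s) ℂ) :
    star (ofRect V) = ofRect Vᴴ := by
  simp only [ofRect, star_sum, star_smul, star_mul, star_star, Matrix.conjTranspose_apply]
  exact Finset.sum_comm

theorem ofRect_one {m : ℕ} (hm : 0 < m) : ofRect (1 : Matrix (Fin m) (Fin m) ℂ) = 1 := by
  rw [← sum_blockIsom_mul_star hm, ofRect]
  refine Finset.sum_congr rfl fun a _ => ?_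
  rw [Finset.sum_eq_single a] <;> simp +contextual [eq_comm]

/-- The amplification `V ⊕ ⋯ ⊕ V` (`k` summands). -/
def amp (k : ℕ) {r s : ℕ} (V : Matrix (Fin r) (Fin s) ℂ) :
    Matrix (Fin (k * r)) (Fin (k * s)) ℂ :=
  Matrix.reindex finProdFinEquiv finProdFinEquiv
    (Matrix.kronecker (1 : Matrix (Fin k) (Fin k) ℂ) V)

theorem amp_apply (k : ℕ) {r s : ℕ} (V : Matrix (Fin r) (Fin s) ℂ) (p : Fin k × Fin r)
    (q : Fin k × Fin s) : amp k V (finProdFinEquiv p) (finProdFinEquiv q) =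
      if p.1 = q.1 then V p.2 q.2 else 0 := by
  simp [amp, Matrix.kroneckerMap_apply, Matrix.one_apply]

theorem ofRect_amp {k : ℕ} (hk : 0 < k) {r s : ℕ} (V : Matrix (Fin r) (Fin s) ℂ) :
    ofRect (amp k V) = ofRect V := by
  have h1 : ∀ (a : Fin r) (b : Fin s), V a b • (blockIsom a * star (blockIsom b)) =
      ∑ t : Fin k, V a b • (blockIsom (finProdFinEquiv (t, a)) *
        star (blockIsom (finProdFinEquiv (t, b)))) := by
    intro a b
    rw [← Finset.smul_sum]
    congr 1
    simp only [← blockIsom_mul, star_mul]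
    have : ∀ t : Fin k, blockIsom a * blockIsom t * (star (blockIsom t) * star (blockIsom b)) =
        blockIsom a * (blockIsom t * star (blockIsom t)) * star (blockIsom b) := fun t => by
      simp only [mul_assoc]
    simp only [this, ← Finset.sum_mul, ← Finset.mul_sum, sum_blockIsom_mul_star hk, mul_one]
  have h2 : ofRect (amp k V) = ∑ t : Fin k, ∑ a, ∑ b, V a b •
      (blockIsom (finProdFinEquiv (t, a)) * star (blockIsom (finProdFinEquiv (t, b)))) := by
    rw [ofRect, ← finProdFinEquiv.sum_comp, Fintype.sum_prod_type]
    refine Finset.sum_congr rfl fun t _ => Finset.sum_congr rfl fun a _ => ?_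
    rw [← finProdFinEquiv.sum_comp, Fintype.sum_prod_type, Finset.sum_eq_single t]
    · simp only [amp_apply, if_true]
    · intro t' _ ht
      simp [amp_apply, Ne.symm ht]
    · simp
  rw [h2, ofRect]
  simp only [h1]
  rw [Finset.sum_comm]
  exact Finset.sum_congr rfl fun a _ => Finset.sum_comm

theorem ofRect_reindex {p q : ℕ} (h : p = q) (b : Matrix (Fin p) (Fin p) ℂ) :
    ofRect (Matrix.reindex (finCongr h) (finCongr h) b) = ofRect b := by
  subst h; rfl

theorem exists_ofRect {T : EllTwo →L[ℂ] EllTwo} (hT : T ∈ StarAlgebra.adjoin ℂ matrixUnits) :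
    ∃ m : ℕ, 0 < m ∧ ∃ a : Matrix (Fin m) (Fin m) ℂ, T = ofRect a := by
  have aux : ∀ {S T : EllTwo →L[ℂ] EllTwo},
      (∃ m : ℕ, 0 < m ∧ ∃ a : Matrix (Fin m) (Fin m) ℂ, S = ofRect a) →
      (∃ m : ℕ, 0 < m ∧ ∃ a : Matrix (Fin m) (Fin m) ℂ, T = ofRect a) →
      ∃ m : ℕ, 0 < m ∧ ∃ a b : Matrix (Fin m) (Fin m) ℂ, S = ofRect a ∧ T = ofRect b := by
    rintro S T ⟨p, hp, a, rfl⟩ ⟨q, hq, b, rfl⟩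
    refine ⟨q * p, Nat.mul_pos hq hp, amp q a,
      Matrix.reindex (finCongr (mul_comm p q)) (finCongr (mul_comm p q)) (amp p b),
      (ofRect_amp hq _).symm, ?_⟩
    rw [ofRect_reindex, ofRect_amp hp]
  induction hT using StarAlgebra.adjoin_induction with
  | mem x hx =>
    obtain ⟨m, i, j, rfl⟩ := hx
    refine ⟨m, i.pos, Matrix.single i j 1, ?_⟩
    rw [ofRect, Finset.sum_eq_single i, Finset.sum_eq_single j]
    · simp [matrixUnit]
    · intro b _ hb; simp [Ne.symm hb]
    · simp
    · intro b _ hb; simp [Ne.symm hb]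
    · simp
  | algebraMap r =>
    refine ⟨1, one_pos, r • 1, ?_⟩
    rw [ofRect_smul, ofRect_one one_pos, Algebra.algebraMap_eq_smul_one]
  | add x y _ _ hx hy =>
    obtain ⟨m, hm, a, b, rfl, rfl⟩ := aux hx hy
    exact ⟨m, hm, a + b, (ofRect_add a b).symm⟩
  | mul x y _ _ hx hy =>
    obtain ⟨m, hm, a, b, rfl, rfl⟩ := aux hx hy
    exact ⟨m, hm, a * b, (ofRect_mul a b).symm⟩
  | star x _ hx =>
    obtain ⟨m, hm, a, rfl⟩ := hx
    exact ⟨m, hm, aᴴ, star_ofRect a⟩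

theorem ofRect_mem {m : ℕ} (a : Matrix (Fin m) (Fin m) ℂ) :
    ofRect a ∈ StarAlgebra.adjoin ℂ matrixUnits :=
  sum_mem fun i _ => sum_mem fun j _ =>
    SMulMemClass.smul_mem _ (StarAlgebra.subset_adjoin ℂ _ ⟨m, i, j, rfl⟩)

theorem conj_ofRect_mem {r s : ℕ} (hs : 0 < s) (V : Matrix (Fin r) (Fin s) ℂ)
    {x : EllTwo →L[ℂ] EllTwo} (hx : x ∈ uhfSubalgebra) :
    ofRect V * x * star (ofRect V) ∈ uhfSubalgebra := by
  have hcl : IsClosed {x : EllTwo →L[ℂ] EllTwo | ofRect V * x * star (ofRect V) ∈ uhfSubalgebra} :=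
    (StarSubalgebra.isClosed_topologicalClosure _).preimage (by fun_prop)
  refine closure_minimal ?_ hcl hx
  intro T hT
  obtain ⟨m, hm, a, rfl⟩ := exists_ofRect hT
  have h : ofRect V * ofRect a * star (ofRect V) = ofRect (amp m V *
      (Matrix.reindex (finCongr (mul_comm s m)) (finCongr (mul_comm s m)) (amp s a)) *
        (amp m V)ᴴ) := by
    rw [ofRect_mul, ofRect_mul, ofRect_reindex, ofRect_amp hs, ← star_ofRect, ofRect_amp hm]
  change _ * _ * _ ∈ uhfSubalgebra
  rw [h]
  exact StarSubalgebra.le_topologicalClosure _ (ofRect_mem _)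

theorem ofRect_e_apply {m : ℕ} (hm : 0 < m) (a : Matrix (Fin m) (Fin m) ℂ) (k : ℕ) :
    ofRect a (e k) k = a ⟨k % m, Nat.mod_lt k hm⟩ ⟨k % m, Nat.mod_lt k hm⟩ := by
  set i : Fin m := ⟨k % m, Nat.mod_lt k hm⟩
  have hk : e k = blockIsom i (e (k / m)) := by
    rw [blockIsom_e]; congr 1; exact (Nat.div_add_mod k m).symm
  have h1 : ofRect a (e k) = ∑ c, a c i • e (m * (k / m) + c) := by
    rw [hk, ← mul_apply_eq_comp, ofRect, Finset.sum_mul, sum_apply]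
    refine Finset.sum_congr rfl fun c _ => ?_
    rw [Finset.sum_mul, Finset.sum_eq_single i]
    · rw [smul_mul_assoc, mul_assoc, star_blockIsom_mul, if_pos rfl, mul_one,
        smul_apply, blockIsom_e]
    · intro b _ hb
      rw [smul_mul_assoc, mul_assoc, star_blockIsom_mul, if_neg hb, mul_zero, smul_zero]
    · simp
  rw [h1, ← inner_e, inner_sum, Finset.sum_eq_single i]
  · rw [inner_smul_right, inner_e, e_apply, if_pos (Nat.div_add_mod k m).symm, mul_one]
  · intro b _ hb
    rw [inner_smul_right, inner_e, e_apply, if_neg, mul_zero]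
    intro h
    apply hb
    apply Fin.ext
    have := Nat.div_add_mod k m
    change (b : ℕ) = k % m
    omega
  · simp

end EllTwo

namespace UHF

open EllTwo

theorem incl_injective : Function.Injective incl := fun _ _ h => Subtype.ext h

theorem trace_eq_of_incl {m : ℕ} (hm : 0 < m) (a : Matrix (Fin m) (Fin m) ℂ) (x : UHF)
    (hx : incl x = ofRect a) : trace x = (m : ℂ)⁻¹ * a.trace := by
  refine tendsto_nhds_unique (tendsto_avg x) ?_
  refine tendsto_const_nhds.congr' ?_
  filter_upwards [eventually_ge_atTop m] with n hn
  obtain ⟨c, hc⟩ := Nat.dvd_factorial hm hn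
  have hc0 : (c : ℂ) ≠ 0 := by
    intro h
    have : c = 0 := by exact_mod_cast h
    subst this
    exact n.factorial_ne_zero (by simpa using hc)
  have hm0 : (m : ℂ) ≠ 0 := by exact_mod_cast hm.ne'
  have hsum : ∀ c : ℕ, ∑ k ∈ Finset.range (m * c), ofRect a (e k) k = c * a.trace := by
    intro c
    induction c with
    | zero => simp
    | succ c ih =>
      rw [mul_add, mul_one, Finset.sum_range_add, ih]
      have : ∑ k ∈ Finset.range m, ofRect a (e (m * c + k)) (m * c + k) = a.trace := by
        rw [Finset.sum_range, Matrix.trace]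
        refine Finset.sum_congr rfl fun i _ => ?_
        rw [ofRect_e_apply hm, Matrix.diag_apply]
        have : (⟨(m * c + i) % m, Nat.mod_lt _ hm⟩ : Fin m) = i :=
          Fin.ext (by simp [Nat.mod_eq_of_lt i.2])
        rw [this]
      rw [this]
      push_cast
      ring
  rw [avg, hx, hc, hsum]
  push_cast
  field_simp

/-- The unital embedding of the matrix algebra of size `m` into `𝒬`. -/
def ofMat {m : ℕ} (hm : 0 < m) : Mat m ℂ →⋆ₐ[ℂ] UHF where
  toFun a := ⟨ofRect (CStarMatrix.ofMatrix.symm a),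
    StarSubalgebra.le_topologicalClosure _ (ofRect_mem _)⟩
  map_one' := Subtype.ext (ofRect_one hm)
  map_mul' a b := Subtype.ext (ofRect_mul _ _)
  map_zero' := Subtype.ext ofRect_zero
  map_add' a b := Subtype.ext (ofRect_add _ _)
  commutes' c := Subtype.ext (by
    change ofRect (algebraMap ℂ (Matrix (Fin m) (Fin m) ℂ) c) = algebraMap ℂ _ c
    rw [Algebra.algebraMap_eq_smul_one, ofRect_smul, ofRect_one hm, Algebra.algebraMap_eq_smul_one])
  map_star' a := Subtype.ext (star_ofRect _).symm

theorem incl_ofMat {m : ℕ} (hm : 0 < m) (a : Mat m ℂ) :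
    incl (ofMat hm a) = ofRect (CStarMatrix.ofMatrix.symm a) := rfl

theorem trace_ofMat {m : ℕ} (hm : 0 < m) (a : Mat m ℂ) :
    trace (ofMat hm a) = (m : ℂ)⁻¹ * (CStarMatrix.ofMatrix.symm a).trace :=
  trace_eq_of_incl hm _ _ rfl

/-- Compression along an isometry between matrix algebras, as an embedding `𝒬 → 𝒬` onto a
corner. -/
def compress {r s : ℕ} (hs : 0 < s) (V : Matrix (Fin r) (Fin s) ℂ)
    (hV : Vᴴ * V = 1) : UHF →⋆ₙₐ[ℂ] UHF where
  toFun x := ⟨ofRect V * incl x * star (ofRect V), conj_ofRect_mem hs V x.2⟩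
  map_smul' c x := incl_injective (by
    change _ * incl (c • x) * _ = c • (_ * incl x * _)
    rw [map_smul, mul_smul_comm, smul_mul_assoc])
  map_zero' := incl_injective (by
    change _ * incl 0 * _ = 0
    rw [map_zero, mul_zero, zero_mul])
  map_add' x y := incl_injective (by
    change _ * incl (x + y) * _ = _ * incl x * _ + _ * incl y * _
    rw [map_add, mul_add, add_mul])
  map_mul' x y := incl_injective (by
    change _ * incl (x * y) * _ = (_ * incl x * _) * (_ * incl y * _)
    have h : star (ofRect V) * ofRect V = 1 := by
      rw [star_ofRect, ← ofRect_mul, hV, ofRect_one hs]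
    rw [map_mul]
    calc _ = ofRect V * incl x * 1 * incl y * star (ofRect V) := by rw [mul_one]; simp only [mul_assoc]
      _ = _ := by rw [← h]; simp only [mul_assoc])
  map_star' x := incl_injective (by
    change _ * incl (star x) * _ = star (_ * incl x * _)
    rw [map_star, star_mul, star_mul, star_star, mul_assoc])

section compress

variable {r s : ℕ} (hs : 0 < s) (V : Matrix (Fin r) (Fin s) ℂ) (hV : Vᴴ * V = 1)

theorem incl_compress (x : UHF) :
    incl (compress hs V hV x) = ofRect V * incl x * star (ofRect V) := rfl

theorem compress_injective : Function.Injective (compress hs V hV) := by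
  intro x y h
  have h' := congrArg (fun z => star (ofRect V) * incl z * ofRect V) h
  have h1 : star (ofRect V) * ofRect V = 1 := by
    rw [star_ofRect, ← ofRect_mul, hV, ofRect_one hs]
  have h2 : ∀ x, star (ofRect V) * incl (compress hs V hV x) * ofRect V = incl x := fun x => by
    rw [incl_compress]
    calc _ = (star (ofRect V) * ofRect V) * incl x * (star (ofRect V) * ofRect V) := by
          simp only [mul_assoc]
      _ = _ := by rw [h1, one_mul, mul_one]
  simp only [h2] at h'
  exact incl_injective h'

theorem compress_ofMat (hr : 0 < r) (a : Mat s ℂ) : compress hs V hV (ofMat hs a) =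
    ofMat hr (CStarMatrix.ofMatrix (V * CStarMatrix.ofMatrix.symm a * Vᴴ)) := by
  refine incl_injective ?_
  rw [incl_compress, incl_ofMat, incl_ofMat, star_ofRect, ← ofRect_mul, ← ofRect_mul]
  rfl

theorem compress_mul_compress {s' : ℕ} (hs' : 0 < s') (W : Matrix (Fin r) (Fin s') ℂ)
    (hW : Wᴴ * W = 1) (hVW : Vᴴ * W = 0) (x y : UHF) :
    compress hs V hV x * compress hs' W hW y = 0 := by
  refine incl_injective ?_
  rw [map_mul, incl_compress, incl_compress, map_zero]
  have h1 : star (ofRect V) * ofRect W = 0 := by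
    rw [star_ofRect, ← ofRect_mul, hVW, ofRect_zero]
  calc _ = ofRect V * incl x * (star (ofRect V) * ofRect W) * incl y * star (ofRect W) := by
        simp only [mul_assoc]
    _ = 0 := by rw [h1]; simp

theorem trace_compress_one (hr : 0 < r) :
    trace (compress hs V hV 1) = (s : ℂ) / r := by
  have h := trace_eq_of_incl hr (V * Vᴴ) (compress hs V hV 1) (by
    rw [incl_compress, map_one, mul_one, star_ofRect, ofRect_mul])
  rw [h, Matrix.trace_mul_comm, hV]
  simp [div_eq_inv_mul]

end compress

theorem trace_one : trace 1 = 1 := by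
  have := trace_eq_of_incl one_pos 1 1 (by rw [map_one, ofRect_one one_pos])
  simpa using this

end UHF

end

noncomputable section


namespace RSHDecomposition

instance {r : ℕ} : FiniteDimensional ℂ (Mat r ℂ) :=
  inferInstanceAs (FiniteDimensional ℂ (Matrix (Fin r) (Fin r) ℂ))

instance {r : ℕ} : TietzeExtension.{v} (Mat r ℂ) := TietzeExtension.of_tvs ℂ

variable {B : Type u} [CStarAlgebra B] (D : RSHDecomposition.{u, v, w} B)

theorem exists_restrict_eq (l : Fin (D.depth + 1)) (f : C(D.Ω l, Mat (D.r l) ℂ)) :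
    ∃ g : C(D.X l, Mat (D.r l) ℂ), g.restrict (D.Ω l) = f :=
  f.exists_restrict_eq (D.isClosed_Ω l)

theorem toPrev_surjective (l : Fin D.depth) : Function.Surjective (D.toPrev l) := by
  intro a
  obtain ⟨g, hg⟩ := D.exists_restrict_eq l.succ (D.φ l a)
  obtain ⟨b, ⟨hb, -⟩, -⟩ := D.pullback_existsUnique l a g hg.symm
  exact ⟨b, hb⟩

theorem ψ_surjective (l : Fin (D.depth + 1)) : Function.Surjective (D.ψ l) := by
  induction l using Fin.reverseInduction with
  | last => exact D.ψ_last_bijective.2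
  | cast l ih =>
    intro a
    obtain ⟨s, rfl⟩ := D.toPrev_surjective l a
    obtain ⟨b, rfl⟩ := ih s
    exact ⟨b, (D.toPrev_ψ l b).symm⟩

theorem ψ_eq_of_component_eq (l : Fin (D.depth + 1)) {a b : B}
    (h : ∀ k ≤ l, D.component k a = D.component k b) : D.ψ l a = D.ψ l b := by
  induction l using Fin.induction with
  | zero => exact D.toFun_zero_bijective.1 (h 0 le_rfl)
  | succ l ih =>
    obtain ⟨c, -, hu⟩ := D.pullback_existsUnique l (D.toPrev l (D.ψ l.succ a))
      (D.toFun l.succ (D.ψ l.succ a)) (D.pullback_comm l _)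
    rw [hu _ ⟨rfl, rfl⟩]
    refine (hu _ ⟨?_, (h _ le_rfl).symm⟩).symm
    change D.toPrev l (D.ψ l.succ b) = D.toPrev l (D.ψ l.succ a)
    rw [D.toPrev_ψ, D.toPrev_ψ, ih fun k hk => h k (hk.trans l.castSucc_le_succ)]

theorem ψ_eq_of_le {k l : Fin (D.depth + 1)} (hkl : k ≤ l) {a b : B} (h : D.ψ l a = D.ψ l b) :
    D.ψ k a = D.ψ k b := by
  induction l using Fin.induction with
  | zero => rwa [Fin.le_zero_iff.1 hkl]
  | succ l ih =>
    rcases hkl.eq_or_lt with rfl | hlt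
    · exact h
    · refine ih (Fin.le_castSucc_iff.2 hlt) ?_
      rw [← D.toPrev_ψ, ← D.toPrev_ψ, h]

theorem component_eq_of_mem_Ω {l : Fin (D.depth + 1)} {a b : B}
    (h : ∀ k < l, D.component k a = D.component k b) {y : D.X l} (hy : y ∈ D.Ω l) :
    D.component l a y = D.component l b y := by
  induction l using Fin.cases with
  | zero => rw [D.Ω_zero] at hy; exact hy.elim
  | succ l =>
    have h1 : D.ψ l.castSucc a = D.ψ l.castSucc b :=
      D.ψ_eq_of_component_eq _ fun k hk => h k (hk.trans_lt l.castSucc_lt_succ)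
    have h2 : ∀ c, D.component l.succ c y = D.φ l (D.ψ l.castSucc c) ⟨y, hy⟩ := by
      intro c
      rw [← D.toPrev_ψ, D.pullback_comm]
      rfl
    rw [h2, h2, h1]

theorem norm_ψ_le (l : Fin (D.depth + 1)) {b : B} {c : ℝ}
    (h : ∀ k ≤ l, ‖D.component k b‖ ≤ c) : ‖D.ψ l b‖ ≤ c := by
  induction l using Fin.induction with
  | zero =>
    have := NonUnitalStarAlgHom.norm_map (D.toFun 0) D.toFun_zero_bijective.1 (D.ψ 0 b)
    rw [← this]
    exact h 0 le_rfl
  | succ l ih =>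
    let T : D.Stage l.succ →⋆ₐ[ℂ] D.Stage l.castSucc × C(D.X l.succ, Mat (D.r l.succ) ℂ) :=
      (D.toPrev l).prod (D.toFun l.succ)
    have hT : Function.Injective T := by
      intro s t hst
      obtain ⟨c, -, hu⟩ := D.pullback_existsUnique l (D.toPrev l s) (D.toFun l.succ s)
        (D.pullback_comm l _)
      rw [hu s ⟨rfl, rfl⟩]
      exact (hu t ⟨(congrArg Prod.fst hst).symm, (congrArg Prod.snd hst).symm⟩).symm
    rw [← NonUnitalStarAlgHom.norm_map T hT]
    refine max_le ?_ (h _ le_rfl)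
    change ‖D.toPrev l (D.ψ l.succ b)‖ ≤ c
    rw [D.toPrev_ψ]
    exact ih fun k hk => h k (hk.trans l.castSucc_le_succ)

theorem norm_component_le_of_mem_Ω {l : Fin (D.depth + 1)} {b : B} {c : ℝ}
    (h : ∀ k < l, ‖D.component k b‖ ≤ c) {y : D.X l} (hy : y ∈ D.Ω l) :
    ‖D.component l b y‖ ≤ c := by
  induction l using Fin.cases with
  | zero => rw [D.Ω_zero] at hy; exact hy.elim
  | succ l =>
    have h2 : D.component l.succ b y = D.φ l (D.ψ l.castSucc b) ⟨y, hy⟩ := by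
      rw [← D.toPrev_ψ, D.pullback_comm]
      rfl
    rw [h2]
    have : CompactSpace (D.Ω l.succ) := isCompact_iff_compactSpace.1 (D.isClosed_Ω _).isCompact
    have h3 : ‖D.φ l (D.ψ l.castSucc b)‖ ≤ ‖D.ψ l.castSucc b‖ :=
      NonUnitalStarAlgHom.norm_apply_le (D.φ l) _
    exact (ContinuousMap.norm_coe_le_norm _ _).trans (h3.trans (D.norm_ψ_le _ fun k hk => h k (hk.trans_lt l.castSucc_lt_succ)))

/-- A function on `X_l` vanishing on `Ω_l` comes from an element of `B` which vanishes on all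
previous base spaces. -/
theorem exists_component_eq (l : Fin (D.depth + 1)) (g : C(D.X l, Mat (D.r l) ℂ))
    (hg : ∀ y ∈ D.Ω l, g y = 0) :
    ∃ b : B, D.component l b = g ∧ ∀ k < l, D.component k b = 0 := by
  induction l using Fin.cases with
  | zero =>
    obtain ⟨s, rfl⟩ := D.toFun_zero_bijective.2 g
    obtain ⟨b, rfl⟩ := D.ψ_surjective 0 s
    exact ⟨b, rfl, fun k hk => (Fin.not_lt_zero k hk).elim⟩
  | succ l =>
    obtain ⟨s, ⟨hs1, hs2⟩, -⟩ := D.pullback_existsUnique l 0 g (by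
      rw [map_zero]; ext1 y; exact (hg y y.2).symm)
    obtain ⟨b, rfl⟩ := D.ψ_surjective _ s
    refine ⟨b, hs2, fun k hk => ?_⟩
    have h0 : D.ψ l.castSucc b = D.ψ l.castSucc 0 := by rw [← D.toPrev_ψ, hs1, map_zero]
    have := D.ψ_eq_of_le (Fin.le_castSucc_iff.2 hk) h0
    change D.toFun k (D.ψ k b) = 0
    rw [this, map_zero, map_zero]

/-- Replacing a component of an element of `B`, without changing the previous ones. -/
theorem exists_component_replace (l : Fin (D.depth + 1)) (b : B) (g : C(D.X l, Mat (D.r l) ℂ))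
    (hg : ∀ y ∈ D.Ω l, g y = D.component l b y) :
    ∃ b' : B, D.component l b' = g ∧ ∀ k < l, D.component k b' = D.component k b := by
  obtain ⟨c, hc, hc'⟩ := D.exists_component_eq l (g - D.component l b) fun y hy => by
    rw [ContinuousMap.sub_apply, hg y hy, sub_self]
  refine ⟨b + c, by rw [map_add, hc, add_sub_cancel], fun k hk => by
    rw [map_add, hc' k hk, add_zero]⟩

theorem eq_of_component_eq {a b : B} (h : ∀ l, D.component l a = D.component l b) : a = b :=
  D.embedding_injective (funext h)

theorem component_eq_toFun (l : Fin (D.depth + 1)) (b : B) :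
    D.component l b = D.toFun l (D.ψ l b) := rfl

end RSHDecomposition

end

noncomputable section


section polar

variable {M N : Type*} [CStarAlgebra M] [PartialOrder M] [StarOrderedRing M]

theorem exists_norm_sub_mul_le {X z : M} (hX : 0 ≤ X) (hz : 0 ≤ z) (h : z * z ≤ X) {ε : ℝ}
    (hε : 0 < ε) : ∃ m, ‖z - CFC.sqrt X * m‖ ^ 2 ≤ ε := by
  have hsp : ∀ t ∈ spectrum ℝ X, 0 ≤ t := fun t ht => spectrum_nonneg_of_nonneg hX ht
  have hc1 : ContinuousOn (fun t : ℝ => 1 / (t + ε)) (spectrum ℝ X) :=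
    ContinuousOn.div (by fun_prop) (by fun_prop) fun t ht => by have := hsp t ht; positivity
  have hc2 : ContinuousOn (fun t : ℝ => ε / (t + ε)) (spectrum ℝ X) :=
    ContinuousOn.div (by fun_prop) (by fun_prop) fun t ht => by have := hsp t ht; positivity
  set g := cfc (fun t : ℝ => 1 / (t + ε)) X with hg
  set v := cfc (fun t : ℝ => ε / (t + ε)) X with hv
  have hXsa : IsSelfAdjoint X := .of_nonneg hX
  have hid : cfc (fun t : ℝ => t) X = X := cfc_id' ℝ X
  have hsum : X * g + v = 1 := by
    rw [hg, hv]
    nth_rw 1 [← hid]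
    rw [← cfc_mul (fun t : ℝ => t) _ X, ← cfc_add (a := X) (fun t : ℝ => t * (1 / (t + ε))) _
      (continuousOn_id.mul hc1) hc2, ← cfc_one ℝ X]
    refine cfc_congr fun t ht => ?_
    have := hsp t ht
    simp only [Pi.one_apply]
    field_simp
  have hvX : v * X * v = cfc (fun t : ℝ => ε / (t + ε) * t * (ε / (t + ε))) X := by
    rw [hv]
    nth_rw 2 [← hid]
    rw [← cfc_mul _ (fun t : ℝ => t) X, 
      ← cfc_mul (fun t : ℝ => ε / (t + ε) * t) _ X (hc2.mul continuousOn_id) hc2]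
  have hvsa : star v = v := (cfc_predicate (p := IsSelfAdjoint) _ X).star_eq
  have hzsa : star z = z := (IsSelfAdjoint.of_nonneg hz).star_eq
  refine ⟨g * CFC.sqrt X * z, ?_⟩
  have hcomm : CFC.sqrt X * g = g * CFC.sqrt X := by
    have h1 : Commute X (CFC.sqrt X) := by
      have := CFC.sqrt_mul_sqrt_self X hX
      calc X * CFC.sqrt X = CFC.sqrt X * CFC.sqrt X * CFC.sqrt X := by rw [this]
        _ = CFC.sqrt X * (CFC.sqrt X * CFC.sqrt X) := mul_assoc _ _ _
        _ = CFC.sqrt X * X := by rw [this]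
    exact ((IsSelfAdjoint.commute_cfc hXsa h1 _).eq).symm
  have h1 : z - CFC.sqrt X * (g * CFC.sqrt X * z) = v * z := by
    have : CFC.sqrt X * (g * CFC.sqrt X * z) = X * g * z := by
      rw [← hcomm, ← mul_assoc, ← mul_assoc, CFC.sqrt_mul_sqrt_self X hX]
    rw [this, sub_eq_iff_eq_add, ← add_mul, add_comm v, hsum, one_mul]
  rw [h1, sq, ← CStarRing.norm_self_mul_star, star_mul, hvsa, hzsa]
  have h2 : v * z * (z * v) ≤ v * X * v := by
    have := star_left_conjugate_le_conjugate h v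
    rw [hvsa] at this
    simpa only [mul_assoc] using this
  have h3 : 0 ≤ v * z * (z * v) := by
    have := mul_star_self_nonneg (v * z)
    rwa [star_mul, hvsa, hzsa] at this
  refine (CStarAlgebra.norm_le_norm_of_nonneg_of_le h3 h2).trans ?_
  rw [hvX]
  refine norm_cfc_le hε.le fun t ht => ?_
  have ht := hsp t ht
  rw [Real.norm_of_nonneg (by positivity)]
  have : ε / (t + ε) * t * (ε / (t + ε)) = ε * ((t / (t + ε)) * (ε / (t + ε))) := by ring
  rw [this]
  refine mul_le_of_le_one_right hε.le (mul_le_one₀ ?_ (by positivity) ?_)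
  · exact (div_le_one (by positivity)).2 (by linarith)
  · exact (div_le_one (by positivity)).2 (by linarith)

/-- A version of the polar decomposition: if `z² ≤ W⋆W`, then `z² = Y⋆Y` for some `Y` in the closed
right ideal generated by `W`, compatibly with morphisms. -/
theorem exists_star_mul_self_eq [CStarAlgebra N] [PartialOrder N] [StarOrderedRing N]
    (π : M →⋆ₐ[ℂ] N) (W z : M) (hz : 0 ≤ z) (h : z * z ≤ star W * W)
    (hπ : π z * π z = star (π W) * π W) :
    ∃ Y ∈ closure (Set.range fun m => W * m), star Y * Y = z * z ∧ π Y = π W := by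
  set s := CFC.sqrt (star W * W) with hs
  have hX : 0 ≤ star W * W := star_mul_self_nonneg W
  have hs0 : 0 ≤ s := CFC.sqrt_nonneg _
  have hss : star s * s = star W * W := by
    rw [(IsSelfAdjoint.of_nonneg hs0).star_eq, hs, CFC.sqrt_mul_sqrt_self _ hX]
  have hnorm : ∀ m, ‖W * m‖ = ‖s * m‖ := by
    intro m
    rw [← sq_eq_sq₀ (norm_nonneg _) (norm_nonneg _), sq, sq, ← CStarRing.norm_star_mul_self,
      ← CStarRing.norm_star_mul_self, star_mul, star_mul]
    congr 1
    rw [mul_assoc, ← mul_assoc (star W), ← hss]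
    simp only [mul_assoc]
  have hex : ∀ n : ℕ, ∃ m, ‖z - s * m‖ ^ 2 ≤ 1 / ((n : ℝ) + 1) := fun n =>
    exists_norm_sub_mul_le hX hz h (by positivity)
  choose m hm using hex
  have hlim : Tendsto (fun n => s * m n) atTop (𝓝 z) := by
    rw [tendsto_iff_norm_sub_tendsto_zero]
    have h1 : Tendsto (fun n => ‖z - s * m n‖ ^ 2) atTop (𝓝 0) :=
      squeeze_zero (fun n => by positivity) hm tendsto_one_div_add_atTop_nhds_zero_nat
    have h2 := h1.sqrt
    simp only [Real.sqrt_sq (norm_nonneg _), Real.sqrt_zero] at h2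
    simpa only [norm_sub_rev] using h2
  have hcau : CauchySeq fun n => W * m n := by
    have := hlim.cauchySeq
    rw [Metric.cauchySeq_iff] at this ⊢
    intro ε hε
    obtain ⟨K, hK⟩ := this ε hε
    refine ⟨K, fun a ha b hb => ?_⟩
    have := hK a ha b hb
    rw [dist_eq_norm, ← mul_sub] at this ⊢
    rwa [hnorm]
  obtain ⟨Y, hY⟩ := cauchySeq_tendsto_of_complete hcau
  refine ⟨Y, mem_closure_of_tendsto hY (Eventually.of_forall fun n => ⟨m n, rfl⟩), ?_, ?_⟩
  · have h1 : Tendsto (fun n => star (W * m n) * (W * m n)) atTop (𝓝 (star Y * Y)) :=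
      (hY.star).mul hY
    have h2 : Tendsto (fun n => star (s * m n) * (s * m n)) atTop (𝓝 (star z * z)) :=
      (hlim.star).mul hlim
    have h3 : ∀ n, star (W * m n) * (W * m n) = star (s * m n) * (s * m n) := fun n => by
      rw [star_mul, star_mul, mul_assoc, ← mul_assoc (star W), ← hss]
      simp only [mul_assoc]
    simp only [h3] at h1
    rw [tendsto_nhds_unique h1 h2, (IsSelfAdjoint.of_nonneg hz).star_eq]
  · have hcont : Continuous π :=
      (NonUnitalStarAlgHom.instContinuousLinearMapClassComplex (F := M →⋆ₐ[ℂ] N)).map_continuous π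
    have hπz : π z = π s := by
      have h1 : 0 ≤ π z := map_nonneg π hz
      have h2 : 0 ≤ π s := map_nonneg π hs0
      have h3 : π z * π z = π s * π s := by
        rw [hπ, ← map_mul π s, ← (IsSelfAdjoint.of_nonneg hs0).star_eq]
        nth_rw 1 [(IsSelfAdjoint.of_nonneg hs0).star_eq]
        rw [← map_star, ← map_mul, ← hss]
        simp only [(IsSelfAdjoint.of_nonneg hs0).star_eq]
      rw [← CFC.sqrt_mul_self _ h1, h3, CFC.sqrt_mul_self _ h2]
    have hnormπ : ∀ m : M, ‖π W * π m - π W‖ = ‖π s * π m - π s‖ := by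
      intro m
      have hss' : star (π s) * π s = star (π W) * π W := by
        rw [← map_star, ← map_star, ← map_mul, ← map_mul, hss]
      have e : ∀ x : N, x * π m - x = x * (π m - 1) := fun x => by rw [mul_sub, mul_one]
      rw [e, e, ← sq_eq_sq₀ (norm_nonneg _) (norm_nonneg _), sq, sq,
        ← CStarRing.norm_star_mul_self, ← CStarRing.norm_star_mul_self, star_mul, star_mul]
      congr 1
      rw [mul_assoc, ← mul_assoc (star (π W)), ← hss']
      simp only [mul_assoc]
    have h1 : Tendsto (fun n => π (W * m n)) atTop (𝓝 (π Y)) := (hcont.tendsto Y).comp hY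
    have h2 : Tendsto (fun n => π (W * m n)) atTop (𝓝 (π W)) := by
      rw [tendsto_iff_norm_sub_tendsto_zero]
      have h3 : Tendsto (fun n => π (s * m n)) atTop (𝓝 (π s)) := by
        rw [← hπz]; exact (hcont.tendsto z).comp hlim
      rw [tendsto_iff_norm_sub_tendsto_zero] at h3
      simp only [map_mul] at h3 ⊢
      simpa only [hnormπ] using h3
    exact tendsto_nhds_unique h1 h2

end polar

end

noncomputable section


set_option linter.unusedSectionVars false

section rows

/-- Square matrices over a C⋆-algebra, with no structure besides that of a C⋆-algebra. -/
def SqMat (I A : Type*) [Fintype I] [DecidableEq I] [CStarAlgebra A] [PartialOrder A]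
    [StarOrderedRing A] : Type _ := CStarMatrix I I A

namespace SqMat

variable {I P : Type*} [Fintype I] [DecidableEq I]
variable {A : Type*} [CStarAlgebra A] [PartialOrder A] [StarOrderedRing A]
variable {A' : Type*} [CStarAlgebra A'] [PartialOrder A'] [StarOrderedRing A']

instance : CStarAlgebra (SqMat I A) := inferInstanceAs (CStarAlgebra (CStarMatrix I I A))

instance : PartialOrder (SqMat I A) := inferInstanceAs (PartialOrder (CStarMatrix I I A))

instance : StarOrderedRing (SqMat I A) := inferInstanceAs (StarOrderedRing (CStarMatrix I I A))

/-- The entries of a matrix. -/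
def entry (T : SqMat I A) (i j : I) : A := CStarMatrix.ofMatrix.symm T i j

/-- The matrix with given entries. -/
def of (f : I → I → A) : SqMat I A := CStarMatrix.ofMatrix f

@[simp] theorem entry_of (f : I → I → A) (i j : I) : (of f).entry i j = f i j := rfl

theorem ext_entry {S T : SqMat I A} (h : ∀ i j, S.entry i j = T.entry i j) : S = T :=
  CStarMatrix.ext h

theorem entry_mul (S T : SqMat I A) (i j : I) :
    (S * T).entry i j = ∑ k, S.entry i k * T.entry k j := CStarMatrix.mul_apply

theorem entry_star (T : SqMat I A) (i j : I) : (star T).entry i j = star (T.entry j i) := rfl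

theorem entry_sub (S T : SqMat I A) (i j : I) :
    (S - T).entry i j = S.entry i j - T.entry i j := rfl

theorem entry_add (S T : SqMat I A) (i j : I) :
    (S + T).entry i j = S.entry i j + T.entry i j := rfl

theorem entry_one (i j : I) : (1 : SqMat I A).entry i j = if i = j then 1 else 0 :=
  CStarMatrix.one_apply

theorem entry_zero (i j : I) : (0 : SqMat I A).entry i j = 0 := rfl

theorem entry_algebraMap (c : ℂ) (i j : I) :
    (algebraMap ℂ (SqMat I A) c).entry i j = if i = j then algebraMap ℂ A c else 0 :=
  CStarMatrix.algebraMap_apply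

theorem norm_entry_le (T : SqMat I A) (i j : I) : ‖T.entry i j‖ ≤ ‖T‖ :=
  CStarMatrix.norm_entry_le_norm

/-- Diagonal matrices with entries in a C⋆-algebra, repeated according to `x : I → P`. -/
def diagonalHom (x : I → P) [Fintype P] : (P → A) →⋆ₐ[ℂ] SqMat I A where
  toFun a := of fun i j => if i = j then a (x i) else 0
  map_one' := ext_entry fun i j => by simp [entry_one]
  map_mul' a b := ext_entry fun i j => by
    rw [entry_mul, Finset.sum_eq_single i]
    · simp
    · intro k _ hk; simp [Ne.symm hk]
    · simp
  map_zero' := ext_entry fun i j => by simp [entry_zero]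
  map_add' a b := ext_entry fun i j => by
    rw [entry_add]
    by_cases h : i = j <;> simp [h]
  commutes' c := ext_entry fun i j => by simp [entry_algebraMap]
  map_star' a := ext_entry fun i j => by
    rw [entry_star]
    by_cases h : i = j
    · subst h; simp
    · simp [h, Ne.symm h]

theorem entry_diagonalHom (x : I → P) [Fintype P] (a : P → A) (i j : I) :
    (diagonalHom x a).entry i j = if i = j then a (x i) else 0 := rfl

theorem diagonalHom_nonneg (x : I → P) [Fintype P] {a : P → A} (ha : ∀ p, 0 ≤ a p) :
    0 ≤ diagonalHom x a := by
  have : a = star (fun p => CFC.sqrt (a p)) * (fun p => CFC.sqrt (a p)) := by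
    funext p
    change a p = star (CFC.sqrt (a p)) * CFC.sqrt (a p)
    rw [(IsSelfAdjoint.of_nonneg (CFC.sqrt_nonneg _)).star_eq, CFC.sqrt_mul_sqrt_self _ (ha p)]
  rw [this, map_mul, map_star]
  exact star_mul_self_nonneg _

/-- Entrywise application of a unital morphism to square matrices. -/
def mapHom (π : A →⋆ₐ[ℂ] A') : SqMat I A →⋆ₐ[ℂ] SqMat I A' where
  toFun T := of fun i j => π (T.entry i j)
  map_one' := ext_entry fun i j => by simp [entry_one, apply_ite π]
  map_mul' S T := ext_entry fun i j => by simp [entry_mul]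
  map_zero' := ext_entry fun i j => by simp [entry_zero]
  map_add' S T := ext_entry fun i j => by simp [entry_add]
  commutes' c := ext_entry fun i j => by
    simp only [entry_of, entry_algebraMap, apply_ite π, map_zero, AlgHomClass.commutes]
  map_star' T := ext_entry fun i j => by
    rw [entry_star, entry_of, entry_of, entry_star]; exact map_star π _

theorem entry_mapHom (π : A →⋆ₐ[ℂ] A') (T : SqMat I A) (i j : I) :
    (mapHom π T).entry i j = π (T.entry i j) := rfl

theorem mapHom_diagonalHom [Fintype P] (π : A →⋆ₐ[ℂ] A') (x : I → P) (a : P → A) :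
    mapHom π (diagonalHom x a) = diagonalHom x fun p => π (a p) :=
  ext_entry fun i j => by
    rw [entry_mapHom, entry_diagonalHom, entry_diagonalHom, apply_ite π, map_zero]

/-- The matrix with only one nonzero row. -/
def row (i₀ : I) (u : I → A) : SqMat I A := of fun i j => if i = i₀ then u j else 0

theorem mapHom_row (π : A →⋆ₐ[ℂ] A') (i₀ : I) (u : I → A) :
    mapHom π (row i₀ u) = row i₀ fun i => π (u i) :=
  ext_entry fun i j => by simp [entry_mapHom, row, apply_ite π]

theorem entry_star_mul_self_of_row (i₀ : I) {Y : SqMat I A}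
    (hY : ∀ i ≠ i₀, ∀ j, Y.entry i j = 0) (i j : I) :
    (star Y * Y).entry i j = star (Y.entry i₀ i) * Y.entry i₀ j := by
  rw [entry_mul, Finset.sum_eq_single i₀]
  · rfl
  · intro k _ hk
    rw [hY k hk j, mul_zero]
  · simp

theorem entry_row (i₀ : I) (u : I → A) (i j : I) :
    (row i₀ u).entry i j = if i = i₀ then u j else 0 := rfl

theorem entry_star_row_mul_row (i₀ : I) (u : I → A) (i j : I) :
    (star (row i₀ u) * row i₀ u).entry i j = star (u i) * u j := by
  have hY : ∀ i ≠ i₀, ∀ j, (row i₀ u).entry i j = 0 := fun i hi j => if_neg hi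
  rw [entry_star_mul_self_of_row i₀ hY, entry_row, entry_row, if_pos rfl, if_pos rfl]

theorem star_sum_mul_sum_le {ι : Type*} [Fintype ι] (a : ι → A) :
    star (∑ i, a i) * ∑ i, a i ≤ (Fintype.card ι : ℝ) • ∑ i, star (a i) * a i := by
  have h : ∑ i, ∑ j, star (a i - a j) * (a i - a j) =
      (2 : ℝ) • ((Fintype.card ι : ℝ) • ∑ i, star (a i) * a i -
        star (∑ i, a i) * ∑ i, a i) := by
    simp only [star_sub, sub_mul, mul_sub, Finset.sum_sub_distrib, Finset.sum_const,
      Finset.card_univ, star_sum, Finset.sum_mul, Finset.mul_sum]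
    rw [Finset.sum_comm (f := fun i j => star (a j) * a i)]
    rw [← Finset.smul_sum, ← Nat.cast_smul_eq_nsmul ℝ, two_smul]
    abel
  have h0 : 0 ≤ ∑ i, ∑ j, star (a i - a j) * (a i - a j) :=
    Finset.sum_nonneg fun i _ => Finset.sum_nonneg fun j _ => star_mul_self_nonneg _
  rw [h] at h0
  have h1 := smul_nonneg (show (0 : ℝ) ≤ 1 / 2 by norm_num) h0
  rw [smul_smul] at h1
  rwa [show (1 : ℝ) / 2 * 2 = 1 by norm_num, one_smul, sub_nonneg] at h1

/-- A positive matrix is dominated by a multiple of its diagonal part. -/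
theorem le_card_smul_diagonal {T : SqMat I A} (hT : 0 ≤ T) :
    (∀ i, 0 ≤ T.entry i i) ∧
    T ≤ (Fintype.card I : ℝ) • diagonalHom id (fun i => T.entry i i) := by
  set r := CFC.sqrt T with hr
  have hrsa : star r = r := (IsSelfAdjoint.of_nonneg (CFC.sqrt_nonneg T)).star_eq
  have hrr : star r * r = T := by rw [hrsa, hr, CFC.sqrt_mul_sqrt_self T hT]
  constructor
  · intro i
    rw [← hrr, entry_mul]
    exact Finset.sum_nonneg fun k _ => star_mul_self_nonneg _
  · let E : I → SqMat I A := fun j => diagonalHom id (Pi.single j (1 : A))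
    have hE : ∑ j, E j = 1 := by
      change ∑ j, diagonalHom id (Pi.single j (1 : A)) = 1
      rw [← map_sum, Finset.univ_sum_single (fun _ : I => (1 : A))]
      exact map_one (diagonalHom id)
    have h := star_sum_mul_sum_le fun j => r * E j
    rw [← Finset.mul_sum, hE, mul_one, hrr] at h
    refine h.trans_eq ?_
    congr 1
    have : ∀ j, star (r * E j) * (r * E j) = diagonalHom id (Pi.single j (T.entry j j)) := by
      intro j
      have h1 : star (r * E j) * (r * E j) = E j * T * E j := by
        have : star (E j) = E j := by
          change star (diagonalHom id (Pi.single j (1 : A))) = _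
          rw [← map_star, ← Pi.single_star, star_one]
        rw [star_mul, this, ← hrr]
        simp only [mul_assoc]
      have h2 : ∀ i k, (E j).entry i k = if i = k ∧ i = j then 1 else 0 := by
        intro i k
        change (if i = k then (Pi.single j (1 : A) : I → A) i else 0) = _
        rw [Pi.single_apply]
        by_cases hik : i = k <;> by_cases hij : i = j <;> simp [hik, hij]
      rw [h1]
      refine ext_entry fun a b => ?_
      have h3 : ∀ S : SqMat I A, ∀ a b, (S * E j).entry a b = if b = j then S.entry a b else 0 := by
        intro S a b
        rw [entry_mul, Finset.sum_eq_single b]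
        · rw [h2]; simp
        · intro k _ hk; rw [h2]; simp [hk]
        · simp
      have h4 : ∀ S : SqMat I A, ∀ a b, (E j * S).entry a b = if a = j then S.entry a b else 0 := by
        intro S a b
        rw [entry_mul, Finset.sum_eq_single a]
        · rw [h2]; simp
        · intro k _ hk; rw [h2]; simp [Ne.symm hk]
        · simp
      rw [h3, h4, entry_diagonalHom]
      simp only [id, Pi.single_apply]
      by_cases haj : a = j <;> by_cases hbj : b = j
      · subst haj; subst hbj; simp
      · subst haj; simp [hbj, Ne.symm hbj]
      · subst hbj; simp [haj]
      · simp [haj, hbj]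
    simp only [this]
    rw [← map_sum, Finset.univ_sum_single]

end SqMat

end rows

end

noncomputable section


/-- The function `t ↦ min (max t 0) 1`. -/
def clampFun (t : ℝ) : ℝ := min (max t 0) 1

theorem continuous_clampFun : Continuous clampFun := by unfold clampFun; fun_prop

theorem clampFun_nonneg (t : ℝ) : 0 ≤ clampFun t := le_min (le_max_right _ _) zero_le_one

theorem clampFun_le_one (t : ℝ) : clampFun t ≤ 1 := min_le_right _ _

theorem clampFun_of_mem {t : ℝ} (h0 : 0 ≤ t) (h1 : t ≤ 1) : clampFun t = t := by
  rw [clampFun, max_eq_left h0, min_eq_left h1]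

theorem clampFun_pow_le (t : ℝ) : clampFun t ^ 3 ≤ clampFun t * t * clampFun t := by
  have h0 := clampFun_nonneg t
  rcases le_total t 0 with ht | ht
  · have : clampFun t = 0 := by rw [clampFun, max_eq_right ht, min_eq_left zero_le_one]
    simp [this]
  · have h : clampFun t ≤ t := by rw [clampFun, max_eq_left ht]; exact min_le_left _ _
    calc clampFun t ^ 3 = clampFun t * clampFun t * clampFun t := by ring
      _ ≤ clampFun t * t * clampFun t := by gcongr

section lift

variable {A A' : Type*} [CStarAlgebra A] [CStarAlgebra A']

theorem StarAlgHom.map_real_smul (f : A →⋆ₐ[ℂ] A') (r : ℝ) (a : A) : f (r • a) = r • f a := by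
  rw [← Complex.coe_smul, ← Complex.coe_smul, map_smul]

theorem exists_isSelfAdjoint_lift (π : A →⋆ₐ[ℂ] A') (hπ : Function.Surjective π) {b : A'}
    (hb : IsSelfAdjoint b) : ∃ a, IsSelfAdjoint a ∧ π a = b := by
  obtain ⟨a, rfl⟩ := hπ b
  refine ⟨(2⁻¹ : ℝ) • (a + star a), ?_, ?_⟩
  · rw [IsSelfAdjoint, star_smul, star_add, star_star, add_comm, star_trivial]
  · rw [StarAlgHom.map_real_smul, map_add, map_star, hb.star_eq, ← two_smul ℝ, smul_smul]
    norm_num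

/-- Families in a C⋆-algebra, with no structure besides that of a C⋆-algebra. -/
def PiAlg (P A : Type*) [Fintype P] [CStarAlgebra A] : Type _ := P → A

instance {P : Type*} [Fintype P] : CStarAlgebra (PiAlg P A) :=
  inferInstanceAs (CStarAlgebra (P → A))

open SqMat in
theorem SqMat.exists_cfc_diagonalHom {I P : Type*} [Fintype I] [DecidableEq I] [Fintype P]
    [PartialOrder A] [StarOrderedRing A] (x : I → P) (e : P → A) (he : IsSelfAdjoint e)
    (f : ℝ → ℝ) (hf : Continuous f) {C : ℝ} (hC : 0 ≤ C) (hfC : ∀ t, |f t| ≤ C) :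
    ∃ d : P → A, (∀ p, ‖d p‖ ≤ C) ∧
      cfc f (diagonalHom x e : SqMat I A) = diagonalHom x d := by
  let δ : PiAlg P A →⋆ₐ[ℂ] SqMat I A := (diagonalHom x : (P → A) →⋆ₐ[ℂ] SqMat I A)
  let e' : PiAlg P A := e
  have he' : IsSelfAdjoint e' := he
  have hcont : Continuous δ :=
    (NonUnitalStarAlgHom.instContinuousLinearMapClassComplex
      (F := PiAlg P A →⋆ₐ[ℂ] SqMat I A)).map_continuous δ
  have h1 := StarAlgHom.map_cfc (δ.restrictScalars ℝ) f e' hf.continuousOn hcont he' (he'.map δ)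
  let d' : PiAlg P A := cfc f e'
  have h2 : ‖d'‖ ≤ C := norm_cfc_le hC fun t _ => hfC t
  exact ⟨d', fun p => (norm_le_pi_norm (ι := P) (G := fun _ => A) d' p).trans h2, h1.symm⟩

set_option maxHeartbeats 1000000 in
open SqMat in
/-- Lifting of rows with orthogonal entries along surjective morphisms, after multiplication with
the entries of the diagonal. -/
theorem exists_lift_row {I P : Type*} [Fintype I] [DecidableEq I] [Fintype P]
    (π : A →⋆ₐ[ℂ] A') (hπ : Function.Surjective π) (x : I → P) (hx : Function.Surjective x)
    (y : I → A') (d : P → A')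
    (h : ∀ i j, star (y i) * y j = if i = j then d (x i) else 0) (hd : ∀ p, ‖d p‖ ≤ 1) :
    ∃ (y' : I → A) (d' : P → A),
      (∀ i j, star (y' i) * y' j = if i = j then d' (x i) else 0) ∧ (∀ p, ‖d' p‖ ≤ 1) ∧
        ∀ i, π (y' i) = y i * d (x i) := by
  rcases isEmpty_or_nonempty I with hI | ⟨⟨i₀⟩⟩
  · have : IsEmpty P := ⟨fun p => hI.elim (hx p).choose⟩
    exact ⟨fun i => hI.elim i, fun p => this.elim p, fun i => hI.elim i, fun p => this.elim p,
      fun i => hI.elim i⟩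
  let _ := CStarAlgebra.spectralOrder A
  let _ := CStarAlgebra.spectralOrder A'
  have := CStarAlgebra.spectralOrderedRing A
  have := CStarAlgebra.spectralOrderedRing A'
  have hd0 : ∀ p, 0 ≤ d p := fun p => by
    obtain ⟨i, rfl⟩ := hx p
    have := h i i
    rw [if_pos rfl] at this
    rw [← this]
    exact star_mul_self_nonneg _
  choose u hu using fun i => hπ (y i)
  choose e he heπ using fun p => exists_isSelfAdjoint_lift π hπ (IsSelfAdjoint.of_nonneg (hd0 p))
  set U : SqMat I A := row i₀ u with hU
  have hUrow : ∀ i ≠ i₀, ∀ j, U.entry i j = 0 := fun i hi j => if_neg hi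
  set G : SqMat I A := star U * U with hG
  set D₀ : SqMat I A' := diagonalHom x d with hD₀
  have hπG : mapHom π G = D₀ := by
    refine ext_entry fun i j => ?_
    rw [entry_mapHom, hG, entry_star_mul_self_of_row i₀ hUrow, map_mul, map_star]
    change star (π (if i₀ = i₀ then u i else 0)) * π (if i₀ = i₀ then u j else 0) = _
    rw [if_pos rfl, if_pos rfl, hu, hu, h, entry_diagonalHom]
  set Δ : SqMat I A := diagonalHom x e - G with hΔ
  have hesa : IsSelfAdjoint (diagonalHom x e : SqMat I A) := by
    rw [IsSelfAdjoint, ← map_star]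
    congr 1
    exact funext fun p => (he p).star_eq
  have hΔsa : IsSelfAdjoint Δ := hesa.sub (.star_mul_self U)
  have hπΔ : mapHom π Δ = 0 := by
    rw [hΔ, map_sub, hπG, mapHom_diagonalHom, hD₀, sub_eq_zero]
    congr 1
    exact funext heπ
  have hcont : ∀ {X Y : Type _} [CStarAlgebra X] [CStarAlgebra Y] (f : X →⋆ₐ[ℂ] Y),
      Continuous f := fun f =>
    (NonUnitalStarAlgHom.instContinuousLinearMapClassComplex (F := _ →⋆ₐ[ℂ] _)).map_continuous f
  set T : SqMat I A := cfc (fun t : ℝ => max t 0) Δ with hT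
  have hT0 : 0 ≤ T := cfc_nonneg fun t _ => le_max_right _ _
  have hΔT : Δ ≤ T := by
    nth_rw 1 [← cfc_id' ℝ Δ]
    exact cfc_mono fun t _ => le_max_left _ _
  have hπT : mapHom π T = 0 := by
    rw [hT]
    have h1 := StarAlgHom.map_cfc ((mapHom π : SqMat I A →⋆ₐ[ℂ] SqMat I A').restrictScalars ℝ)
      (fun t : ℝ => max t 0) Δ (by fun_prop) (hcont (mapHom π)) hΔsa (hΔsa.map _)
    change mapHom π (cfc _ Δ) = cfc _ (mapHom π Δ) at h1
    rw [h1, hπΔ, cfc_apply_zero]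
    simp
  obtain ⟨hTdiag, hTle⟩ := le_card_smul_diagonal hT0
  set s : A := ∑ i, T.entry i i with hs
  have hπs : π s = 0 := by
    rw [hs, map_sum]
    refine Finset.sum_eq_zero fun i _ => ?_
    rw [← entry_mapHom, hπT, entry_zero]
  set e' : P → A := fun p => e p - (Fintype.card I : ℝ) • s with he'
  have hs0 : 0 ≤ s := Finset.sum_nonneg fun i _ => hTdiag i
  have he'sa : ∀ p, IsSelfAdjoint (e' p) := fun p =>
    (he p).sub ((IsSelfAdjoint.all (Fintype.card I : ℝ)).smul (IsSelfAdjoint.of_nonneg hs0))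
  have he'sa' : IsSelfAdjoint e' := funext fun p => (he'sa p).star_eq
  have hπe' : ∀ p, π (e' p) = d p := fun p => by
    rw [he', map_sub, StarAlgHom.map_real_smul, hπs, smul_zero, sub_zero, heπ]
  set E : SqMat I A := diagonalHom x e' with hE
  have hEsa : IsSelfAdjoint E := he'sa'.map _
  have hEG : E ≤ G := by
    have h1 : T ≤ (Fintype.card I : ℝ) • diagonalHom x (fun _ => s) := by
      refine hTle.trans (smul_le_smul_of_nonneg_left ?_ (Nat.cast_nonneg _))
      rw [← sub_nonneg]
      have : (diagonalHom x (fun _ => s) : SqMat I A) - diagonalHom id (fun i => T.entry i i) =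
          diagonalHom id (fun i => s - T.entry i i) := by
        refine ext_entry fun i j => ?_
        rw [entry_sub, entry_diagonalHom, entry_diagonalHom, entry_diagonalHom]
        split_ifs <;> simp
      rw [this]
      refine diagonalHom_nonneg id fun i => sub_nonneg.2 ?_
      exact Finset.single_le_sum (f := fun i => T.entry i i) (fun i _ => hTdiag i)
        (Finset.mem_univ i)
    have h2 : E = diagonalHom x e - (Fintype.card I : ℝ) • diagonalHom x (fun _ => s) := by
      have : (Fintype.card I : ℝ) • (diagonalHom x (fun _ => s) : SqMat I A) =
          diagonalHom x (fun _ => (Fintype.card I : ℝ) • s) := by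
        rw [← Complex.coe_smul, ← Complex.coe_smul, ← map_smul]
        rfl
      rw [this, ← map_sub]
      rfl
    rw [h2, sub_le_iff_le_add, ← sub_le_iff_le_add']
    exact hΔT.trans h1
  have hE₀sa : IsSelfAdjoint D₀ := by
    rw [← hπG]; exact (IsSelfAdjoint.star_mul_self U).map _
  have hπE : mapHom π E = D₀ := by
    rw [hE, mapHom_diagonalHom]
    congr 1
    exact funext hπe'
  have hmapcfc : ∀ f : ℝ → ℝ, Continuous f → mapHom π (cfc f E) = cfc f D₀ := fun f hf => by
    have h1 := StarAlgHom.map_cfc ((mapHom π : SqMat I A →⋆ₐ[ℂ] SqMat I A').restrictScalars ℝ)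
      f E hf.continuousOn (hcont (mapHom π)) hEsa (hEsa.map _)
    change mapHom π (cfc _ E) = cfc _ (mapHom π E) at h1
    rw [h1, hπE]
  have hD₀sp : ∀ t ∈ spectrum ℝ D₀, clampFun t = t := by
    intro t ht
    have h1 : 0 ≤ D₀ := diagonalHom_nonneg x hd0
    have h2 : ‖D₀‖ ≤ 1 := by
      refine (NonUnitalStarAlgHom.norm_apply_le (diagonalHom x : (P → A') →⋆ₐ[ℂ] SqMat I A') d).trans ?_
      exact (pi_norm_le_iff_of_nonneg zero_le_one).2 hd
    refine clampFun_of_mem (spectrum_nonneg_of_nonneg h1 ht) ?_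
    rcases subsingleton_or_nontrivial (SqMat I A') with hsub | hnt
    · rw [spectrum.of_subsingleton] at ht
      exact ht.elim
    · exact (le_abs_self t).trans ((spectrum.norm_le_norm_of_mem ht).trans h2)
  have hfc := continuous_clampFun
  set c : SqMat I A := cfc clampFun E with hc
  have hcsa : star c = c := (cfc_predicate (p := IsSelfAdjoint) _ E).star_eq
  have hπc : mapHom π c = D₀ := by
    rw [hc, hmapcfc _ hfc]
    nth_rw 2 [← cfc_id ℝ D₀]
    exact cfc_congr hD₀sp
  set W : SqMat I A := U * c with hW
  have hWW : star W * W = c * G * c := by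
    rw [hW, star_mul, hcsa, hG]; simp only [mul_assoc]
  set z : SqMat I A := cfc (fun t => clampFun t * Real.sqrt (clampFun t)) E with hz
  have hzf : Continuous fun t => clampFun t * Real.sqrt (clampFun t) := by fun_prop
  have hz0 : 0 ≤ z := cfc_nonneg fun t _ => mul_nonneg (clampFun_nonneg t) (Real.sqrt_nonneg _)
  have hzz : z * z = cfc (fun t => clampFun t ^ 3) E := by
    rw [hz, ← cfc_mul _ _ E hzf.continuousOn hzf.continuousOn]
    refine cfc_congr fun t _ => ?_
    have := Real.mul_self_sqrt (clampFun_nonneg t)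
    calc clampFun t * Real.sqrt (clampFun t) * (clampFun t * Real.sqrt (clampFun t))
        = clampFun t ^ 2 * (Real.sqrt (clampFun t) * Real.sqrt (clampFun t)) := by ring
      _ = clampFun t ^ 3 := by rw [this]; ring
  have hcEc : c * E * c = cfc (fun t => clampFun t * t * clampFun t) E := by
    rw [hc]
    nth_rw 2 [← cfc_id' ℝ E]
    rw [← cfc_mul _ (fun t : ℝ => t) E hfc.continuousOn, ← cfc_mul (fun t => clampFun t * t) _ E
      (hfc.mul continuous_id).continuousOn hfc.continuousOn]
  have hle : z * z ≤ star W * W := by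
    rw [hzz, hWW]
    have h1 : cfc (fun t => clampFun t ^ 3) E ≤ c * E * c := by
      rw [hcEc]
      exact cfc_mono (fun t _ => clampFun_pow_le t) (by fun_prop) (by fun_prop)
    refine h1.trans ?_
    have := star_left_conjugate_le_conjugate hEG c
    rwa [hcsa] at this
  have hD₀3 : cfc (fun t => clampFun t ^ 3) D₀ = D₀ * D₀ * D₀ := by
    have : cfc (fun t => clampFun t ^ 3) D₀ = cfc (fun t : ℝ => t ^ 3) D₀ :=
      cfc_congr fun t ht => by simp only [hD₀sp t ht]
    rw [this, cfc_pow_id D₀ 3, pow_succ, pow_two]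
  have hππ : mapHom π z * mapHom π z = star (mapHom π W) * mapHom π W := by
    have h1 : star (mapHom π W) * mapHom π W = D₀ * D₀ * D₀ := by
      rw [← map_star (mapHom π) W, ← map_mul (mapHom π) (star W) W, hWW,
        map_mul (mapHom π) (c * G), map_mul (mapHom π) c, hπc, hπG]
    rw [h1, ← map_mul (mapHom π) z z, hzz, hmapcfc _ (by fun_prop), hD₀3]
  obtain ⟨Y, hYcl, hYY, hπY⟩ := exists_star_mul_self_eq (mapHom π) W z hz0 hle hππ
  have hYrow : ∀ i ≠ i₀, ∀ j, Y.entry i j = 0 := by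
    intro i hi j
    have hcl : IsClosed {Y : SqMat I A | Y.entry i j = 0} := by
      refine isClosed_eq ?_ continuous_const
      refine continuous_iff_continuousAt.2 fun S => ?_
      rw [ContinuousAt, tendsto_iff_norm_sub_tendsto_zero]
      refine squeeze_zero (fun _ => norm_nonneg _) (fun S' => ?_)
        (tendsto_iff_norm_sub_tendsto_zero.1 (tendsto_id (x := 𝓝 S)))
      rw [← entry_sub]
      exact norm_entry_le _ i j
    refine closure_minimal ?_ hcl hYcl
    rintro _ ⟨m, rfl⟩
    change (W * m).entry i j = 0
    rw [hW, mul_assoc, entry_mul]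
    exact Finset.sum_eq_zero fun k _ => by rw [hUrow i hi k, zero_mul]
  obtain ⟨d', hd'norm, hdiag⟩ := exists_cfc_diagonalHom (I := I) x e' he'sa'
    (fun t => clampFun t ^ 3) (by fun_prop) zero_le_one fun t => by
      rw [abs_of_nonneg (pow_nonneg (clampFun_nonneg t) 3)]
      exact pow_le_one₀ (clampFun_nonneg t) (clampFun_le_one t)
  refine ⟨fun i => Y.entry i₀ i, d', fun i j => ?_, fun p => ?_, fun i => ?_⟩
  · rw [← entry_star_mul_self_of_row i₀ hYrow, hYY, hzz, hdiag, entry_diagonalHom]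
  · exact hd'norm p
  · rw [← entry_mapHom, hπY, hW, map_mul, hπc, hU, mapHom_row, entry_mul, Finset.sum_eq_single i]
    · simp only [row, entry_of, if_true, hu, hD₀, entry_diagonalHom]
    · intro k _ hk
      rw [hD₀, entry_diagonalHom, if_neg hk, mul_zero]
    · simp

end lift

end

noncomputable section


set_option linter.unusedSectionVars false

section rowMap

variable {I P : Type*} [Fintype I] [DecidableEq I]

/-- The map `a ↦ Y a Y⋆` for a row `Y` of elements of a C⋆-algebra and scalar matrices `a`. -/
def rowMap {A : Type*} [CStarAlgebra A] (y : I → A) : Matrix I I ℂ →ₗ[ℂ] A where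
  toFun a := ∑ i, ∑ j, a i j • (y i * star (y j))
  map_add' a b := by simp [add_smul, Finset.sum_add_distrib]
  map_smul' c a := by simp [mul_smul, Finset.smul_sum]

variable {A A' : Type*} [CStarAlgebra A] [CStarAlgebra A']

theorem rowMap_apply (y : I → A) (a : Matrix I I ℂ) :
    rowMap y a = ∑ i, ∑ j, a i j • (y i * star (y j)) := rfl

theorem map_rowMap (f : A →⋆ₐ[ℂ] A') (y : I → A) (a : Matrix I I ℂ) :
    f (rowMap y a) = rowMap (fun i => f (y i)) a := by
  simp only [rowMap_apply, map_sum, map_smul, map_mul, map_star]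

theorem rowMap_one (y : I → A) : rowMap y 1 = ∑ i, y i * star (y i) := by
  rw [rowMap_apply]
  refine Finset.sum_congr rfl fun i _ => ?_
  rw [Finset.sum_eq_single i]
  · simp
  · intro j _ hj; simp [Ne.symm hj]
  · simp

theorem star_rowMap (y : I → A) (a : Matrix I I ℂ) : star (rowMap y a) = rowMap y aᴴ := by
  simp only [rowMap_apply, star_sum, star_smul, star_mul, star_star, Matrix.conjTranspose_apply]
  rw [Finset.sum_comm]

theorem rowMap_conjTranspose_mul (y : I → A) (a b : Matrix I I ℂ) :
    rowMap y (aᴴ * b) = ∑ k, star (∑ i, a k i • star (y i)) * ∑ j, b k j • star (y j) := by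
  simp only [rowMap_apply, Matrix.mul_apply, Matrix.conjTranspose_apply, star_sum, star_smul,
    star_star, Finset.sum_mul, Finset.mul_sum, smul_mul_smul_comm, Finset.sum_smul]
  rw [Finset.sum_comm]
  simp only [fun j => Finset.sum_comm (s := (Finset.univ : Finset I)) (t := Finset.univ)
    (f := fun i k => (star (a k i) * b k j) • (y i * star (y j)))]
  exact Finset.sum_comm

variable {x : I → P} {y : I → A} {d : P → A}

theorem rowMap_one_mul (h : ∀ i j, star (y i) * y j = if i = j then d (x i) else 0) (i : I) :
    rowMap y 1 * y i = y i * d (x i) := by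
  rw [rowMap_one, Finset.sum_mul, Finset.sum_eq_single i]
  · rw [mul_assoc, h, if_pos rfl]
  · intro j _ hj
    rw [mul_assoc, h, if_neg hj, mul_zero]
  · simp

theorem rowMap_mul_rowMap (h : ∀ i j, star (y i) * y j = if i = j then d (x i) else 0)
    {a : Matrix I I ℂ} (ha : ∀ i j, x i ≠ x j → a i j = 0) (b : Matrix I I ℂ) :
    rowMap y a * rowMap y b = rowMap y 1 * rowMap y (a * b) := by
  have h1 : ∀ i j, (a i j • (y i * star (y j))) * rowMap y b =
      ∑ k, (a i j * b j k) • (rowMap y 1 * (y i * star (y k))) := by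
    intro i j
    rw [rowMap_apply y b, Finset.mul_sum, Finset.sum_eq_single j]
    · rw [Finset.mul_sum]
      refine Finset.sum_congr rfl fun k _ => ?_
      rw [smul_mul_smul_comm]
      by_cases hij : x i = x j
      · congr 1
        rw [mul_assoc, ← mul_assoc (star (y j)), h, if_pos rfl, ← mul_assoc, ← hij,
          ← rowMap_one_mul h, mul_assoc]
      · rw [ha i j hij]; simp
    · intro k _ hk
      rw [Finset.mul_sum]
      refine Finset.sum_eq_zero fun m _ => ?_
      rw [smul_mul_smul_comm, mul_assoc, ← mul_assoc (star (y j)), h, if_neg (Ne.symm hk)]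
      simp
    · simp
  rw [rowMap_apply y a, Finset.sum_mul, rowMap_apply y (a * b), Finset.mul_sum]
  refine Finset.sum_congr rfl fun i _ => ?_
  rw [Finset.sum_mul, Finset.mul_sum]
  simp only [h1]
  rw [Finset.sum_comm]
  refine Finset.sum_congr rfl fun k _ => ?_
  rw [← Finset.sum_smul, Matrix.mul_apply, mul_smul_comm]

theorem rowMap_mul_left (h : ∀ i j, star (y i) * y j = if i = j then d (x i) else 0)
    {a : Matrix I I ℂ} (ha : ∀ i j, x i ≠ x j → a i j = 0) :
    rowMap (fun i => rowMap y 1 * y i) a = rowMap y 1 * rowMap y 1 * rowMap y a := by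
  have h1 : rowMap (fun i => rowMap y 1 * y i) a = rowMap y 1 * rowMap y a * rowMap y 1 := by
    have hst : star (rowMap y 1) = rowMap y 1 := by
      rw [star_rowMap, Matrix.conjTranspose_one]
    rw [rowMap_apply, rowMap_apply y a, Finset.mul_sum, Finset.sum_mul]
    refine Finset.sum_congr rfl fun i _ => ?_
    rw [Finset.mul_sum, Finset.sum_mul]
    refine Finset.sum_congr rfl fun j _ => ?_
    rw [star_mul, hst, mul_smul_comm, smul_mul_assoc]
    simp only [mul_assoc]
  rw [h1, mul_assoc, rowMap_mul_rowMap h ha, mul_one, mul_assoc]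

theorem norm_rowMap_le [Fintype P]
    (h : ∀ i j, star (y i) * y j = if i = j then d (x i) else 0)
    (hd : ∀ p, ‖d p‖ ≤ 1) {E : Type*} [CStarAlgebra E] (β : E →⋆ₐ[ℂ] Matrix I I ℂ) (a : E) :
    ‖rowMap y (β a)‖ ≤ ‖a‖ := by
  rcases isEmpty_or_nonempty I with hI | ⟨⟨i₀⟩⟩
  · simp [rowMap_apply]
  let _ := CStarAlgebra.spectralOrder A
  have := CStarAlgebra.spectralOrderedRing A
  let γ : E →⋆ₐ[ℂ] SqMat I A :=
    { toFun := fun e => SqMat.of fun i j => algebraMap ℂ A (β e i j)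
      map_one' := SqMat.ext_entry fun i j => by
        rw [SqMat.entry_of, map_one, Matrix.one_apply, SqMat.entry_one]
        split_ifs <;> simp
      map_mul' := fun e f => SqMat.ext_entry fun i j => by
        simp only [SqMat.entry_of, map_mul, Matrix.mul_apply, SqMat.entry_mul, map_sum]
      map_zero' := SqMat.ext_entry fun i j => by simp [SqMat.entry_zero]
      map_add' := fun e f => SqMat.ext_entry fun i j => by
        simp only [SqMat.entry_of, map_add, Matrix.add_apply, SqMat.entry_add]
      commutes' := fun c => SqMat.ext_entry fun i j => by
        rw [SqMat.entry_of, AlgHomClass.commutes, Matrix.algebraMap_matrix_apply,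
          SqMat.entry_algebraMap]
        split_ifs <;> simp
      map_star' := fun e => SqMat.ext_entry fun i j => by
        rw [SqMat.entry_of, map_star, Matrix.star_apply, SqMat.entry_star, SqMat.entry_of,
          algebraMap_star_comm] }
  let W : SqMat I A := SqMat.row i₀ y
  have hW : star W * W = SqMat.diagonalHom x d := SqMat.ext_entry fun i j => by
    rw [SqMat.entry_star_row_mul_row, h, SqMat.entry_diagonalHom]
  have hWn : ‖W‖ * ‖W‖ ≤ 1 := by
    rw [← CStarRing.norm_star_mul_self, hW]
    have h1 : ‖(SqMat.diagonalHom x d : SqMat I A)‖ ≤ ‖d‖ :=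
      NonUnitalStarAlgHom.norm_apply_le (SqMat.diagonalHom x : (P → A) →⋆ₐ[ℂ] SqMat I A) d
    exact h1.trans ((pi_norm_le_iff_of_nonneg zero_le_one).2 hd)
  have hentry : (W * γ a * star W).entry i₀ i₀ = rowMap y (β a) := by
    have h1 : ∀ k, (star W).entry k i₀ = star (y k) := fun k => by
      rw [SqMat.entry_star, SqMat.entry_row, if_pos rfl]
    have h2 : ∀ k, W.entry i₀ k = y k := fun k => by rw [SqMat.entry_row, if_pos rfl]
    simp only [SqMat.entry_mul, h1, h2, Finset.sum_mul, rowMap_apply]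
    rw [Finset.sum_comm]
    refine Finset.sum_congr rfl fun i _ => Finset.sum_congr rfl fun j _ => ?_
    change y i * algebraMap ℂ A (β a i j) * star (y j) = _
    rw [← Algebra.commutes, mul_assoc, Algebra.smul_def]
  rw [← hentry]
  have hγ : ‖γ a‖ ≤ ‖a‖ := NonUnitalStarAlgHom.norm_apply_le γ a
  calc ‖(W * γ a * star W).entry i₀ i₀‖ ≤ ‖W * γ a * star W‖ := SqMat.norm_entry_le _ _ _
    _ ≤ ‖W‖ * ‖γ a‖ * ‖star W‖ :=
        (norm_mul_le _ _).trans (mul_le_mul_of_nonneg_right (norm_mul_le _ _) (norm_nonneg _))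
    _ = (‖W‖ * ‖W‖) * ‖γ a‖ := by rw [norm_star]; ring
    _ ≤ 1 * ‖a‖ := by gcongr
    _ = ‖a‖ := one_mul _

theorem norm_rowMap_one_le [Fintype P]
    (h : ∀ i j, star (y i) * y j = if i = j then d (x i) else 0) (hd : ∀ p, ‖d p‖ ≤ 1) :
    ‖rowMap y 1‖ ≤ 1 := by
  let β : ℂ →⋆ₐ[ℂ] Matrix I I ℂ := StarAlgHom.ofId ℂ _
  have := norm_rowMap_le h hd β 1
  rwa [map_one, norm_one] at this

/-- A matrix of the form `∑ w, star (κ w s) * κ w t` is positive. -/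
theorem CStarMatrix.nonneg_of_eq_sum [PartialOrder A] [StarOrderedRing A] {ι : Type*} [Fintype ι]
    {k : ℕ} (κ : ι → Fin k → A) (M : CStarMatrix (Fin k) (Fin k) A)
    (hM : ∀ s t, M s t = ∑ w, star (κ w s) * κ w t) : 0 ≤ M := by
  rcases k.eq_zero_or_pos with rfl | hk
  · have : M = 0 := CStarMatrix.ext fun i => i.elim0
    rw [this]
  have : M = ∑ w, star (SqMat.row ⟨0, hk⟩ (κ w)) * SqMat.row ⟨0, hk⟩ (κ w) := by
    refine SqMat.ext_entry fun s t => ?_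
    change M s t = _
    have h2 : ∀ (f : ι → SqMat (Fin k) A), (∑ w, f w).entry s t = ∑ w, (f w).entry s t :=
      fun f => map_sum (⟨⟨fun T : SqMat (Fin k) A => T.entry s t, rfl⟩, fun _ _ => rfl⟩ :
        SqMat (Fin k) A →+ A) f _
    rw [hM, h2]
    refine Finset.sum_congr rfl fun w _ => ?_
    rw [SqMat.entry_star_row_mul_row]
  rw [this]
  exact Finset.sum_nonneg (N := SqMat (Fin k) A) fun w _ => star_mul_self_nonneg _

theorem isCompletelyPositive_rowMap (y : I → A) {E : Type*} [CStarAlgebra E]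
    (β : E →⋆ₐ[ℂ] Matrix I I ℂ) :
    IsCompletelyPositive (rowMap y ∘ₗ (β : E →ₗ[ℂ] Matrix I I ℂ)) := by
  let _ := CStarAlgebra.spectralOrder E
  let _ := CStarAlgebra.spectralOrder A
  have := CStarAlgebra.spectralOrderedRing E
  have := CStarAlgebra.spectralOrderedRing A
  refine ⟨⟨rowMap y ∘ₗ (β : E →ₗ[ℂ] Matrix I I ℂ), fun k M hM => ?_⟩, rfl⟩
  obtain ⟨N, rfl⟩ := (CStarAlgebra.nonneg_iff_eq_star_mul_self (A := SqMat (Fin k) E)).1 hM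
  refine CStarMatrix.nonneg_of_eq_sum (ι := Fin k × I)
    (fun w t => ∑ j, β (N.entry w.1 t) w.2 j • star (y j)) _ fun s t => ?_
  have h1 : (star N * N).entry s t = ∑ u, star (N.entry u s) * N.entry u t := SqMat.entry_mul _ _ _ _
  rw [Fintype.sum_prod_type]
  change rowMap y (β ((star N * N).entry s t)) = _
  rw [h1]
  rw [map_sum, map_sum]
  refine Finset.sum_congr rfl fun u _ => ?_
  rw [map_mul, map_star]
  exact rowMap_conjTranspose_mul y _ _

end rowMap

end

noncomputable section


set_option linter.unusedSectionVars false

/-- Pairwise disjoint closed sets have pairwise orthogonal bump functions. -/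
theorem exists_orthogonal_bumps {X J : Type*} [TopologicalSpace X] [NormalSpace X] [Finite J]
    (C O : J → Set X) (hC : ∀ j, IsClosed (C j)) (hO : ∀ j, IsOpen (O j)) (hCO : ∀ j, C j ⊆ O j)
    (hdisj : Pairwise fun i j => Disjoint (C i) (C j)) :
    ∃ f : J → C(X, ℝ), (∀ j z, 0 ≤ f j z) ∧ (∀ j z, f j z ≤ 1) ∧ (∀ j, ∀ z ∈ C j, f j z = 1) ∧
      (∀ j, ∀ z ∉ O j, f j z = 0) ∧ ∀ j k, j ≠ k → ∀ z, f j z = 0 ∨ f k z = 0 := by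
  classical
  cases nonempty_fintype J
  have hex : ∀ j, ∃ u : C(X, ℝ), Set.EqOn u 0 ((O j)ᶜ ∪ ⋃ k : {k // k ≠ j}, C k) ∧
      Set.EqOn u 1 (C j) ∧ ∀ x, u x ∈ Set.Icc (0 : ℝ) 1 := fun j => by
    refine exists_continuous_zero_one_of_isClosed ((hO j).isClosed_compl.union
      (isClosed_iUnion_of_finite fun k => hC k)) (hC j) ?_
    rw [Set.disjoint_union_left]
    refine ⟨Set.disjoint_left.2 fun z hz hz' => hz (hCO j hz'), ?_⟩
    rw [Set.disjoint_iUnion_left]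
    exact fun k => hdisj k.2
  choose u hu0 hu1 hu using hex
  refine ⟨fun j => ⟨fun z => max 0 (u j z - ∑ k ∈ Finset.univ.erase j, u k z), by fun_prop⟩,
    fun j z => le_max_left _ _, fun j z => ?_, fun j z hz => ?_, fun j z hz => ?_,
    fun j k hjk z => ?_⟩
  · have : 0 ≤ ∑ k ∈ Finset.univ.erase j, u k z := Finset.sum_nonneg fun k _ => (hu k z).1
    exact max_le zero_le_one (by have := (hu j z).2; linarith)
  · have h0 : ∑ k ∈ Finset.univ.erase j, u k z = 0 := Finset.sum_eq_zero fun k hk =>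
      hu0 k (Or.inr (Set.mem_iUnion.2 ⟨⟨j, (Finset.ne_of_mem_erase hk).symm⟩, hz⟩))
    have h1 : u j z = 1 := hu1 j hz
    change max 0 (u j z - ∑ k ∈ Finset.univ.erase j, u k z) = 1
    rw [h0, h1]; norm_num
  · have h0 : u j z = 0 := hu0 j (Or.inl hz)
    have : 0 ≤ ∑ k ∈ Finset.univ.erase j, u k z := Finset.sum_nonneg fun k _ => (hu k z).1
    refine max_eq_left ?_
    rw [h0]; linarith
  · by_contra hcon
    rw [not_or] at hcon
    obtain ⟨h1, h2⟩ := hcon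
    have h1' : 0 < u j z - ∑ k ∈ Finset.univ.erase j, u k z := by
      by_contra h; exact h1 (max_eq_left (not_lt.1 h))
    have h2' : 0 < u k z - ∑ j ∈ Finset.univ.erase k, u j z := by
      by_contra h; exact h2 (max_eq_left (not_lt.1 h))
    have h3 := Finset.single_le_sum (f := fun k => u k z) (fun k _ => (hu k z).1)
      (Finset.mem_erase.2 ⟨hjk.symm, Finset.mem_univ k⟩)
    have h4 := Finset.single_le_sum (f := fun k => u k z) (fun k _ => (hu k z).1)
      (Finset.mem_erase.2 ⟨hjk, Finset.mem_univ j⟩)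
    linarith

theorem exists_lt_forall_le_of_finite {ι : Type*} [Finite ι] (f : ι → ℝ) {η : ℝ}
    (h : ∀ i, f i < η) : ∃ c < η, ∀ i, f i ≤ c := by
  rcases isEmpty_or_nonempty ι with hι | hι
  · exact ⟨η - 1, by linarith, fun i => hι.elim i⟩
  · obtain ⟨i, hi⟩ := Finite.exists_max f
    exact ⟨f i, h i, hi⟩

namespace RSHDecomposition

variable {B : Type u} [CStarAlgebra B] (D : RSHDecomposition.{u, v, w} B)
variable (ι : Fin (D.depth + 1) → Type) [∀ l, Fintype (ι l)] [∀ l, DecidableEq (ι l)]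

/-- The index set of a row of elements, one for each row of each matrix summand. -/
abbrev RowIdx : Type := Σ p : (Σ l, ι l), Fin (D.r p.1)

/-- The block-diagonal embedding of `⨁_l ⨁_{ι_l} M_{r_l}`. -/
def blockEmb : (∀ l, ι l → Mat (D.r l) ℂ) →⋆ₐ[ℂ] Matrix (D.RowIdx ι) (D.RowIdx ι) ℂ where
  toFun a := Matrix.blockDiagonal' fun p : (Σ l, ι l) => CStarMatrix.ofMatrix.symm (a p.1 p.2)
  map_one' := Matrix.blockDiagonal'_one
  map_mul' a b := Matrix.blockDiagonal'_mul
    (fun p : (Σ l, ι l) => CStarMatrix.ofMatrix.symm (a p.1 p.2))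
    (fun p : (Σ l, ι l) => CStarMatrix.ofMatrix.symm (b p.1 p.2))
  map_zero' := Matrix.blockDiagonal'_zero
  map_add' a b := Matrix.blockDiagonal'_add _ _
  commutes' c := by
    ext ⟨p, i⟩ ⟨q, j⟩
    rw [Matrix.algebraMap_matrix_apply]
    by_cases hpq : p = q
    · subst hpq
      rw [Matrix.blockDiagonal'_apply_eq]
      change algebraMap ℂ (Mat (D.r p.1) ℂ) c i j = _
      rw [CStarMatrix.algebraMap_apply]
      by_cases hij : i = j <;> simp [hij]
    · rw [Matrix.blockDiagonal'_apply_ne _ _ _ hpq, if_neg (fun h => hpq (congrArg Sigma.fst h))]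
  map_star' a := (Matrix.blockDiagonal'_conjTranspose _).symm

theorem blockEmb_apply_self (a : ∀ l, ι l → Mat (D.r l) ℂ) (p : Σ l, ι l) (i j : Fin (D.r p.1)) :
    D.blockEmb ι a ⟨p, i⟩ ⟨p, j⟩ = a p.1 p.2 i j :=
  Matrix.blockDiagonal'_apply_eq (fun p : (Σ l, ι l) => CStarMatrix.ofMatrix.symm (a p.1 p.2)) p i j

theorem blockEmb_apply_ne (a : ∀ l, ι l → Mat (D.r l) ℂ) (i j : D.RowIdx ι) (h : i.1 ≠ j.1) :
    D.blockEmb ι a i j = 0 :=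
  Matrix.blockDiagonal'_apply_ne (fun p : (Σ l, ι l) => CStarMatrix.ofMatrix.symm (a p.1 p.2))
    i.2 j.2 h

/-- The standard row exciting the point `i ∈ ι_k`: the matrix units `e_{c0}`. -/
def unitRow (k : Fin (D.depth + 1)) (i : ι k) (j : D.RowIdx ι) : Mat (D.r k) ℂ :=
  CStarMatrix.ofMatrix fun c c' => if j = ⟨⟨k, i⟩, c⟩ ∧ c' = ⟨0, D.r_pos k⟩ then 1 else 0

theorem unitRow_apply (k : Fin (D.depth + 1)) (i : ι k) (j : D.RowIdx ι) (c c' : Fin (D.r k)) :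
    D.unitRow ι k i j c c' = if j = ⟨⟨k, i⟩, c⟩ ∧ c' = ⟨0, D.r_pos k⟩ then 1 else 0 := rfl

theorem rowMap_unitRow (k : Fin (D.depth + 1)) (i : ι k) (a : ∀ l, ι l → Mat (D.r l) ℂ) :
    rowMap (D.unitRow ι k i) (D.blockEmb ι a) = a k i := by
  refine CStarMatrix.ext fun c c' => ?_
  have h1 : ∀ j j' : D.RowIdx ι, (D.unitRow ι k i j * star (D.unitRow ι k i j')) c c' =
      if j = ⟨⟨k, i⟩, c⟩ ∧ j' = ⟨⟨k, i⟩, c'⟩ then 1 else 0 := by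
    intro j j'
    rw [CStarMatrix.mul_apply, Finset.sum_eq_single ⟨0, D.r_pos k⟩]
    · rw [CStarMatrix.star_apply, unitRow_apply, unitRow_apply]
      by_cases h : j = ⟨⟨k, i⟩, c⟩ <;> by_cases h' : j' = ⟨⟨k, i⟩, c'⟩ <;> simp [h, h']
    · intro c'' _ hc
      rw [unitRow_apply, if_neg (fun h => hc h.2), zero_mul]
    · simp
  have h2 : (rowMap (D.unitRow ι k i) (D.blockEmb ι a)) c c' = ∑ j, ∑ j', D.blockEmb ι a j j' *
      (D.unitRow ι k i j * star (D.unitRow ι k i j')) c c' := by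
    let ev : Mat (D.r k) ℂ →+ ℂ := ⟨⟨fun T => T c c', rfl⟩, fun _ _ => rfl⟩
    change ev (rowMap (D.unitRow ι k i) (D.blockEmb ι a)) = _
    rw [rowMap_apply, map_sum]
    refine Finset.sum_congr rfl fun j _ => ?_
    rw [map_sum]
    rfl
  rw [h2, Finset.sum_eq_single ⟨⟨k, i⟩, c⟩, Finset.sum_eq_single ⟨⟨k, i⟩, c'⟩, h1]
  · rw [if_pos ⟨rfl, rfl⟩, mul_one, blockEmb_apply_self]
  · intro j' _ hj'; rw [h1, if_neg (fun h => hj' h.2), mul_zero]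
  · simp
  · intro j _ hj
    exact Finset.sum_eq_zero fun j' _ => by rw [h1, if_neg (fun h => hj h.1), mul_zero]
  · simp

theorem rowMap_unitRow_one (k : Fin (D.depth + 1)) (i : ι k) :
    rowMap (D.unitRow ι k i) 1 = 1 := by
  rw [← map_one (D.blockEmb ι), rowMap_unitRow]
  rfl

theorem star_unitRow_mul (k : Fin (D.depth + 1)) (i : ι k) (j j' : D.RowIdx ι) :
    star (D.unitRow ι k i j) * D.unitRow ι k i j' = if j = j' ∧ j.1 = ⟨k, i⟩ then
      CStarMatrix.ofMatrix (Matrix.single ⟨0, D.r_pos k⟩ ⟨0, D.r_pos k⟩ 1) else 0 := by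
  have hent : ∀ c c', (star (D.unitRow ι k i j) * D.unitRow ι k i j') c c' =
      if (j = j' ∧ j.1 = ⟨k, i⟩) ∧ (c = ⟨0, D.r_pos k⟩ ∧ c' = ⟨0, D.r_pos k⟩) then 1 else 0 := by
    intro c c'
    rw [CStarMatrix.mul_apply]
    simp only [CStarMatrix.star_apply, unitRow_apply]
    by_cases hj : j.1 = ⟨k, i⟩
    · obtain ⟨p, a⟩ := j
      change p = _ at hj
      subst hj
      rw [Finset.sum_eq_single a]
      · by_cases hj' : j' = ⟨⟨k, i⟩, a⟩
        · subst hj'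
          by_cases hc : c = ⟨0, D.r_pos k⟩ <;> by_cases hc' : c' = ⟨0, D.r_pos k⟩ <;>
            simp [hc, hc']
        · rw [if_neg (c := j' = _ ∧ _) (fun h => hj' h.1), mul_zero, if_neg (fun h => hj' h.1.1.symm)]
      · intro b _ hb
        rw [if_neg, star_zero, zero_mul]
        rintro ⟨h, -⟩
        exact hb (by simpa using h.symm)
      · simp
    · rw [if_neg (fun h => hj h.1.2)]
      refine Finset.sum_eq_zero fun b _ => ?_
      rw [if_neg (fun h => hj (congrArg Sigma.fst h.1)), star_zero, zero_mul]
  refine CStarMatrix.ext fun c c' => ?_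
  rw [hent]
  by_cases h : j = j' ∧ j.1 = ⟨k, i⟩
  · rw [if_pos h]
    change _ = Matrix.single _ _ (1 : ℂ) c c'
    rw [Matrix.single_apply]
    refine if_congr ?_ rfl rfl
    rw [and_iff_right h, eq_comm, eq_comm (a := c')]
  · rw [if_neg h, if_neg (fun h' => h h'.1)]
    rfl

variable {ι}

/-- A row of pairwise orthogonal elements of norm at most one of a C⋆-algebra whose moduli only
depend on the summand. -/
structure IsOrthogonalRow {A : Type*} [CStarAlgebra A] (Y : D.RowIdx ι → A) : Prop where
  orth : ∀ i j, i ≠ j → star (Y i) * Y j = 0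
  diag : ∀ (p : Σ l, ι l) (a a' : Fin (D.r p.1)),
    star (Y ⟨p, a⟩) * Y ⟨p, a⟩ = star (Y ⟨p, a'⟩) * Y ⟨p, a'⟩
  norm_le : ∀ i, ‖star (Y i) * Y i‖ ≤ 1

/-- The common moduli of the members of a row. -/
def modulus {A : Type*} [CStarAlgebra A] (Y : D.RowIdx ι → A) (p : Σ l, ι l) : A :=
  star (Y ⟨p, ⟨0, D.r_pos p.1⟩⟩) * Y ⟨p, ⟨0, D.r_pos p.1⟩⟩

variable {D}

namespace IsOrthogonalRow

variable {A : Type*} [CStarAlgebra A] {Y : D.RowIdx ι → A}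

theorem star_mul_eq_ite (h : D.IsOrthogonalRow Y) (i j : D.RowIdx ι) :
    star (Y i) * Y j = if i = j then D.modulus Y i.1 else 0 := by
  split_ifs with hij
  · subst hij
    exact h.diag i.1 _ _
  · exact h.orth i j hij

theorem norm_rowMap_one_le (h : D.IsOrthogonalRow Y) : ‖rowMap Y 1‖ ≤ 1 :=
  _root_.norm_rowMap_one_le h.star_mul_eq_ite fun _ => h.norm_le _

theorem mul_left (h : D.IsOrthogonalRow Y) :
    D.IsOrthogonalRow (fun i => rowMap Y 1 * Y i) := by
  set d : (Σ l, ι l) → A := D.modulus Y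
  have hd1 : ∀ p, ‖d p‖ ≤ 1 := fun p => h.norm_le _
  have hH : ∀ i, rowMap Y 1 * Y i = Y i * d i.1 := rowMap_one_mul h.star_mul_eq_ite
  have hstar : ∀ i j, star (rowMap Y 1 * Y i) * (rowMap Y 1 * Y j) =
      star (d i.1) * (star (Y i) * Y j) * d j.1 := fun i j => by
    rw [hH, hH, star_mul]; simp only [mul_assoc]
  have hrel' : ∀ p a, star (Y ⟨p, a⟩) * Y ⟨p, a⟩ = d p := fun p a => h.diag p a _
  refine ⟨fun i j hij => ?_, fun p a a' => ?_, fun i => ?_⟩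
  · rw [hstar, h.orth i j hij, mul_zero, zero_mul]
  · rw [hstar, hstar, hrel', hrel']
  · rw [hstar, hrel' i.1 i.2]
    calc ‖star (d i.1) * d i.1 * d i.1‖ ≤ ‖star (d i.1)‖ * ‖d i.1‖ * ‖d i.1‖ :=
          (norm_mul_le _ _).trans (mul_le_mul_of_nonneg_right (norm_mul_le _ _) (norm_nonneg _))
      _ ≤ 1 * 1 * 1 := by
          rw [norm_star]
          have := hd1 i.1
          gcongr
      _ = 1 := by norm_num

theorem norm_mul_left_sub_le (h : D.IsOrthogonalRow Y) (c : A) (a : ∀ l, ι l → Mat (D.r l) ℂ) :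
    ‖rowMap (fun i => rowMap Y 1 * Y i) 1 * c - rowMap (fun i => rowMap Y 1 * Y i)
      (D.blockEmb ι a)‖ ≤ ‖rowMap Y 1 * c - rowMap Y (D.blockEmb ι a)‖ := by
  have h1 : ∀ a : Matrix (D.RowIdx ι) (D.RowIdx ι) ℂ,
      (∀ i j, (Sigma.fst i : Σ l, ι l) ≠ Sigma.fst j → a i j = 0) →
      rowMap (fun i => rowMap Y 1 * Y i) a = rowMap Y 1 * rowMap Y 1 * rowMap Y a :=
    fun a ha => rowMap_mul_left h.star_mul_eq_ite ha
  have hnorm := h.norm_rowMap_one_le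
  rw [h1 _ (D.blockEmb_apply_ne ι a), h1 1 (fun i j hij => Matrix.one_apply_ne (fun hh =>
    hij (congrArg _ hh))), mul_assoc _ _ c, ← mul_sub]
  calc _ ≤ ‖rowMap Y 1‖ * ‖rowMap Y 1‖ * _ :=
        (norm_mul_le _ _).trans (mul_le_mul_of_nonneg_right (norm_mul_le _ _) (norm_nonneg _))
    _ ≤ 1 * 1 * _ := by gcongr
    _ = _ := by rw [one_mul, one_mul]

theorem map (h : D.IsOrthogonalRow Y) {A' : Type*} [CStarAlgebra A'] (f : A →⋆ₐ[ℂ] A') :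
    D.IsOrthogonalRow (fun i => f (Y i)) := by
  refine ⟨fun i j hij => ?_, fun p a a' => ?_, fun i => ?_⟩
  · rw [← map_star, ← map_mul, h.orth i j hij, map_zero]
  · rw [← map_star, ← map_mul, h.diag p a a', map_mul, map_star]
  · rw [← map_star, ← map_mul]
    exact (NonUnitalStarAlgHom.norm_apply_le f _).trans (h.norm_le i)

end IsOrthogonalRow

/-- Evaluation of continuous functions with values in a C⋆-algebra. -/
def _root_.ContinuousMap.evalStarHom {X A : Type*} [TopologicalSpace X] [CompactSpace X]
    [CStarAlgebra A] (x : X) : C(X, A) →⋆ₐ[ℂ] A where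
  toFun f := f x
  map_one' := rfl
  map_mul' _ _ := rfl
  map_zero' := rfl
  map_add' _ _ := rfl
  commutes' _ := rfl
  map_star' _ := rfl

variable (D)

/-- A row of matrix-valued functions on `X_k` which excises the given points. -/
structure IsExcisionRow (F : Finset B) (η : ℝ) (x : ∀ l, ι l → D.X l) (K : ∀ l, ι l → Set (D.X l))
    (k : Fin (D.depth + 1)) (Y : D.RowIdx ι → C(D.X k, Mat (D.r k) ℂ)) : Prop where
  row : D.IsOrthogonalRow Y
  approx : ∀ b ∈ F, ‖rowMap Y 1 * D.component k b -
    rowMap Y (D.blockEmb ι fun l i => D.eval l (x l i) b)‖ < η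
  val : ∀ (i : ι k), ∀ z ∈ K k i, ∀ j, Y j z = D.unitRow ι k i j

variable {D}

theorem IsExcisionRow.mul_left {F : Finset B} {η : ℝ} {x : ∀ l, ι l → D.X l}
    {K : ∀ l, ι l → Set (D.X l)} {k : Fin (D.depth + 1)}
    {Y : D.RowIdx ι → C(D.X k, Mat (D.r k) ℂ)} (h : D.IsExcisionRow F η x K k Y) :
    D.IsExcisionRow F η x K k (fun i => rowMap Y 1 * Y i) := by
  refine ⟨h.row.mul_left, fun b hb => (h.row.norm_mul_left_sub_le _ _).trans_lt (h.approx b hb),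
    fun i z hz j => ?_⟩
  let evz : C(D.X k, Mat (D.r k) ℂ) →⋆ₐ[ℂ] Mat (D.r k) ℂ := ContinuousMap.evalStarHom z
  have h1 : evz (rowMap Y 1) = 1 := by
    refine (map_rowMap (ContinuousMap.evalStarHom z) Y 1).trans ?_
    rw [← D.rowMap_unitRow_one ι k i]
    exact congrArg (fun y => rowMap y 1) (funext fun j => h.val i z hz j)
  have h2 : evz (rowMap Y 1 * Y j) = evz (rowMap Y 1) * evz (Y j) := rfl
  change evz (rowMap Y 1 * Y j) = _
  rw [h2, h1, one_mul]
  exact h.val i z hz j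

end RSHDecomposition

end

noncomputable section


set_option linter.unusedSectionVars false

theorem rowMap_smul_row {I A : Type*} [Fintype I] [CStarAlgebra A] (t : ℝ) (y : I → A)
    (a : Matrix I I ℂ) :
    rowMap (fun i => (t : ℂ) • y i) a = ((t : ℂ) * t) • rowMap y a := by
  simp only [rowMap_apply, Finset.smul_sum, star_smul, Complex.star_def, Complex.conj_ofReal,
    smul_mul_smul_comm]
  refine Finset.sum_congr rfl fun i _ => Finset.sum_congr rfl fun j _ => ?_
  rw [smul_comm]

theorem norm_star_mul_self_le_one {A : Type*} [CStarAlgebra A] {a : A} (h : ‖a‖ ≤ 1) :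
    ‖star a * a‖ ≤ 1 := by
  rw [CStarRing.norm_star_mul_self]
  exact mul_le_one₀ h (norm_nonneg _) h

/-- Restriction of continuous functions to a subset. -/
def ContinuousMap.restrictStarHom {X A : Type*} [TopologicalSpace X] [CompactSpace X]
    [CStarAlgebra A] (s : Set X) [CompactSpace s] : C(X, A) →⋆ₐ[ℂ] C(s, A) where
  toFun f := f.restrict s
  map_one' := rfl
  map_mul' _ _ := rfl
  map_zero' := rfl
  map_add' _ _ := rfl
  commutes' _ := rfl
  map_star' _ := rfl

namespace RSHDecomposition

variable {B : Type u} [CStarAlgebra B] {D : RSHDecomposition.{u, v, w} B}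
variable {ι : Fin (D.depth + 1) → Type} [∀ l, Fintype (ι l)] [∀ l, DecidableEq (ι l)]

theorem component_rowMap (D : RSHDecomposition.{u, v, w} B) {I : Type*} [Fintype I] [DecidableEq I]
    (k : Fin (D.depth + 1)) (y : I → B) (a : Matrix I I ℂ) :
    D.component k (rowMap y a) = rowMap (fun i => D.component k (y i)) a :=
  map_rowMap (A' := C(D.X k, Mat (D.r k) ℂ)) (D.component k) y a

theorem IsOrthogonalRow.of_star_mul_eq {A : Type*} [CStarAlgebra A] {Y : D.RowIdx ι → A}
    {d : (Σ l, ι l) → A} (h : ∀ i j, star (Y i) * Y j = if i = j then d i.1 else 0)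
    (hd : ∀ p, ‖d p‖ ≤ 1) : D.IsOrthogonalRow Y :=
  ⟨fun i j hij => by rw [h, if_neg hij], fun p a a' => by rw [h, h, if_pos rfl, if_pos rfl],
    fun i => by rw [h, if_pos rfl]; exact hd _⟩

theorem IsOrthogonalRow.smul {A : Type*} [CStarAlgebra A] {Y : D.RowIdx ι → A}
    (h : D.IsOrthogonalRow Y) {t : ℝ} (h0 : 0 ≤ t) (h1 : t ≤ 1) :
    D.IsOrthogonalRow (fun i => (t : ℂ) • Y i) := by
  have hst : ∀ i j, star ((t : ℂ) • Y i) * ((t : ℂ) • Y j) =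
      ((t : ℂ) * t) • (star (Y i) * Y j) := fun i j => by
    rw [star_smul, smul_mul_smul_comm, Complex.star_def, Complex.conj_ofReal]
  refine ⟨fun i j hij => by rw [hst, h.orth i j hij, smul_zero],
    fun p a a' => by rw [hst, hst, h.diag p a a'], fun i => ?_⟩
  rw [hst, norm_smul, norm_mul, Complex.norm_real, Real.norm_of_nonneg h0]
  have := h.norm_le i
  exact mul_le_one₀ (mul_le_one₀ h1 h0 h1) (norm_nonneg _) this

theorem IsOrthogonalRow.cutoff {A : Type*} [CStarAlgebra A] {Y : D.RowIdx ι → A}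
    {d : (Σ l, ι l) → A} (h : ∀ i j, star (Y i) * Y j = if i = j then d i.1 else 0)
    (hd : ∀ p, ‖d p‖ ≤ 1) (s : (Σ l, ι l) → Prop) [DecidablePred s] :
    D.IsOrthogonalRow fun j => if s j.1 then Y j else 0 := by
  refine IsOrthogonalRow.of_star_mul_eq (d := fun p => if s p then d p else 0)
    (fun i j => ?_) (fun p => ?_)
  · by_cases hij : i = j
    · subst hij
      by_cases hi : s i.1
      · simp only [if_pos hi]; rw [h, if_pos rfl, if_pos True.intro]
      · simp [hi]
    · have h0 : star (Y i) * Y j = 0 := by rw [h, if_neg hij]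
      by_cases hi : s i.1 <;> by_cases hj : s j.1 <;> simp [hi, hj, h0, hij]
  · by_cases hp : s p
    · simp only [if_pos hp]; exact hd p
    · simp [hp]

theorem IsOrthogonalRow.of_apply {X A : Type*} [TopologicalSpace X] [CompactSpace X]
    [CStarAlgebra A] {Y : D.RowIdx ι → C(X, A)}
    (h : ∀ z, D.IsOrthogonalRow fun i => Y i z) : D.IsOrthogonalRow Y := by
  refine ⟨fun i j hij => ContinuousMap.ext fun z => (h z).orth i j hij,
    fun p a a' => ContinuousMap.ext fun z => (h z).diag p a a', fun i => ?_⟩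
  exact (ContinuousMap.norm_le _ zero_le_one).2 fun z => (h z).norm_le i

theorem isOrthogonalRow_unitRow (k : Fin (D.depth + 1)) (i : ι k) :
    D.IsOrthogonalRow (D.unitRow ι k i) := by
  refine IsOrthogonalRow.of_star_mul_eq (d := fun p => if p = ⟨k, i⟩ then
    CStarMatrix.ofMatrix (Matrix.single ⟨0, D.r_pos k⟩ ⟨0, D.r_pos k⟩ 1) else 0)
    (fun j j' => ?_) fun p => ?_
  · rw [star_unitRow_mul]
    by_cases h1 : j = j' <;> by_cases h2 : j.1 = ⟨k, i⟩ <;> simp [h1, h2]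
  · have key : ‖(D.unitRow ι k i) ⟨⟨k, i⟩, ⟨0, D.r_pos k⟩⟩‖ ≤ 1 := by
      refine IsStarProjection.norm_le _ ⟨?_, ?_⟩
      · refine CStarMatrix.ext fun c c' => ?_
        rw [CStarMatrix.mul_apply, Finset.sum_eq_single ⟨0, D.r_pos k⟩]
        · simp only [unitRow_apply]
          by_cases hc : c = ⟨0, D.r_pos k⟩
          · subst hc; simp
          · rw [if_neg, zero_mul, if_neg]
            · rintro ⟨h, -⟩; exact hc (by simpa using h.symm)
            · rintro ⟨h, -⟩; exact hc (by simpa using h.symm)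
        · intro b _ hb
          rw [unitRow_apply, if_neg (fun h => hb h.2), zero_mul]
        · simp
      · refine CStarMatrix.ext fun c c' => ?_
        rw [CStarMatrix.star_apply, unitRow_apply, unitRow_apply]
        by_cases hc : c = ⟨0, D.r_pos k⟩ <;> by_cases hc' : c' = ⟨0, D.r_pos k⟩ <;>
          simp [hc, hc', eq_comm]
    split_ifs
    · have h1 := D.star_unitRow_mul ι k i ⟨⟨k, i⟩, ⟨0, D.r_pos k⟩⟩ ⟨⟨k, i⟩, ⟨0, D.r_pos k⟩⟩
      rw [if_pos ⟨rfl, rfl⟩] at h1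
      rw [← h1]
      exact norm_star_mul_self_le_one key
    · rw [norm_zero]; exact zero_le_one

theorem IsOrthogonalRow.exists_lift {A A' : Type*} [CStarAlgebra A] [CStarAlgebra A']
    (π : A →⋆ₐ[ℂ] A') (hπ : Function.Surjective π) (θ : B →⋆ₐ[ℂ] A') {y : D.RowIdx ι → B}
    (h : D.IsOrthogonalRow fun j => θ (y j)) (s : (Σ l, ι l) → Prop) [DecidablePred s] :
    ∃ Y : D.RowIdx ι → A, D.IsOrthogonalRow Y ∧ (∀ j, ¬ s j.1 → Y j = 0) ∧
      ∀ j, s j.1 → π (Y j) = θ (rowMap y 1 * y j) := by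
  have hsurj : Function.Surjective (Sigma.fst : D.RowIdx ι → Σ l, ι l) :=
    fun p => ⟨⟨p, ⟨0, D.r_pos p.1⟩⟩, rfl⟩
  obtain ⟨Y, d, hY, hd, hπY⟩ := exists_lift_row π hπ Sigma.fst
    hsurj (fun j => θ (y j)) (D.modulus fun j => θ (y j)) h.star_mul_eq_ite
    (fun p => h.norm_le _)
  refine ⟨_, IsOrthogonalRow.cutoff hY hd s, fun j hj => if_neg hj, fun j hj => ?_⟩
  rw [if_pos hj, hπY, ← rowMap_one_mul h.star_mul_eq_ite, map_mul, map_rowMap]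

variable {F : Finset B} {η : ℝ} {x : ∀ l, ι l → D.X l} {K : ∀ l, ι l → Set (D.X l)}

/-- A row over `B` which excises the given points on the first `m` base spaces, and whose members
of the later summands vanish there. -/
def IsPartialExcisionRow (D : RSHDecomposition.{u, v, w} B) {ι : Fin (D.depth + 1) → Type}
    [∀ l, Fintype (ι l)] [∀ l, DecidableEq (ι l)] (F : Finset B) (η : ℝ)
    (x : ∀ l, ι l → D.X l) (K : ∀ l, ι l → Set (D.X l)) (m : ℕ) (y : D.RowIdx ι → B) : Prop :=
  (∀ k : Fin (D.depth + 1), k.val < m →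
    D.IsExcisionRow F η x K k fun j => D.component k (y j)) ∧
  ∀ k : Fin (D.depth + 1), k.val < m → ∀ j : D.RowIdx ι, m ≤ j.1.1.val → D.component k (y j) = 0

theorem IsPartialExcisionRow.exists_lift {l : Fin (D.depth + 1)}
    {y : D.RowIdx ι → B} (h : D.IsPartialExcisionRow F η x K l.val y) :
    ∃ Y : D.RowIdx ι → C(D.X l, Mat (D.r l) ℂ), D.IsOrthogonalRow Y ∧
      (∀ j : D.RowIdx ι, l.val ≤ j.1.1.val → Y j = 0) ∧
      ∀ z ∈ D.Ω l, ∀ j, Y j z = D.component l (rowMap y 1 * y j) z := by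
  have : CompactSpace (D.Ω l) := isCompact_iff_compactSpace.1 (D.isClosed_Ω l).isCompact
  let π : C(D.X l, Mat (D.r l) ℂ) →⋆ₐ[ℂ] C(D.Ω l, Mat (D.r l) ℂ) :=
    ContinuousMap.restrictStarHom (D.Ω l)
  have hπ : Function.Surjective π := fun f => D.exists_restrict_eq l f
  let θ : B →⋆ₐ[ℂ] C(D.Ω l, Mat (D.r l) ℂ) := π.comp (D.component l)
  have hθ : ∀ {a b : B}, (∀ k < l, D.component k a = D.component k b) → θ a = θ b :=
    fun hab => ContinuousMap.ext fun z => D.component_eq_of_mem_Ω hab z.2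
  have hcomp : ∀ k < l, D.IsOrthogonalRow fun j => D.component k (y j) := fun k hk =>
    (h.1 k hk).row
  have hrow : D.IsOrthogonalRow fun j => θ (y j) := by
    refine ⟨fun i j hij => ?_, fun p a a' => ?_, fun i => ?_⟩
    · have h1 : θ (star (y i) * y j) = θ 0 := hθ fun k hk => by
        rw [map_zero, map_mul, map_star]; exact (hcomp k hk).orth i j hij
      rw [map_zero, map_mul, map_star] at h1
      exact h1
    · have h1 : θ (star (y ⟨p, a⟩) * y ⟨p, a⟩) = θ (star (y ⟨p, a'⟩) * y ⟨p, a'⟩) :=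
        hθ fun k hk => by
          simp only [map_mul, map_star]; exact (hcomp k hk).diag p a a'
      simp only [map_mul, map_star] at h1
      exact h1
    · have h1 : ‖θ (star (y i) * y i)‖ ≤ 1 :=
        (ContinuousMap.norm_le _ zero_le_one).2 fun z =>
          D.norm_component_le_of_mem_Ω (fun k hk => by
            rw [map_mul, map_star]; exact (hcomp k hk).norm_le i) z.2
      rw [map_mul, map_star] at h1
      exact h1
  obtain ⟨Y, hY, hY0, hπY⟩ := IsOrthogonalRow.exists_lift (A := C(D.X l, Mat (D.r l) ℂ))
    (A' := C(D.Ω l, Mat (D.r l) ℂ)) π hπ θ hrow (fun p => p.1.val < l.val)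
  refine ⟨Y, hY, fun j hj => hY0 j (by omega), fun z hz j => ?_⟩
  by_cases hj : j.1.1.val < l.val
  · exact congrArg (fun f : C(D.Ω l, Mat (D.r l) ℂ) => f ⟨z, hz⟩) (hπY j hj)
  · rw [hY0 j hj]
    have h1 : θ (rowMap y 1 * y j) = θ 0 := hθ fun k hk => by
      rw [map_mul, h.2 k hk j (by omega), map_zero]
      exact mul_zero (M₀ := C(D.X k, Mat (D.r k) ℂ)) _
    rw [map_zero] at h1
    exact (congrArg (fun f : C(D.Ω l, Mat (D.r l) ℂ) => f ⟨z, hz⟩) h1).symm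

theorem norm_scaled_lt {A : Type*} [CStarAlgebra A] {Y : D.RowIdx ι → A} {c : A}
    {a : Matrix (D.RowIdx ι) (D.RowIdx ι) ℂ} {t : ℝ} (h0 : 0 ≤ t) (h1 : t ≤ 1) (hη : 0 < η)
    (h : t ≠ 0 → ‖rowMap Y 1 * c - rowMap Y a‖ < η) :
    ‖rowMap (fun i => (t : ℂ) • Y i) 1 * c - rowMap (fun i => (t : ℂ) • Y i) a‖ < η := by
  rw [rowMap_smul_row, rowMap_smul_row, smul_mul_assoc, ← smul_sub, norm_smul, norm_mul,
    Complex.norm_real, Real.norm_of_nonneg h0]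
  by_cases ht : t = 0
  · rw [ht, zero_mul, zero_mul]; exact hη
  · calc t * t * ‖rowMap Y 1 * c - rowMap Y a‖ ≤ 1 * ‖rowMap Y 1 * c - rowMap Y a‖ := by
          gcongr; exact mul_le_one₀ h1 h0 h1
      _ < η := by rw [one_mul]; exact h ht

theorem IsPartialExcisionRow.step (hη : 0 < η) (hK : ∀ l i, IsClosed (K l i))
    (hKΩ : ∀ l i, K l i ⊆ (D.Ω l)ᶜ) (hdisj : ∀ l, Pairwise fun i j => Disjoint (K l i) (K l j))
    (hosc : ∀ l i, ∀ z ∈ K l i, ∀ b ∈ F, ‖D.component l b z - D.eval l (x l i) b‖ < η)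
    {l : Fin (D.depth + 1)} {y : D.RowIdx ι → B} (h : D.IsPartialExcisionRow F η x K l.val y) :
    ∃ y', D.IsPartialExcisionRow F η x K (l.val + 1) y' := by
  classical
  obtain ⟨Y, hY, hY0, hYΩ⟩ := h.exists_lift
  let δ : B → C(D.X l, Mat (D.r l) ℂ) := fun b =>
    rowMap Y 1 * D.component l b - rowMap Y (D.blockEmb ι fun l i => D.eval l (x l i) b)
  let C : Option (ι l) → Set (D.X l) := fun o => o.elim (D.Ω l) (K l)
  let O : Option (ι l) → Set (D.X l) := fun o => o.elim {z | ∀ b ∈ F, ‖δ b z‖ < η}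
    fun i => {z | ∀ b ∈ F, ‖D.component l b z - D.eval l (x l i) b‖ < η}
  have hopen : ∀ f : B → C(D.X l, Mat (D.r l) ℂ), IsOpen {z | ∀ b ∈ F, ‖f b z‖ < η} := fun f => by
    have : {z | ∀ b ∈ F, ‖f b z‖ < η} = ⋂ b ∈ F, {z | ‖f b z‖ < η} := by ext; simp
    rw [this]
    exact isOpen_biInter_finset fun b _ =>
      isOpen_lt (continuous_norm.comp (f b).continuous) continuous_const
  have hopen' : ∀ i : ι l, IsOpen {z | ∀ b ∈ F, ‖D.component l b z - D.eval l (x l i) b‖ < η} :=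
    fun i => by
      have : {z | ∀ b ∈ F, ‖D.component l b z - D.eval l (x l i) b‖ < η} =
          ⋂ b ∈ F, {z | ‖D.component l b z - D.eval l (x l i) b‖ < η} := by ext; simp
      rw [this]
      exact isOpen_biInter_finset fun b _ => isOpen_lt (continuous_norm.comp
        ((D.component l b).continuous.sub continuous_const)) continuous_const
  have hΩ : ∀ z ∈ D.Ω l, ∀ b ∈ F, ‖δ b z‖ < η := by
    intro z hz b hb
    let s : B := rowMap (fun i => rowMap y 1 * y i) 1 * b -
      rowMap (fun i => rowMap y 1 * y i) (D.blockEmb ι fun l i => D.eval l (x l i) b)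
    have h1 : δ b z = D.component l s z := by
      let e : C(D.X l, Mat (D.r l) ℂ) →⋆ₐ[ℂ] Mat (D.r l) ℂ := ContinuousMap.evalStarHom z
      have h2 : ∀ a, e (rowMap Y a) =
          D.eval l z (rowMap (fun i => rowMap y 1 * y i) a) := fun a => by
        refine (map_rowMap (ContinuousMap.evalStarHom z) Y a).trans ?_
        refine Eq.trans ?_ (map_rowMap (D.eval l z) _ a).symm
        exact congrArg (fun y => rowMap y a) (funext fun j => hYΩ z hz j)
      change e (rowMap Y 1) * D.eval l z b - e (rowMap Y _) = D.eval l z s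
      rw [h2, h2, map_sub, map_mul]
    have hs : ∀ k < l, ‖D.component k s‖ < η := by
      intro k hk
      have h3 := ((h.1 k hk).mul_left).approx b hb
      have h4 : ∀ a, D.component k (rowMap (fun i => rowMap y 1 * y i) a) =
          rowMap (fun i => rowMap (fun j => D.component k (y j)) 1 * D.component k (y i)) a := by
        intro a
        refine (D.component_rowMap k _ a).trans ?_
        refine congrArg (fun y => rowMap y a) (funext fun j => ?_)
        rw [map_mul]
        exact congrArg (fun w => w * D.component k (y j)) (D.component_rowMap k y 1)
      rw [← h4, ← h4, ← map_mul, ← map_sub] at h3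
      exact h3
    obtain ⟨c, hc, hcs⟩ := exists_lt_forall_le_of_finite
      (fun k : {k // k < l} => ‖D.component k.1 s‖) fun k => hs k.1 k.2
    rw [h1]
    exact (D.norm_component_le_of_mem_Ω (fun k hk => hcs ⟨k, hk⟩) hz).trans_lt hc
  obtain ⟨f, hf0, hf1, hfC, hfO, hfo⟩ := exists_orthogonal_bumps C O
    (by rintro (_ | i); exacts [D.isClosed_Ω l, hK l i])
    (by
      rintro (_ | i)
      · exact hopen δ
      · exact hopen' i)
    (by
      rintro (_ | i) z hz
      · exact hΩ z hz
      · exact hosc l i z hz)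
    (by
      rintro (_ | i) (_ | j) hij
      · exact (hij rfl).elim
      · exact (Set.disjoint_left.2 fun z hz hz' => hKΩ l j hz' hz)
      · exact (Set.disjoint_left.2 fun z hz hz' => hKΩ l i hz hz')
      · exact hdisj l fun hij' => hij (congrArg some hij'))
  let g : D.RowIdx ι → C(D.X l, Mat (D.r l) ℂ) := fun j =>
    ⟨fun z => (f none z : ℂ) • Y j z + ∑ i, (f (some i) z : ℂ) • D.unitRow ι l i j, by fun_prop⟩
  have hg : ∀ j z, g j z = (f none z : ℂ) • Y j z +
    ∑ i, (f (some i) z : ℂ) • D.unitRow ι l i j := fun _ _ => rfl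
  have hgnone : ∀ z, (∀ i, f (some i) z = 0) → ∀ j, g j z = (f none z : ℂ) • Y j z := by
    intro z hz j
    rw [hg, Finset.sum_eq_zero fun i _ => by rw [hz, Complex.ofReal_zero, zero_smul], add_zero]
  have hgsome : ∀ z i, f (some i) z ≠ 0 →
      ∀ j, g j z = (f (some i) z : ℂ) • D.unitRow ι l i j := by
    intro z i hz j
    have h0 : ∀ o, o ≠ some i → f o z = 0 := fun o ho => (hfo o _ ho z).resolve_right hz
    rw [hg, h0 none (by simp), Finset.sum_eq_single i, Complex.ofReal_zero, zero_smul, zero_add]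
    · intro i' _ hi'
      rw [h0 _ (by simpa using hi'), Complex.ofReal_zero, zero_smul]
    · simp
  have hcase : ∀ z, (∀ i, f (some i) z = 0) ∨ ∃ i, f (some i) z ≠ 0 := fun z => by
    by_contra! hcon
    obtain ⟨⟨i, hi⟩, h2⟩ := hcon
    exact hi (h2 i)
  have hYz : ∀ z, D.IsOrthogonalRow fun j => Y j z := fun z =>
    hY.map (ContinuousMap.evalStarHom z)
  have hgl : D.IsExcisionRow F η x K l g := by
    refine ⟨IsOrthogonalRow.of_apply fun z => ?_, fun b hb => ?_, fun i z hz j => ?_⟩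
    · rcases hcase z with hz | ⟨i, hz⟩
      · rw [funext (hgnone z hz)]
        exact (hYz z).smul (hf0 _ _) (hf1 _ _)
      · rw [funext (hgsome z i hz)]
        exact (isOrthogonalRow_unitRow l i).smul (hf0 _ _) (hf1 _ _)
    · rw [ContinuousMap.norm_lt_iff _ hη]
      intro z
      have h2 : ∀ (W : D.RowIdx ι → C(D.X l, Mat (D.r l) ℂ)) a,
          (rowMap W a : C(D.X l, Mat (D.r l) ℂ)) z = rowMap (fun j => W j z) a := fun W a =>
        map_rowMap (ContinuousMap.evalStarHom z) W a
      change ‖rowMap g 1 z * D.component l b z - rowMap g _ z‖ < η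
      rw [h2, h2]
      rcases hcase z with hz | ⟨i, hz⟩
      · rw [funext (hgnone z hz)]
        refine norm_scaled_lt (hf0 _ _) (hf1 _ _) hη fun ht => ?_
        have hzO : z ∈ O none := by
          by_contra hcon
          exact ht (hfO _ _ hcon)
        have := hzO b hb
        rw [← h2, ← h2]
        exact this
      · rw [funext (hgsome z i hz)]
        refine norm_scaled_lt (hf0 _ _) (hf1 _ _) hη fun ht => ?_
        have hzO : z ∈ O (some i) := by
          by_contra hcon
          exact ht (hfO _ _ hcon)
        have := hzO b hb
        rw [rowMap_unitRow_one, rowMap_unitRow, one_mul]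
        exact this
    · have h1 : f (some i) z = 1 := hfC (some i) z hz
      rw [hgsome z i (by rw [h1]; exact one_ne_zero), h1, Complex.ofReal_one, one_smul]
  have hgΩ : ∀ j, ∀ z ∈ D.Ω l, g j z = D.component l (rowMap y 1 * y j) z := by
    intro j z hz
    have h1 : f none z = 1 := hfC none z hz
    rw [hgnone z (fun i => (hfo none (some i) (by simp) z).resolve_left
      (by rw [h1]; exact one_ne_zero)), h1, Complex.ofReal_one, one_smul, hYΩ z hz]
  have hex := fun j => D.exists_component_replace l (rowMap y 1 * y j) (g j) (hgΩ j)
  choose y' hy'l hy'k using hex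
  have hk' : ∀ k < l, ∀ j, D.component k (y' j) =
      rowMap (fun j => D.component k (y j)) 1 * D.component k (y j) := fun k hk j => by
    rw [hy'k j k hk, map_mul]
    exact congrArg (fun w => w * D.component k (y j)) (D.component_rowMap k y 1)
  refine ⟨y', fun k hk => ?_, fun k hk j hj => ?_⟩
  · rcases (show k ≤ l by rw [Fin.le_def]; omega).eq_or_lt with rfl | hlt
    · rw [funext hy'l]; exact hgl
    · rw [funext (hk' k hlt)]
      exact (h.1 k hlt).mul_left
  · rcases (show k ≤ l by rw [Fin.le_def]; omega).eq_or_lt with rfl | hlt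
    · rw [hy'l]
      refine ContinuousMap.ext fun z => ?_
      rw [hg, hY0 j (by omega), ContinuousMap.zero_apply, smul_zero, zero_add]
      refine Finset.sum_eq_zero fun i _ => ?_
      have : D.unitRow ι k i j = 0 := CStarMatrix.ext fun c c' => by
        rw [unitRow_apply, if_neg]
        · rfl
        · rintro ⟨rfl, -⟩
          change k.val + 1 ≤ k.val at hj
          omega
      rw [this, smul_zero]
    · rw [hk' k hlt, h.2 k hlt j (by omega)]
      exact mul_zero (M₀ := C(D.X k, Mat (D.r k) ℂ)) _

/-- Finitely many points with disjoint compact neighbourhoods can be simultaneously excised. -/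
theorem exists_isExcisionRow (hη : 0 < η) (hK : ∀ l i, IsClosed (K l i))
    (hKΩ : ∀ l i, K l i ⊆ (D.Ω l)ᶜ) (hdisj : ∀ l, Pairwise fun i j => Disjoint (K l i) (K l j))
    (hosc : ∀ l i, ∀ z ∈ K l i, ∀ b ∈ F, ‖D.component l b z - D.eval l (x l i) b‖ < η) :
    ∃ y : D.RowIdx ι → B, ∀ k, D.IsExcisionRow F η x K k fun j => D.component k (y j) := by
  have key : ∀ m ≤ D.depth + 1, ∃ y, D.IsPartialExcisionRow F η x K m y := by
    intro m
    induction m with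
    | zero => exact fun _ => ⟨0, fun k hk => absurd hk (by omega), fun k hk => absurd hk (by omega)⟩
    | succ m ih =>
      intro hm
      obtain ⟨y, hy⟩ := ih (by omega)
      exact IsPartialExcisionRow.step hη hK hKΩ hdisj hosc (l := ⟨m, by omega⟩) hy
  obtain ⟨y, hy⟩ := key _ le_rfl
  exact ⟨y, fun k => hy.1 k k.2⟩

end RSHDecomposition

end

noncomputable section


set_option linter.unusedSectionVars false

section Positivity

variable {A₁ A₂ A₃ : Type*} [CStarAlgebra A₁] [CStarAlgebra A₂] [CStarAlgebra A₃]

theorem IsPositiveElement.exists_eq {a : A₁} (h : IsPositiveElement a) : ∃ b, a = star b * b := by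
  let _ := CStarAlgebra.spectralOrder A₁
  have := CStarAlgebra.spectralOrderedRing A₁
  exact CStarAlgebra.nonneg_iff_eq_star_mul_self.1 h

theorem isPositiveElement_star_mul_self (b : A₁) : IsPositiveElement (star b * b) := by
  let _ := CStarAlgebra.spectralOrder A₁
  have := CStarAlgebra.spectralOrderedRing A₁
  exact star_mul_self_nonneg b

theorem IsPositiveElement.map {a : A₁} (h : IsPositiveElement a) (f : A₁ →⋆ₐ[ℂ] A₂) :
    IsPositiveElement (f a) := by
  obtain ⟨b, rfl⟩ := h.exists_eq
  rw [map_mul, map_star]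
  exact isPositiveElement_star_mul_self _

theorem IsCompletelyPositive.sum {ι : Type*} (s : Finset ι) {σ : ι → A₁ →ₗ[ℂ] A₂}
    (h : ∀ i, IsCompletelyPositive (σ i)) : IsCompletelyPositive (∑ i ∈ s, σ i) := by
  let _ := CStarAlgebra.spectralOrder A₁
  let _ := CStarAlgebra.spectralOrder A₂
  have := CStarAlgebra.spectralOrderedRing A₁
  have := CStarAlgebra.spectralOrderedRing A₂
  choose Φ hΦ using h
  refine ⟨⟨∑ i ∈ s, σ i, fun k M hM => ?_⟩, rfl⟩
  have h1 : CStarMatrix.map M (⇑(∑ i ∈ s, σ i)) = ∑ i ∈ s, CStarMatrix.map M (Φ i) := by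
    refine CStarMatrix.ext fun a b => ?_
    have h2 : (∑ i ∈ s, CStarMatrix.map M (Φ i)) a b = ∑ i ∈ s, CStarMatrix.map M (Φ i) a b :=
      map_sum (⟨⟨fun T : CStarMatrix (Fin k) (Fin k) A₂ => T a b, rfl⟩, fun _ _ => rfl⟩ :
        CStarMatrix (Fin k) (Fin k) A₂ →+ A₂) _ _
    rw [h2]
    change (∑ i ∈ s, σ i) (M a b) = _
    rw [LinearMap.sum_apply]
    refine Finset.sum_congr rfl fun i _ => ?_
    rw [← hΦ i]
    rfl
  refine le_of_le_of_eq ?_ h1.symm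
  exact Finset.sum_nonneg fun i _ => (Φ i).map_cstarMatrix_nonneg' k M hM

theorem IsCompletelyPositive.comp {σ : A₂ →ₗ[ℂ] A₃} {σ' : A₁ →ₗ[ℂ] A₂}
    (h : IsCompletelyPositive σ) (h' : IsCompletelyPositive σ') :
    IsCompletelyPositive (σ ∘ₗ σ') := by
  let _ := CStarAlgebra.spectralOrder A₁
  let _ := CStarAlgebra.spectralOrder A₂
  let _ := CStarAlgebra.spectralOrder A₃
  have := CStarAlgebra.spectralOrderedRing A₁
  have := CStarAlgebra.spectralOrderedRing A₂
  have := CStarAlgebra.spectralOrderedRing A₃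
  obtain ⟨Φ, rfl⟩ := h
  obtain ⟨Φ', rfl⟩ := h'
  exact ⟨⟨Φ.toLinearMap ∘ₗ Φ'.toLinearMap, fun k M hM =>
    Φ.map_cstarMatrix_nonneg' k _ (Φ'.map_cstarMatrix_nonneg' k M hM)⟩, rfl⟩

theorem NonUnitalStarAlgHom.isCompletelyPositive (f : A₁ →⋆ₙₐ[ℂ] A₂) :
    IsCompletelyPositive (f : A₁ →ₗ[ℂ] A₂) := by
  let _ := CStarAlgebra.spectralOrder A₁
  let _ := CStarAlgebra.spectralOrder A₂
  have := CStarAlgebra.spectralOrderedRing A₁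
  have := CStarAlgebra.spectralOrderedRing A₂
  exact ⟨(f : CompletelyPositiveMap A₁ A₂), rfl⟩

end Positivity

section OrthogonalSum

variable {ι : Type*} [Fintype ι] {A : ι → Type*} [∀ i, CStarAlgebra (A i)]
  {A' : Type*} [CStarAlgebra A']

/-- The sum of star homomorphisms with orthogonal ranges. -/
def NonUnitalStarAlgHom.orthogonalSum (f : ∀ i, A i →⋆ₙₐ[ℂ] A')
    (h : ∀ i j, i ≠ j → ∀ x y, f i x * f j y = 0) : (∀ i, A i) →⋆ₙₐ[ℂ] A' where
  toFun a := ∑ i, f i (a i)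
  map_smul' c a := by simp [Finset.smul_sum]
  map_zero' := by simp
  map_add' a b := by simp [Finset.sum_add_distrib]
  map_mul' a b := by
    rw [Finset.sum_mul]
    refine Finset.sum_congr rfl fun i _ => ?_
    rw [Finset.mul_sum, Finset.sum_eq_single i]
    · exact map_mul (f i) _ _
    · exact fun j _ hj => h i j hj.symm _ _
    · simp
  map_star' a := by simp [map_star]

theorem NonUnitalStarAlgHom.orthogonalSum_apply (f : ∀ i, A i →⋆ₙₐ[ℂ] A')
    (h : ∀ i j, i ≠ j → ∀ x y, f i x * f j y = 0) (a : ∀ i, A i) :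
    orthogonalSum f h a = ∑ i, f i (a i) := rfl

theorem NonUnitalStarAlgHom.orthogonalSum_injective (f : ∀ i, A i →⋆ₙₐ[ℂ] A')
    (h : ∀ i j, i ≠ j → ∀ x y, f i x * f j y = 0) (hf : ∀ i, Function.Injective (f i)) :
    Function.Injective (orthogonalSum f h) := by
  refine (injective_iff_map_eq_zero _).2 fun a ha => funext fun i => ?_
  have h1 : f i (star (a i)) * orthogonalSum f h a = f i (star (a i) * a i) := by
    rw [orthogonalSum_apply, Finset.mul_sum, Finset.sum_eq_single i, map_mul]
    · exact fun j _ hj => h i j hj.symm _ _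
    · simp
  rw [ha, mul_zero] at h1
  have h2 : star (a i) * a i = 0 := hf i (by rw [← h1, map_zero])
  exact CStarRing.star_mul_self_eq_zero_iff _ |>.1 h2

theorem NonUnitalStarAlgHom.norm_orthogonalSum (f : ∀ i, A i →⋆ₙₐ[ℂ] A')
    (h : ∀ i j, i ≠ j → ∀ x y, f i x * f j y = 0) (hf : ∀ i, Function.Injective (f i))
    (a : ∀ i, A i) : ‖∑ i, f i (a i)‖ = ‖a‖ :=
  NonUnitalStarAlgHom.norm_map (orthogonalSum f h) (orthogonalSum_injective f h hf) a

end OrthogonalSum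

namespace RSHDecomposition

variable {B : Type u} [CStarAlgebra B] (D : RSHDecomposition.{u, v, w} B)

/-- A bounded linear map from a star homomorphism of C⋆-algebras. -/
def _root_.NonUnitalStarAlgHom.toCLM {A A' : Type*} [CStarAlgebra A] [CStarAlgebra A']
    (ψ : A →⋆ₙₐ[ℂ] A') : A →L[ℂ] A' :=
  ⟨(ψ : A →ₗ[ℂ] A'), (NonUnitalStarAlgHom.instContinuousLinearMapClassComplex
    (F := A →⋆ₙₐ[ℂ] A')).map_continuous ψ⟩

/-- Entrywise application of an endomorphism of `𝒬`. -/
def ambientPush (ψ : UHF →⋆ₙₐ[ℂ] UHF) : D.Ambient →L[ℂ] D.Ambient :=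
  ContinuousLinearMap.pi fun l =>
    ((Mat.mapL (D.r l) ψ.toCLM).compLeftContinuous ℂ (D.X l)).comp (ContinuousLinearMap.proj l)

theorem ambientPush_apply (ψ : UHF →⋆ₙₐ[ℂ] UHF) (t : D.Ambient) (l : Fin (D.depth + 1))
    (x : D.X l) (i j : Fin (D.r l)) : D.ambientPush ψ t l x i j = ψ (t l x i j) := rfl

theorem ambientPush_elem (ψ : UHF →⋆ₙₐ[ℂ] UHF) (b : B) (q : UHF) :
    D.ambientPush ψ (D.elem b q) = D.elem b (ψ q) := by
  funext l
  ext x i j : 2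
  rw [ambientPush_apply, elem_apply, elem_apply, map_smul]

theorem ambientPush_mem (ψ : UHF →⋆ₙₐ[ℂ] UHF) {t : D.Ambient}
    (ht : t ∈ D.algTensor.topologicalClosure) :
    D.ambientPush ψ t ∈ D.algTensor.topologicalClosure := by
  have hcl : IsClosed (D.ambientPush ψ ⁻¹' (D.algTensor.topologicalClosure : Set D.Ambient)) :=
    (StarSubalgebra.isClosed_topologicalClosure _).preimage (D.ambientPush ψ).continuous
  refine closure_minimal (s := (D.algTensor : Set D.Ambient)) ?_ hcl ht
  intro s hs
  refine Submodule.span_induction (p := fun t _ =>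
      D.ambientPush ψ t ∈ D.algTensor.topologicalClosure) ?_ ?_ ?_ ?_ hs
  · rintro _ ⟨b, q, rfl⟩
    rw [ambientPush_elem]
    exact (D.tmul b (ψ q)).2
  · rw [map_zero]; exact zero_mem _
  · intro x y _ _ h1 h2; rw [map_add]; exact add_mem h1 h2
  · intro c x _ h; rw [map_smul]; exact SMulMemClass.smul_mem c h

/-- The endomorphism `id_B ⊗ ψ` of `B ⊗ 𝒬`. -/
def push (ψ : UHF →⋆ₙₐ[ℂ] UHF) : D.Tensor →⋆ₙₐ[ℂ] D.Tensor where
  toFun t := ⟨D.ambientPush ψ t.1, D.ambientPush_mem ψ t.2⟩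
  map_smul' c t := Subtype.ext (map_smul (D.ambientPush ψ) c t.1)
  map_zero' := Subtype.ext (map_zero (D.ambientPush ψ))
  map_add' s t := Subtype.ext (map_add (D.ambientPush ψ) s.1 t.1)
  map_mul' s t := Subtype.ext (by
    funext l
    ext x i j : 2
    change ψ (∑ k, s.1 l x i k * t.1 l x k j) = ∑ k, ψ (s.1 l x i k) * ψ (t.1 l x k j)
    simp only [map_sum, map_mul])
  map_star' t := Subtype.ext (by
    funext l
    ext x i j : 2
    exact map_star ψ (t.1 l x j i))

theorem push_tmul (ψ : UHF →⋆ₙₐ[ℂ] UHF) (b : B) (q : UHF) :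
    D.push ψ (D.tmul b q) = D.tmul b (ψ q) := Subtype.ext (D.ambientPush_elem ψ b q)

theorem push_injective {ψ : UHF →⋆ₙₐ[ℂ] UHF} (hψ : Function.Injective ψ) :
    Function.Injective (D.push ψ) := by
  intro s t h
  refine Subtype.ext ?_
  funext l
  ext x i j : 2
  have h1 : D.ambientPush ψ s.1 = D.ambientPush ψ t.1 := congrArg Subtype.val h
  have h2 : D.ambientPush ψ s.1 l x i j = D.ambientPush ψ t.1 l x i j := by rw [h1]
  exact hψ h2

theorem push_mul_push {ψ ψ' : UHF →⋆ₙₐ[ℂ] UHF} (h : ∀ x y, ψ x * ψ' y = 0) (s t : D.Tensor) :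
    D.push ψ s * D.push ψ' t = 0 := by
  refine Subtype.ext ?_
  funext l
  ext x i j : 2
  change ∑ k, ψ (s.1 l x i k) * ψ' (t.1 l x k j) = 0
  exact Finset.sum_eq_zero fun k _ => h _ _

theorem push_mul_tmul_one (ψ : UHF →⋆ₙₐ[ℂ] UHF) (t : D.Tensor) (b : B) :
    D.push ψ t * D.tmul b 1 = D.push ψ (t * D.tmul b 1) := by
  refine Subtype.ext ?_
  funext l
  ext x i j : 2
  change ∑ k, ψ (t.1 l x i k) * D.elem b 1 l x k j = ψ (∑ k, t.1 l x i k * D.elem b 1 l x k j)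
  simp only [map_sum, elem_apply, mul_smul_comm, mul_one, map_smul]

theorem tmul_mul (a b : B) (p q : UHF) : D.tmul a p * D.tmul b q = D.tmul (a * b) (p * q) :=
  Subtype.ext (D.elem_mul a b p q)

theorem tmul_star (b : B) (q : UHF) : star (D.tmul b q) = D.tmul (star b) (star q) :=
  Subtype.ext (D.elem_star b q)

theorem push_mem_corner (ψ : UHF →⋆ₙₐ[ℂ] UHF) (t : D.Tensor) : D.push ψ t ∈ D.corner (ψ 1) := by
  have hcont : Continuous (D.push ψ) := (NonUnitalStarAlgHom.toCLM (D.push ψ)).continuous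
  have hcl : IsClosed (D.push ψ ⁻¹' D.corner (ψ 1)) := isClosed_closure.preimage hcont
  have hdense : t ∈ closure {t : D.Tensor | t.1 ∈ D.algTensor} := by
    refine Metric.mem_closure_iff.2 fun ε hε => ?_
    obtain ⟨s, hs, hd⟩ := Metric.mem_closure_iff.1
      (show t.1 ∈ closure (D.algTensor : Set D.Ambient) from t.2) ε hε
    exact ⟨⟨s, StarSubalgebra.le_topologicalClosure _ hs⟩, hs, hd⟩
  refine closure_minimal ?_ hcl hdense
  intro s hs
  refine subset_closure ?_
  obtain ⟨s, hs'⟩ := s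
  change s ∈ D.algTensor at hs
  have key : ∀ s ∈ Submodule.span ℂ {t | ∃ b q, t = D.elem b q}, ∃ s' : D.Tensor, s'.1 = s ∧
      D.push ψ s' ∈ Submodule.span ℂ {t | ∃ b y, t = D.tmul b (ψ 1 * y * ψ 1)} := by
    intro s hs
    refine Submodule.span_induction (p := fun s _ => ∃ s' : D.Tensor, s'.1 = s ∧
      D.push ψ s' ∈ Submodule.span ℂ {t | ∃ b y, t = D.tmul b (ψ 1 * y * ψ 1)}) ?_ ?_ ?_ ?_ hs
    · rintro _ ⟨b, q, rfl⟩
      refine ⟨D.tmul b q, rfl, Submodule.subset_span ⟨b, ψ q, ?_⟩⟩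
      rw [push_tmul, ← map_mul, ← map_mul, one_mul, mul_one]
    · exact ⟨0, rfl, by rw [map_zero]; exact Submodule.zero_mem _⟩
    · rintro _ _ _ _ ⟨s₁, rfl, h1⟩ ⟨s₂, rfl, h2⟩
      exact ⟨s₁ + s₂, rfl, by rw [map_add]; exact Submodule.add_mem _ h1 h2⟩
    · rintro c _ _ ⟨s₁, rfl, h1⟩
      exact ⟨c • s₁, rfl, by rw [map_smul]; exact Submodule.smul_mem _ c h1⟩
  obtain ⟨s', rfl, h⟩ := key s hs
  exact h

/-- The embedding `b ↦ b ⊗ p` for a projection `p`. -/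
def tmulHom {p : UHF} (hp : IsStarProjection p) : B →⋆ₙₐ[ℂ] D.Tensor where
  toFun b := D.tmul b p
  map_smul' c b := Subtype.ext (by
    funext l
    ext x i j : 2
    change D.elem (c • b) p l x i j = c • D.elem b p l x i j
    rw [elem_apply, elem_apply, map_smul, smul_smul]
    rfl)
  map_zero' := Subtype.ext (by
    funext l
    ext x i j : 2
    change D.elem 0 p l x i j = 0
    rw [elem_apply, map_zero]
    exact zero_smul ℂ p)
  map_add' a b := Subtype.ext (by
    funext l
    ext x i j : 2
    change D.elem (a + b) p l x i j = D.elem a p l x i j + D.elem b p l x i j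
    rw [elem_apply, elem_apply, elem_apply, map_add, ← add_smul]
    rfl)
  map_mul' a b := by rw [tmul_mul, hp.isIdempotentElem.eq]
  map_star' b := by rw [tmul_star, hp.isSelfAdjoint.star_eq]

theorem tmulHom_injective {p : UHF} (hp : IsStarProjection p) (hp0 : p ≠ 0) :
    Function.Injective (D.tmulHom hp) := by
  refine (injective_iff_map_eq_zero _).2 fun b hb => ?_
  refine D.eq_of_component_eq fun l => ?_
  ext x i j : 2
  have h1 : (D.tmulHom hp b).1 l x i j = 0 := by rw [hb]; rfl
  have h2 : (D.component l b x i j) • p = 0 := h1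
  rw [map_zero]
  exact (smul_eq_zero.1 h2).resolve_right hp0

theorem norm_tmul {p : UHF} (hp : IsStarProjection p) (hp0 : p ≠ 0) (b : B) :
    ‖D.tmul b p‖ = ‖b‖ :=
  NonUnitalStarAlgHom.norm_map (D.tmulHom hp) (D.tmulHom_injective hp hp0) b

end RSHDecomposition

end

noncomputable section


set_option linter.unusedSectionVars false

/-- Evaluation of a family at an index. -/
def Pi.swapEvalHom {L ι : Type*} (E : L → ι → Type*) [∀ l i, CStarAlgebra (E l i)] (i : ι) :
    (∀ l i, E l i) →⋆ₐ[ℂ] ∀ l, E l i where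
  toFun a l := a l i
  map_one' := rfl
  map_mul' _ _ := rfl
  map_zero' := rfl
  map_add' _ _ := rfl
  commutes' _ := rfl
  map_star' _ := rfl

section SumMap

variable {ι : Type*} [Fintype ι] {G T : Type*} {E : ι → Type*} [CStarAlgebra G] [CStarAlgebra T]
  [∀ i, CStarAlgebra (E i)]

/-- The underlying linear map. -/
def NonUnitalStarAlgHom.toLin {A A' : Type*} [CStarAlgebra A] [CStarAlgebra A']
    (f : A →⋆ₙₐ[ℂ] A') : A →ₗ[ℂ] A' := f

/-- The sum of linear maps into orthogonal corners. -/
def orthogonalSumMap (f : ι → T →⋆ₙₐ[ℂ] T) (σ : ∀ i, E i →ₗ[ℂ] T) (g : ∀ i, G →⋆ₐ[ℂ] E i) :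
    G →ₗ[ℂ] T where
  toFun a := ∑ i, f i (σ i (g i a))
  map_add' a b := by simp [Finset.sum_add_distrib]
  map_smul' c a := by simp [Finset.smul_sum]

variable {f : ι → T →⋆ₙₐ[ℂ] T} {σ : ∀ i, E i →ₗ[ℂ] T} {g : ∀ i, G →⋆ₐ[ℂ] E i}

theorem orthogonalSumMap_apply (a : G) :
    orthogonalSumMap f σ g a = ∑ i, f i (σ i (g i a)) := rfl

theorem norm_orthogonalSumMap (hf : ∀ i, Function.Injective (f i))
    (h : ∀ i j, i ≠ j → ∀ x y, f i x * f j y = 0) (hσ : ∀ i a, ‖σ i a‖ = ‖a‖) (a : G) :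
    ‖orthogonalSumMap f σ g a‖ = ‖fun i => g i a‖ := by
  rw [orthogonalSumMap_apply, NonUnitalStarAlgHom.norm_orthogonalSum f h hf]
  simp only [Pi.norm_def]
  congr 1
  refine Finset.sup_congr rfl fun i _ => NNReal.eq (hσ i _)

theorem isCompletelyPositive_orthogonalSumMap (hσ : ∀ i, IsCompletelyPositive (σ i)) :
    IsCompletelyPositive (orthogonalSumMap f σ g) := by
  have h1 : orthogonalSumMap f σ g = ∑ i, ((f i).toLin ∘ₗ σ i) ∘ₗ (g i).toNonUnitalStarAlgHom.toLin := by
    refine LinearMap.ext fun a => ?_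
    rw [LinearMap.sum_apply]
    rfl
  rw [h1]
  exact IsCompletelyPositive.sum _ fun i => ((f i).isCompletelyPositive.comp (hσ i)).comp
    (g i).toNonUnitalStarAlgHom.isCompletelyPositive

theorem isOrderZero_orthogonalSumMap (h : ∀ i j, i ≠ j → ∀ x y, f i x * f j y = 0)
    (hσ : ∀ i, IsOrderZero (σ i)) : IsOrderZero (orthogonalSumMap f σ g) := by
  intro a b ha hb hab
  rw [orthogonalSumMap_apply, orthogonalSumMap_apply, Finset.sum_mul]
  refine Finset.sum_eq_zero fun i _ => ?_
  rw [Finset.mul_sum]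
  refine Finset.sum_eq_zero fun j _ => ?_
  by_cases hij : i = j
  · subst hij
    rw [← map_mul, hσ i _ _ (ha.map (g i)) (hb.map (g i)) (by rw [← map_mul, hab, map_zero]),
      map_zero]
  · exact h i j hij _ _

theorem norm_orthogonalSumMap_sub_lt (hf : ∀ i, Function.Injective (f i))
    (h : ∀ i j, i ≠ j → ∀ x y, f i x * f j y = 0) {m : T} (hm : ∀ i t, f i t * m = f i (t * m))
    (a b : G) {η : ℝ} (hη : 0 < η) (hab : ∀ i, ‖σ i (g i a) * m - σ i (g i b)‖ < η) :
    ‖orthogonalSumMap f σ g a * m - orthogonalSumMap f σ g b‖ < η := by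
  have h1 : orthogonalSumMap f σ g a * m - orthogonalSumMap f σ g b =
      ∑ i, f i (σ i (g i a) * m - σ i (g i b)) := by
    rw [orthogonalSumMap_apply, orthogonalSumMap_apply, Finset.sum_mul, ← Finset.sum_sub_distrib]
    refine Finset.sum_congr rfl fun i _ => ?_
    rw [hm, map_sub]
  rw [h1, NonUnitalStarAlgHom.norm_orthogonalSum f h hf]
  exact (pi_norm_lt_iff hη).2 hab

end SumMap

/-- The homomorphism into a product with given components. -/
def StarAlgHom.piHom {ι A : Type*} {E : ι → Type*} [Semiring A] [Algebra ℂ A] [Star A]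
    [∀ i, CStarAlgebra (E i)] (f : ∀ i, A →⋆ₐ[ℂ] E i) : A →⋆ₐ[ℂ] ∀ i, E i where
  toFun a i := f i a
  map_one' := funext fun i => map_one (f i)
  map_mul' a b := funext fun i => map_mul (f i) a b
  map_zero' := funext fun i => map_zero (f i)
  map_add' a b := funext fun i => map_add (f i) a b
  commutes' c := funext fun i => (f i).commutes' c
  map_star' a := funext fun i => map_star (f i) a

namespace WeightedExcisor

variable {B : Type u} [CStarAlgebra B] {D : RSHDecomposition.{u, v, w} B} {F : Finset B} {η : ℝ}

/-- The sum of weighted excisors, pushed into orthogonal corners of `𝒬`. -/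
def sum {ι : Type} [Fintype ι] (e : ι → WeightedExcisor D F η) (hη : 0 < η)
    (ψ : ι → UHF →⋆ₙₐ[ℂ] UHF) (hψ : ∀ i, Function.Injective (ψ i))
    (horth : ∀ i j, i ≠ j → ∀ x y, ψ i x * ψ j y = 0)
    (κ : (∀ l, ∀ i, (e i).E l) →⋆ₐ[ℂ] UHF) : WeightedExcisor D F η where
  E l := ∀ i, (e i).E l
  ρ l := StarAlgHom.piHom fun i => (e i).ρ l
  σ := orthogonalSumMap (fun i => D.push (ψ i)) (fun i => (e i).σ)
    (Pi.swapEvalHom fun l i => (e i).E l)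
  norm_σ a := by
    refine (norm_orthogonalSumMap (fun i => D.push_injective (hψ i))
      (fun i j hij => D.push_mul_push (horth i j hij)) (fun i => (e i).norm_σ) a).trans
      (le_antisymm ?_ ?_)
    · refine (pi_norm_le_iff_of_nonneg (norm_nonneg _)).2 fun i => ?_
      refine (pi_norm_le_iff_of_nonneg (norm_nonneg _)).2 fun l => ?_
      exact (norm_le_pi_norm (a l) i).trans (norm_le_pi_norm a l)
    · refine (pi_norm_le_iff_of_nonneg (norm_nonneg _)).2 fun l => ?_
      refine (pi_norm_le_iff_of_nonneg (norm_nonneg _)).2 fun i => ?_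
      exact le_trans (norm_le_pi_norm (fun l => a l i) l)
        (norm_le_pi_norm (fun i => Pi.swapEvalHom (fun l i => (e i).E l) i a) i)
  completelyPositive_σ := isCompletelyPositive_orthogonalSumMap fun i => (e i).completelyPositive_σ
  orderZero_σ := isOrderZero_orthogonalSumMap (fun i j hij => D.push_mul_push (horth i j hij))
    fun i => (e i).orderZero_σ
  approx b hb := norm_orthogonalSumMap_sub_lt (fun i => D.push_injective (hψ i))
    (fun i j hij => D.push_mul_push (horth i j hij)) (fun i t => D.push_mul_tmul_one (ψ i) t b)
    _ _ hη fun i => (e i).approx b hb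
  κ := κ

variable {ι : Type} [Fintype ι] {e : ι → WeightedExcisor D F η} {hη : 0 < η}
  {ψ : ι → UHF →⋆ₙₐ[ℂ] UHF} {hψ : ∀ i, Function.Injective (ψ i)}
  {horth : ∀ i j, i ≠ j → ∀ x y, ψ i x * ψ j y = 0}
  {κ : (∀ l, ∀ i, (e i).E l) →⋆ₐ[ℂ] UHF}

theorem sum_compatible (h : ∀ i, (e i).Compatible) : (sum e hη ψ hψ horth κ).Compatible := by
  intro l
  have h' := fun i => h i l
  choose Y hY hYΩ ρ' hρ' using h'
  let r (i : ι) : C(⋃ i, Y i, Mat (D.r l) ℂ) →⋆ₐ[ℂ] C(Y i, Mat (D.r l) ℂ) :=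
    ContinuousMap.compStarAlgHom' ℂ _ ⟨Set.inclusion (Set.subset_iUnion Y i),
      continuous_inclusion _⟩
  refine ⟨⋃ i, Y i, isCompact_iUnion hY, Set.iUnion_subset hYΩ,
    StarAlgHom.piHom fun i => (ρ' i).comp (r i), fun b => funext fun i => ?_⟩
  exact hρ' i b

end WeightedExcisor

end

noncomputable section


set_option linter.unusedSectionVars false

/-- The unital sum of star homomorphisms with orthogonal ranges. -/
def StarAlgHom.orthogonalSum {ι : Type*} [Fintype ι] {A : ι → Type*} [∀ i, CStarAlgebra (A i)]
    {A' : Type*} [CStarAlgebra A'] (f : ∀ i, A i →⋆ₙₐ[ℂ] A')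
    (h : ∀ i j, i ≠ j → ∀ x y, f i x * f j y = 0) (h1 : ∑ i, f i 1 = 1) :
    (∀ i, A i) →⋆ₐ[ℂ] A' where
  toFun := NonUnitalStarAlgHom.orthogonalSum f h
  map_one' := h1
  map_mul' := map_mul _
  map_zero' := map_zero _
  map_add' := map_add _
  commutes' c := by
    rw [Algebra.algebraMap_eq_smul_one, Algebra.algebraMap_eq_smul_one, map_smul]
    exact congrArg _ h1
  map_star' := map_star _

namespace RSHDecomposition

variable {B : Type u} [CStarAlgebra B] {D : RSHDecomposition.{u, v, w} B}

theorem norm_component_le (l : Fin (D.depth + 1)) (b : B) : ‖D.component l b‖ ≤ ‖b‖ := by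
  have h1 : ‖D.embedding b‖ = ‖b‖ := NonUnitalStarAlgHom.norm_map D.embedding D.embedding_injective b
  rw [← h1]
  exact norm_le_pi_norm (D.embedding b) l

theorem norm_eval_le (l : Fin (D.depth + 1)) (z : D.X l) (b : B) : ‖D.eval l z b‖ ≤ ‖b‖ :=
  ((D.component l b).norm_coe_le_norm z).trans (norm_component_le l b)

theorem norm_lt_of_component {b : B} {c : ℝ} (hc : 0 < c) (h : ∀ l, ‖D.component l b‖ < c) :
    ‖b‖ < c := by
  have h1 : ‖D.embedding b‖ = ‖b‖ := NonUnitalStarAlgHom.norm_map D.embedding D.embedding_injective b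
  rw [← h1]
  exact (pi_norm_lt_iff hc).2 h

theorem norm_le_of_component {b : B} {c : ℝ} (hc : 0 ≤ c) (h : ∀ l, ‖D.component l b‖ ≤ c) :
    ‖b‖ ≤ c := by
  have h1 : ‖D.embedding b‖ = ‖b‖ := NonUnitalStarAlgHom.norm_map D.embedding D.embedding_injective b
  rw [← h1]
  exact (pi_norm_le_iff_of_nonneg hc).2 h

theorem norm_tmul_mul_sub (D : RSHDecomposition.{u, v, w} B) {p : UHF} (hp : IsStarProjection p)
    (hp0 : p ≠ 0) (s b t : B) : ‖D.tmul s p * D.tmul b 1 - D.tmul t p‖ = ‖s * b - t‖ := by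
  rw [D.tmul_mul, mul_one, ← D.norm_tmul hp hp0 (s * b - t)]
  exact congrArg norm (map_sub (D.tmulHom hp) (s * b) t).symm

variable {ι : Fin (D.depth + 1) → Type} [∀ l, Fintype (ι l)] [∀ l, DecidableEq (ι l)]
variable {F : Finset B} {η : ℝ} {x : ∀ l, ι l → D.X l} {K : ∀ l, ι l → Set (D.X l)}
  {y : D.RowIdx ι → B}

theorem isOrthogonalRow_of_component (h : ∀ k, D.IsOrthogonalRow fun j => D.component k (y j)) :
    D.IsOrthogonalRow y := by
  refine ⟨fun i j hij => ?_, fun p a a' => ?_, fun i => ?_⟩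
  · refine D.eq_of_component_eq fun k => ?_
    rw [map_mul, map_star, map_zero]
    exact (h k).orth i j hij
  · refine D.eq_of_component_eq fun k => ?_
    rw [map_mul, map_star, map_mul, map_star]
    exact (h k).diag p a a'
  · refine norm_le_of_component (D := D) zero_le_one fun k => ?_
    rw [map_mul, map_star]
    exact (h k).norm_le i

theorem eval_rowMap (h : ∀ k, D.IsExcisionRow F η x K k fun j => D.component k (y j))
    (l : Fin (D.depth + 1)) (i : ι l) {z : D.X l} (hz : z ∈ K l i)
    (a : ∀ l, ι l → Mat (D.r l) ℂ) : D.eval l z (rowMap y (D.blockEmb ι a)) = a l i := by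
  rw [← D.rowMap_unitRow ι l i a]
  refine (map_rowMap (D.eval l z) y _).trans ?_
  exact congrArg (fun y => rowMap y (D.blockEmb ι a)) (funext fun j => (h l).val i z hz j)

/-- The order zero map of an excision row. -/
def excisionMap (y : D.RowIdx ι → B) : (∀ l, ι l → Mat (D.r l) ℂ) →ₗ[ℂ] B where
  toFun a := rowMap y (D.blockEmb ι a)
  map_add' a b := by rw [map_add, map_add]
  map_smul' c a := by rw [map_smul, map_smul]; rfl

theorem excisionMap_apply (a : ∀ l, ι l → Mat (D.r l) ℂ) :
    excisionMap y a = rowMap y (D.blockEmb ι a) := rfl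

theorem isCompletelyPositive_excisionMap : IsCompletelyPositive (excisionMap y) :=
  isCompletelyPositive_rowMap y (D.blockEmb ι)

theorem norm_excisionMap (h : ∀ k, D.IsExcisionRow F η x K k fun j => D.component k (y j))
    (hK : ∀ l i, (K l i).Nonempty) (a : ∀ l, ι l → Mat (D.r l) ℂ) : ‖excisionMap y a‖ = ‖a‖ := by
  have hrow := isOrthogonalRow_of_component fun k => (h k).row
  refine le_antisymm ?_ ?_
  · exact norm_rowMap_le hrow.star_mul_eq_ite (fun p => hrow.norm_le _) (D.blockEmb ι) a
  · refine (pi_norm_le_iff_of_nonneg (norm_nonneg _)).2 fun l =>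
      (pi_norm_le_iff_of_nonneg (norm_nonneg _)).2 fun i => ?_
    obtain ⟨z, hz⟩ := hK l i
    rw [← eval_rowMap h l i hz a]
    exact norm_eval_le l z _

theorem isOrderZero_excisionMap (h : ∀ k, D.IsExcisionRow F η x K k fun j => D.component k (y j)) :
    IsOrderZero (excisionMap y) := by
  intro a b _ _ hab
  have hrow := isOrthogonalRow_of_component fun k => (h k).row
  rw [excisionMap_apply, excisionMap_apply,
    rowMap_mul_rowMap hrow.star_mul_eq_ite (D.blockEmb_apply_ne ι a),
    ← map_mul (D.blockEmb ι), hab, map_zero, map_zero, mul_zero]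

theorem norm_excisionMap_sub_lt (hη : 0 < η)
    (h : ∀ k, D.IsExcisionRow F η x K k fun j => D.component k (y j)) {b : B} (hb : b ∈ F) :
    ‖excisionMap y 1 * b - excisionMap y fun l i => D.eval l (x l i) b‖ < η := by
  refine norm_lt_of_component (D := D) hη fun k => ?_
  have h3 := (h k).approx b hb
  rw [excisionMap_apply, excisionMap_apply, map_one, map_sub, map_mul, D.component_rowMap,
    D.component_rowMap]
  exact h3

end RSHDecomposition

theorem norm_sum_map_sub_sum_map_le {ι A A' : Type*} [Fintype ι] [CStarAlgebra A]
    [CStarAlgebra A'] (ψ : ι → A →⋆ₙₐ[ℂ] A') (u v : ι → A) (a : ι) (h : ∀ i, i ≠ a → u i = v i) :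
    ‖∑ i, ψ i (u i) - ∑ i, ψ i (v i)‖ ≤ ‖u a - v a‖ := by
  rw [← Finset.sum_sub_distrib, Finset.sum_eq_single a]
  · rw [← map_sub]
    exact NonUnitalStarAlgHom.norm_apply_le (ψ a) _
  · intro i _ hi
    rw [h i hi, sub_self]
  · simp

section Comp

variable {A₁ A₂ A₃ : Type*} [CStarAlgebra A₁] [CStarAlgebra A₂] [CStarAlgebra A₃]

theorem IsOrderZero.hom_comp {σ : A₁ →ₗ[ℂ] A₂} (h : IsOrderZero σ) (f : A₂ →⋆ₙₐ[ℂ] A₃) :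
    IsOrderZero (f.toLin ∘ₗ σ) := by
  intro a b ha hb hab
  change f (σ a) * f (σ b) = 0
  rw [← map_mul, h a b ha hb hab, map_zero]

theorem IsCompletelyPositive.hom_comp {σ : A₁ →ₗ[ℂ] A₂} (h : IsCompletelyPositive σ)
    (f : A₂ →⋆ₙₐ[ℂ] A₃) : IsCompletelyPositive (f.toLin ∘ₗ σ) :=
  f.isCompletelyPositive.comp h

end Comp

namespace WeightedExcisor

variable {B : Type u} [CStarAlgebra B] {D : RSHDecomposition.{u, v, w} B}
variable {ι : Fin (D.depth + 1) → Type} [∀ l, Fintype (ι l)] [∀ l, DecidableEq (ι l)]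
variable {F : Finset B} {η : ℝ} {x : ∀ l, ι l → D.X l} {K : ∀ l, ι l → Set (D.X l)}
  {y : D.RowIdx ι → B}

/-- The weighted excisor of an excision row. -/
def ofRow (hη : 0 < η) (h : ∀ k, D.IsExcisionRow F η x K k fun j => D.component k (y j))
    (hK : ∀ l i, (K l i).Nonempty) {p : UHF} (hp : IsStarProjection p) (hp0 : p ≠ 0)
    (κ : (∀ l, ι l → Mat (D.r l) ℂ) →⋆ₐ[ℂ] UHF) : WeightedExcisor D F η where
  E l := ι l → Mat (D.r l) ℂ
  ρ l := StarAlgHom.piHom fun i => D.eval l (x l i)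
  σ := (D.tmulHom hp).toLin ∘ₗ RSHDecomposition.excisionMap y
  norm_σ a := (D.norm_tmul hp hp0 _).trans (RSHDecomposition.norm_excisionMap h hK a)
  completelyPositive_σ := RSHDecomposition.isCompletelyPositive_excisionMap.hom_comp _
  orderZero_σ := (RSHDecomposition.isOrderZero_excisionMap h).hom_comp _
  approx _ hb := (D.norm_tmul_mul_sub hp hp0 _ _ _).trans_lt
    (RSHDecomposition.norm_excisionMap_sub_lt hη h hb)
  κ := κ

theorem ofRow_compatible (hη : 0 < η)
    (h : ∀ k, D.IsExcisionRow F η x K k fun j => D.component k (y j))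
    (hK : ∀ l i, (K l i).Nonempty) {p : UHF} (hp : IsStarProjection p) (hp0 : p ≠ 0)
    (κ : (∀ l, ι l → Mat (D.r l) ℂ) →⋆ₐ[ℂ] UHF) (hx : ∀ l i, x l i ∉ D.Ω l) :
    (ofRow hη h hK hp hp0 κ).Compatible := by
  intro l
  have : CompactSpace (Set.range (x l)) :=
    isCompact_iff_compactSpace.1 (Set.finite_range (x l)).isCompact
  let r (i : ι l) : C(Set.range (x l), Mat (D.r l) ℂ) →⋆ₐ[ℂ] Mat (D.r l) ℂ :=
    ContinuousMap.evalStarHom ⟨x l i, Set.mem_range_self i⟩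
  refine ⟨Set.range (x l), (Set.finite_range (x l)).isCompact, ?_, StarAlgHom.piHom r,
    fun b => rfl⟩
  rintro _ ⟨i, rfl⟩
  exact hx l i

end WeightedExcisor

section Realizable

variable {B : Type u} [CStarAlgebra B] (D : RSHDecomposition.{u, v, w} B) (F : Finset B) (η : ℝ)

/-- The maps `κ ∘ ρ` of compatible weighted excisors. -/
def Realizable (θ : B → UHF) : Prop :=
  ∃ e : WeightedExcisor D F η, e.Compatible ∧ e.κρ = θ

/-- The relation of neighbours in a bridge, in terms of the maps `κ ∘ ρ`. -/
def Linked (θ θ' : B → UHF) : Prop :=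
  Realizable D F η θ ∧ Realizable D F η θ' ∧ ∀ b ∈ F, ‖θ b - θ' b‖ < η

/-- The relation of being connected by a bridge, in terms of the maps `κ ∘ ρ`. -/
def BridgePath : (B → UHF) → (B → UHF) → Prop := Relation.ReflTransGen (Linked D F η)

variable {D F η}

theorem Linked.symm {θ θ' : B → UHF} (h : Linked D F η θ θ') : Linked D F η θ' θ :=
  ⟨h.2.1, h.1, fun b hb => by rw [norm_sub_rev]; exact h.2.2 b hb⟩

theorem BridgePath.refl (θ : B → UHF) : BridgePath D F η θ θ := Relation.ReflTransGen.refl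

theorem BridgePath.symm {θ θ' : B → UHF} (h : BridgePath D F η θ θ') : BridgePath D F η θ' θ := by
  induction h with
  | refl => exact BridgePath.refl _
  | tail _ h ih => exact Relation.ReflTransGen.head h.symm ih

theorem BridgePath.trans {θ θ' θ'' : B → UHF} (h : BridgePath D F η θ θ') (h' : BridgePath D F η θ' θ'') :
    BridgePath D F η θ θ'' := Relation.ReflTransGen.trans h h'

theorem BridgePath.realizable {θ θ' : B → UHF} (h : BridgePath D F η θ θ') (hθ : Realizable D F η θ) :
    Realizable D F η θ' := by
  induction h with
  | refl => exact hθ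
  | tail _ h _ => exact h.2.1

theorem WeightedExcisor.Bridged.path {e f : WeightedExcisor D F η} (h : e.Bridged f) :
    BridgePath D F η e.κρ f.κρ := by
  obtain ⟨K, g, -, rfl, rfl, hg, hg'⟩ := h
  have key : ∀ j ≤ K, BridgePath D F η (g 0).κρ (g j).κρ := by
    intro j
    induction j with
    | zero => exact fun _ => BridgePath.refl _
    | succ j ih =>
      exact fun hj => (ih (by omega)).tail ⟨⟨_, hg j (by omega), rfl⟩, ⟨_, hg _ hj, rfl⟩,
        hg' j (by omega)⟩
  exact key K le_rfl

variable {ι : Type} [Fintype ι] (ψ : ι → UHF →⋆ₙₐ[ℂ] UHF)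

theorem Realizable.sum (hη : 0 < η) (hψ : ∀ i, Function.Injective (ψ i))
    (horth : ∀ i j, i ≠ j → ∀ x y, ψ i x * ψ j y = 0) (h1 : ∑ i, ψ i 1 = 1) {θ : ι → B → UHF}
    (h : ∀ i, Realizable D F η (θ i)) : Realizable D F η fun b => ∑ i, ψ i (θ i b) := by
  choose e he heθ using h
  refine ⟨WeightedExcisor.sum e hη ψ hψ horth ((StarAlgHom.orthogonalSum ψ horth h1).comp
    (StarAlgHom.piHom fun i => ((e i).κ).comp (Pi.swapEvalHom (fun l i => (e i).E l) i))),
    WeightedExcisor.sum_compatible he, funext fun b => ?_⟩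
  simp only [← heθ]
  rfl

theorem BridgePath.sum_update [DecidableEq ι] (hη : 0 < η) (hψ : ∀ i, Function.Injective (ψ i))
    (horth : ∀ i j, i ≠ j → ∀ x y, ψ i x * ψ j y = 0) (h1 : ∑ i, ψ i 1 = 1) {θ : ι → B → UHF}
    (h : ∀ i, Realizable D F η (θ i)) (a : ι) {t : B → UHF} (ht : BridgePath D F η (θ a) t) :
    BridgePath D F η (fun b => ∑ i, ψ i (θ i b)) fun b => ∑ i, ψ i (Function.update θ a t i b) := by
  induction ht with
  | refl => rw [Function.update_eq_self]; exact BridgePath.refl _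
  | @tail t t' ht htt' ih =>
    have hr : ∀ s, Realizable D F η s → ∀ i, Realizable D F η (Function.update θ a s i) := by
      intro s hs i
      by_cases hi : i = a
      · subst hi; rwa [Function.update_self]
      · rw [Function.update_of_ne hi]; exact h i
    refine ih.tail ⟨Realizable.sum ψ hη hψ horth h1 (hr t htt'.1),
      Realizable.sum ψ hη hψ horth h1 (hr t' htt'.2.1), fun b hb => ?_⟩
    refine (norm_sum_map_sub_sum_map_le ψ (fun i => Function.update θ a t i b)
      (fun i => Function.update θ a t' i b) a fun i hi => ?_).trans_lt ?_
    · rw [Function.update_of_ne hi, Function.update_of_ne hi]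
    · rw [Function.update_self, Function.update_self]
      exact htt'.2.2 b hb

theorem BridgePath.sum (hη : 0 < η) (hψ : ∀ i, Function.Injective (ψ i))
    (horth : ∀ i j, i ≠ j → ∀ x y, ψ i x * ψ j y = 0) (h1 : ∑ i, ψ i 1 = 1) {θ θ' : ι → B → UHF}
    (h : ∀ i, Realizable D F η (θ i)) (ht : ∀ i, BridgePath D F η (θ i) (θ' i)) :
    BridgePath D F η (fun b => ∑ i, ψ i (θ i b)) fun b => ∑ i, ψ i (θ' i b) := by
  classical
  have key : ∀ s : Finset ι, BridgePath D F η (fun b => ∑ i, ψ i (θ i b))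
      fun b => ∑ i, ψ i ((if i ∈ s then θ' i else θ i) b) := by
    intro s
    induction s using Finset.induction_on with
    | empty => simpa using BridgePath.refl _
    | insert a s ha ih =>
      have h2 := BridgePath.sum_update ψ hη hψ horth h1 (θ := fun i => if i ∈ s then θ' i else θ i)
        (fun i => by
          split_ifs
          · exact (ht i).realizable (h i)
          · exact h i) a (t := θ' a) (by rw [if_neg ha]; exact ht a)
      refine ih.trans ?_
      convert h2 using 6 with b i _
      by_cases hi : i = a
      · subst hi; simp
      · rw [Function.update_of_ne hi]; simp [hi]
  simpa using key Finset.univ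

end Realizable

end

noncomputable section


set_option linter.unusedSectionVars false

namespace RSHDecomposition

variable {B : Type u} [CStarAlgebra B] (D : RSHDecomposition.{u, v, w} B)

/-- The evaluation at a point, with values in plain matrices. -/
def evalMatrix (l : Fin (D.depth + 1)) (z : D.X l) :
    B →⋆ₐ[ℂ] Matrix (Fin (D.r l)) (Fin (D.r l)) ℂ :=
  (CStarMatrix.ofMatrixStarAlgEquiv.symm.toStarAlgHom).comp (D.eval l z)

theorem evalMatrix_apply (l : Fin (D.depth + 1)) (z : D.X l) (b : B) :
    D.evalMatrix l z b = CStarMatrix.ofMatrix.symm (D.eval l z b) := rfl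

theorem component_ext {l : Fin (D.depth + 1)} {a b : B}
    (h : ∀ z, D.evalMatrix l z a = D.evalMatrix l z b) : D.component l a = D.component l b :=
  ContinuousMap.ext fun z => h z

/-- Elements which vanish on the base spaces before `X_l` are prescribed by functions on `X_l`. -/
theorem exists_evalMatrix_eq (l : Fin (D.depth + 1))
    (g : Fin (D.r l) → Fin (D.r l) → C(D.X l, ℂ)) (hg : ∀ i j, ∀ z ∈ D.Ω l, g i j z = 0) :
    ∃ b : B, (∀ k < l, D.component k b = 0) ∧
      ∀ z, D.evalMatrix l z b = Matrix.of fun i j => g i j z := by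
  have hc : Continuous fun z : D.X l =>
      (CStarMatrix.ofMatrix (Matrix.of fun i j => g i j z) : Mat (D.r l) ℂ) := by
    change Continuous fun z => (fun i j => g i j z : Fin (D.r l) → Fin (D.r l) → ℂ)
    fun_prop
  obtain ⟨b, hb, hb'⟩ := D.exists_component_eq l ⟨_, hc⟩ fun z hz =>
    CStarMatrix.ext fun i j => hg i j z hz
  refine ⟨b, hb', fun z => ?_⟩
  rw [evalMatrix_apply]
  change CStarMatrix.ofMatrix.symm (D.component l b z) = _
  rw [hb]
  rfl

/-- Elements vanishing on the base spaces before `X_l` which are scalar on `X_l`. -/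
def IsScalarAt (l : Fin (D.depth + 1)) (b : B) (f : C(D.X l, ℂ)) : Prop :=
  (∀ k < l, D.component k b = 0) ∧ ∀ z, D.evalMatrix l z b = f z • 1

theorem exists_isScalarAt (l : Fin (D.depth + 1)) (f : C(D.X l, ℂ)) (hf : ∀ z ∈ D.Ω l, f z = 0) :
    ∃ b, D.IsScalarAt l b f := by
  obtain ⟨b, hb, hb'⟩ := D.exists_evalMatrix_eq l (fun i j => if i = j then f else 0)
    (fun i j z hz => by split_ifs; exacts [hf z hz, rfl])
  refine ⟨b, hb, fun z => ?_⟩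
  rw [hb']
  ext i j
  by_cases hij : i = j <;> simp [hij]

variable {D}

theorem evalMatrix_eq_zero_of_mem_Ω {l : Fin (D.depth + 1)} {b : B}
    (h : ∀ k < l, D.component k b = 0) {z : D.X l} (hz : z ∈ D.Ω l) : D.evalMatrix l z b = 0 := by
  have h1 := D.component_eq_of_mem_Ω (b := 0) (fun k hk => by rw [h k hk, map_zero]) hz
  rw [evalMatrix_apply]
  change CStarMatrix.ofMatrix.symm (D.component l b z) = 0
  rw [h1, map_zero]
  rfl

theorem IsScalarAt.mul {l : Fin (D.depth + 1)} {b c : B} {f g : C(D.X l, ℂ)}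
    (hb : D.IsScalarAt l b f) (hc : D.IsScalarAt l c g) : D.IsScalarAt l (b * c) (f * g) :=
  ⟨fun k hk => by rw [map_mul, hb.1 k hk]; exact zero_mul (M₀ := C(D.X k, Mat (D.r k) ℂ)) _,
    fun z => by
      rw [map_mul, hb.2, hc.2, smul_mul_smul_comm, one_mul]; rfl⟩

theorem IsScalarAt.star {l : Fin (D.depth + 1)} {b : B} {f : C(D.X l, ℂ)}
    (hb : D.IsScalarAt l b f) : D.IsScalarAt l (star b) (star f) :=
  ⟨fun k hk => by rw [map_star, hb.1 k hk]; exact star_zero (R := C(D.X k, Mat (D.r k) ℂ)),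
    fun z => by
      rw [map_star, hb.2, star_smul, star_one]; rfl⟩

theorem IsScalarAt.apply_eq_zero {l : Fin (D.depth + 1)} {b : B} {f : C(D.X l, ℂ)}
    (hb : D.IsScalarAt l b f) {z : D.X l} (hz : z ∈ D.Ω l) : f z = 0 := by
  have h1 := evalMatrix_eq_zero_of_mem_Ω hb.1 hz
  rw [hb.2] at h1
  have h2 := congrFun (congrFun h1 ⟨0, D.r_pos l⟩) ⟨0, D.r_pos l⟩
  simpa using h2

section Core

variable {N : ℕ} {π : B →⋆ₐ[ℂ] Matrix (Fin N) (Fin N) ℂ} {M : Submodule ℂ (Fin N → ℂ)}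
  {l : Fin (D.depth + 1)}

theorem mulVec_eq_of_component_eq
    (hkill : ∀ b, (∀ k ≤ l, D.component k b = 0) → ∀ v ∈ M, π b *ᵥ v = 0) {a b : B}
    (h : ∀ k < l, D.component k a = D.component k b)
    (h' : ∀ z, D.evalMatrix l z a = D.evalMatrix l z b) {v : Fin N → ℂ} (hv : v ∈ M) :
    π a *ᵥ v = π b *ᵥ v := by
  have h1 := hkill (a - b) (fun k hk => by
    rw [map_sub, sub_eq_zero]
    rcases hk.eq_or_lt with rfl | hk
    · exact D.component_ext h'
    · exact h k hk) v hv
  rwa [map_sub, Matrix.sub_mulVec, sub_eq_zero] at h1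

theorem exists_isScalarAt_mulVec_ne_zero (hM : ∀ b, ∀ v ∈ M, π b *ᵥ v ∈ M)
    (hkill : ∀ b, (∀ k ≤ l, D.component k b = 0) → ∀ v ∈ M, π b *ᵥ v = 0)
    (hex : ∃ b, (∀ k < l, D.component k b = 0) ∧ ∃ v ∈ M, π b *ᵥ v ≠ 0) :
    ∃ h f, D.IsScalarAt l h f ∧ star h = h ∧ ∃ v ∈ M, π h *ᵥ v ≠ 0 := by
  suffices hs : ∃ s f, D.IsScalarAt l s f ∧ ∃ v ∈ M, π s *ᵥ v ≠ 0 by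
    obtain ⟨s, f, hs, v, hv, hne⟩ := hs
    refine ⟨star s * s, star f * f, hs.star.mul hs, by rw [star_mul, star_star], v, hv,
      fun h0 => hne ?_⟩
    rw [map_mul, map_star, Matrix.star_eq_conjTranspose] at h0
    exact (Matrix.conjTranspose_mul_self_mulVec_eq_zero _ _).1 h0
  by_contra! hcon
  obtain ⟨b, hb, v, hv, hne⟩ := hex
  let g (i j : Fin (D.r l)) : C(D.X l, ℂ) :=
    ⟨fun z => D.component l b z i j, by
      have h1 := (D.component l b).continuous
      exact (continuous_apply j).comp ((continuous_apply i).comp h1)⟩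
  have hbΩ : ∀ z ∈ D.Ω l, D.evalMatrix l z b = 0 := fun z hz => evalMatrix_eq_zero_of_mem_Ω hb hz
  have hgz : ∀ z, D.evalMatrix l z b = Matrix.of fun i j => g i j z := fun z => rfl
  have hs := fun i j => D.exists_isScalarAt l (g i j) fun z hz =>
    congrFun (congrFun (hbΩ z hz) i) j
  choose s hs using hs
  let c : Fin (D.r l) → Fin (D.r l) → C(D.X l, ℂ) := fun i j => ∑ k, star (g k i) * g k j
  have ht := fun i j => D.exists_evalMatrix_eq l
    (fun i' j' => if i' = i then c j j' else 0) (fun i' j' z hz => by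
      split_ifs
      · have h2 : c j j' z = ∑ k, star (g k j z) * g k j' z := by simp [c]
        rw [h2]
        refine Finset.sum_eq_zero fun k _ => ?_
        rw [show g k j' z = 0 from congrFun (congrFun (hbΩ z hz) k) j', mul_zero]
      · rfl)
  choose t ht ht' using ht
  have hkey : π (b * (star b * b)) *ᵥ v = π (∑ i, ∑ j, s i j * t i j) *ᵥ v := by
    refine mulVec_eq_of_component_eq hkill (fun k hk => ?_) (fun z => ?_) hv
    · rw [map_mul, hb k hk, map_sum]
      refine (zero_mul (M₀ := C(D.X k, Mat (D.r k) ℂ)) _).trans (Finset.sum_eq_zero fun i _ => ?_).symm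
      rw [map_sum]
      refine Finset.sum_eq_zero fun j _ => ?_
      rw [map_mul, ht i j k hk]
      exact mul_zero (M₀ := C(D.X k, Mat (D.r k) ℂ)) _
    · have hc : ∀ j j', c j j' z = ∑ k, star (g k j z) * g k j' z := fun j j' => by simp [c]
      have hR : ∀ i' j' i, (D.evalMatrix l z) (∑ j, s i j * t i j) i' j' =
          if i' = i then ∑ j, g i j z * c j j' z else 0 := fun i' j' i => by
        rw [map_sum, Matrix.sum_apply]
        split_ifs with hi
        · refine Finset.sum_congr rfl fun j _ => ?_
          rw [map_mul, (hs i j).2, ht', smul_mul_assoc, one_mul, Matrix.smul_apply,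
            Matrix.of_apply, if_pos hi, smul_eq_mul]
        · refine Finset.sum_eq_zero fun j _ => ?_
          rw [map_mul, (hs i j).2, ht', smul_mul_assoc, one_mul, Matrix.smul_apply,
            Matrix.of_apply, if_neg hi]
          exact mul_zero _
      ext i' j'
      rw [map_sum, Matrix.sum_apply]
      simp only [hR, Finset.sum_ite_eq, Finset.mem_univ, if_true]
      rw [map_mul, map_mul, map_star, Matrix.mul_apply]
      refine Finset.sum_congr rfl fun j _ => ?_
      rw [Matrix.mul_apply, hc]
      rfl
  have h0 : π (b * (star b * b)) *ᵥ v = 0 := by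
    rw [hkey, map_sum, Matrix.sum_mulVec]
    refine Finset.sum_eq_zero fun i _ => ?_
    rw [map_sum, Matrix.sum_mulVec]
    refine Finset.sum_eq_zero fun j _ => ?_
    rw [map_mul, ← Matrix.mulVec_mulVec]
    exact hcon _ _ (hs i j) _ (hM _ _ hv)
  rw [map_mul, map_mul, map_star, Matrix.star_eq_conjTranspose, ← mul_assoc,
    ← Matrix.mulVec_mulVec] at h0
  have h1 := (Matrix.self_mul_conjTranspose_mulVec_eq_zero _ _).1 h0
  rw [Matrix.mulVec_mulVec] at h1
  exact hne ((Matrix.conjTranspose_mul_self_mulVec_eq_zero _ _).1 h1)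

theorem exists_common_eigenvector (hM : ∀ b, ∀ v ∈ M, π b *ᵥ v ∈ M)
    (hkill : ∀ b, (∀ k ≤ l, D.component k b = 0) → ∀ v ∈ M, π b *ᵥ v = 0)
    {h : B} {f : C(D.X l, ℂ)} (hh : D.IsScalarAt l h f) (hst : star h = h)
    (hne : ∃ v ∈ M, π h *ᵥ v ≠ 0) :
    ∃ w ∈ M, π h *ᵥ w ≠ 0 ∧ ∀ s g, D.IsScalarAt l s g → ∃ μ : ℂ, π s *ᵥ w = μ • w := by
  have hcomm : ∀ s g, D.IsScalarAt l s g → ∀ s' g', D.IsScalarAt l s' g' → ∀ v ∈ M,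
      π s *ᵥ (π s' *ᵥ v) = π s' *ᵥ (π s *ᵥ v) := by
    intro s g hs s' g' hs' v hv
    rw [Matrix.mulVec_mulVec, Matrix.mulVec_mulVec, ← map_mul, ← map_mul]
    refine mulVec_eq_of_component_eq hkill (fun k hk => ?_) (fun z => ?_) hv
    · rw [(hs.mul hs').1 k hk, (hs'.mul hs).1 k hk]
    · rw [(hs.mul hs').2, (hs'.mul hs).2, mul_comm]
  let W₀ : Submodule ℂ (Fin N → ℂ) := M.map (π h).mulVecLin
  have hW₀ : ∀ w ∈ W₀, w ∈ M := by
    rintro _ ⟨v, hv, rfl⟩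
    exact hM h v hv
  let S : Set (Submodule ℂ (Fin N → ℂ)) := {W | W ≤ W₀ ∧ W ≠ ⊥ ∧
    ∀ s g, D.IsScalarAt l s g → ∀ w ∈ W, π s *ᵥ w ∈ W}
  have hS : S.Nonempty := by
    refine ⟨W₀, le_rfl, ?_, ?_⟩
    · obtain ⟨v, hv, hne⟩ := hne
      exact (Submodule.ne_bot_iff _).2 ⟨_, ⟨v, hv, rfl⟩, hne⟩
    · rintro s g hs _ ⟨v, hv, rfl⟩
      exact ⟨π s *ᵥ v, hM s v hv, hcomm h f hh s g hs v hv⟩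
  obtain ⟨W, ⟨hWW₀, hWne, hWinv⟩, hmin⟩ := (set_has_minimal_iff_artinian (R := ℂ)
    (M := Fin N → ℂ)).2
    inferInstance S hS
  obtain ⟨w, hw, hw0⟩ := (Submodule.ne_bot_iff _).1 hWne
  refine ⟨w, hW₀ w (hWW₀ hw), fun h0 => ?_, fun s g hs => ?_⟩
  · obtain ⟨v, hv, rfl⟩ := hWW₀ hw
    refine hw0 ?_
    change π h *ᵥ (π h *ᵥ v) = 0 at h0
    have hherm : (π h)ᴴ = π h := by
      rw [← Matrix.star_eq_conjTranspose, ← map_star, hst]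
    rw [Matrix.mulVec_mulVec] at h0
    nth_rewrite 1 [← hherm] at h0
    exact (Matrix.conjTranspose_mul_self_mulVec_eq_zero _ _).1 h0
  · let T : Module.End ℂ W := (π s).mulVecLin.restrict fun w hw => hWinv s g hs w hw
    have : Nontrivial W := Submodule.nontrivial_iff_ne_bot.2 hWne
    obtain ⟨μ, hμ⟩ := Module.End.exists_eigenvalue T
    obtain ⟨w', hw'⟩ := hμ.exists_hasEigenvector
    let W' : Submodule ℂ (Fin N → ℂ) := W ⊓ LinearMap.ker ((π s).mulVecLin - μ • LinearMap.id)
    have hmem : ∀ u, u ∈ W' ↔ u ∈ W ∧ π s *ᵥ u = μ • u := fun u => by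
      rw [Submodule.mem_inf, LinearMap.mem_ker, LinearMap.sub_apply, sub_eq_zero]
      rfl
    have hW' : W' ∈ S := by
      refine ⟨inf_le_left.trans hWW₀, (Submodule.ne_bot_iff _).2 ⟨w', (hmem _).2 ⟨w'.2, ?_⟩, ?_⟩,
        fun s' g' hs' u hu => (hmem _).2 ⟨hWinv s' g' hs' u ((hmem _).1 hu).1, ?_⟩⟩
      · exact congrArg Subtype.val hw'.apply_eq_smul
      · exact fun h0 => hw'.2 (Subtype.ext h0)
      · obtain ⟨huW, hu⟩ := (hmem _).1 hu
        rw [hcomm s g hs s' g' hs' u (hW₀ u (hWW₀ huW)), hu, Matrix.mulVec_smul]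
    have hle : W ≤ W' := by
      by_contra hcon
      exact hmin W' hW' (lt_of_le_not_ge inf_le_left hcon)
    exact ⟨μ, ((hmem _).1 (hle hw)).2⟩

theorem exists_point_of_common_eigenvector
    (hkill : ∀ b, (∀ k ≤ l, D.component k b = 0) → ∀ v ∈ M, π b *ᵥ v = 0)
    {h : B} {f : C(D.X l, ℂ)} (hh : D.IsScalarAt l h f) {w : Fin N → ℂ} (hwM : w ∈ M)
    (hw : π h *ᵥ w ≠ 0) (hs : ∀ s g, D.IsScalarAt l s g → ∃ μ : ℂ, π s *ᵥ w = μ • w) :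
    ∃ z ∉ D.Ω l, ∀ s g, D.IsScalarAt l s g → π s *ᵥ w = g z • w := by
  have hw0 : w ≠ 0 := by rintro rfl; exact hw (Matrix.mulVec_zero _)
  have hinj : ∀ {a b : ℂ}, a • w = b • w → a = b := fun {a b} hab => by
    by_contra hne
    exact hw0 ((smul_eq_zero.1 (show (a - b) • w = 0 by rw [sub_smul, hab, sub_self])).resolve_left
      (sub_ne_zero.2 hne))
  obtain ⟨c, hc⟩ := hs h f hh
  have hc0 : c ≠ 0 := by rintro rfl; exact hw (by rw [hc, zero_smul])
  have heq : ∀ {s s' g}, D.IsScalarAt l s g → D.IsScalarAt l s' g → π s *ᵥ w = π s' *ᵥ w :=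
    fun {s s' g} h1 h2 => mulVec_eq_of_component_eq hkill
      (fun k hk => by rw [h1.1 k hk, h2.1 k hk]) (fun z => by rw [h1.2, h2.2]) hwM
  have hex := fun g : C(D.X l, ℂ) => D.exists_isScalarAt l (g * f) fun z hz => by
    rw [ContinuousMap.mul_apply, hh.apply_eq_zero hz, mul_zero]
  choose s hsg using hex
  have hμ := fun g => hs _ _ (hsg g)
  choose μ hμ using hμ
  have hprod : ∀ {s s' : B} {g g' : C(D.X l, ℂ)} {a a' : ℂ}, D.IsScalarAt l s g → D.IsScalarAt l s' g' →
      π s *ᵥ w = a • w → π s' *ᵥ w = a' • w → π (s * s') *ᵥ w = (a * a') • w :=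
    fun {s s' g g' a a'} _ _ h1 h2 => by
      rw [map_mul, ← Matrix.mulVec_mulVec, h2, Matrix.mulVec_smul (π s) a' w, h1, smul_smul, mul_comm]
  have hmul : ∀ g g', μ (g * g') * c = μ g * μ g' := fun g g' => hinj (by
    rw [← hprod (hsg _) hh (hμ _) hc, ← hprod (hsg g) (hsg g') (hμ g) (hμ g')]
    refine heq ((hsg _).mul hh) ?_
    have h1 := (hsg g).mul (hsg g')
    rwa [show g * f * (g' * f) = g * g' * f * f by ring] at h1)
  have hone : μ 1 = c := hinj (by
    rw [← hμ, ← hc]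
    refine heq (hsg 1) ?_
    rwa [one_mul])
  have hadd : ∀ g g', μ (g + g') = μ g + μ g' := fun g g' => hinj (by
    rw [← hμ, add_smul, ← hμ, ← hμ, ← Matrix.add_mulVec, ← map_add]
    refine heq (hsg _) ⟨fun k hk => by rw [map_add, (hsg g).1 k hk, (hsg g').1 k hk, add_zero],
      fun z => ?_⟩
    rw [map_add, (hsg g).2, (hsg g').2, ← add_smul, add_mul]
    rfl)
  have hconst : ∀ a : ℂ, μ (algebraMap ℂ C(D.X l, ℂ) a) = a * c := fun a => hinj (by
    rw [← hμ, mul_smul, ← hc, ← Matrix.smul_mulVec a (π h) w, ← map_smul π a h]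
    refine heq (hsg _) ⟨fun k hk => by rw [map_smul, hh.1 k hk, smul_zero], fun z => ?_⟩
    rw [map_smul, hh.2, smul_smul]
    rfl)
  let χ : C(D.X l, ℂ) →ₐ[ℂ] ℂ :=
    { toFun := fun g => μ g / c
      map_one' := by rw [hone, div_self hc0]
      map_mul' := fun g g' => by
        field_simp
        exact hmul g g'
      map_zero' := by
        have := hconst 0
        rw [map_zero, zero_mul] at this
        rw [this, zero_div]
      map_add' := fun g g' => by rw [hadd, add_div]
      commutes' := fun a => by rw [hconst, mul_div_cancel_right₀ _ hc0]; rfl }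
  obtain ⟨z, hz⟩ := (WeakDual.CharacterSpace.continuousMapEval_bijective (X := D.X l) (𝕜 := ℂ)).2
    (WeakDual.CharacterSpace.equivAlgHom.symm χ)
  have hχ : ∀ g : C(D.X l, ℂ), μ g = g z * c := fun g => by
    have h1 : g z = χ g := by
      have h2 := congrArg (fun φ => WeakDual.CharacterSpace.equivAlgHom φ g) hz
      rw [Equiv.apply_symm_apply] at h2
      exact h2
    rw [h1]
    exact (div_mul_cancel₀ _ hc0).symm
  have hval : ∀ s g, D.IsScalarAt l s g → π s *ᵥ w = g z • w := by
    intro t g ht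
    obtain ⟨a, ha⟩ := hs t g ht
    rw [ha]
    congr 1
    refine mul_right_cancel₀ hc0 (hinj ?_)
    rw [← hprod ht hh ha hc, ← hχ, ← hμ]
    exact heq (ht.mul hh) (hsg g)
  refine ⟨z, fun hz => hw ?_, hval⟩
  rw [hval h f hh, hh.apply_eq_zero hz, zero_smul]

theorem exists_isometry_of_point (hM : ∀ b, ∀ v ∈ M, π b *ᵥ v ∈ M)
    (hkill : ∀ b, (∀ k ≤ l, D.component k b = 0) → ∀ v ∈ M, π b *ᵥ v = 0)
    {z : D.X l} (hz : z ∉ D.Ω l) {w : Fin N → ℂ} (hwM : w ∈ M) (hw0 : w ≠ 0)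
    (hs : ∀ s g, D.IsScalarAt l s g → π s *ᵥ w = g z • w) :
    ∃ V : Matrix (Fin N) (Fin (D.r l)) ℂ, Vᴴ * V = 1 ∧ (∀ u, V *ᵥ u ∈ M) ∧
      ∀ b, π b * V = V * D.evalMatrix l z b := by
  obtain ⟨u₀, hu0, hu1, -⟩ := exists_continuous_zero_one_of_isClosed (D.isClosed_Ω l)
    (isClosed_singleton (x := z)) (Set.disjoint_singleton_right.2 hz)
  let f : C(D.X l, ℂ) := ⟨fun y => (u₀ y : ℂ), by fun_prop⟩
  have hfz : f z = 1 := by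
    change (u₀ z : ℂ) = 1
    rw [hu1 rfl]; simp
  have hfΩ : ∀ y ∈ D.Ω l, f y = 0 := fun y hy => by
    change (u₀ y : ℂ) = 0
    rw [hu0 hy]; simp
  obtain ⟨h, hh⟩ := D.exists_isScalarAt l f hfΩ
  -- elements vanishing at `z` kill `w`
  have hzero : ∀ b, (∀ k < l, D.component k b = 0) → D.evalMatrix l z b = 0 → π b *ᵥ w = 0 := by
    intro b hb hbz
    let g (i j : Fin (D.r l)) : C(D.X l, ℂ) :=
      ⟨fun z => D.component l b z i j, by
        have h1 := (D.component l b).continuous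
        exact (continuous_apply j).comp ((continuous_apply i).comp h1)⟩
    have hgz : ∀ z, D.evalMatrix l z b = Matrix.of fun i j => g i j z := fun z => rfl
    have hs' := fun i j => D.exists_isScalarAt l (g i j) fun z hz =>
      congrFun (congrFun (evalMatrix_eq_zero_of_mem_Ω hb hz) i) j
    choose s hs' using hs'
    have ht := fun i j => D.exists_evalMatrix_eq l
      (fun i' j' => if i' = i ∧ j' = j then f else 0) (fun i' j' z hz => by
        split_ifs
        · exact hfΩ z hz
        · rfl)
    choose t ht ht' using ht
    have hkey : π (b * h) *ᵥ w = π (∑ i, ∑ j, t i j * s i j) *ᵥ w := by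
      refine mulVec_eq_of_component_eq hkill (fun k hk => ?_) (fun y => ?_) hwM
      · rw [map_mul, hb k hk, map_sum]
        refine (zero_mul (M₀ := C(D.X k, Mat (D.r k) ℂ)) _).trans
          (Finset.sum_eq_zero fun i _ => ?_).symm
        rw [map_sum]
        refine Finset.sum_eq_zero fun j _ => ?_
        rw [map_mul, ht i j k hk]
        exact zero_mul (M₀ := C(D.X k, Mat (D.r k) ℂ)) _
      · have hR : ∀ i' j' i j, (D.evalMatrix l y) (t i j * s i j) i' j' =
            if i' = i ∧ j' = j then f y * g i j y else 0 := fun i' j' i j => by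
          rw [map_mul, (hs' i j).2, ht', mul_smul_comm, mul_one, Matrix.smul_apply,
            Matrix.of_apply]
          split_ifs
          · rw [smul_eq_mul, mul_comm]
          · exact mul_zero _
        ext i' j'
        rw [map_mul, hh.2, mul_smul_comm, mul_one, Matrix.smul_apply, map_sum, Matrix.sum_apply,
          Finset.sum_eq_single i', map_sum, Matrix.sum_apply, Finset.sum_eq_single j', hR,
          if_pos ⟨rfl, rfl⟩, hgz]
        · rfl
        · intro j _ hj
          rw [hR, if_neg (fun hh => hj hh.2.symm)]
        · simp
        · intro i _ hi
          rw [map_sum, Matrix.sum_apply]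
          exact Finset.sum_eq_zero fun j _ => by rw [hR, if_neg (fun hh => hi hh.1.symm)]
        · simp
    have h1 : π (b * h) *ᵥ w = π b *ᵥ w := by
      rw [map_mul, ← Matrix.mulVec_mulVec, hs h f hh, hfz, one_smul]
    rw [← h1, hkey, map_sum, Matrix.sum_mulVec]
    refine Finset.sum_eq_zero fun i _ => ?_
    rw [map_sum, Matrix.sum_mulVec]
    refine Finset.sum_eq_zero fun j _ => ?_
    rw [map_mul, ← Matrix.mulVec_mulVec, hs _ _ (hs' i j)]
    rw [show g i j z = 0 from congrFun (congrFun hbz i) j, zero_smul, Matrix.mulVec_zero]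
  have heq : ∀ b b', (∀ k < l, D.component k b = 0) → (∀ k < l, D.component k b' = 0) →
      D.evalMatrix l z b = D.evalMatrix l z b' → π b *ᵥ w = π b' *ᵥ w := by
    intro b b' hb hb' hbb
    have := hzero (b - b') (fun k hk => by rw [map_sub, hb k hk, hb' k hk, sub_zero])
      (by rw [map_sub, hbb, sub_self])
    rwa [map_sub, Matrix.sub_mulVec, sub_eq_zero] at this
  have hex := fun a : Matrix (Fin (D.r l)) (Fin (D.r l)) ℂ => D.exists_evalMatrix_eq l
    (fun i j => a i j • f) fun i j y hy => by
      rw [ContinuousMap.smul_apply, hfΩ y hy, smul_zero]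
  choose e he he' using hex
  have hez : ∀ a, D.evalMatrix l z (e a) = a := fun a => by
    rw [he']
    ext i j
    simp [hfz]
  let Θ : Matrix (Fin (D.r l)) (Fin (D.r l)) ℂ →ₗ[ℂ] (Fin N → ℂ) :=
    { toFun := fun a => π (e a) *ᵥ w
      map_add' := fun a a' => by
        rw [← Matrix.add_mulVec, ← map_add]
        exact heq _ _ (he _) (fun k hk => by rw [map_add, he a k hk, he a' k hk, add_zero])
          (by rw [map_add, hez, hez, hez])
      map_smul' := fun c a => by
        rw [RingHom.id_apply, ← Matrix.smul_mulVec c, ← map_smul]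
        exact heq _ _ (he _) (fun k hk => by rw [map_smul, he a k hk, smul_zero])
          (by rw [map_smul, hez, hez]) }
  have hΘ : ∀ b a, π b *ᵥ Θ a = Θ (D.evalMatrix l z b * a) := fun b a => by
    change π b *ᵥ (π (e a) *ᵥ w) = π (e _) *ᵥ w
    rw [Matrix.mulVec_mulVec, ← map_mul]
    exact heq _ _ (fun k hk => by
      rw [map_mul, he a k hk]
      exact mul_zero (M₀ := C(D.X k, Mat (D.r k) ℂ)) _) (he _) (by rw [map_mul, hez, hez])
  have hΘM : ∀ a, Θ a ∈ M := fun a => hM _ _ hwM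
  have hΘ1 : Θ 1 = w := by
    change π (e 1) *ᵥ w = w
    rw [heq (e 1) h (he 1) hh.1 (by rw [hez, hh.2, hfz, one_smul]), hs h f hh, hfz, one_smul]
  have hinner : ∀ a a', star (Θ a) ⬝ᵥ Θ a' = star w ⬝ᵥ Θ (aᴴ * a') := fun a a' => by
    change star (π (e a) *ᵥ w) ⬝ᵥ Θ a' = _
    rw [Matrix.star_mulVec, ← Matrix.dotProduct_mulVec, ← Matrix.star_eq_conjTranspose, ← map_star,
      hΘ, map_star, hez, Matrix.star_eq_conjTranspose]
  obtain ⟨j, hj⟩ : ∃ j, Θ (Matrix.single j j 1) ≠ 0 := by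
    by_contra! hcon
    refine hw0 ?_
    rw [← hΘ1, ← Matrix.sum_single_one, map_sum]
    exact Finset.sum_eq_zero fun i _ => hcon i
  set c : ℝ := (star (Θ (Matrix.single j j 1)) ⬝ᵥ Θ (Matrix.single j j 1)).re with hc
  have hcc : star (Θ (Matrix.single j j 1)) ⬝ᵥ Θ (Matrix.single j j 1) = (c : ℂ) ∧ 0 < c := by
    have h1 : 0 < star (Θ (Matrix.single j j 1)) ⬝ᵥ Θ (Matrix.single j j 1) :=
      Matrix.dotProduct_star_self_pos_iff.2 hj
    rw [Complex.pos_iff] at h1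
    exact ⟨Complex.ext rfl h1.2.symm, h1.1⟩
  let V₀ : Matrix (Fin N) (Fin (D.r l)) ℂ := Matrix.of fun n a => Θ (Matrix.single a j 1) n
  have hV₀ : V₀ᴴ * V₀ = (c : ℂ) • 1 := by
    ext a a'
    have h1 : (V₀ᴴ * V₀) a a' = star (Θ (Matrix.single a j 1)) ⬝ᵥ Θ (Matrix.single a' j 1) := rfl
    rw [h1, hinner, Matrix.conjTranspose_single, star_one]
    by_cases haa : a = a'
    · subst haa
      rw [Matrix.single_mul_single_same, mul_one, Matrix.smul_apply, Matrix.one_apply_eq,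
        smul_eq_mul, mul_one, ← hcc.1, hinner, Matrix.conjTranspose_single,
        Matrix.single_mul_single_same, star_one, mul_one]
    · rw [Matrix.single_mul_single_of_ne _ _ _ _ haa, map_zero, dotProduct_zero, Matrix.smul_apply,
        Matrix.one_apply_ne haa, smul_zero]
  have hπV₀ : ∀ b, π b * V₀ = V₀ * D.evalMatrix l z b := fun b => by
    ext n a
    have h1 : (π b * V₀) n a = (π b *ᵥ Θ (Matrix.single a j 1)) n := rfl
    have h2 : D.evalMatrix l z b * Matrix.single a j 1 =
        ∑ k, D.evalMatrix l z b k a • Matrix.single k j 1 := by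
      ext i i'
      rw [Matrix.sum_apply, Finset.sum_eq_single i]
      · by_cases hi : i' = j
        · subst hi; simp
        · rw [Matrix.mul_single_apply_of_ne _ _ _ _ _ hi, Matrix.smul_apply,
            Matrix.single_apply_of_col_ne _ _ (Ne.symm hi), smul_zero]
      · intro k _ hk
        rw [Matrix.smul_apply, Matrix.single_apply_of_row_ne hk, smul_zero]
      · simp
    rw [h1, hΘ, h2, map_sum, Finset.sum_apply, Matrix.mul_apply]
    refine Finset.sum_congr rfl fun k _ => ?_
    rw [map_smul Θ, Pi.smul_apply, smul_eq_mul, mul_comm]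
    rfl
  have hsq : ((Real.sqrt c : ℝ) : ℂ) * (Real.sqrt c : ℝ) = c := by
    rw [← Complex.ofReal_mul, Real.mul_self_sqrt hcc.2.le]
  have hsq0 : ((Real.sqrt c : ℝ) : ℂ) ≠ 0 := by
    rw [Complex.ofReal_ne_zero]; exact (Real.sqrt_pos.2 hcc.2).ne'
  refine ⟨((Real.sqrt c : ℝ) : ℂ)⁻¹ • V₀, ?_, fun u => ?_, fun b => ?_⟩
  · rw [Matrix.conjTranspose_smul, Matrix.smul_mul, Matrix.mul_smul, hV₀, smul_smul, smul_smul,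
      star_inv₀, Complex.star_def, Complex.conj_ofReal, ← hsq]
    rw [show ((Real.sqrt c : ℝ) : ℂ)⁻¹ * ((Real.sqrt c : ℝ) : ℂ)⁻¹ *
      (((Real.sqrt c : ℝ) : ℂ) * (Real.sqrt c : ℝ)) = 1 by field_simp, one_smul]
  · rw [Matrix.smul_mulVec]
    refine M.smul_mem _ ?_
    have : V₀ *ᵥ u = ∑ a, u a • Θ (Matrix.single a j 1) := by
      ext n
      rw [Finset.sum_apply]
      change ∑ a, Θ (Matrix.single a j 1) n * u a = _
      refine Finset.sum_congr rfl fun a _ => ?_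
      rw [Pi.smul_apply, smul_eq_mul, mul_comm]
    rw [this]
    exact M.sum_mem fun a _ => M.smul_mem _ (hΘM _)
  · rw [Matrix.mul_smul, hπV₀, Matrix.smul_mul]

end Core

/-- The data `(l_i, z_i, V_i)` exhibit `π` as a direct sum of point evaluations. -/
structure Decomposes {N : ℕ} (π : B →⋆ₐ[ℂ] Matrix (Fin N) (Fin N) ℂ) {ι : Type} [Fintype ι]
    (l : ι → Fin (D.depth + 1)) (z : ∀ i, D.X (l i))
    (V : ∀ i, Matrix (Fin N) (Fin (D.r (l i))) ℂ) : Prop where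
  isometry : ∀ i, (V i)ᴴ * V i = 1
  orth : ∀ i j, i ≠ j → (V i)ᴴ * V j = 0
  complete : ∑ i, V i * (V i)ᴴ = 1
  intertwine : ∀ i b, π b * V i = V i * D.evalMatrix (l i) (z i) b

theorem exists_decomposition_aux {N : ℕ} (π : B →⋆ₐ[ℂ] Matrix (Fin N) (Fin N) ℂ) (n : ℕ) :
    ∀ M : Submodule ℂ (Fin N → ℂ), Module.finrank ℂ M ≤ n → (∀ b, ∀ v ∈ M, π b *ᵥ v ∈ M) →
    ∃ (ι : Type) (_ : Fintype ι) (_ : DecidableEq ι) (l : ι → Fin (D.depth + 1))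
      (z : ∀ i, D.X (l i)) (V : ∀ i, Matrix (Fin N) (Fin (D.r (l i))) ℂ),
      (∀ i, z i ∉ D.Ω (l i)) ∧ (∀ i, (V i)ᴴ * V i = 1) ∧ (∀ i j, i ≠ j → (V i)ᴴ * V j = 0) ∧
      (∀ i u, V i *ᵥ u ∈ M) ∧ (∀ v ∈ M, (∑ i, V i * (V i)ᴴ) *ᵥ v = v) ∧
      (∀ i b, π b * V i = V i * D.evalMatrix (l i) (z i) b) ∧
      ∀ m : ℕ, (∀ b, (∀ k : Fin (D.depth + 1), k.val < m → D.component k b = 0) →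
        ∀ v ∈ M, π b *ᵥ v = 0) → ∀ i, (l i).val < m := by
  classical
  induction n with
  | zero =>
    intro M hM _
    have hbot : M = ⊥ := Submodule.finrank_eq_zero.1 (by omega)
    refine ⟨Empty, inferInstance, inferInstance, fun i => i.elim, fun i => i.elim,
      fun i => i.elim, fun i => i.elim, fun i => i.elim, fun i => i.elim, fun i => i.elim,
      fun v hv => ?_, fun i => i.elim, fun m _ i => i.elim⟩
    rw [hbot, Submodule.mem_bot] at hv
    rw [hv, Matrix.mulVec_zero]
  | succ n ih =>
    intro M hM hinv
    by_cases hbot : M = ⊥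
    · exact ih M (by rw [hbot, finrank_bot]; omega) hinv
    let Q : ℕ → Prop := fun m => ∀ b, (∀ k : Fin (D.depth + 1), k.val < m → D.component k b = 0) →
      ∀ v ∈ M, π b *ᵥ v = 0
    have hQ : ∃ m, Q m := ⟨D.depth + 1, fun b hb v _ => by
      have : b = 0 := D.eq_of_component_eq fun k => by rw [hb k k.2, map_zero]
      rw [this, map_zero, Matrix.zero_mulVec]⟩
    have hQ0 : ¬ Q 0 := fun h => by
      obtain ⟨v, hv, hv0⟩ := (Submodule.ne_bot_iff _).1 hbot
      have := h 1 (fun k hk => absurd hk (by omega)) v hv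
      rw [map_one, Matrix.one_mulVec] at this
      exact hv0 this
    have hm0 : Nat.find hQ ≠ 0 := fun h => hQ0 (h ▸ Nat.find_spec hQ)
    obtain ⟨m, hm⟩ := Nat.exists_eq_succ_of_ne_zero hm0
    have hQm : Q (m + 1) := by
      rw [← Nat.succ_eq_add_one, ← hm]; exact Nat.find_spec hQ
    have hmD : m < D.depth + 1 := by
      have : Nat.find hQ ≤ D.depth + 1 := Nat.find_min' hQ fun b hb v _ => by
        have : b = 0 := D.eq_of_component_eq fun k => by rw [hb k k.2, map_zero]
        rw [this, map_zero, Matrix.zero_mulVec]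
      omega
    let l : Fin (D.depth + 1) := ⟨m, hmD⟩
    have hkill : ∀ b, (∀ k ≤ l, D.component k b = 0) → ∀ v ∈ M, π b *ᵥ v = 0 := fun b hb =>
      hQm b fun k hk => hb k (Fin.le_def.2 (Nat.lt_succ_iff.1 hk))
    have hex : ∃ b, (∀ k < l, D.component k b = 0) ∧ ∃ v ∈ M, π b *ᵥ v ≠ 0 := by
      by_contra! hcon
      exact Nat.find_min hQ (m := m) (by omega) fun b hb => hcon b fun k hk => hb k hk
    obtain ⟨h, f, hh, hst, hne⟩ := exists_isScalarAt_mulVec_ne_zero hinv hkill hex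
    obtain ⟨w, hwM, hw, hws⟩ := exists_common_eigenvector hinv hkill hh hst hne
    obtain ⟨z, hz, hzs⟩ := exists_point_of_common_eigenvector hkill hh hwM hw hws
    obtain ⟨V, hV1, hVM, hVπ⟩ := exists_isometry_of_point hinv hkill hz hwM
      (by rintro rfl; exact hw (Matrix.mulVec_zero _)) hzs
    let M' : Submodule ℂ (Fin N → ℂ) := M ⊓ LinearMap.ker Vᴴ.mulVecLin
    have hmem : ∀ u, u ∈ M' ↔ u ∈ M ∧ Vᴴ *ᵥ u = 0 := fun u => by
      rw [Submodule.mem_inf, LinearMap.mem_ker]; rfl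
    have hM'inv : ∀ b, ∀ v ∈ M', π b *ᵥ v ∈ M' := by
      intro b v hv
      obtain ⟨hvM, hv⟩ := (hmem v).1 hv
      refine (hmem _).2 ⟨hinv b v hvM, ?_⟩
      have h1 := congrArg Matrix.conjTranspose (hVπ (star b))
      rw [Matrix.conjTranspose_mul, Matrix.conjTranspose_mul, map_star, map_star,
        Matrix.star_eq_conjTranspose, Matrix.star_eq_conjTranspose,
        Matrix.conjTranspose_conjTranspose, Matrix.conjTranspose_conjTranspose] at h1
      rw [Matrix.mulVec_mulVec, h1, ← Matrix.mulVec_mulVec, hv, Matrix.mulVec_zero]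
    have hlt : M' < M := by
      refine lt_of_le_of_ne inf_le_left fun heq => ?_
      let u : Fin (D.r l) → ℂ := Pi.single ⟨0, D.r_pos l⟩ 1
      have h1 : V *ᵥ u ∈ M' := heq ▸ hVM u
      have h2 := ((hmem _).1 h1).2
      rw [Matrix.mulVec_mulVec, hV1, Matrix.one_mulVec] at h2
      have h3 := congrFun h2 ⟨0, D.r_pos l⟩
      simp [u] at h3
    obtain ⟨ι, _, _, l', z', V', hz', hV1', horth, hVM', hcomp, hint, hlev⟩ := ih M' (by
      have := Submodule.finrank_lt_finrank_of_lt hlt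
      omega) hM'inv
    have hVV' : ∀ i, Vᴴ * V' i = 0 := fun i => by
      refine Matrix.ext_of_mulVec_single fun a => ?_
      rw [← Matrix.mulVec_mulVec, ((hmem _).1 (hVM' i _)).2, Matrix.zero_mulVec]
    have hV'V : ∀ i, (V' i)ᴴ * V = 0 := fun i => by
      have := congrArg Matrix.conjTranspose (hVV' i)
      rwa [Matrix.conjTranspose_mul, Matrix.conjTranspose_conjTranspose,
        Matrix.conjTranspose_zero] at this
    let l'' : Option ι → Fin (D.depth + 1) := fun o => o.elim l l'
    let z'' : ∀ o, D.X (l'' o) := fun o => match o with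
      | none => z
      | some i => z' i
    let V'' : ∀ o, Matrix (Fin N) (Fin (D.r (l'' o))) ℂ := fun o => match o with
      | none => V
      | some i => V' i
    refine ⟨Option ι, inferInstance, inferInstance, l'', z'', V'', ?_, ?_, ?_, ?_, ?_, ?_, ?_⟩
    · rintro (_ | i); exacts [hz, hz' i]
    · rintro (_ | i); exacts [hV1, hV1' i]
    · rintro (_ | i) (_ | j) hij
      · exact (hij rfl).elim
      · exact hVV' j
      · exact hV'V i
      · exact horth i j fun h => hij (congrArg some h)
    · rintro (_ | i) u
      · exact hVM u
      · exact ((hmem _).1 (hVM' i u)).1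
    · intro v hv
      rw [Fintype.sum_option]
      change (V * Vᴴ + ∑ i, V' i * (V' i)ᴴ) *ᵥ v = v
      have h1 : v - (V * Vᴴ) *ᵥ v ∈ M' := by
        refine (hmem _).2 ⟨M.sub_mem hv ?_, ?_⟩
        · rw [← Matrix.mulVec_mulVec]; exact hVM _
        · rw [Matrix.mulVec_sub, Matrix.mulVec_mulVec, ← Matrix.mul_assoc, hV1, Matrix.one_mul,
            sub_self]
      have h2 := hcomp _ h1
      have h3 : (∑ i, V' i * (V' i)ᴴ) * (V * Vᴴ) = 0 := by
        rw [Finset.sum_mul]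
        refine Finset.sum_eq_zero fun i _ => ?_
        rw [Matrix.mul_assoc, ← Matrix.mul_assoc _ V, hV'V, Matrix.zero_mul, Matrix.mul_zero]
      rw [Matrix.mulVec_sub, Matrix.mulVec_mulVec, h3, Matrix.zero_mulVec, sub_zero] at h2
      rw [Matrix.add_mulVec, h2, add_sub_cancel]
    · rintro (_ | i) b; exacts [hVπ b, hint i b]
    · rintro m' hm' (_ | i)
      · have : Nat.find hQ ≤ m' := Nat.find_min' hQ hm'
        change m < m'
        omega
      · exact hlev m' (fun b hb v hv => hm' b hb v ((hmem _).1 hv).1) i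

/-- Every finite-dimensional unital representation is a direct sum of evaluations at points
outside the attaching sets. -/
theorem exists_decomposition {N : ℕ} (π : B →⋆ₐ[ℂ] Matrix (Fin N) (Fin N) ℂ) :
    ∃ (ι : Type) (_ : Fintype ι) (_ : DecidableEq ι) (l : ι → Fin (D.depth + 1))
      (z : ∀ i, D.X (l i)) (V : ∀ i, Matrix (Fin N) (Fin (D.r (l i))) ℂ),
      (∀ i, z i ∉ D.Ω (l i)) ∧ D.Decomposes π l z V ∧
      ∀ m : ℕ, (∀ b, (∀ k : Fin (D.depth + 1), k.val < m → D.component k b = 0) → π b = 0) →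
        ∀ i, (l i).val < m := by
  obtain ⟨ι, h1, h2, l, z, V, hz, hV1, horth, -, hcomp, hint, hlev⟩ :=
    exists_decomposition_aux (D := D) π _ ⊤ le_rfl fun _ _ _ => Submodule.mem_top
  refine ⟨ι, h1, h2, l, z, V, hz, ⟨hV1, horth, ?_, hint⟩, fun m hm => hlev m fun b hb v _ => by
    rw [hm b hb, Matrix.zero_mulVec]⟩
  refine Matrix.ext_of_mulVec_single fun a => ?_
  rw [hcomp _ Submodule.mem_top, Matrix.one_mulVec]

end RSHDecomposition

end

noncomputable section


set_option linter.unusedSectionVars false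

section Unitary

open scoped Pointwise in
theorem exists_norm_one_smul_joined {N : ℕ} (u : unitary (Mat N ℂ)) :
    ∃ c : ℂ, star c * c = 1 ∧ ∃ v : unitary (Mat N ℂ), (v : Mat N ℂ) = c • (u : Mat N ℂ) ∧
      Joined 1 v := by
  have hfin : (spectrum ℂ (u : Mat N ℂ)).Finite := by
    have h := Matrix.finite_spectrum (R := ℂ) (CStarMatrix.ofMatrixStarAlgEquiv.symm (u : Mat N ℂ))
    rwa [AlgEquiv.spectrum_eq] at h
  have hinf : (Metric.sphere (0 : ℂ) 1).Infinite := by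
    refine IsPreconnected.infinite_of_nontrivial
      (isPreconnected_sphere (E := ℂ) (by rw [Complex.rank_real_complex]; norm_num) 0 1) ?_
    exact ⟨1, by simp, -1, by simp, by norm_num⟩
  obtain ⟨c, hc, hc'⟩ := hinf.exists_notMem_finite (hfin.image fun s => -s⁻¹)
  have hc1 : star c * c = 1 := by
    rw [mem_sphere_zero_iff_norm] at hc
    rw [Complex.star_def, ← Complex.normSq_eq_conj_mul_self, Complex.normSq_eq_norm_sq, hc]
    norm_num
  have hc0 : c ≠ 0 := by rintro rfl; simp at hc1
  have hv : c • (u : Mat N ℂ) ∈ unitary (Mat N ℂ) := by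
    have h1 := Unitary.star_mul_self_of_mem u.2
    have h2 := Unitary.mul_star_self_of_mem u.2
    rw [Unitary.mem_iff, star_smul, smul_mul_smul_comm, smul_mul_smul_comm, h1, h2, mul_comm c,
      hc1, one_smul]
    exact ⟨rfl, rfl⟩
  refine ⟨c, hc1, ⟨_, hv⟩, rfl, Unitary.joined _ _ ?_⟩
  refine (Unitary.norm_sub_one_lt_two_iff hv).2 fun hmem => hc' ?_
  have h1 := (spectrum.unit_smul_eq_smul (u : Mat N ℂ) (Units.mk0 c hc0))
  have h2 : (-1 : ℂ) ∈ (Units.mk0 c hc0) • spectrum ℂ (u : Mat N ℂ) := by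
    rw [← h1]; exact hmem
  obtain ⟨s, hs, hs'⟩ := h2
  refine ⟨s, hs, ?_⟩
  have hs'' : c * s = -1 := hs'
  have hs0 : s ≠ 0 := by rintro rfl; simp at hs''
  field_simp
  linear_combination -hs''

end Unitary

section Conj

variable {B : Type u} [CStarAlgebra B] {D : RSHDecomposition.{u, v, w} B} {F : Finset B} {η : ℝ}
variable {N : ℕ} (hN : 0 < N)

/-- Unitary conjugates of a representation are connected. -/
theorem BridgePath.conj (hη : 0 < η) (π : B → Mat N ℂ)
    (h : ∀ u : unitary (Mat N ℂ), Realizable D F η fun b =>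
      UHF.ofMat hN ((u : Mat N ℂ) * π b * star (u : Mat N ℂ))) (u : unitary (Mat N ℂ)) :
    BridgePath D F η (fun b => UHF.ofMat hN (π b))
      fun b => UHF.ofMat hN ((u : Mat N ℂ) * π b * star (u : Mat N ℂ)) := by
  obtain ⟨c, hc, v, hv, ⟨γ⟩⟩ := exists_norm_one_smul_joined u
  have hcont : ∀ b, Continuous fun t => UHF.ofMat hN ((γ t : Mat N ℂ) * π b * star (γ t : Mat N ℂ)) := by
    intro b
    have h1 : Continuous fun t => (γ t : Mat N ℂ) := continuous_subtype_val.comp γ.continuous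
    have h2 : Continuous (UHF.ofMat hN) := AddMonoidHomClass.continuous_of_bound (UHF.ofMat hN) 1 fun x =>
      (NonUnitalStarAlgHom.norm_apply_le (UHF.ofMat hN) x).trans_eq (one_mul _).symm
    exact h2.comp ((h1.mul continuous_const).mul h1.star)
  let P (s t : unitInterval) : Prop := BridgePath D F η
    (fun b => UHF.ofMat hN ((γ s : Mat N ℂ) * π b * star (γ s : Mat N ℂ)))
    fun b => UHF.ofMat hN ((γ t : Mat N ℂ) * π b * star (γ t : Mat N ℂ))
  have : Std.Symm P := ⟨fun _ _ h => h.symm⟩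
  have hP : P 0 1 := by
    refine PreconnectedSpace.induction₂ P (fun s => ?_) ⟨fun _ _ _ h h' => h.trans h'⟩ 0 1
    have h1 : ∀ᶠ t in 𝓝 s, ∀ b ∈ F, ‖UHF.ofMat hN ((γ s : Mat N ℂ) * π b * star (γ s : Mat N ℂ)) -
        UHF.ofMat hN ((γ t : Mat N ℂ) * π b * star (γ t : Mat N ℂ))‖ < η := by
      rw [Finset.eventually_all]
      intro b _
      have h2 := ((hcont b).tendsto s).eventually (Metric.ball_mem_nhds _ hη)
      filter_upwards [h2] with t ht
      rw [← dist_eq_norm, dist_comm]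
      exact ht
    filter_upwards [h1] with t ht
    exact Relation.ReflTransGen.single ⟨h _, h _, ht⟩
  have h0 : ∀ b, (γ 0 : Mat N ℂ) * π b * star (γ 0 : Mat N ℂ) = π b := fun b => by
    rw [γ.source]
    change 1 * π b * star 1 = π b
    rw [star_one, one_mul, mul_one]
  have h1 : ∀ b, (γ 1 : Mat N ℂ) * π b * star (γ 1 : Mat N ℂ) =
      (u : Mat N ℂ) * π b * star (u : Mat N ℂ) := fun b => by
    rw [γ.target, hv, star_smul, smul_mul_assoc, smul_mul_smul_comm, mul_comm c, hc, one_smul]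
  simpa only [P, h0, h1] using hP

end Conj

/-- The representation of a direct sum of matrix algebras given by a family of isometries with
orthogonal ranges summing up to the whole space. -/
def conjSum {ι : Type} [Fintype ι] {N : ℕ} {s : ι → ℕ} (V : ∀ i, Matrix (Fin N) (Fin (s i)) ℂ)
    (hV : ∀ i, (V i)ᴴ * V i = 1) (horth : ∀ i j, i ≠ j → (V i)ᴴ * V j = 0)
    (hcomp : ∑ i, V i * (V i)ᴴ = 1) :
    (∀ i, Matrix (Fin (s i)) (Fin (s i)) ℂ) →⋆ₐ[ℂ] Matrix (Fin N) (Fin N) ℂ where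
  toFun a := ∑ i, V i * a i * (V i)ᴴ
  map_one' := by simpa using hcomp
  map_mul' a b := by
    rw [Finset.sum_mul_sum]
    refine Finset.sum_congr rfl fun i _ => ?_
    rw [Finset.sum_eq_single i]
    · calc _ = V i * a i * (1 : Matrix (Fin (s i)) (Fin (s i)) ℂ) * b i * (V i)ᴴ := by
            simp [Matrix.mul_assoc]
        _ = V i * a i * ((V i)ᴴ * V i) * b i * (V i)ᴴ := by rw [hV]
        _ = _ := by simp only [Matrix.mul_assoc]
    · intro j _ hj
      calc _ = V i * a i * ((V i)ᴴ * V j) * b j * (V j)ᴴ := by simp only [Matrix.mul_assoc]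
        _ = 0 := by rw [horth i j hj.symm]; simp
    · simp
  map_zero' := by simp
  map_add' a b := by simp [Matrix.mul_add, Matrix.add_mul, Finset.sum_add_distrib]
  commutes' c := by
    rw [Algebra.algebraMap_eq_smul_one, Algebra.algebraMap_eq_smul_one, ← hcomp, Finset.smul_sum]
    refine Finset.sum_congr rfl fun i _ => ?_
    simp
  map_star' a := by
    rw [star_sum]
    refine Finset.sum_congr rfl fun i _ => ?_
    simp [Matrix.star_eq_conjTranspose, Matrix.mul_assoc]

section ConjSum

variable {ι : Type} [Fintype ι] {N : ℕ} {s : ι → ℕ} (V : ∀ i, Matrix (Fin N) (Fin (s i)) ℂ)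
    (hV : ∀ i, (V i)ᴴ * V i = 1) (horth : ∀ i j, i ≠ j → (V i)ᴴ * V j = 0)
    (hcomp : ∑ i, V i * (V i)ᴴ = 1)

theorem conjSum_apply (a : ∀ i, Matrix (Fin (s i)) (Fin (s i)) ℂ) :
    conjSum V hV horth hcomp a = ∑ i, V i * a i * (V i)ᴴ := rfl

theorem conjSum_mul (a : ∀ i, Matrix (Fin (s i)) (Fin (s i)) ℂ) (i : ι) :
    conjSum V hV horth hcomp a * V i = V i * a i := by
  rw [conjSum_apply, Matrix.sum_mul, Finset.sum_eq_single i]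
  · rw [Matrix.mul_assoc, hV, Matrix.mul_one]
  · intro j _ hj
    rw [Matrix.mul_assoc, horth j i hj, Matrix.mul_zero]
  · simp

theorem conjSum_injective : Function.Injective (conjSum V hV horth hcomp) := by
  intro a b hab
  funext i
  have h1 := congrArg (fun x => (V i)ᴴ * (x * V i)) hab
  simpa only [conjSum_mul, ← Matrix.mul_assoc, hV, Matrix.one_mul] using h1

end ConjSum

theorem sum_mul_card_eq {ι : Type} [Fintype ι] {N : ℕ} {s : ι → ℕ}
    {V : ∀ i, Matrix (Fin N) (Fin (s i)) ℂ}
    (hV : ∀ i, (V i)ᴴ * V i = 1) (hcomp : ∑ i, V i * (V i)ᴴ = 1) : ∑ i, s i = N := by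
  have h := congrArg Matrix.trace hcomp
  rw [Matrix.trace_sum, Matrix.trace_one, Fintype.card_fin] at h
  have h2 : ∀ i, (V i * (V i)ᴴ).trace = s i := fun i => by
    rw [Matrix.trace_mul_comm, hV, Matrix.trace_one, Fintype.card_fin]
  simp only [h2] at h
  exact_mod_cast h

/-- Isometries onto consecutive blocks. -/
theorem exists_isometries {ι : Type} [Fintype ι] [DecidableEq ι] {N : ℕ} {s : ι → ℕ}
    (h : ∑ i, s i = N) : ∃ V : ∀ i, Matrix (Fin N) (Fin (s i)) ℂ, (∀ i, (V i)ᴴ * V i = 1) ∧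
      (∀ i j, i ≠ j → (V i)ᴴ * V j = 0) ∧ ∑ i, V i * (V i)ᴴ = 1 := by
  have hc : Fintype.card (Σ i, Fin (s i)) = Fintype.card (Fin N) := by simp [h]
  let e : (Σ i, Fin (s i)) ≃ Fin N := Fintype.equivOfCardEq hc
  let V : ∀ i, Matrix (Fin N) (Fin (s i)) ℂ := fun i =>
    Matrix.of fun n a => if e ⟨i, a⟩ = n then 1 else 0
  have hVV : ∀ i j a b, ((V i)ᴴ * V j) a b = if (⟨i, a⟩ : Σ i, Fin (s i)) = ⟨j, b⟩ then 1 else 0 := by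
    intro i j a b
    have h1 : ((V i)ᴴ * V j) a b = if e ⟨i, a⟩ = e ⟨j, b⟩ then 1 else 0 := by
      simp [V, Matrix.mul_apply, Matrix.conjTranspose_apply]
    rw [h1]
    exact if_congr e.apply_eq_iff_eq rfl rfl
  refine ⟨V, fun i => ?_, fun i j hij => ?_, ?_⟩
  · ext a b
    rw [hVV, Matrix.one_apply]
    simp
  · ext a b
    rw [hVV, if_neg (fun h => hij (congrArg Sigma.fst h))]
    rfl
  · ext n n'
    rw [Matrix.sum_apply, Matrix.one_apply]
    have h1 : ∀ i, (V i * (V i)ᴴ) n n' = ∑ a : Fin (s i), if e ⟨i, a⟩ = n ∧ e ⟨i, a⟩ = n' then 1 else 0 := by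
      intro i
      rw [Matrix.mul_apply]
      refine Finset.sum_congr rfl fun a _ => ?_
      simp only [V, Matrix.conjTranspose_apply, Matrix.of_apply]
      split_ifs <;> first | (simp; done) | grind
    simp only [h1]
    rw [← Fintype.sum_sigma (f := fun x : Σ i, Fin (s i) => if e x = n ∧ e x = n' then (1 : ℂ) else 0),
      e.sum_comp (fun x => if x = n ∧ x = n' then (1 : ℂ) else 0)]
    by_cases hn : n = n'
    · subst hn; simp
    · rw [if_neg hn]
      refine Finset.sum_eq_zero fun x _ => if_neg ?_
      rintro ⟨rfl, h⟩; exact hn h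

end

noncomputable section


set_option linter.unusedSectionVars false

/-- The homomorphism reading off the summands with labels `q i`. -/
def slotHom {L : Type} {r : L → ℕ} {ι' : L → Type} {ι : Type} (l : ι → L) (q : ∀ i, ι' (l i)) :
    (∀ k, ι' k → Mat (r k) ℂ) →⋆ₐ[ℂ] ∀ i, Matrix (Fin (r (l i))) (Fin (r (l i))) ℂ where
  toFun a i := CStarMatrix.ofMatrix.symm (a (l i) (q i))
  map_one' := rfl
  map_mul' _ _ := rfl
  map_zero' := rfl
  map_add' _ _ := rfl
  commutes' _ := rfl
  map_star' _ := rfl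

theorem slotHom_injective {L : Type} {r : L → ℕ} {ι' : L → Type} {ι : Type} {l : ι → L}
    {q : ∀ i, ι' (l i)} (hq : ∀ k j, ∃ i, (⟨l i, q i⟩ : Σ k, ι' k) = ⟨k, j⟩) :
    Function.Injective (slotHom (r := r) l q) := by
  intro a b hab
  funext k j
  obtain ⟨i, hi⟩ := hq k j
  have h1 : ∀ s : Σ k, ι' k, (⟨l i, q i⟩ : Σ k, ι' k) = s → a s.1 s.2 = b s.1 s.2 := by
    rintro _ rfl
    exact congrFun hab i
  exact h1 _ hi

theorem UHF.one_ne_zero : (1 : UHF) ≠ 0 := fun h => by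
  have := UHF.trace_one
  rw [h, map_zero] at this
  exact zero_ne_one this

namespace RSHDecomposition

variable {B : Type u} [CStarAlgebra B] {D : RSHDecomposition.{u, v, w} B}

/-- A finite family of points is indexed, without repetitions, by finite types over the levels. -/
theorem exists_distinct_points {ι : Type} [Fintype ι] (l : ι → Fin (D.depth + 1))
    (z : ∀ i, D.X (l i)) : ∃ (ι' : Fin (D.depth + 1) → Type) (_ : ∀ k, Fintype (ι' k))
      (_ : ∀ k, DecidableEq (ι' k)) (x : ∀ k, ι' k → D.X k) (q : ∀ i, ι' (l i)),
      (∀ k, Function.Injective (x k)) ∧ (∀ i, x (l i) (q i) = z i) ∧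
      ∀ k j, ∃ i, (⟨l i, q i⟩ : Σ k, ι' k) = ⟨k, j⟩ := by
  classical
  let p₀ : ι → Σ k, D.X k := fun i => ⟨l i, z i⟩
  have hfin : Fintype (Set.range p₀) := (Set.finite_range p₀).fintype
  let e : Set.range p₀ ≃ Fin (Fintype.card (Set.range p₀)) := Fintype.equivFin _
  let p : Fin (Fintype.card (Set.range p₀)) → Σ k, D.X k := fun q => (e.symm q).1
  have hp : Function.Injective p := Subtype.val_injective.comp e.symm.injective
  let ι' : Fin (D.depth + 1) → Type := fun k => {q // (p q).1 = k}
  let x : ∀ k, ι' k → D.X k := fun k q => q.2 ▸ (p q.1).2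
  have hx : ∀ k (q : ι' k), (⟨k, x k q⟩ : Σ k, D.X k) = p q.1 := by
    rintro _ ⟨q, rfl⟩
    rfl
  let c : ι → Fin (Fintype.card (Set.range p₀)) := fun i => e ⟨p₀ i, Set.mem_range_self i⟩
  have hc : ∀ i, p (c i) = p₀ i := fun i => by simp [p, c]
  let q : ∀ i, ι' (l i) := fun i => ⟨c i, by rw [hc i]⟩
  refine ⟨ι', fun k => inferInstance, fun k => inferInstance, x, q, fun k j j' hj => ?_,
    fun i => ?_, fun k j => ?_⟩
  · refine Subtype.ext (hp ?_)
    rw [← hx, ← hx, hj]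
  · have h1 : (⟨l i, x (l i) (q i)⟩ : Σ k, D.X k) = ⟨l i, z i⟩ := (hx _ _).trans (hc i)
    exact eq_of_heq (Sigma.mk.inj h1).2
  · obtain ⟨j, rfl⟩ := j
    obtain ⟨i, hi⟩ := (e.symm j).2
    have hij : c i = j := hp ((hc i).trans hi)
    refine ⟨i, ?_⟩
    subst hij
    have h2 : l i = (p (c i)).1 := by rw [hc i]
    have h3 : ∀ k k' (_ : k = k') (h : (p (c i)).1 = k) (h' : (p (c i)).1 = k'),
        (⟨k, ⟨c i, h⟩⟩ : Σ k, ι' k) = ⟨k', ⟨c i, h'⟩⟩ := by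
      rintro k _ rfl _ _
      rfl
    exact h3 _ _ h2 _ _

theorem Decomposes.apply_eq {N : ℕ} {π : B →⋆ₐ[ℂ] Matrix (Fin N) (Fin N) ℂ} {ι : Type} [Fintype ι]
    {l : ι → Fin (D.depth + 1)} {z : ∀ i, D.X (l i)} {V : ∀ i, Matrix (Fin N) (Fin (D.r (l i))) ℂ}
    (h : D.Decomposes π l z V) (b : B) :
    π b = conjSum V h.isometry h.orth h.complete fun i => D.evalMatrix (l i) (z i) b := by
  rw [conjSum_apply]
  calc π b = π b * ∑ i, V i * (V i)ᴴ := by rw [h.complete, mul_one]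
    _ = _ := by
      rw [Matrix.mul_sum]
      refine Finset.sum_congr rfl fun i _ => ?_
      rw [← Matrix.mul_assoc, h.intertwine]

/-- The map to `𝒬` of a finite-dimensional representation. -/
def repMap {N : ℕ} (hN : 0 < N) (π : B →⋆ₐ[ℂ] Matrix (Fin N) (Fin N) ℂ) (b : B) : UHF :=
  UHF.ofMat hN (CStarMatrix.ofMatrix (π b))

variable {F : Finset B} {η : ℝ}

/-- Excisors for finite-dimensional representations, supported at finitely many points. -/
theorem exists_weightedExcisor (hη : 0 < η) {N : ℕ} (hN : 0 < N)
    (π : B →⋆ₐ[ℂ] Matrix (Fin N) (Fin N) ℂ) :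
    ∃ e : WeightedExcisor D F η, e.Compatible ∧
      Function.Surjective (fun (b : B) (k : Fin (D.depth + 1)) => e.ρ k b) ∧
      ∃ i : (∀ k, e.E k) →⋆ₐ[ℂ] Mat N ℂ, Function.Injective i ∧
        (∀ b, i (fun k => e.ρ k b) = CStarMatrix.ofMatrix (π b)) ∧ ∀ a, e.κ a = UHF.ofMat hN (i a) := by
  obtain ⟨ι, _, _, l, z, V, hz, hdec, -⟩ := exists_decomposition (D := D) π
  obtain ⟨ι', _, _, x, q, hx, hxz, hq⟩ := exists_distinct_points l z
  have hxΩ : ∀ k j, x k j ∉ D.Ω k := by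
    intro k j
    obtain ⟨i, hi⟩ := hq k j
    have h1 : ∀ s : Σ k, ι' k, (⟨l i, q i⟩ : Σ k, ι' k) = s → x s.1 s.2 ∉ D.Ω s.1 := by
      rintro _ rfl
      rw [hxz]
      exact hz i
    exact h1 _ hi
  obtain ⟨y, hy⟩ := D.exists_isExcisionRow (F := F) (ι := ι') (x := x) (K := fun l i => {x l i}) hη
    (fun k j => isClosed_singleton) (fun k j => Set.singleton_subset_iff.2 (hxΩ k j))
    (fun k i j hij => Set.disjoint_singleton.2 fun h => hij (hx k h))
    (fun k j z' hz' b _ => by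
      rw [Set.mem_singleton_iff.1 hz']
      change ‖D.component k b (x k j) - D.component k b (x k j)‖ < η
      rwa [sub_self, norm_zero])
  let i : (∀ k, ι' k → Mat (D.r k) ℂ) →⋆ₐ[ℂ] Mat N ℂ :=
    (CStarMatrix.ofMatrixStarAlgEquiv.toStarAlgHom).comp
      ((conjSum V hdec.isometry hdec.orth hdec.complete).comp (slotHom l q))
  refine ⟨WeightedExcisor.ofRow hη hy (fun l i => Set.singleton_nonempty _) (.one _)
    UHF.one_ne_zero ((UHF.ofMat hN).comp i), WeightedExcisor.ofRow_compatible _ _ _ _ _ _ hxΩ,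
    fun a => ⟨excisionMap y a, ?_⟩, i, ?_, fun b => ?_, fun a => rfl⟩
  · funext k j
    exact eval_rowMap hy k j (Set.mem_singleton _) a
  · exact CStarMatrix.ofMatrixStarAlgEquiv.injective.comp
      ((conjSum_injective V hdec.isometry hdec.orth hdec.complete).comp (slotHom_injective hq))
  · rw [hdec.apply_eq]
    refine congrArg (fun a => CStarMatrix.ofMatrix (conjSum V hdec.isometry hdec.orth
      hdec.complete a)) (funext fun i => ?_)
    rw [← hxz i]
    rfl

theorem realizable_repMap (hη : 0 < η) {N : ℕ} (hN : 0 < N)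
    (π : B →⋆ₐ[ℂ] Matrix (Fin N) (Fin N) ℂ) : Realizable D F η (repMap hN π) := by
  obtain ⟨e, he, -, i, -, hi, hκ⟩ := exists_weightedExcisor (D := D) (F := F) hη hN π
  exact ⟨e, he, funext fun b => (hκ _).trans (congrArg _ (hi b))⟩

/-- In a connected decomposition, evaluations at points of the same base space are connected. -/
theorem Connected.bridgePath (hconn : D.Connected F η) (hη : 0 < η) (l : Fin (D.depth + 1))
    (x y : D.X l) : BridgePath D F η (repMap (D.r_pos l) (D.evalMatrix l x))
      (repMap (D.r_pos l) (D.evalMatrix l y)) := by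
  obtain ⟨e, he, hes, i, hii, hi, hκ⟩ :=
    exists_weightedExcisor (D := D) (F := F) hη (D.r_pos l) (D.evalMatrix l x)
  obtain ⟨e', he', hes', i', hii', hi', hκ'⟩ :=
    exists_weightedExcisor (D := D) (F := F) hη (D.r_pos l) (D.evalMatrix l y)
  have h := (hconn l x y e e' he he' ⟨hes, i, UHF.ofMat (D.r_pos l), hii, hi, hκ⟩
    ⟨hes', i', UHF.ofMat (D.r_pos l), hii', hi', hκ'⟩).path
  have h1 : e.κρ = repMap (D.r_pos l) (D.evalMatrix l x) :=
    funext fun b => (hκ _).trans (congrArg _ (hi b))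
  have h2 : e'.κρ = repMap (D.r_pos l) (D.evalMatrix l y) :=
    funext fun b => (hκ' _).trans (congrArg _ (hi' b))
  rwa [h1, h2] at h

end RSHDecomposition

end

noncomputable section


set_option linter.unusedSectionVars false

/-- The direct sum of representations, along isometries with orthogonal ranges summing up to the
whole space. -/
def sumRep {B : Type u} [CStarAlgebra B] {ι : Type} [Fintype ι] {N : ℕ} {s : ι → ℕ}
    (V : ∀ i, Matrix (Fin N) (Fin (s i)) ℂ) (hV : ∀ i, (V i)ᴴ * V i = 1)
    (horth : ∀ i j, i ≠ j → (V i)ᴴ * V j = 0) (hcomp : ∑ i, V i * (V i)ᴴ = 1)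
    (π : ∀ i, B →⋆ₐ[ℂ] Matrix (Fin (s i)) (Fin (s i)) ℂ) : B →⋆ₐ[ℂ] Matrix (Fin N) (Fin N) ℂ where
  toFun b := conjSum V hV horth hcomp fun i => π i b
  map_one' := (congrArg _ (funext fun i => map_one (π i))).trans (map_one _)
  map_mul' a b := (congrArg _ (funext fun i => map_mul (π i) a b)).trans (map_mul _ _ _)
  map_zero' := (congrArg _ (funext fun i => map_zero (π i))).trans (map_zero _)
  map_add' a b := (congrArg _ (funext fun i => map_add (π i) a b)).trans (map_add _ _ _)
  commutes' c := (congrArg _ (funext fun i => (π i).commutes' c)).trans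
    ((conjSum V hV horth hcomp).commutes' c)
  map_star' a := (congrArg _ (funext fun i => map_star (π i) a)).trans (map_star _ _)

namespace RSHDecomposition

variable {B : Type u} [CStarAlgebra B] {D : RSHDecomposition.{u, v, w} B}

section Sum

variable {ι : Type} [Fintype ι] {N : ℕ} {s : ι → ℕ} (V : ∀ i, Matrix (Fin N) (Fin (s i)) ℂ)
  (hV : ∀ i, (V i)ᴴ * V i = 1) (horth : ∀ i j, i ≠ j → (V i)ᴴ * V j = 0)
  (hcomp : ∑ i, V i * (V i)ᴴ = 1) (π : ∀ i, B →⋆ₐ[ℂ] Matrix (Fin (s i)) (Fin (s i)) ℂ)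

theorem sumRep_mul (b : B) (i : ι) :
    sumRep V hV horth hcomp π b * V i = V i * π i b :=
  conjSum_mul V hV horth hcomp _ i

theorem repMap_sumRep (hN : 0 < N) (hs : ∀ i, 0 < s i) (b : B) :
    repMap hN (sumRep V hV horth hcomp π) b =
      ∑ i, UHF.compress (hs i) (V i) (hV i) (repMap (hs i) (π i) b) := by
  have h1 : ∀ i, UHF.compress (hs i) (V i) (hV i) (repMap (hs i) (π i) b) =
      UHF.ofMat hN (CStarMatrix.ofMatrix (V i * π i b * (V i)ᴴ)) := fun i =>
    UHF.compress_ofMat (hs i) (V i) (hV i) hN _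
  simp only [h1]
  rw [← map_sum]
  refine congrArg (UHF.ofMat hN) ?_
  exact map_sum CStarMatrix.ofMatrixStarAlgEquiv (fun i => V i * π i b * (V i)ᴴ) Finset.univ

theorem sum_compress_one (hcomp : ∑ i, V i * (V i)ᴴ = 1) (hN : 0 < N) (hs : ∀ i, 0 < s i) :
    ∑ i, UHF.compress (hs i) (V i) (hV i) 1 = 1 := by
  have h1 : ∀ i, UHF.compress (hs i) (V i) (hV i) 1 =
      UHF.ofMat hN (CStarMatrix.ofMatrix (V i * (V i)ᴴ)) := fun i => by
    rw [← map_one (UHF.ofMat (hs i)), UHF.compress_ofMat (hs i) (V i) (hV i) hN]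
    refine congrArg (fun a => UHF.ofMat hN (CStarMatrix.ofMatrix (a * (V i)ᴴ))) ?_
    exact Matrix.mul_one _
  simp only [h1]
  rw [← map_sum, ← map_one (UHF.ofMat hN)]
  refine congrArg (UHF.ofMat hN) ?_
  exact (map_sum CStarMatrix.ofMatrixStarAlgEquiv (fun i => V i * (V i)ᴴ) Finset.univ).symm.trans
    (congrArg CStarMatrix.ofMatrixStarAlgEquiv hcomp)

variable {F : Finset B} {η : ℝ}

theorem bridgePath_sumRep (hη : 0 < η) (hN : 0 < N) (hs : ∀ i, 0 < s i)
    (π' : ∀ i, B →⋆ₐ[ℂ] Matrix (Fin (s i)) (Fin (s i)) ℂ)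
    (h : ∀ i, BridgePath D F η (repMap (hs i) (π i)) (repMap (hs i) (π' i))) :
    BridgePath D F η (repMap hN (sumRep V hV horth hcomp π))
      (repMap hN (sumRep V hV horth hcomp π')) := by
  have h1 := BridgePath.sum (fun i => UHF.compress (hs i) (V i) (hV i)) hη
    (fun i => UHF.compress_injective (hs i) (V i) (hV i))
    (fun i j hij x y => UHF.compress_mul_compress (hs i) (V i) (hV i) (hs j) (V j) (hV j)
      (horth i j hij) x y) (sum_compress_one V hV hcomp hN hs)
    (fun i => realizable_repMap hη (hs i) (π i)) h
  have h2 : ∀ ρ : ∀ i, B →⋆ₐ[ℂ] Matrix (Fin (s i)) (Fin (s i)) ℂ,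
      repMap hN (sumRep V hV horth hcomp ρ) = fun b =>
        ∑ i, UHF.compress (hs i) (V i) (hV i) (repMap (hs i) (ρ i) b) := fun ρ =>
    funext fun b => repMap_sumRep V hV horth hcomp ρ hN hs b
  rwa [h2, h2]

end Sum

theorem Decomposes.eq_sumRep {N : ℕ} {π : B →⋆ₐ[ℂ] Matrix (Fin N) (Fin N) ℂ} {ι : Type} [Fintype ι]
    {l : ι → Fin (D.depth + 1)} {z : ∀ i, D.X (l i)} {V : ∀ i, Matrix (Fin N) (Fin (D.r (l i))) ℂ}
    (h : D.Decomposes π l z V) :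
    π = sumRep V h.isometry h.orth h.complete fun i => D.evalMatrix (l i) (z i) :=
  StarAlgHom.ext h.apply_eq

theorem decomposes_sumRep {N : ℕ} {ι : Type} [Fintype ι]
    (l : ι → Fin (D.depth + 1)) (z : ∀ i, D.X (l i)) {V : ∀ i, Matrix (Fin N) (Fin (D.r (l i))) ℂ}
    (hV : ∀ i, (V i)ᴴ * V i = 1) (horth : ∀ i j, i ≠ j → (V i)ᴴ * V j = 0)
    (hcomp : ∑ i, V i * (V i)ᴴ = 1) :
    D.Decomposes (sumRep V hV horth hcomp fun i => D.evalMatrix (l i) (z i)) l z V :=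
  ⟨hV, horth, hcomp, fun i b => sumRep_mul V hV horth hcomp _ b i⟩

/-- The representation `π` is a direct sum of point evaluations, `c k` of which are at points
of `X_k`, for all `k`. -/
def HasType (D : RSHDecomposition.{u, v, w} B) {N : ℕ} (π : B →⋆ₐ[ℂ] Matrix (Fin N) (Fin N) ℂ)
    (c : Fin (D.depth + 1) → ℕ) : Prop :=
  ∃ (ι : Type) (_ : Fintype ι) (l : ι → Fin (D.depth + 1)) (z : ∀ i, D.X (l i))
    (V : ∀ i, Matrix (Fin N) (Fin (D.r (l i))) ℂ), D.Decomposes π l z V ∧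
      ∀ k, (∑ i, if l i = k then 1 else 0) = c k

theorem sum_mul_r {ι : Type} [Fintype ι] {l : ι → Fin (D.depth + 1)} {c : Fin (D.depth + 1) → ℕ}
    (h : ∀ k, (∑ i, if l i = k then 1 else 0) = c k) : ∑ k, c k * D.r k = ∑ i, D.r (l i) := by
  simp only [← h, Finset.sum_mul]
  rw [Finset.sum_comm]
  refine Finset.sum_congr rfl fun i _ => ?_
  simp

theorem HasType.dim {N : ℕ} {π : B →⋆ₐ[ℂ] Matrix (Fin N) (Fin N) ℂ} {c : Fin (D.depth + 1) → ℕ}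
    (h : D.HasType π c) : ∑ k, c k * D.r k = N := by
  obtain ⟨ι, _, l, z, V, hdec, hc⟩ := h
  rw [sum_mul_r hc]
  exact sum_mul_card_eq hdec.isometry hdec.complete

theorem exists_hasType [∀ k, Nonempty (D.X k)] (c : Fin (D.depth + 1) → ℕ) {N : ℕ}
    (h : ∑ k, c k * D.r k = N) : ∃ π : B →⋆ₐ[ℂ] Matrix (Fin N) (Fin N) ℂ, D.HasType π c := by
  have hc : ∀ k, (∑ i : Σ k, Fin (c k), if i.1 = k then 1 else 0) = c k := fun k => by
    rw [Fintype.sum_sigma, Finset.sum_eq_single k]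
    · simp
    · intro j _ hj
      exact Finset.sum_eq_zero fun i _ => if_neg hj
    · simp
  obtain ⟨V, hV, horth, hcomp⟩ := exists_isometries (s := fun i : Σ k, Fin (c k) => D.r i.1)
    ((sum_mul_r (l := fun i : Σ k, Fin (c k) => i.1) hc).symm.trans h)
  exact ⟨_, _, _, fun i : Σ k, Fin (c k) => i.1, fun i => Classical.arbitrary _, V,
    decomposes_sumRep _ _ hV horth hcomp, hc⟩

theorem hasType_sumRep {ι : Type} [Fintype ι] {N : ℕ} {s : ι → ℕ}
    (V : ∀ i, Matrix (Fin N) (Fin (s i)) ℂ)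
    (hV : ∀ i, (V i)ᴴ * V i = 1) (horth : ∀ i j, i ≠ j → (V i)ᴴ * V j = 0)
    (hcomp : ∑ i, V i * (V i)ᴴ = 1) {π : ∀ i, B →⋆ₐ[ℂ] Matrix (Fin (s i)) (Fin (s i)) ℂ}
    {c : ι → Fin (D.depth + 1) → ℕ} (h : ∀ i, D.HasType (π i) (c i)) :
    D.HasType (sumRep V hV horth hcomp π) (∑ i, c i) := by
  choose κ _ l z W hW hc using h
  refine ⟨Σ i, κ i, inferInstance, fun x => l x.1 x.2, fun x => z x.1 x.2,
    fun x => V x.1 * W x.1 x.2, ⟨?_, ?_, ?_, ?_⟩, fun k => ?_⟩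
  · rintro ⟨i, a⟩
    rw [Matrix.conjTranspose_mul, Matrix.mul_assoc, ← Matrix.mul_assoc _ (V i), hV, Matrix.one_mul,
      (hW i).isometry]
  · rintro ⟨i, a⟩ ⟨j, a'⟩ hij
    rw [Matrix.conjTranspose_mul, Matrix.mul_assoc, ← Matrix.mul_assoc _ (V j)]
    by_cases h : i = j
    · subst h
      rw [hV, Matrix.one_mul]
      exact (hW i).orth a a' fun h => hij (by rw [h])
    · rw [horth i j h, Matrix.zero_mul, Matrix.mul_zero]
  · rw [Fintype.sum_sigma, ← hcomp]
    refine Finset.sum_congr rfl fun i _ => ?_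
    have h1 : ∀ a, V i * W i a * (V i * W i a)ᴴ = V i * (W i a * (W i a)ᴴ) * (V i)ᴴ := fun a => by
      rw [Matrix.conjTranspose_mul]; simp only [Matrix.mul_assoc]
    simp only [h1]
    rw [← Matrix.sum_mul, ← Matrix.mul_sum, (hW i).complete, Matrix.mul_one]
  · rintro ⟨i, a⟩ b
    rw [← Matrix.mul_assoc, sumRep_mul, Matrix.mul_assoc, (hW i).intertwine, Matrix.mul_assoc]
  · rw [Fintype.sum_sigma, Finset.sum_apply]
    exact Finset.sum_congr rfl fun i _ => hc i k

theorem hasType_evalMatrix (l : Fin (D.depth + 1)) (z : D.X l) :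
    D.HasType (D.evalMatrix l z) (Pi.single l 1) := by
  refine ⟨Unit, inferInstance, fun _ => l, fun _ => z, fun _ => 1, ⟨?_, ?_, ?_, ?_⟩, fun k => ?_⟩
  · simp
  · exact fun i j h => (h rfl).elim
  · simp
  · exact fun i b => by rw [Matrix.mul_one, Matrix.one_mul]
  · simp [Pi.single_apply, eq_comm]

theorem exists_equiv_of_card {ι ι' L : Type} [Fintype ι] [Fintype ι'] [DecidableEq L]
    {l : ι → L} {l' : ι' → L}
    (h : ∀ k, (∑ i, if l i = k then 1 else 0) = ∑ i, if l' i = k then 1 else 0) :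
    ∃ e : ι ≃ ι', l = l' ∘ e := by
  have h1 : ∀ k, Nonempty ({i // l i = k} ≃ {i // l' i = k}) := fun k => by
    refine ⟨Fintype.equivOfCardEq ?_⟩
    rw [Fintype.card_subtype, Fintype.card_subtype, Finset.card_filter, Finset.card_filter]
    exact h k
  let f := fun k => (h1 k).some
  refine ⟨(Equiv.sigmaFiberEquiv l).symm.trans ((Equiv.sigmaCongrRight f).trans
    (Equiv.sigmaFiberEquiv l')), funext fun i => ?_⟩
  exact ((f (l i)) ⟨i, rfl⟩).2.symm

variable {F : Finset B} {η : ℝ}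

theorem bridgePath_of_decomposes (hconn : D.Connected F η) (hη : 0 < η) {N : ℕ} (hN : 0 < N)
    {π π' : B →⋆ₐ[ℂ] Matrix (Fin N) (Fin N) ℂ} {ι : Type} [Fintype ι]
    {l : ι → Fin (D.depth + 1)} {z z' : ∀ i, D.X (l i)}
    {V V' : ∀ i, Matrix (Fin N) (Fin (D.r (l i))) ℂ}
    (h : D.Decomposes π l z V) (h' : D.Decomposes π' l z' V') :
    BridgePath D F η (repMap hN π) (repMap hN π') := by
  let U : Matrix (Fin N) (Fin N) ℂ := ∑ i, V' i * (V i)ᴴ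
  have hUV : ∀ i, U * V i = V' i := fun i => by
    rw [Matrix.sum_mul, Finset.sum_eq_single i]
    · rw [Matrix.mul_assoc, h.isometry, Matrix.mul_one]
    · intro j _ hj
      rw [Matrix.mul_assoc, h.orth j i hj, Matrix.mul_zero]
    · simp
  have hU : U * Uᴴ = 1 := by
    rw [← h'.complete, Matrix.conjTranspose_sum, Matrix.mul_sum]
    refine Finset.sum_congr rfl fun i _ => ?_
    rw [Matrix.conjTranspose_mul, Matrix.conjTranspose_conjTranspose, ← Matrix.mul_assoc, hUV]
  have hU' : Uᴴ * U = 1 := mul_eq_one_comm.1 hU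
  let u : unitary (Mat N ℂ) := ⟨CStarMatrix.ofMatrix U, hU', hU⟩
  have h1 := BridgePath.conj (D := D) (F := F) hN hη (fun b => CStarMatrix.ofMatrix (π b)) (fun v => by
    let πv : B →⋆ₐ[ℂ] Matrix (Fin N) (Fin N) ℂ :=
      sumRep (ι := Unit) (s := fun _ => N) (fun _ => CStarMatrix.ofMatrix.symm (v : Mat N ℂ))
        (fun _ => v.2.1) (fun i j hij => (hij rfl).elim)
        ((Fintype.sum_unique _).trans v.2.2) fun _ => π
    have h2 : ∀ b, πv b = CStarMatrix.ofMatrix.symm (v : Mat N ℂ) * π b *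
        (CStarMatrix.ofMatrix.symm (v : Mat N ℂ))ᴴ := fun b =>
      Fintype.sum_unique fun _ : Unit => (CStarMatrix.ofMatrix.symm (v : Mat N ℂ) * π b *
        (CStarMatrix.ofMatrix.symm (v : Mat N ℂ))ᴴ : Matrix (Fin N) (Fin N) ℂ)
    have h3 := realizable_repMap (D := D) (F := F) hη hN πv
    have h4 : repMap hN πv = fun b => UHF.ofMat hN ((v : Mat N ℂ) * CStarMatrix.ofMatrix (π b) *
        star (v : Mat N ℂ)) := funext fun b => congrArg (UHF.ofMat hN) (h2 b)
    rwa [h4] at h3) u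
  have h2 : (fun b => UHF.ofMat hN ((u : Mat N ℂ) * CStarMatrix.ofMatrix (π b) *
      star (u : Mat N ℂ))) = repMap hN (sumRep V' h'.isometry h'.orth h'.complete
        fun i => D.evalMatrix (l i) (z i)) := by
    funext b
    refine congrArg (UHF.ofMat hN) ?_
    change U * π b * Uᴴ = conjSum V' h'.isometry h'.orth h'.complete _
    rw [h.apply_eq, conjSum_apply, conjSum_apply, Matrix.mul_sum, Matrix.sum_mul]
    refine Finset.sum_congr rfl fun i _ => ?_
    rw [← hUV, Matrix.conjTranspose_mul]
    simp only [Matrix.mul_assoc]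
  rw [h2] at h1
  refine BridgePath.trans h1 ?_
  have h3 := bridgePath_sumRep (D := D) (F := F) V' h'.isometry h'.orth h'.complete
    (fun i => D.evalMatrix (l i) (z i)) hη hN (fun i => D.r_pos (l i))
    (fun i => D.evalMatrix (l i) (z' i)) fun i => hconn.bridgePath hη (l i) (z i) (z' i)
  rwa [← h'.eq_sumRep] at h3

/-- Representations of the same type are connected. -/
theorem HasType.bridgePath (hconn : D.Connected F η) (hη : 0 < η) {N : ℕ} (hN : 0 < N)
    {π π' : B →⋆ₐ[ℂ] Matrix (Fin N) (Fin N) ℂ} {c : Fin (D.depth + 1) → ℕ}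
    (h : D.HasType π c) (h' : D.HasType π' c) : BridgePath D F η (repMap hN π) (repMap hN π') := by
  obtain ⟨ι, _, l, z, V, hdec, hc⟩ := h
  obtain ⟨ι', _, l', z', V', hdec', hc'⟩ := h'
  obtain ⟨e, rfl⟩ := exists_equiv_of_card fun k => (hc k).trans (hc' k).symm
  refine bridgePath_of_decomposes hconn hη hN hdec (z' := fun i => z' (e i))
    (V' := fun i => V' (e i)) ⟨fun i => hdec'.isometry _, fun i j hij => hdec'.orth _ _
      (e.injective.ne hij), ?_, fun i b => hdec'.intertwine _ b⟩
  rw [← hdec'.complete]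
  exact e.sum_comp fun i => V' i * (V' i)ᴴ

/-- The congruence on types generated by connectedness of representations. -/
def typeCon [∀ k, Nonempty (D.X k)] (hconn : D.Connected F η) (hη : 0 < η) :
    AddCon (Fin (D.depth + 1) → ℕ) where
  r c d := ∑ k, c k * D.r k = ∑ k, d k * D.r k ∧
    ∀ (N : ℕ) (hN : 0 < N) (π π' : B →⋆ₐ[ℂ] Matrix (Fin N) (Fin N) ℂ), D.HasType π c →
      D.HasType π' d → BridgePath D F η (repMap hN π) (repMap hN π')
  iseqv := by
    refine ⟨fun c => ⟨rfl, fun N hN π π' h h' => h.bridgePath hconn hη hN h'⟩,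
      fun {c d} h => ⟨h.1.symm, fun N hN π π' hπ hπ' => (h.2 N hN π' π hπ' hπ).symm⟩,
      fun {c d e} h h' => ⟨h.1.trans h'.1, fun N hN π π' hπ hπ' => ?_⟩⟩
    obtain ⟨π'', hπ''⟩ := D.exists_hasType d (h'.1.trans hπ'.dim)
    exact (h.2 N hN _ _ hπ hπ'').trans (h'.2 N hN _ _ hπ'' hπ')
  add' := by
    intro c d c' d' h h'
    have hzero : ∀ {c d : Fin (D.depth + 1) → ℕ}, ∑ k, c k * D.r k = 0 →
        ∑ k, c k * D.r k = ∑ k, d k * D.r k → c = 0 ∧ d = 0 := by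
      have h1 : ∀ {c : Fin (D.depth + 1) → ℕ}, ∑ k, c k * D.r k = 0 → c = 0 := fun {c} h => by
        funext k
        have h2 := (Finset.sum_eq_zero_iff.1 h) k (Finset.mem_univ k)
        exact (Nat.mul_eq_zero.1 h2).resolve_right (D.r_pos k).ne'
      intro c d h h'
      exact ⟨h1 h, h1 (h'.symm.trans h)⟩
    rcases Nat.eq_zero_or_pos (∑ k, c k * D.r k) with hc | hc
    · obtain ⟨rfl, rfl⟩ := hzero hc h.1
      rwa [zero_add, zero_add]
    rcases Nat.eq_zero_or_pos (∑ k, c' k * D.r k) with hc' | hc'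
    · obtain ⟨rfl, rfl⟩ := hzero hc' h'.1
      rwa [add_zero, add_zero]
    have hdim : ∀ c c' : Fin (D.depth + 1) → ℕ, ∑ k, (c + c') k * D.r k =
        ∑ k, c k * D.r k + ∑ k, c' k * D.r k := fun c c' => by
      rw [← Finset.sum_add_distrib]
      exact Finset.sum_congr rfl fun k _ => add_mul _ _ _
    refine ⟨by rw [hdim, hdim, h.1, h'.1], fun N hN π π' hπ hπ' => ?_⟩
    let C : Bool → Fin (D.depth + 1) → ℕ := fun b => cond b c c'
    let E : Bool → Fin (D.depth + 1) → ℕ := fun b => cond b d d'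
    have hCE : ∀ b, ∑ k, C b k * D.r k = ∑ k, E b k * D.r k := by
      rintro (_ | _)
      exacts [h'.1, h.1]
    have hpos : ∀ b, 0 < ∑ k, C b k * D.r k := by
      rintro (_ | _)
      exacts [hc', hc]
    have hC : ∑ b, C b = c + c' := by simp [C]
    have hE : ∑ b, E b = d + d' := by simp [E]
    obtain ⟨V, hV, horth, hcomp⟩ := exists_isometries (ι := Bool)
      (s := fun b => ∑ k, C b k * D.r k) (N := N) (by
        rw [← hπ.dim, hdim]; simp [C])
    choose ρ hρ using fun b => D.exists_hasType (C b) rfl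
    choose ρ' hρ' using fun b => D.exists_hasType (E b) (hCE b).symm
    have h1 : D.HasType (sumRep V hV horth hcomp ρ) (c + c') := hC ▸ hasType_sumRep V hV horth hcomp hρ
    have h2 : D.HasType (sumRep V hV horth hcomp ρ') (d + d') :=
      hE ▸ hasType_sumRep V hV horth hcomp hρ'
    refine (hπ.bridgePath hconn hη hN h1).trans (BridgePath.trans ?_ (h2.bridgePath hconn hη hN hπ'))
    refine bridgePath_sumRep V hV horth hcomp ρ hη hN hpos ρ' ?_
    rintro (_ | _)
    exacts [h'.2 _ _ _ _ (hρ _) (hρ' _), h.2 _ _ _ _ (hρ _) (hρ' _)]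

theorem typeCon_of_hasType [∀ k, Nonempty (D.X k)] (hconn : D.Connected F η) (hη : 0 < η) {N : ℕ}
    {π : B →⋆ₐ[ℂ] Matrix (Fin N) (Fin N) ℂ} {c d : Fin (D.depth + 1) → ℕ}
    (h : D.HasType π c) (h' : D.HasType π d) : typeCon hconn hη c d := by
  refine ⟨h.dim.trans h'.dim.symm, fun N' hN' π₁ π₂ h₁ h₂ => ?_⟩
  obtain rfl : N' = N := h₁.dim.symm.trans h.dim
  exact (h₁.bridgePath hconn hη hN' h).trans (h'.bridgePath hconn hη hN' h₂)

end RSHDecomposition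

end

noncomputable section


set_option linter.unusedSectionVars false

/-- Finitely many reals can be approximated by rationals in a `ℚ`-linear way. -/
theorem exists_rat_linearMap_approx {ι : Type*} [Finite ι] (w : ι → ℝ) {ε : ℝ} (hε : 0 < ε) :
    ∃ φ : ℝ →ₗ[ℚ] ℚ, ∀ i, |(φ (w i) : ℝ) - w i| < ε := by
  have := Fintype.ofFinite ι
  let V : Submodule ℚ ℝ := Submodule.span ℚ (Set.range w)
  have : Module.Finite ℚ V := Module.Finite.span_of_finite ℚ (Set.finite_range w)
  let b := Module.finBasis ℚ V
  let v : ι → V := fun i => ⟨w i, Submodule.subset_span (Set.mem_range_self i)⟩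
  let C : ℝ := 1 + ∑ i, ∑ j, |((b.repr (v i) j : ℚ) : ℝ)|
  have hC : 0 < C := by positivity
  have hq : ∀ j, ∃ q : ℚ, |(q : ℝ) - (b j : ℝ)| < ε / C := fun j => by
    obtain ⟨q, h1, h2⟩ := exists_rat_btwn (show (b j : ℝ) - ε / C < b j + ε / C by
      have := div_pos hε hC
      linarith)
    exact ⟨q, abs_lt.2 ⟨by linarith, by linarith⟩⟩
  choose q hq using hq
  obtain ⟨φ, hφ⟩ := LinearMap.exists_extend (b.constr ℚ q)
  refine ⟨φ, fun i => ?_⟩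
  have h1 : φ (w i) = ∑ j, b.repr (v i) j * q j := by
    have h2 := congrArg (fun f => f (v i)) hφ
    have h3 : φ (w i) = b.constr ℚ q (v i) := h2
    rw [h3, Module.Basis.constr_apply_fintype]
    simp [Module.Basis.equivFun_apply]
  have h2 : w i = ∑ j, (b.repr (v i) j : ℝ) * b j := by
    have h3 := congrArg (Subtype.val) (b.sum_repr (v i))
    rw [Submodule.coe_sum] at h3
    change _ = w i at h3
    rw [← h3]
    exact Finset.sum_congr rfl fun j _ => by simp [Rat.smul_def]
  have h3 : (φ (w i) : ℝ) - w i = ∑ j, (b.repr (v i) j : ℝ) * (q j - b j) := by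
    rw [h1]
    conv_lhs => rw [h2]
    push_cast
    rw [← Finset.sum_sub_distrib]
    exact Finset.sum_congr rfl fun j _ => by ring
  rw [h3]
  have h4 : ∑ j, |((b.repr (v i) j : ℚ) : ℝ)| < C := by
    have := Finset.single_le_sum (f := fun i => ∑ j, |((b.repr (v i) j : ℚ) : ℝ)|)
      (fun i _ => by positivity) (Finset.mem_univ i)
    simp only [C]
    linarith
  calc |∑ j, (b.repr (v i) j : ℝ) * (q j - b j)| ≤ ∑ j, |((b.repr (v i) j : ℚ) : ℝ)| * (ε / C) := by
        refine (Finset.abs_sum_le_sum_abs _ _).trans (Finset.sum_le_sum fun j _ => ?_)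
        rw [abs_mul]
        gcongr
        exact (hq j).le
    _ = (∑ j, |((b.repr (v i) j : ℚ) : ℝ)|) * (ε / C) := by rw [Finset.sum_mul]
    _ < C * (ε / C) := by gcongr
    _ = ε := by field_simp

section Con

variable {L : Type*}

variable (R : AddCon (L → ℕ))

theorem AddCon.exists_nsmul_add [Fintype L] [DecidableEq L] [LinearOrder L] {c : L → ℕ}
    (h : ∀ l, c l = 0 → ∃ l', l < l' ∧ ∃ m : L → ℕ, R (Pi.single l' 1) m ∧ 0 < m l) (u : L → ℕ) :
    ∃ k, 0 < k ∧ ∃ z, R (k • c) (u + z) := by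
  have hpos : ∀ {c : L → ℕ} {l}, 0 < c l → ∃ z : L → ℕ, c = Pi.single l 1 + z := fun {c l} hl =>
    ⟨c - Pi.single l 1, funext fun j => by
      by_cases hj : j = l
      · subst hj; simp; omega
      · simp [hj]⟩
  have hsingle : ∀ l, ∃ k, 0 < k ∧ ∃ z : L → ℕ, R (k • c) (Pi.single l 1 + z) := by
    intro l
    induction l using WellFoundedGT.induction with
    | ind l ih =>
      rcases Nat.eq_zero_or_pos (c l) with hl | hl
      · obtain ⟨l', hl', m, hm, hml⟩ := h l hl
        obtain ⟨k, hk, z, hz⟩ := ih l' hl'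
        obtain ⟨z', rfl⟩ := hpos hml
        refine ⟨k, hk, z' + z, R.trans hz ?_⟩
        rw [← add_assoc]
        exact R.add hm (R.refl z)
      · obtain ⟨z, hz⟩ := hpos hl
        exact ⟨1, one_pos, z, by rw [one_smul, ← hz]; exact R.refl _⟩
  have hadd : ∀ {u v : L → ℕ}, (∃ k, 0 < k ∧ ∃ z, R (k • c) (u + z)) →
      (∃ k, 0 < k ∧ ∃ z, R (k • c) (v + z)) → ∃ k, 0 < k ∧ ∃ z, R (k • c) (u + v + z) := by
    rintro u v ⟨k, hk, z, hz⟩ ⟨k', hk', z', hz'⟩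
    refine ⟨k + k', by omega, z + z', ?_⟩
    rw [add_smul, add_add_add_comm]
    exact R.add hz hz'
  have hzero : ∃ k, 0 < k ∧ ∃ z : L → ℕ, R (k • c) (0 + z) := ⟨1, one_pos, c, by simp [R.refl]⟩
  have hnsmul : ∀ l (k : ℕ), ∃ k', 0 < k' ∧ ∃ z : L → ℕ, R (k' • c) (k • Pi.single l 1 + z) := by
    intro l k
    induction k with
    | zero => simpa using hzero
    | succ k ih => rw [succ_nsmul]; exact hadd ih (hsingle l)
  have hu : u = ∑ l, u l • Pi.single l 1 := by
    funext j
    rw [Finset.sum_apply, Finset.sum_eq_single j]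
    · simp
    · intro l _ hl
      simp [Ne.symm hl]
    · simp
  rw [hu]
  refine Finset.sum_induction _ (fun u => ∃ k, 0 < k ∧ ∃ z, R (k • c) (u + z))
    (fun u v => hadd) hzero fun l _ => hnsmul l (u l)

theorem AddCon.exists_nsmul_of_add {M : Type*} [AddCommMonoid M] (R : AddCon M) {c c' u : M}
    (h : R (c + u) (c' + u)) (hc : ∃ k, 0 < k ∧ ∃ z, R (k • c) (u + z))
    (hc' : ∃ k, 0 < k ∧ ∃ z, R (k • c') (u + z)) : ∃ k, 0 < k ∧ R (k • c) (k • c') := by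
  have hmul : ∀ t : ℕ, R (t • c + u) (t • c' + u) := by
    intro t
    induction t with
    | zero => simp [R.refl]
    | succ t ih =>
      have h1 : R (t • c + (c + u)) (t • c + (c' + u)) := R.add (R.refl _) h
      have h2 : R (c' + (t • c + u)) (c' + (t • c' + u)) := R.add (R.refl _) ih
      rw [succ_nsmul, succ_nsmul, add_assoc]
      refine R.trans h1 ?_
      rw [add_left_comm]
      refine R.trans h2 ?_
      rw [← add_assoc, add_comm c']
      exact R.refl _
  have key : ∀ {d : M} {k : ℕ}, (∃ z, R (k • d) (u + z)) → ∀ t : ℕ,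
      R (t • c + k • d) (t • c' + k • d) := by
    rintro d k ⟨z, hz⟩ t
    have h1 : R (t • c + k • d) (t • c + (u + z)) := R.add (R.refl _) hz
    have h2 : R (t • c' + k • d) (t • c' + (u + z)) := R.add (R.refl _) hz
    refine R.trans h1 (R.trans ?_ (R.symm h2))
    rw [← add_assoc, ← add_assoc]
    exact R.add (hmul t) (R.refl z)
  obtain ⟨k, hk, hz⟩ := hc
  obtain ⟨k', hk', hz'⟩ := hc'
  refine ⟨k + k', by omega, ?_⟩
  have h1 := key hz k'
  have h2 := key hz' k
  rw [add_smul, add_smul]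
  rw [add_comm, add_comm _ (k • c)] at h1
  exact R.trans h1 h2

theorem AddCon.exists_nsmul_add_of_mem_span {S : Set ((L → ℕ) × (L → ℕ))} (hS : ∀ p ∈ S, R p.1 p.2)
    {c c' : L → ℕ}
    (h : (fun l => (c l : ℚ) - c' l) ∈ Submodule.span ℚ
      ((fun p : (L → ℕ) × (L → ℕ) => fun l => (p.1 l : ℚ) - p.2 l) '' S)) :
    ∃ k, 0 < k ∧ ∃ u, R (k • c + u) (k • c' + u) := by
  have key : ∀ x ∈ Submodule.span ℚ
      ((fun p : (L → ℕ) × (L → ℕ) => fun l => (p.1 l : ℚ) - p.2 l) '' S),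
      ∃ k : ℕ, 0 < k ∧ ∃ a b : L → ℕ, R a b ∧ ∀ l, k * x l = a l - b l := by
    intro x hx
    induction hx using Submodule.span_induction with
    | mem x hx =>
      obtain ⟨p, hp, rfl⟩ := hx
      exact ⟨1, one_pos, p.1, p.2, hS p hp, fun l => by simp⟩
    | zero => exact ⟨1, one_pos, 0, 0, R.refl _, fun l => by simp⟩
    | add x y _ _ hx hy =>
      obtain ⟨k, hk, a, b, hab, h⟩ := hx
      obtain ⟨k', hk', a', b', hab', h'⟩ := hy
      refine ⟨k * k', Nat.mul_pos hk hk', k' • a + k • a', k' • b + k • b',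
        R.add (R.nsmul k' hab) (R.nsmul k hab'), fun l => ?_⟩
      simp only [Pi.add_apply, Pi.smul_apply, smul_eq_mul]
      push_cast
      linear_combination (k' : ℚ) * h l + (k : ℚ) * h' l
    | smul q x _ hx =>
      obtain ⟨k, hk, a, b, hab, h⟩ := hx
      have hq : (q.den : ℚ) * q = q.num := Rat.den_mul_eq_num q
      rcases le_total 0 q.num with hn | hn
      · obtain ⟨p, hp⟩ := Int.eq_ofNat_of_zero_le hn
        refine ⟨q.den * k, Nat.mul_pos q.den_pos hk, p • a, p • b, R.nsmul p hab, fun l => ?_⟩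
        rw [hp] at hq
        simp only [Pi.smul_apply, smul_eq_mul]
        push_cast at hq ⊢
        linear_combination (p : ℚ) * h l + k * x l * hq
      · obtain ⟨p, hp⟩ := Int.eq_ofNat_of_zero_le (show 0 ≤ -q.num by omega)
        refine ⟨q.den * k, Nat.mul_pos q.den_pos hk, p • b, p • a, R.nsmul p (R.symm hab),
          fun l => ?_⟩
        have hp' : q.num = -(p : ℤ) := by rw [← hp]; ring
        rw [hp'] at hq
        simp only [Pi.smul_apply, smul_eq_mul]
        push_cast at hq ⊢
        linear_combination -(p : ℚ) * h l + k * x l * hq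
  obtain ⟨k, hk, a, b, hab, h⟩ := key _ h
  refine ⟨k, hk, b, ?_⟩
  have h1 : k • c + b = k • c' + a := funext fun l => by
    have h2 := h l
    simp only [Pi.add_apply, Pi.smul_apply, smul_eq_mul]
    have h3 : ((k * c l + b l : ℕ) : ℚ) = (k * c' l + a l : ℕ) := by
      push_cast
      linear_combination h2
    exact_mod_cast h3
  rw [h1]
  exact R.add (R.refl _) hab

/-- Membership in the span is detected by positive integral functionals. -/
theorem mem_span_of_forall_nat [Fintype L] {S : Set ((L → ℕ) × (L → ℕ))} {r : L → ℕ}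
    (hr : ∀ l, 0 < r l) (hrS : ∀ p ∈ S, ∑ l, p.1 l * r l = ∑ l, p.2 l * r l) {c c' : L → ℕ}
    (h : ∀ d : L → ℕ, (∀ p ∈ S, ∑ l, p.1 l * d l = ∑ l, p.2 l * d l) →
      ∑ l, c l * d l = ∑ l, c' l * d l) :
    (fun l => (c l : ℚ) - c' l) ∈ Submodule.span ℚ
      ((fun p : (L → ℕ) × (L → ℕ) => fun l => (p.1 l : ℚ) - p.2 l) '' S) := by
  classical
  by_contra hcon
  obtain ⟨f, hf, hfS⟩ := Submodule.exists_le_ker_of_notMem hcon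
  let g : L → ℚ := fun l => f (Pi.single l 1)
  have hfg : ∀ x : L → ℚ, f x = ∑ l, x l * g l := fun x => by
    rw [LinearMap.pi_apply_eq_sum_univ f x]
    refine Finset.sum_congr rfl fun l _ => congrArg (fun y => x l * f y) (funext fun j => ?_)
    simp [Pi.single_apply, eq_comm]
  let P : ℕ := ∏ l, (g l).den
  have hP : 0 < P := Finset.prod_pos fun l _ => (g l).den_pos
  have hint : ∀ l, ∃ a : ℤ, (P : ℚ) * g l = a := fun l => by
    obtain ⟨k, hk⟩ := Finset.dvd_prod_of_mem (fun l => (g l).den) (Finset.mem_univ l)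
    refine ⟨(g l).num * k, ?_⟩
    have h1 : (P : ℚ) = (g l).den * k := by exact_mod_cast hk
    rw [h1, mul_right_comm, Rat.den_mul_eq_num]
    push_cast
    ring
  choose a ha using hint
  let t : ℕ := ∑ l, (a l).natAbs
  have ht : ∀ l, 0 ≤ a l + t * r l := fun l => by
    have h1 : (a l).natAbs ≤ t := Finset.single_le_sum (f := fun l => (a l).natAbs)
      (fun _ _ => Nat.zero_le _) (Finset.mem_univ l)
    have h2 : t ≤ t * r l := Nat.le_mul_of_pos_right t (hr l)
    have h3 : ((a l).natAbs : ℤ) ≤ t * r l := by exact_mod_cast h1.trans h2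
    have h4 := abs_le.1 (show |a l| ≤ t * r l by rwa [Int.abs_eq_natAbs])
    linarith [h4.1]
  choose d hd using fun l => Int.eq_ofNat_of_zero_le (ht l)
  have hdq : ∀ l, (d l : ℚ) = P * g l + t * r l := fun l => by
    rw [ha]
    exact_mod_cast (hd l).symm
  have hsum : ∀ x y : L → ℕ, ∑ l, x l * r l = ∑ l, y l * r l →
      ((∑ l, x l * d l : ℕ) : ℚ) - (∑ l, y l * d l : ℕ) = P * f fun l => (x l : ℚ) - y l := by
    intro x y hxy
    have h1 : (∑ l, (x l : ℚ) * r l) = ∑ l, (y l : ℚ) * r l := by exact_mod_cast hxy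
    rw [hfg]
    push_cast
    have h2 : ∀ x : L → ℕ, ∑ l, (x l : ℚ) * d l = P * (∑ l, x l * g l) + t * ∑ l, (x l : ℚ) * r l := by
      intro x
      rw [Finset.mul_sum, Finset.mul_sum, ← Finset.sum_add_distrib]
      exact Finset.sum_congr rfl fun l _ => by rw [hdq]; ring
    rw [h2, h2, h1]
    simp only [sub_mul, Finset.sum_sub_distrib]
    ring
  have hP0 : (P : ℚ) ≠ 0 := by exact_mod_cast hP.ne'
  have hd' : ∑ l, c l * d l = ∑ l, c' l * d l := h d fun p hp => by
    have h1 := hsum p.1 p.2 (hrS p hp)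
    have h2 : (f fun l => (p.1 l : ℚ) - p.2 l) = 0 :=
      hfS (Submodule.subset_span (Set.mem_image_of_mem _ hp))
    rw [h2, mul_zero, sub_eq_zero] at h1
    exact_mod_cast h1
  have h1 := hsum c c' (h r hrS)
  rw [hd', sub_self] at h1
  exact hf ((mul_eq_zero.1 h1.symm).resolve_left hP0)

theorem AddCon.exists_nsmul_of_forall_nat [Fintype L] [DecidableEq L] [LinearOrder L]
    {S : Set ((L → ℕ) × (L → ℕ))} (hS : ∀ p ∈ S, R p.1 p.2) {r : L → ℕ}
    (hr : ∀ l, 0 < r l) (hrS : ∀ p ∈ S, ∑ l, p.1 l * r l = ∑ l, p.2 l * r l) {c c' : L → ℕ}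
    (h : ∀ d : L → ℕ, (∀ p ∈ S, ∑ l, p.1 l * d l = ∑ l, p.2 l * d l) →
      ∑ l, c l * d l = ∑ l, c' l * d l)
    (hc : ∀ l, c l = 0 → ∃ l', l < l' ∧ ∃ m : L → ℕ, R (Pi.single l' 1) m ∧ 0 < m l)
    (hc' : ∀ l, c' l = 0 → ∃ l', l < l' ∧ ∃ m : L → ℕ, R (Pi.single l' 1) m ∧ 0 < m l) :
    ∃ k, 0 < k ∧ R (k • c) (k • c') := by
  obtain ⟨k, hk, u, hu⟩ := R.exists_nsmul_add_of_mem_span hS (mem_span_of_forall_nat hr hrS h)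
  have hk' : ∀ {c : L → ℕ} {l}, (k • c) l = 0 → c l = 0 := fun {c l} h =>
    (Nat.mul_eq_zero.1 h).resolve_left hk.ne'
  obtain ⟨k', hk', h'⟩ := R.exists_nsmul_of_add hu (R.exists_nsmul_add (fun l hl => hc l (hk' hl)) u)
    (R.exists_nsmul_add (fun l hl => hc' l (hk' hl)) u)
  exact ⟨k' * k, Nat.mul_pos hk' hk, by rwa [mul_smul, mul_smul]⟩

end Con

end

noncomputable section


set_option linter.unusedSectionVars false

theorem Matrix.exists_nat_trace_eq {n : Type*} [Fintype n] [DecidableEq n] {P : Matrix n n ℂ}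
    (h : IsIdempotentElem P) : ∃ k : ℕ, P.trace = k := by
  have h1 : IsIdempotentElem (Matrix.toLin' P) := by
    exact (Matrix.toLin'_mul P P).symm.trans (congrArg _ h.eq)
  refine ⟨Module.finrank ℂ (LinearMap.range (Matrix.toLin' P)), ?_⟩
  rw [← Matrix.trace_toLin'_eq]
  exact (LinearMap.IsIdempotentElem.isProj_range _ h1).trace

theorem Matrix.isStarProjection_map_iff {N : ℕ} {A A' : Type*} [Ring A] [StarRing A] [Algebra ℂ A]
    [Ring A'] [StarRing A'] [Algebra ℂ A'] (f : A →⋆ₐ[ℂ] A') (a : Matrix (Fin N) (Fin N) A) :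
    IsStarProjection (a.map f) ↔
      ∀ i j, f (∑ k, a i k * a k j) = f (a i j) ∧ f (star (a j i)) = f (a i j) := by
  have h1 : ∀ i j, (a.map f * a.map f) i j = f (∑ k, a i k * a k j) := fun i j => by
    rw [Matrix.mul_apply, map_sum]
    exact Finset.sum_congr rfl fun k _ => (map_mul f _ _).symm
  have h2 : ∀ i j, star (a.map f) i j = f (star (a j i)) := fun i j => (map_star f _).symm
  rw [isStarProjection_iff, IsIdempotentElem, IsSelfAdjoint]
  constructor
  · rintro ⟨h, h'⟩ i j
    rw [← h1, ← h2, h, h']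
    exact ⟨rfl, rfl⟩
  · intro h
    exact ⟨Matrix.ext fun i j => (h1 i j).trans (h i j).1,
      Matrix.ext fun i j => (h2 i j).trans (h i j).2⟩

namespace RSHDecomposition

variable {B : Type u} [CStarAlgebra B] (D : RSHDecomposition.{u, v, w} B)

theorem component_eq_iff {l : Fin (D.depth + 1)} {a b : B} :
    D.component l a = D.component l b ↔ ∀ z, D.evalMatrix l z a = D.evalMatrix l z b :=
  ⟨fun h z => congrArg (fun f : C(D.X l, Mat (D.r l) ℂ) => CStarMatrix.ofMatrix.symm (f z)) h,
    fun h => D.component_ext h⟩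

theorem ψ_eq_iff {l : Fin (D.depth + 1)} {a b : B} :
    D.ψ l a = D.ψ l b ↔ ∀ k ≤ l, ∀ z : D.X k, D.evalMatrix k z a = D.evalMatrix k z b := by
  simp only [← component_eq_iff]
  refine ⟨fun h k hk => ?_, D.ψ_eq_of_component_eq l⟩
  rw [component_eq_toFun, component_eq_toFun, D.ψ_eq_of_le hk h]

theorem continuous_evalMatrix (l : Fin (D.depth + 1)) (b : B) (i j : Fin (D.r l)) :
    Continuous fun z => D.evalMatrix l z b i j := by
  have h1 := (D.component l b).continuous
  exact (continuous_apply j).comp ((continuous_apply i).comp h1)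

/-- The trace of the value at a point of a matrix over `B`. -/
def traceAt {N : ℕ} (a : Matrix (Fin N) (Fin N) B) (l : Fin (D.depth + 1)) (z : D.X l) : ℂ :=
  ∑ i, (D.evalMatrix l z (a i i)).trace

theorem continuous_traceAt {N : ℕ} (a : Matrix (Fin N) (Fin N) B) (l : Fin (D.depth + 1)) :
    Continuous (D.traceAt a l) :=
  continuous_finsetSum _ fun i _ => continuous_finsetSum _ fun j _ =>
    D.continuous_evalMatrix l (a i i) j j

theorem exists_nat_traceAt_eq {N : ℕ} {a : Matrix (Fin N) (Fin N) B} {l : Fin (D.depth + 1)}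
    {z : D.X l} (h : IsStarProjection (a.map (D.evalMatrix l z))) : ∃ k : ℕ, D.traceAt a l z = k := by
  obtain ⟨k, hk⟩ := Matrix.exists_nat_trace_eq
    (P := Matrix.compRingEquiv (Fin N) (Fin (D.r l)) ℂ (a.map (D.evalMatrix l z))) (by
      rw [IsIdempotentElem, ← map_mul, h.isIdempotentElem.eq])
  refine ⟨k, hk ▸ ?_⟩
  rw [Matrix.trace, Fintype.sum_prod_type]
  rfl

variable {D}

theorem isStarProjection_ψ_iff {N : ℕ} {a : Matrix (Fin N) (Fin N) B} {l : Fin (D.depth + 1)} :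
    IsStarProjection (a.map (D.ψ l)) ↔
      ∀ k ≤ l, ∀ z : D.X k, IsStarProjection (a.map (D.evalMatrix k z)) := by
  simp only [Matrix.isStarProjection_map_iff, D.ψ_eq_iff]
  exact ⟨fun h k hk z i j => ⟨(h i j).1 k hk z, (h i j).2 k hk z⟩,
    fun h i j => ⟨fun k hk z => (h k hk z i j).1, fun k hk z => (h k hk z i j).2⟩⟩

/-- A projection over a stage can be modified on the last base space, off the part where it has
the prescribed trace. -/
theorem exists_projection_replace {N : ℕ} {a : Matrix (Fin N) (Fin N) B} {l : Fin (D.depth + 1)}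
    (ha : ∀ k ≤ l, ∀ z : D.X k, IsStarProjection (a.map (D.evalMatrix k z))) {d : ℕ} (hd : d ≤ N)
    (hΩ : ∀ z ∈ D.Ω l, D.traceAt a l z = d) :
    ∃ a' : Matrix (Fin N) (Fin N) B,
      (∀ k ≤ l, ∀ z : D.X k, IsStarProjection (a'.map (D.evalMatrix k z))) ∧
      (∀ k < l, ∀ z, D.traceAt a' k z = D.traceAt a k z) ∧ ∀ z, D.traceAt a' l z = d := by
  classical
  let U : Set (D.X l) := {z | D.traceAt a l z = d}
  have hU : IsClopen U := by
    refine ⟨isClosed_eq (D.continuous_traceAt a l) continuous_const, ?_⟩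
    have h1 : U = D.traceAt a l ⁻¹' Metric.ball (d : ℂ) 1 := by
      ext z
      constructor
      · intro hz
        rw [Set.mem_preimage, show D.traceAt a l z = d from hz]
        exact Metric.mem_ball_self one_pos
      · intro hz
        obtain ⟨k, hk⟩ := D.exists_nat_traceAt_eq (ha l le_rfl z)
        rw [Set.mem_preimage, hk, Metric.mem_ball, Complex.dist_eq] at hz
        have h2 : |((k : ℤ) - d : ℤ)| < 1 := by
          have h3 : ‖(k : ℂ) - d‖ = |(((k : ℤ) - d : ℤ) : ℝ)| := by
            rw [← Complex.norm_intCast]; push_cast; rfl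
          rw [h3] at hz
          exact_mod_cast hz
        have h4 : k = d := by have := Int.abs_lt_one_iff.1 h2; omega
        change D.traceAt a l z = d
        rw [hk, h4]
    rw [h1]
    exact Metric.isOpen_ball.preimage (D.continuous_traceAt a l)
  let i₀ : Fin (D.r l) := ⟨0, D.r_pos l⟩
  let Q : Matrix (Fin N) (Fin N) (Matrix (Fin (D.r l)) (Fin (D.r l)) ℂ) :=
    Matrix.diagonal fun i => if i.val < d then Matrix.single i₀ i₀ 1 else 0
  have hQ : IsStarProjection Q := by
    refine ⟨?_, ?_⟩
    · rw [IsIdempotentElem, Matrix.diagonal_mul_diagonal]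
      refine congrArg _ (funext fun i => ?_)
      split_ifs
      · rw [Matrix.single_mul_single_same, mul_one]
      · exact mul_zero _
    · rw [IsSelfAdjoint, Matrix.star_eq_conjTranspose, Matrix.diagonal_conjTranspose]
      refine congrArg _ (funext fun i => ?_)
      rw [Pi.star_apply]
      split_ifs
      · rw [Matrix.star_eq_conjTranspose, Matrix.conjTranspose_single, star_one]
      · exact star_zero _
  have hQtr : ∑ i, (Q i i).trace = d := by
    have h1 : ∀ i, (Q i i).trace = if i.val < d then 1 else 0 := fun i => by
      have h2 : Q i i = if i.val < d then Matrix.single i₀ i₀ 1 else 0 :=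
        Matrix.diagonal_apply_eq _ i
      rw [h2]
      split_ifs
      · simp
      · simp
    simp only [h1]
    rw [Fin.sum_univ_eq_sum_range (fun i => if i < d then (1 : ℂ) else 0), ← Finset.sum_filter]
    rw [Finset.sum_const, nsmul_eq_mul, mul_one]
    congr 1
    have : (Finset.range N).filter (· < d) = Finset.range d := by
      ext i; simp; omega
    rw [this, Finset.card_range]
  let g (i j : Fin N) : C(D.X l, Mat (D.r l) ℂ) :=
    ⟨U.piecewise (D.component l (a i j)) fun _ => CStarMatrix.ofMatrix (Q i j), by
      refine Continuous.piecewise (fun z hz => ?_) (D.component l (a i j)).continuous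
        continuous_const
      rw [hU.frontier_eq] at hz
      exact hz.elim⟩
  have hg := fun i j => D.exists_component_replace l (a i j) (g i j) fun y hy =>
    Set.piecewise_eq_of_mem U (D.component l (a i j)) (fun _ => CStarMatrix.ofMatrix (Q i j))
      (hΩ y hy)
  choose a' ha' ha'' using hg
  have hval : ∀ z, (Matrix.of a').map (D.evalMatrix l z) =
      if z ∈ U then a.map (D.evalMatrix l z) else Q := by
    intro z
    ext1 i j
    have h1 : D.component l (a' i j) z = g i j z := by rw [ha']
    change CStarMatrix.ofMatrix.symm (D.component l (a' i j) z) = _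
    rw [h1]
    by_cases hz : z ∈ U
    · rw [if_pos hz]
      exact Set.piecewise_eq_of_mem U (D.component l (a i j))
        (fun _ => CStarMatrix.ofMatrix (Q i j)) hz
    · rw [if_neg hz]
      exact Set.piecewise_eq_of_notMem U (D.component l (a i j))
        (fun _ => CStarMatrix.ofMatrix (Q i j)) hz
  have hval' : ∀ k < l, ∀ z : D.X k, (Matrix.of a').map (D.evalMatrix k z) =
      a.map (D.evalMatrix k z) := fun k hk z => by
    ext1 i j
    exact D.component_eq_iff.1 (ha'' i j k hk) z
  have htr : ∀ (b : Matrix (Fin N) (Fin N) B) k (z : D.X k), D.traceAt b k z =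
      ∑ i, (b.map (D.evalMatrix k z) i i).trace := fun b k z => rfl
  refine ⟨Matrix.of a', fun k hk z => ?_, fun k hk z => ?_, fun z => ?_⟩
  · rcases hk.eq_or_lt with rfl | hk
    · rw [hval]
      split_ifs
      exacts [ha k le_rfl z, hQ]
    · rw [hval' k hk]
      exact ha k hk.le z
  · rw [htr, hval' k hk, htr]
  · rw [htr, hval]
    split_ifs with hz
    · exact hz
    · exact hQtr

theorem Decomposes.trace_eq {N : ℕ} {π : B →⋆ₐ[ℂ] Matrix (Fin N) (Fin N) ℂ} {ι : Type} [Fintype ι]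
    {l : ι → Fin (D.depth + 1)} {z : ∀ i, D.X (l i)} {V : ∀ i, Matrix (Fin N) (Fin (D.r (l i))) ℂ}
    (h : D.Decomposes π l z V) (b : B) :
    (π b).trace = ∑ i, (D.evalMatrix (l i) (z i) b).trace := by
  rw [h.apply_eq, conjSum_apply, Matrix.trace_sum]
  refine Finset.sum_congr rfl fun i _ => ?_
  rw [Matrix.mul_assoc, Matrix.trace_mul_comm, Matrix.mul_assoc, h.isometry, Matrix.mul_one]

/-- The type `m` occurs at a point of the attaching set of `X_l`, with all points in previous
base spaces. -/
def IsBoundaryType (D : RSHDecomposition.{u, v, w} B) (l : Fin (D.depth + 1))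
    (m : Fin (D.depth + 1) → ℕ) : Prop :=
  ∃ y ∈ D.Ω l, D.HasType (D.evalMatrix l y) m ∧ ∀ k, m k ≠ 0 → k < l

theorem exists_decomposition_of_mem_Ω {l : Fin (D.depth + 1)} {y : D.X l} (hy : y ∈ D.Ω l) :
    ∃ (ι : Type) (_ : Fintype ι) (l' : ι → Fin (D.depth + 1)) (z : ∀ i, D.X (l' i))
      (V : ∀ i, Matrix (Fin (D.r l)) (Fin (D.r (l' i))) ℂ),
      D.Decomposes (D.evalMatrix l y) l' z V ∧ (∀ i, l' i < l) ∧
      D.IsBoundaryType l fun k => ∑ i, if l' i = k then 1 else 0 := by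
  obtain ⟨ι, _, _, l', z, V, -, hdec, hlev⟩ := exists_decomposition (D := D) (D.evalMatrix l y)
  have hl : ∀ i, l' i < l := fun i => Fin.lt_def.2 (hlev l.val (fun b hb =>
    evalMatrix_eq_zero_of_mem_Ω (fun k hk => hb k (Fin.lt_def.1 hk)) hy) i)
  refine ⟨ι, _, l', z, V, hdec, hl, y, hy, ⟨ι, _, l', z, V, hdec, fun k => rfl⟩, fun k hk => ?_⟩
  obtain ⟨i, -, hi⟩ := Finset.exists_ne_zero_of_sum_ne_zero hk
  have : l' i = k := by by_contra hne; exact hi (if_neg hne)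
  exact this ▸ hl i

theorem traceAt_eq_of_mem_Ω {N : ℕ} {a : Matrix (Fin N) (Fin N) B} {l : Fin (D.depth + 1)}
    {d : Fin (D.depth + 1) → ℕ} (hd : ∀ m, D.IsBoundaryType l m → ∑ k, m k * d k = d l)
    (ha : ∀ k < l, ∀ z, D.traceAt a k z = d k) {y : D.X l} (hy : y ∈ D.Ω l) :
    D.traceAt a l y = d l := by
  obtain ⟨ι, _, l', z, V, hdec, hl, hb⟩ := exists_decomposition_of_mem_Ω hy
  have h1 : D.traceAt a l y = ∑ i, D.traceAt a (l' i) (z i) := by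
    simp only [traceAt, hdec.trace_eq]
    exact Finset.sum_comm
  rw [h1, Finset.sum_congr rfl fun i _ => ha (l' i) (hl i) (z i), ← hd _ hb]
  push_cast
  simp only [Finset.sum_mul]
  rw [Finset.sum_comm]
  refine Finset.sum_congr rfl fun i _ => ?_
  simp

/-- If projections can be lifted, there are projections over `B` with constant trace on each of the
base spaces, for all values compatible with the attaching maps. -/
theorem ProjectionsLift.exists_projection (hlift : D.ProjectionsLift) {d : Fin (D.depth + 1) → ℕ}
    (hd : ∀ l m, D.IsBoundaryType l m → ∑ k, m k * d k = d l) :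
    ∃ p : MatrixProjection B, ∀ l z, D.traceAt p.val l z = d l := by
  let N := ∑ k, d k
  have hN : ∀ k, d k ≤ N := fun k => Finset.single_le_sum (fun _ _ => Nat.zero_le _)
    (Finset.mem_univ k)
  have key : ∀ l : Fin (D.depth + 1), ∃ a : Matrix (Fin N) (Fin N) B,
      (∀ k ≤ l, ∀ z : D.X k, IsStarProjection (a.map (D.evalMatrix k z))) ∧
      ∀ k ≤ l, ∀ z, D.traceAt a k z = d k := by
    intro l
    induction l using Fin.induction with
    | zero =>
      obtain ⟨a, h1, -, h3⟩ := exists_projection_replace (D := D) (l := 0)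
        (a := (0 : Matrix (Fin N) (Fin N) B)) (fun k _ z => by
          rw [Matrix.map_zero _ (map_zero _)]; exact .zero _) (hN 0)
        (fun z hz => by rw [D.Ω_zero] at hz; exact hz.elim)
      refine ⟨a, h1, fun k hk => ?_⟩
      obtain rfl := Fin.le_zero_iff.1 hk
      exact h3
    | succ l ih =>
      obtain ⟨a, ha, hat⟩ := ih
      obtain ⟨p', hp', hpa⟩ := hlift N l _ (isStarProjection_ψ_iff.2 ha)
      choose a' ha' using fun i j => D.ψ_surjective l.succ (p' i j)
      have hp'' : p' = (Matrix.of a').map (D.ψ l.succ) := by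
        ext i j; exact (ha' i j).symm
      rw [hp'', isStarProjection_ψ_iff] at hp'
      have hcomp : ∀ k ≤ l.castSucc, ∀ z : D.X k, D.traceAt (Matrix.of a') k z = d k := by
        intro k hk z
        rw [← hat k hk z]
        refine Finset.sum_congr rfl fun i _ => congrArg _ ?_
        refine D.ψ_eq_iff.1 ?_ k hk z
        have h1 := congrFun (congrFun hpa i) i
        rw [hp''] at h1
        change D.toPrev l (D.ψ l.succ (a' i i)) = D.ψ l.castSucc (a i i) at h1
        rwa [D.toPrev_ψ] at h1
      obtain ⟨a'', h1, h2, h3⟩ := exists_projection_replace hp' (hN l.succ) fun y hy =>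
        traceAt_eq_of_mem_Ω (hd l.succ) (fun k hk => hcomp k (Fin.le_castSucc_iff.2 hk)) hy
      refine ⟨a'', h1, fun k hk z => ?_⟩
      rcases hk.eq_or_lt with rfl | hk
      · exact h3 z
      · rw [h2 k hk, hcomp k (Fin.le_castSucc_iff.2 hk)]
  obtain ⟨a, ha, hat⟩ := key (Fin.last _)
  refine ⟨⟨N, a, ?_⟩, fun l z => hat l (Fin.le_last l) z⟩
  have h1 := (Matrix.isStarProjection_map_iff (D.ψ (Fin.last _)) a).1 (isStarProjection_ψ_iff.2 ha)
  have h2 := (Matrix.isStarProjection_map_iff (StarAlgHom.id ℂ B) a).2 fun i j =>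
    ⟨D.ψ_last_bijective.1 (h1 i j).1, D.ψ_last_bijective.1 (h1 i j).2⟩
  exact h2

end RSHDecomposition

end

noncomputable section


set_option linter.unusedSectionVars false

/-- Positive tracial functionals. -/
structure IsPositiveTrace {B : Type*} [CStarAlgebra B] (t : B →ₗ[ℂ] ℂ) : Prop where
  nonneg : ∀ b, 0 ≤ t (star b * b)
  tracial : ∀ a b, t (a * b) = t (b * a)

theorem continuous_div_sqrt_norm : Continuous fun z : ℂ => z / (Real.sqrt ‖z‖ : ℂ) := by
  rw [continuous_iff_continuousAt]
  intro z
  by_cases hz : z = 0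
  · subst hz
    have h1 : ∀ z : ℂ, ‖z / (Real.sqrt ‖z‖ : ℂ)‖ = Real.sqrt ‖z‖ := fun z => by
      rw [norm_div, Complex.norm_real, Real.norm_of_nonneg (Real.sqrt_nonneg _), Real.div_sqrt]
    rw [ContinuousAt, zero_div, tendsto_zero_iff_norm_tendsto_zero]
    simp only [h1]
    have h2 : Continuous fun z : ℂ => Real.sqrt ‖z‖ := by fun_prop
    simpa using h2.tendsto 0
  · have h1 : (Real.sqrt ‖z‖ : ℂ) ≠ 0 := by
      rw [Complex.ofReal_ne_zero]
      exact (Real.sqrt_pos.2 (norm_pos_iff.2 hz)).ne'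
    have h2 : Continuous fun z : ℂ => (Real.sqrt ‖z‖ : ℂ) := by fun_prop
    exact continuousAt_id.div h2.continuousAt h1

/-- A continuous complex function is the product of two continuous functions vanishing at its
zeros. -/
theorem ContinuousMap.exists_mul_eq {X : Type*} [TopologicalSpace X] (g : C(X, ℂ)) :
    ∃ a b : C(X, ℂ), g = a * b ∧ ∀ z, g z = 0 → a z = 0 ∧ b z = 0 := by
  refine ⟨⟨fun z => (Real.sqrt ‖g z‖ : ℂ), by fun_prop⟩,
    ⟨fun z => g z / (Real.sqrt ‖g z‖ : ℂ), continuous_div_sqrt_norm.comp g.continuous⟩, ?_, ?_⟩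
  · ext z
    change g z = (Real.sqrt ‖g z‖ : ℂ) * (g z / (Real.sqrt ‖g z‖ : ℂ))
    by_cases hz : g z = 0
    · simp [hz]
    · have h1 : (Real.sqrt ‖g z‖ : ℂ) ≠ 0 := by
        rw [Complex.ofReal_ne_zero]
        exact (Real.sqrt_pos.2 (norm_pos_iff.2 hz)).ne'
      field_simp
  · intro z hz
    exact ⟨by simp [hz], by simp [hz]⟩

namespace RSHDecomposition

variable {B : Type u} [CStarAlgebra B] {D : RSHDecomposition.{u, v, w} B}

/-- The functional factorizes through the first base spaces, up to the one of index `l`. -/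
def FactorsThrough (D : RSHDecomposition.{u, v, w} B) (t : B →ₗ[ℂ] ℂ) (l : Fin (D.depth + 1)) :
    Prop := ∀ b, (∀ k ≤ l, D.component k b = 0) → t b = 0

variable {t : B →ₗ[ℂ] ℂ} {l : Fin (D.depth + 1)}

theorem FactorsThrough.apply_eq (ht : D.FactorsThrough t l) {a b : B}
    (h : ∀ k < l, D.component k a = D.component k b)
    (h' : ∀ z, D.evalMatrix l z a = D.evalMatrix l z b) : t a = t b := by
  rw [← sub_eq_zero, ← map_sub]
  refine ht _ fun k hk => ?_
  rw [map_sub, sub_eq_zero]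
  rcases hk.eq_or_lt with rfl | hk
  · exact D.component_ext h'
  · exact h k hk

/-- The element is supported on the base spaces from `X_l` on, and there it is the function `g`
times the matrix unit `e_{ij}`. -/
def IsUnitAt (D : RSHDecomposition.{u, v, w} B) (l : Fin (D.depth + 1)) (i j : Fin (D.r l))
    (g : C(D.X l, ℂ)) (b : B) : Prop :=
  (∀ k < l, D.component k b = 0) ∧ ∀ z, D.evalMatrix l z b = g z • Matrix.single i j 1

theorem exists_isUnitAt (i j : Fin (D.r l)) (g : C(D.X l, ℂ)) (hg : ∀ z ∈ D.Ω l, g z = 0) :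
    ∃ b, D.IsUnitAt l i j g b := by
  obtain ⟨b, hb, hb'⟩ := D.exists_evalMatrix_eq l
    (fun i' j' => if i = i' ∧ j = j' then g else 0)
    (fun i' j' z hz => by split_ifs; exacts [hg z hz, rfl])
  refine ⟨b, hb, fun z => ?_⟩
  rw [hb']
  ext i' j'
  by_cases h : i = i' ∧ j = j' <;> simp [h, Matrix.single_apply]

theorem component_mul_eq_zero {k : Fin (D.depth + 1)} {a : B} (b : B) (h : D.component k a = 0) :
    D.component k (a * b) = 0 := by
  rw [map_mul, h]
  exact zero_mul (M₀ := C(D.X k, Mat (D.r k) ℂ)) _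

theorem component_mul_eq_zero' {k : Fin (D.depth + 1)} {b : B} (a : B) (h : D.component k b = 0) :
    D.component k (a * b) = 0 := by
  rw [map_mul, h]
  exact mul_zero (M₀ := C(D.X k, Mat (D.r k) ℂ)) _

theorem FactorsThrough.apply_isUnitAt (ht : D.FactorsThrough t l)
    (htr : ∀ a b, t (a * b) = t (b * a)) {i j : Fin (D.r l)} (k : Fin (D.r l)) {g : C(D.X l, ℂ)}
    {b b' : B} (hb : D.IsUnitAt l i j g b) (hb' : D.IsUnitAt l k k g b') :
    t b = if i = j then t b' else 0 := by
  have hg : ∀ z ∈ D.Ω l, g z = 0 := fun z hz => by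
    have h1 := evalMatrix_eq_zero_of_mem_Ω hb.1 hz
    rw [hb.2] at h1
    have h2 := congrFun (congrFun h1 i) j
    simpa using h2
  obtain ⟨u, v, rfl, huv⟩ := g.exists_mul_eq
  obtain ⟨a, ha⟩ := exists_isUnitAt (D := D) i k u fun z hz => (huv z (hg z hz)).1
  obtain ⟨c, hc⟩ := exists_isUnitAt (D := D) k j v fun z hz => (huv z (hg z hz)).2
  have h1 : t b = t (a * c) := ht.apply_eq
    (fun m hm => by rw [hb.1 m hm, component_mul_eq_zero c (ha.1 m hm)])
    fun z => by
      rw [hb.2, map_mul, ha.2, hc.2, smul_mul_smul_comm, Matrix.single_mul_single_same, one_mul]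
      rfl
  rw [h1, htr]
  split_ifs with hij
  · subst hij
    refine ht.apply_eq (fun m hm => by rw [hb'.1 m hm, component_mul_eq_zero a (hc.1 m hm)])
      fun z => ?_
    rw [hb'.2, map_mul, ha.2, hc.2, smul_mul_smul_comm, Matrix.single_mul_single_same, one_mul,
      mul_comm (v z)]
    rfl
  · rw [← map_zero t]
    refine ht.apply_eq (fun m hm => by rw [component_mul_eq_zero a (hc.1 m hm), map_zero])
      fun z => ?_
    rw [map_mul, ha.2, hc.2, smul_mul_smul_comm, Matrix.single_mul_single_of_ne _ _ _ _ (Ne.symm hij),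
      smul_zero, map_zero]

/-- The normalised trace of the values on `X_l`. -/
def normTrace (D : RSHDecomposition.{u, v, w} B) (l : Fin (D.depth + 1)) : B →ₗ[ℂ] C(D.X l, ℂ) where
  toFun b := ⟨fun z => (D.r l : ℂ)⁻¹ * (D.evalMatrix l z b).trace,
    continuous_const.mul (continuous_finsetSum _ fun i _ => D.continuous_evalMatrix l b i i)⟩
  map_add' a b := by
    ext z
    simp [mul_add]
  map_smul' c b := by
    ext z
    simp only [ContinuousMap.coe_mk, map_smul, Matrix.trace_smul, smul_eq_mul, RingHom.id_apply,
      ContinuousMap.smul_apply]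
    ring

theorem normTrace_apply (b : B) (z : D.X l) :
    D.normTrace l b z = (D.r l : ℂ)⁻¹ * (D.evalMatrix l z b).trace := rfl

theorem normTrace_mul_comm (a b : B) : D.normTrace l (a * b) = D.normTrace l (b * a) := by
  ext z
  rw [normTrace_apply, normTrace_apply, map_mul, map_mul, Matrix.trace_mul_comm]

theorem r_ne_zero (D : RSHDecomposition.{u, v, w} B) (l : Fin (D.depth + 1)) : (D.r l : ℂ) ≠ 0 := by
  exact_mod_cast (D.r_pos l).ne'

/-- A trace only depends on the pointwise traces. -/
theorem FactorsThrough.apply_eq_of_isScalarAt (ht : D.FactorsThrough t l)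
    (htr : ∀ a b, t (a * b) = t (b * a)) {b s : B} (hb : ∀ k < l, D.component k b = 0)
    (hs : D.IsScalarAt l s (D.normTrace l b)) : t b = t s := by
  let g (i j : Fin (D.r l)) : C(D.X l, ℂ) := ⟨_, D.continuous_evalMatrix l b i j⟩
  have hg : ∀ i j, ∀ z ∈ D.Ω l, g i j z = 0 := fun i j z hz =>
    congrFun (congrFun (evalMatrix_eq_zero_of_mem_Ω hb hz) i) j
  let i₀ : Fin (D.r l) := ⟨0, D.r_pos l⟩
  have hf : ∀ z ∈ D.Ω l, D.normTrace l b z = 0 := fun z hz => hs.apply_eq_zero hz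
  choose e he using fun i j => exists_isUnitAt (D := D) i j (g i j) (hg i j)
  choose e' he' using fun i => exists_isUnitAt (D := D) i i _ hf
  choose c hc using fun i => exists_isUnitAt (D := D) i₀ i₀ (g i i) (hg i i)
  have hzero : ∀ k < l, ∀ {ι : Type} [Fintype ι] (x : ι → B), (∀ i, D.component k (x i) = 0) →
      D.component k (∑ i, x i) = 0 := by
    intro k _ ι _ x hx
    rw [map_sum]
    exact Finset.sum_eq_zero fun i _ => hx i
  have h1 : t b = ∑ i, ∑ j, t (e i j) := by
    have h2 : t b = t (∑ i, ∑ j, e i j) := ht.apply_eq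
      (fun k hk => by
        rw [hb k hk, hzero k hk _ fun i => hzero k hk _ fun j => (he i j).1 k hk])
      fun z => by
        rw [map_sum]
        simp only [map_sum, (he _ _).2]
        exact (Matrix.matrix_eq_sum_single (D.evalMatrix l z b)).trans
          (Finset.sum_congr rfl fun i _ => Finset.sum_congr rfl fun j _ => by
            rw [Matrix.smul_single, smul_eq_mul, mul_one]; rfl)
    rw [h2, map_sum]
    simp only [map_sum]
  have h3 : t b = ∑ i, t (c i) := by
    rw [h1]
    refine Finset.sum_congr rfl fun i _ => ?_
    rw [Finset.sum_eq_single i]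
    · rw [ht.apply_isUnitAt htr i₀ (he i i) (hc i), if_pos rfl]
    · intro j _ hj
      obtain ⟨x, hx⟩ := exists_isUnitAt (D := D) i₀ i₀ (g i j) (hg i j)
      rw [ht.apply_isUnitAt htr i₀ (he i j) hx, if_neg hj.symm]
    · simp
  have h4 : t s = ∑ i, t (e' i) := by
    rw [← map_sum]
    refine ht.apply_eq (fun k hk => by rw [hs.1 k hk, hzero k hk _ fun i => (he' i).1 k hk])
      fun z => ?_
    rw [hs.2, map_sum]
    simp only [(he' _).2]
    rw [← Finset.smul_sum, Matrix.sum_single_one]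
  have h5 : ∑ i, t (e' i) = D.r l * t (e' i₀) := by
    rw [Finset.sum_congr rfl fun i _ => (ht.apply_isUnitAt htr i₀ (he' i) (he' i₀)).trans (if_pos rfl)]
    simp
  rw [h3, h4, h5, ← map_sum, ← smul_eq_mul, ← map_smul]
  refine ht.apply_eq (fun k hk => by
    rw [hzero k hk _ fun i => (hc i).1 k hk, map_smul, (he' i₀).1 k hk, smul_zero]) fun z => ?_
  rw [map_sum, map_smul, (he' i₀).2]
  simp only [(hc _).2]
  rw [← Finset.sum_smul, smul_smul, normTrace_apply, mul_inv_cancel_left₀ (D.r_ne_zero l)]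
  rfl

end RSHDecomposition

end

noncomputable section


set_option linter.unusedSectionVars false

section Analysis

variable {X : Type*} [TopologicalSpace X] [CompactSpace X] [TopologicalSpace.MetrizableSpace X]

/-- Approximate units consisting of functions vanishing on a closed set. -/
theorem exists_approximateUnit {Ω : Set X} (hΩ : IsClosed Ω) :
    ∃ h : ℕ → C(X, ℝ), (∀ n z, 0 ≤ h n z) ∧ (∀ n z, h n z ≤ 1) ∧ (∀ n, ∀ z ∈ Ω, h n z = 0) ∧
      (∀ z ∉ Ω, ∀ᶠ n in atTop, h n z = 1) ∧
      ∀ f : C(X, ℝ), (∀ z ∈ Ω, f z = 0) → Tendsto (fun n => ‖f * h n - f‖) atTop (𝓝 0) := by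
  let _ := TopologicalSpace.metrizableSpaceMetric X
  obtain ⟨d, hd0, hd⟩ : ∃ d : C(X, ℝ), (∀ z, 0 ≤ d z) ∧ ∀ z, d z = 0 ↔ z ∈ Ω := by
    rcases Ω.eq_empty_or_nonempty with rfl | hne
    · exact ⟨1, fun z => zero_le_one, fun z => by simp⟩
    · exact ⟨⟨fun z => Metric.infDist z Ω, Metric.continuous_infDist_pt Ω⟩,
        fun z => Metric.infDist_nonneg, fun z => (hΩ.mem_iff_infDist_zero hne).symm⟩
  let h : ℕ → C(X, ℝ) := fun n => ⟨fun z => min 1 (n * d z), by fun_prop⟩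
  have h0 : ∀ n z, 0 ≤ h n z := fun n z => le_min zero_le_one (mul_nonneg n.cast_nonneg (hd0 z))
  have h1 : ∀ n z, h n z ≤ 1 := fun n z => min_le_left _ _
  have hone : ∀ {δ : ℝ}, 0 < δ → ∀ᶠ n : ℕ in atTop, ∀ z, δ ≤ d z → h n z = 1 := by
    intro δ hδ
    filter_upwards [eventually_ge_atTop ⌈δ⁻¹⌉₊] with n hn z hz
    refine min_eq_left ?_
    have h2 : δ⁻¹ ≤ n := (Nat.le_ceil _).trans (by exact_mod_cast hn)
    calc (1 : ℝ) = δ⁻¹ * δ := (inv_mul_cancel₀ hδ.ne').symm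
      _ ≤ n * d z := mul_le_mul h2 hz hδ.le n.cast_nonneg
  refine ⟨h, h0, h1, fun n z hz => ?_, fun z hz => ?_, fun f hf => ?_⟩
  · change min 1 (n * d z) = 0
    rw [(hd z).2 hz, mul_zero]
    exact min_eq_right zero_le_one
  · have h2 : 0 < d z := (hd0 z).lt_of_ne fun h => hz ((hd z).1 h.symm)
    filter_upwards [hone h2] with n hn using hn z le_rfl
  · rw [Metric.tendsto_atTop]
    intro ε hε
    have hK : IsCompact {z | ε / 2 ≤ |f z|} :=
      (isClosed_le continuous_const f.continuous.abs).isCompact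
    obtain ⟨δ, hδ, hδ'⟩ := hK.exists_forall_le' (f := d) d.continuous.continuousOn (a := 0)
      fun z hz => (hd0 z).lt_of_ne fun h => by
        have h2 := hf z ((hd z).1 h.symm)
        rw [Set.mem_ofPred_eq, h2, abs_zero] at hz
        linarith
    obtain ⟨N, hN⟩ := eventually_atTop.1 (hone hδ)
    refine ⟨N, fun n hn => ?_⟩
    rw [dist_zero_right, norm_norm]
    refine lt_of_le_of_lt ?_ (half_lt_self hε)
    refine (ContinuousMap.norm_le _ (by positivity)).2 fun z => ?_
    rw [ContinuousMap.sub_apply, ContinuousMap.mul_apply, Real.norm_eq_abs]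
    by_cases hz : ε / 2 ≤ |f z|
    · rw [hN n hn z (hδ' z hz), mul_one, sub_self, abs_zero]
      positivity
    · rw [show f z * h n z - f z = f z * (h n z - 1) by ring, abs_mul]
      have h2 : |h n z - 1| ≤ 1 := abs_le.2 ⟨by linarith [h0 n z], by linarith [h1 n z]⟩
      push Not at hz
      calc |f z| * |h n z - 1| ≤ |f z| * 1 := by gcongr
        _ ≤ ε / 2 := by rw [mul_one]; exact hz.le

/-- The continuous functions vanishing on a set. -/
def vanishingOn (Ω : Set X) : Submodule ℝ C(X, ℝ) where
  carrier := {f | ∀ z ∈ Ω, f z = 0}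
  add_mem' hf hg z hz := by rw [ContinuousMap.add_apply, hf z hz, hg z hz, add_zero]
  zero_mem' _ _ := rfl
  smul_mem' c f hf z hz := by rw [ContinuousMap.smul_apply, hf z hz, smul_zero]

open MeasureTheory in
/-- Positive bounded functionals on the functions vanishing on a closed set are represented by
finite measures on the complement. -/
theorem exists_measure_of_vanishingOn [MeasurableSpace X] [BorelSpace X] {Ω : Set X}
    (hΩ : IsClosed Ω) (T : vanishingOn Ω →ₗ[ℝ] ℝ)
    (hT : ∀ f : vanishingOn Ω, (∀ z, 0 ≤ (f : C(X, ℝ)) z) → 0 ≤ T f) {C : ℝ}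
    (hC : ∀ f : vanishingOn Ω, (∀ z, (f : C(X, ℝ)) z ≤ 1) → T f ≤ C) :
    ∃ μ : Measure X, IsFiniteMeasure μ ∧ μ Ω = 0 ∧
      ∀ f : vanishingOn Ω, ∫ z, (f : C(X, ℝ)) z ∂μ = T f := by
  obtain ⟨h, h0, h1, hΩ0, -, happ⟩ := exists_approximateUnit hΩ
  have hle : ∀ (f : vanishingOn Ω) (c : ℝ), 0 < c → (∀ z, (f : C(X, ℝ)) z ≤ c) → T f ≤ C * c := by
    intro f c hc hf
    have h2 := hC (c⁻¹ • f) fun z => by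
      change c⁻¹ * (f : C(X, ℝ)) z ≤ 1
      rw [inv_mul_le_one₀ hc]
      exact hf z
    rw [map_smul, smul_eq_mul, inv_mul_le_iff₀ hc] at h2
    linarith
  have hC0 : 0 ≤ C := by
    have := hC 0 fun z => zero_le_one
    rwa [map_zero] at this
  have hbound : ∀ f : vanishingOn Ω, |T f| ≤ C * ‖(f : C(X, ℝ))‖ := by
    intro f
    refine le_of_forall_pos_le_add fun ε hε => ?_
    have hC1 : 0 < C + 1 := by linarith
    have h2 : ∀ z, |(f : C(X, ℝ)) z| ≤ ‖(f : C(X, ℝ))‖ + ε / (C + 1) := fun z =>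
      ((f : C(X, ℝ)).norm_coe_le_norm z).trans (le_add_of_nonneg_right (by positivity))
    have h3 : C * (‖(f : C(X, ℝ))‖ + ε / (C + 1)) ≤ C * ‖(f : C(X, ℝ))‖ + ε := by
      rw [mul_add]
      gcongr
      rw [mul_div_assoc', div_le_iff₀ hC1]
      nlinarith
    refine abs_le'.2 ⟨(hle f _ (by positivity) fun z => (abs_le.1 (h2 z)).2).trans h3, ?_⟩
    rw [← map_neg]
    refine (hle (-f) _ (by positivity) fun z => ?_).trans h3
    change -(f : C(X, ℝ)) z ≤ _
    linarith [(abs_le.1 (h2 z)).1]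
  let m (n : ℕ) (f : C(X, ℝ)) : vanishingOn Ω := ⟨f * h n, fun z hz => by
    rw [ContinuousMap.mul_apply, hΩ0 n z hz, mul_zero]⟩
  let U := hyperfilter ℕ
  have hex : ∀ f : C(X, ℝ), ∃ x, Tendsto (fun n => T (m n f)) U (𝓝 x) := by
    intro f
    have h2 : ∀ n, T (m n f) ∈ Set.Icc (-(C * ‖f‖)) (C * ‖f‖) := fun n => by
      refine abs_le.1 ((hbound _).trans ?_)
      gcongr
      refine (ContinuousMap.norm_le _ (norm_nonneg _)).2 fun z => ?_
      change ‖f z * h n z‖ ≤ _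
      rw [norm_mul, Real.norm_of_nonneg (h0 n z)]
      calc ‖f z‖ * h n z ≤ ‖f‖ * 1 := by
            exact mul_le_mul (f.norm_coe_le_norm z) (h1 n z) (h0 n z) (norm_nonneg _)
        _ = ‖f‖ := mul_one _
    obtain ⟨x, -, hx⟩ := (isCompact_Icc (a := -(C * ‖f‖)) (b := C * ‖f‖)).ultrafilter_le_nhds
      (U.map fun n => T (m n f)) (by
        rw [le_principal_iff]
        exact Filter.mem_map.2 (Eventually.of_forall h2))
    exact ⟨x, hx⟩
  choose Λ hΛ using hex
  have hadd : ∀ f g, Λ (f + g) = Λ f + Λ g := fun f g => by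
    refine tendsto_nhds_unique (hΛ (f + g)) (((hΛ f).add (hΛ g)).congr fun n => ?_)
    rw [← map_add]
    congr 1
    exact Subtype.ext (add_mul _ _ _).symm
  have hsmul : ∀ (c : ℝ) f, Λ (c • f) = c * Λ f := fun c f => by
    refine tendsto_nhds_unique (hΛ (c • f)) (((hΛ f).const_mul c).congr fun n => ?_)
    rw [← smul_eq_mul, ← map_smul]
    congr 1
    exact Subtype.ext (smul_mul_assoc _ _ _).symm
  have hnonneg : ∀ f : C(X, ℝ), (∀ z, 0 ≤ f z) → 0 ≤ Λ f := fun f hf =>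
    ge_of_tendsto' (hΛ f) fun n => hT _ fun z => mul_nonneg (hf z) (h0 n z)
  have hΛT : ∀ f : vanishingOn Ω, Λ f = T f := fun f => by
    refine tendsto_nhds_unique (hΛ f) (Tendsto.mono_left ?_ Nat.hyperfilter_le_atTop)
    rw [tendsto_iff_norm_sub_tendsto_zero]
    have h2 := (happ f f.2).const_mul C
    rw [mul_zero] at h2
    refine squeeze_zero (fun _ => norm_nonneg _) (fun n => ?_) h2
    rw [← map_sub]
    exact hbound _
  let Λ' : CompactlySupportedContinuousMap X ℝ →ₚ[ℝ] ℝ := PositiveLinearMap.mk₀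
    { toFun := fun f => Λ f.toContinuousMap
      map_add' := fun f g => hadd _ _
      map_smul' := fun c f => hsmul c _ } fun f hf => hnonneg _ fun z => hf z
  refine ⟨(RealRMK.rieszMeasure Λ').restrict Ωᶜ, inferInstance, ?_, fun f => ?_⟩
  · rw [Measure.restrict_apply hΩ.measurableSet, Set.inter_compl_self, measure_empty]
  · have h2 : ∀ z, z ∉ Ωᶜ → (f : C(X, ℝ)) z = 0 := fun z hz => f.2 z (not_not.1 hz)
    rw [setIntegral_eq_integral_of_forall_compl_eq_zero h2, ← hΛT]
    exact RealRMK.integral_rieszMeasure Λ' ⟨f, HasCompactSupport.of_compactSpace _⟩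

end Analysis

end

noncomputable section


set_option linter.unusedSectionVars false

/-- A real function, regarded as a complex one. -/
def ContinuousMap.toComplex {X : Type*} [TopologicalSpace X] (f : C(X, ℝ)) : C(X, ℂ) :=
  ⟨fun z => (f z : ℂ), by fun_prop⟩

namespace RSHDecomposition

variable {B : Type u} [CStarAlgebra B] {D : RSHDecomposition.{u, v, w} B}

instance (l : Fin (D.depth + 1)) : MeasurableSpace (D.X l) := borel _

instance (l : Fin (D.depth + 1)) : BorelSpace (D.X l) := ⟨rfl⟩

variable {t : B →ₗ[ℂ] ℂ} {l : Fin (D.depth + 1)}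

theorem FactorsThrough.apply_eq_of_ψ_eq (ht : D.FactorsThrough t l) {a b : B}
    (h : D.ψ l a = D.ψ l b) : t a = t b :=
  ht.apply_eq (fun k hk => by rw [component_eq_toFun, component_eq_toFun, D.ψ_eq_of_le hk.le h])
    fun z => D.ψ_eq_iff.1 h l le_rfl z

theorem IsScalarAt.ψ_eq {a b : B} {f : C(D.X l, ℂ)} (ha : D.IsScalarAt l a f)
    (hb : D.IsScalarAt l b f) : D.ψ l a = D.ψ l b := by
  refine D.ψ_eq_of_component_eq l fun k hk => ?_
  rcases hk.eq_or_lt with rfl | hk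
  · exact D.component_ext fun z => by rw [ha.2, hb.2]
  · rw [ha.1 k hk, hb.1 k hk]

theorem IsScalarAt.add {b c : B} {f g : C(D.X l, ℂ)}
    (hb : D.IsScalarAt l b f) (hc : D.IsScalarAt l c g) : D.IsScalarAt l (b + c) (f + g) :=
  ⟨fun k hk => by rw [map_add, hb.1 k hk, hc.1 k hk, add_zero],
    fun z => by rw [map_add, hb.2, hc.2, ← add_smul]; rfl⟩

theorem IsScalarAt.smul {b : B} {f : C(D.X l, ℂ)} (hb : D.IsScalarAt l b f) (c : ℂ) :
    D.IsScalarAt l (c • b) (c • f) :=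
  ⟨fun k hk => by rw [map_smul, hb.1 k hk, smul_zero],
    fun z => by rw [map_smul, hb.2, smul_smul]; rfl⟩

theorem _root_.IsPositiveTrace.apply_nonneg_of_isScalarAt (ht : IsPositiveTrace t)
    (hl : D.FactorsThrough t l) {f : C(D.X l, ℝ)} (hf : ∀ z, 0 ≤ f z) {b : B}
    (hb : D.IsScalarAt l b f.toComplex) : 0 ≤ t b := by
  let g : C(D.X l, ℝ) := ⟨fun z => Real.sqrt (f z), by fun_prop⟩
  obtain ⟨s, hs⟩ := D.exists_isScalarAt l g.toComplex fun z hz => by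
    have h1 : ((f z : ℝ) : ℂ) = 0 := hb.apply_eq_zero hz
    change ((Real.sqrt (f z) : ℝ) : ℂ) = 0
    rw [Complex.ofReal_eq_zero.1 h1, Real.sqrt_zero, Complex.ofReal_zero]
  have h1 : star g.toComplex * g.toComplex = f.toComplex := by
    ext z
    change star ((Real.sqrt (f z) : ℝ) : ℂ) * ((Real.sqrt (f z) : ℝ) : ℂ) = ((f z : ℝ) : ℂ)
    rw [Complex.star_def, Complex.conj_ofReal, ← Complex.ofReal_mul, Real.mul_self_sqrt (hf z)]
  have h2 := hs.star.mul hs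
  rw [h1] at h2
  rw [hl.apply_eq_of_ψ_eq (hb.ψ_eq h2)]
  exact ht.nonneg s

theorem exists_star_mul_self_ψ_eq_one_sub {f : C(D.X l, ℝ)} (hf : ∀ z, f z ≤ 1) {b : B}
    (hb : D.IsScalarAt l b f.toComplex) : ∃ c : B, D.ψ l (star c * c) = D.ψ l (1 - b) := by
  let g : C(D.X l, ℝ) := ⟨fun z => 1 - Real.sqrt (1 - f z), by fun_prop⟩
  obtain ⟨s, hs⟩ := D.exists_isScalarAt l g.toComplex fun z hz => by
    have h1 : ((f z : ℝ) : ℂ) = 0 := hb.apply_eq_zero hz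
    change ((1 - Real.sqrt (1 - f z) : ℝ) : ℂ) = 0
    rw [Complex.ofReal_eq_zero.1 h1, sub_zero, Real.sqrt_one, sub_self, Complex.ofReal_zero]
  refine ⟨1 - s, ?_⟩
  have h1 : D.IsScalarAt l (s + star s + (-1 : ℂ) • (star s * s)) f.toComplex := by
    have h2 := (hs.add hs.star).add ((hs.star.mul hs).smul (-1))
    convert h2 using 1
    ext z
    change ((f z : ℝ) : ℂ) = ((1 - Real.sqrt (1 - f z) : ℝ) : ℂ) +
      star ((1 - Real.sqrt (1 - f z) : ℝ) : ℂ) + -1 * (star ((1 - Real.sqrt (1 - f z) : ℝ) : ℂ) *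
      ((1 - Real.sqrt (1 - f z) : ℝ) : ℂ))
    rw [Complex.star_def, Complex.conj_ofReal]
    have h3 := congrArg ((↑) : ℝ → ℂ) (Real.mul_self_sqrt (show 0 ≤ 1 - f z by linarith [hf z]))
    push_cast at h3 ⊢
    linear_combination h3
  have h2 := h1.ψ_eq hb
  rw [map_sub, ← h2, ← map_sub]
  congr 1
  rw [star_sub, star_one, neg_one_smul]
  noncomm_ring

/-- The functional on functions vanishing on `Ω_l` induced by a trace which factorizes through the
base spaces up to `X_l`. -/
def inducedFunctional (t : B →ₗ[ℂ] ℂ) (hl : D.FactorsThrough t l) :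
    vanishingOn (D.Ω l) →ₗ[ℝ] ℝ :=
  have hex := fun f : vanishingOn (D.Ω l) => D.exists_isScalarAt l (f : C(D.X l, ℝ)).toComplex
    fun z hz => Complex.ofReal_eq_zero.2 (f.2 z hz)
  { toFun := fun f => (t (hex f).choose).re
    map_add' := fun f g => by
      have h1 := (hex f).choose_spec.add (hex g).choose_spec
      have h2 : (f : C(D.X l, ℝ)).toComplex + (g : C(D.X l, ℝ)).toComplex =
          ((f + g : vanishingOn (D.Ω l)) : C(D.X l, ℝ)).toComplex := by
        ext z; exact (Complex.ofReal_add _ _).symm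
      rw [h2] at h1
      rw [← Complex.add_re, ← map_add, hl.apply_eq_of_ψ_eq ((hex _).choose_spec.ψ_eq h1)]
    map_smul' := fun c f => by
      have h1 := (hex f).choose_spec.smul c
      have h2 : (c : ℂ) • (f : C(D.X l, ℝ)).toComplex =
          ((c • f : vanishingOn (D.Ω l)) : C(D.X l, ℝ)).toComplex := by
        ext z; exact (Complex.ofReal_mul _ _).symm
      rw [h2] at h1
      rw [hl.apply_eq_of_ψ_eq ((hex _).choose_spec.ψ_eq h1), map_smul, smul_eq_mul,
        Complex.re_ofReal_mul]
      rfl }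

theorem inducedFunctional_apply (hl : D.FactorsThrough t l) (f : vanishingOn (D.Ω l)) {b : B}
    (hb : D.IsScalarAt l b (f : C(D.X l, ℝ)).toComplex) : inducedFunctional t hl f = (t b).re := by
  have hex := D.exists_isScalarAt l (f : C(D.X l, ℝ)).toComplex
    fun z hz => Complex.ofReal_eq_zero.2 (f.2 z hz)
  exact congrArg Complex.re (hl.apply_eq_of_ψ_eq (hex.choose_spec.ψ_eq hb))

theorem _root_.IsPositiveTrace.im_eq_zero (ht : IsPositiveTrace t)
    (hl : D.FactorsThrough t l) {f : C(D.X l, ℝ)} {b : B}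
    (hb : D.IsScalarAt l b f.toComplex) : (t b).im = 0 := by
  have hf : ∀ z ∈ D.Ω l, f z = 0 := fun z hz => Complex.ofReal_eq_zero.1 (hb.apply_eq_zero hz)
  let p : C(D.X l, ℝ) := ⟨fun z => max (f z) 0, by fun_prop⟩
  let q : C(D.X l, ℝ) := ⟨fun z => max (-f z) 0, by fun_prop⟩
  obtain ⟨a, ha⟩ := D.exists_isScalarAt l p.toComplex fun z hz => by
    change ((max (f z) 0 : ℝ) : ℂ) = 0
    rw [hf z hz, max_self, Complex.ofReal_zero]
  obtain ⟨c, hc⟩ := D.exists_isScalarAt l q.toComplex fun z hz => by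
    change ((max (-f z) 0 : ℝ) : ℂ) = 0
    rw [hf z hz, neg_zero, max_self, Complex.ofReal_zero]
  have h1 : D.IsScalarAt l (a + (-1 : ℂ) • c) f.toComplex := by
    have h2 := ha.add (hc.smul (-1))
    convert h2 using 1
    ext z
    change ((f z : ℝ) : ℂ) = ((max (f z) 0 : ℝ) : ℂ) + -1 * ((max (-f z) 0 : ℝ) : ℂ)
    norm_cast
    rcases le_total 0 (f z) with h | h
    · rw [max_eq_left h, max_eq_right (by linarith)]; simp
    · rw [max_eq_right h, max_eq_left (by linarith)]; simp
  have h2 := ht.apply_nonneg_of_isScalarAt hl (f := p) (fun z => le_max_right _ _) ha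
  have h3 := ht.apply_nonneg_of_isScalarAt hl (f := q) (fun z => le_max_right _ _) hc
  rw [hl.apply_eq_of_ψ_eq (hb.ψ_eq h1), map_add, map_smul]
  simp [← (Complex.nonneg_iff.1 h2).2, ← (Complex.nonneg_iff.1 h3).2]

open MeasureTheory

theorem integrable_continuousMap (μ : Measure (D.X l)) [IsFiniteMeasure μ] {E : Type*}
    [NormedAddCommGroup E] (f : C(D.X l, E)) [SecondCountableTopologyEither (D.X l) E] :
    Integrable f μ :=
  f.continuous.integrable_of_hasCompactSupport (HasCompactSupport.of_compactSpace _)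

/-- The integral of the normalised trace. -/
def integralTrace (μ : Measure (D.X l)) [IsFiniteMeasure μ] : B →ₗ[ℂ] ℂ where
  toFun b := ∫ z, D.normTrace l b z ∂μ
  map_add' a b := by
    rw [map_add]
    exact integral_add (integrable_continuousMap μ _) (integrable_continuousMap μ _)
  map_smul' c b := by
    rw [map_smul]
    exact integral_const_mul c _

theorem integralTrace_apply (μ : Measure (D.X l)) [IsFiniteMeasure μ] (b : B) :
    integralTrace μ b = ∫ z, D.normTrace l b z ∂μ := rfl

theorem normTrace_star_mul_self (b : B) : ∃ g : C(D.X l, ℝ), (∀ z, 0 ≤ g z) ∧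
    D.normTrace l (star b * b) = g.toComplex := by
  refine ⟨⟨fun z => (D.normTrace l (star b * b) z).re,
    Complex.continuous_re.comp (D.normTrace l (star b * b)).continuous⟩, ?_, ?_⟩ <;>
  · have h1 : ∀ z, 0 ≤ D.normTrace l (star b * b) z := fun z => by
      rw [normTrace_apply, map_mul, map_star]
      refine mul_nonneg ?_ (Matrix.posSemidef_conjTranspose_mul_self _).trace_nonneg
      rw [← Complex.ofReal_natCast, ← Complex.ofReal_inv]
      exact Complex.zero_le_real.2 (by positivity)
    first
    | exact fun z => (Complex.nonneg_iff.1 (h1 z)).1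
    | exact ContinuousMap.ext fun z => Complex.ext rfl (Complex.nonneg_iff.1 (h1 z)).2.symm

theorem integralTrace_star_mul_self (μ : Measure (D.X l)) [IsFiniteMeasure μ] {b : B}
    {g : C(D.X l, ℝ)} (hg : D.normTrace l (star b * b) = g.toComplex) :
    integralTrace μ (star b * b) = ((∫ z, g z ∂μ : ℝ) : ℂ) := by
  rw [integralTrace_apply, hg]
  exact integral_ofReal

theorem isPositiveTrace_integralTrace (μ : Measure (D.X l)) [IsFiniteMeasure μ] :
    IsPositiveTrace (integralTrace (D := D) μ) := by
  refine ⟨fun b => ?_, fun a b => ?_⟩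
  · obtain ⟨g, hg0, hg⟩ := normTrace_star_mul_self (D := D) (l := l) b
    rw [integralTrace_star_mul_self μ hg]
    exact Complex.zero_le_real.2 (integral_nonneg hg0)
  · rw [integralTrace_apply, integralTrace_apply, normTrace_mul_comm]

/-- A trace which factorizes through the base spaces up to `X_l` is given by a measure on the
elements supported on `X_l`, and dominates the integral with respect to this measure. -/
theorem exists_measure_of_factorsThrough (ht : IsPositiveTrace t) (hl : D.FactorsThrough t l) :
    ∃ (μ : Measure (D.X l)) (_ : IsFiniteMeasure μ), μ (D.Ω l) = 0 ∧
      (∀ b, (∀ k < l, D.component k b = 0) → t b = integralTrace μ b) ∧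
      ∀ b, integralTrace μ (star b * b) ≤ t (star b * b) := by
  have hex := fun f : vanishingOn (D.Ω l) => D.exists_isScalarAt l (f : C(D.X l, ℝ)).toComplex
    fun z hz => Complex.ofReal_eq_zero.2 (f.2 z hz)
  obtain ⟨μ, hμ, hμΩ, hμT⟩ := exists_measure_of_vanishingOn (D.isClosed_Ω l)
    (inducedFunctional t hl) (fun f hf => by
      obtain ⟨b, hb⟩ := hex f
      rw [inducedFunctional_apply hl f hb]
      exact (Complex.nonneg_iff.1 (ht.apply_nonneg_of_isScalarAt hl hf hb)).1) (C := (t 1).re)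
    (fun f hf => by
      obtain ⟨b, hb⟩ := hex f
      rw [inducedFunctional_apply hl f hb]
      obtain ⟨c, hc⟩ := exists_star_mul_self_ψ_eq_one_sub hf hb
      have h1 := (Complex.nonneg_iff.1 (ht.nonneg c)).1
      rw [hl.apply_eq_of_ψ_eq hc, map_sub, Complex.sub_re] at h1
      linarith)
  have hreal : ∀ (f : vanishingOn (D.Ω l)) b, D.IsScalarAt l b (f : C(D.X l, ℝ)).toComplex →
      t b = ((∫ z, (f : C(D.X l, ℝ)) z ∂μ : ℝ) : ℂ) := fun f b hb => by
    rw [hμT, inducedFunctional_apply hl f hb]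
    exact Complex.ext rfl (ht.im_eq_zero hl hb)
  refine ⟨μ, hμ, hμΩ, fun b hb => ?_, fun b => ?_⟩
  · have hz : ∀ z ∈ D.Ω l, D.normTrace l b z = 0 := fun z hz => by
      rw [normTrace_apply, evalMatrix_eq_zero_of_mem_Ω hb hz, Matrix.trace_zero, mul_zero]
    obtain ⟨s, hs⟩ := D.exists_isScalarAt l _ hz
    let p : vanishingOn (D.Ω l) := ⟨⟨fun z => (D.normTrace l b z).re,
      Complex.continuous_re.comp (D.normTrace l b).continuous⟩,
      fun z h => by rw [ContinuousMap.coe_mk, hz z h, Complex.zero_re]⟩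
    let q : vanishingOn (D.Ω l) := ⟨⟨fun z => (D.normTrace l b z).im,
      Complex.continuous_im.comp (D.normTrace l b).continuous⟩,
      fun z h => by rw [ContinuousMap.coe_mk, hz z h, Complex.zero_im]⟩
    obtain ⟨a, ha⟩ := hex p
    obtain ⟨c, hc⟩ := hex q
    have h1 : D.IsScalarAt l (a + Complex.I • c) (D.normTrace l b) := by
      have h2 := ha.add (hc.smul Complex.I)
      convert h2 using 1
      ext z
      change D.normTrace l b z = ((D.normTrace l b z).re : ℂ) +
        Complex.I * ((D.normTrace l b z).im : ℂ)
      rw [mul_comm, Complex.re_add_im]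
    rw [hl.apply_eq_of_isScalarAt ht.tracial hb hs, hl.apply_eq_of_ψ_eq (hs.ψ_eq h1), map_add,
      map_smul, hreal p a ha, hreal q c hc, integralTrace_apply, smul_eq_mul, mul_comm]
    exact integral_re_add_im (𝕜 := ℂ) (integrable_continuousMap μ (D.normTrace l b))
  · obtain ⟨g, hg0, hg⟩ := normTrace_star_mul_self (D := D) (l := l) b
    obtain ⟨h, h0, h1, hΩ, hlim, -⟩ := exists_approximateUnit (D.isClosed_Ω l)
    have hb := ht.nonneg b
    rw [Complex.nonneg_iff] at hb
    rw [integralTrace_star_mul_self μ hg, Complex.le_def]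
    refine ⟨?_, by rw [Complex.ofReal_im]; exact hb.2⟩
    rw [Complex.ofReal_re]
    have hae : ∀ᵐ z ∂μ, Tendsto (fun n => g z * h n z) atTop (𝓝 (g z)) := by
      have h2 : ∀ᵐ z ∂μ, z ∉ D.Ω l := measure_eq_zero_iff_ae_notMem.1 hμΩ
      filter_upwards [h2] with z hz
      refine tendsto_const_nhds.congr' ?_
      filter_upwards [hlim z hz] with n hn
      rw [hn, mul_one]
    have hconv := tendsto_integral_of_dominated_convergence (μ := μ) (fun z => ‖g z‖)
      (F := fun n z => g z * h n z) (fun n => (g * h n).continuous.aestronglyMeasurable)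
      (integrable_continuousMap μ g).norm (fun n => Eventually.of_forall fun z => by
        rw [norm_mul, Real.norm_of_nonneg (h0 n z)]
        exact mul_le_of_le_one_right (norm_nonneg _) (h1 n z)) hae
    refine le_of_tendsto' hconv fun n => ?_
    obtain ⟨e, he⟩ := D.exists_isScalarAt l (h n).toComplex
      fun z hz => Complex.ofReal_eq_zero.2 (hΩ n z hz)
    obtain ⟨c, hc⟩ := exists_star_mul_self_ψ_eq_one_sub (h1 n) he
    have h2 : t (star b * e * b) = ((∫ z, g z * h n z ∂μ : ℝ) : ℂ) := by
      have hgh : D.normTrace l (star b * e * b) = (g * h n).toComplex := by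
        ext z
        rw [normTrace_apply, map_mul, map_mul, he.2, mul_smul_comm, mul_one, smul_mul_assoc,
          Matrix.trace_smul, ← map_mul, smul_eq_mul, mul_left_comm, ← normTrace_apply, hg, mul_comm]
        exact (Complex.ofReal_mul _ _).symm
      have hmem : g * h n ∈ vanishingOn (D.Ω l) := fun z hz => by
        rw [ContinuousMap.mul_apply, hΩ n z hz, mul_zero]
      obtain ⟨s, hs⟩ := hex ⟨g * h n, hmem⟩
      have h3 : ∀ k < l, D.component k (star b * e * b) = 0 := fun k hk =>
        component_mul_eq_zero b (component_mul_eq_zero' (star b) (he.1 k hk))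
      rw [hl.apply_eq_of_isScalarAt ht.tracial h3 (s := s) (by rw [hgh]; exact hs)]
      exact hreal ⟨g * h n, hmem⟩ s hs
    have h3 := (Complex.nonneg_iff.1 (ht.nonneg (c * b))).1
    have h4 : D.ψ l (star (c * b) * (c * b)) = D.ψ l (star b * b - star b * e * b) := by
      have h5 : star (c * b) * (c * b) = star b * (star c * c) * b := by
        rw [star_mul]; noncomm_ring
      rw [h5, map_mul, map_mul, hc, ← map_mul, ← map_mul]
      congr 1
      noncomm_ring
    rw [hl.apply_eq_of_ψ_eq h4, map_sub, h2, Complex.sub_re, Complex.ofReal_re] at h3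
    linarith

theorem exists_measures_aux (m : ℕ) : ∀ t : B →ₗ[ℂ] ℂ, IsPositiveTrace t →
    (∀ b, (∀ k : Fin (D.depth + 1), k.val < m → D.component k b = 0) → t b = 0) →
    m ≤ D.depth + 1 →
    ∃ (μ : ∀ l, Measure (D.X l)) (_ : ∀ l, IsFiniteMeasure (μ l)), (∀ l, μ l (D.Ω l) = 0) ∧
      ∀ b, t b = ∑ l, integralTrace (μ l) b := by
  induction m with
  | zero =>
    intro t _ ht0 _
    refine ⟨fun l => 0, fun l => inferInstance, fun l => rfl, fun b => ?_⟩
    rw [ht0 b fun k hk => absurd hk (by omega)]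
    exact (Finset.sum_eq_zero fun l _ => by rw [integralTrace_apply, integral_zero_measure]).symm
  | succ m ih =>
    intro t ht hm hmD
    let l : Fin (D.depth + 1) := ⟨m, by omega⟩
    obtain ⟨μ, hμ, hμΩ, hμl, hμle⟩ := exists_measure_of_factorsThrough (D := D) (l := l) ht
      fun b hb => hm b fun k hk => hb k (Fin.le_def.2 (Nat.lt_succ_iff.1 hk))
    obtain ⟨ν, hν, hνΩ, hν'⟩ := ih (t - integralTrace μ)
      ⟨fun b => by rw [LinearMap.sub_apply]; exact sub_nonneg.2 (hμle b), fun a b => by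
        rw [LinearMap.sub_apply, LinearMap.sub_apply, ht.tracial,
          (isPositiveTrace_integralTrace μ).tracial]⟩
      (fun b hb => by
        rw [LinearMap.sub_apply, sub_eq_zero]
        exact hμl b fun k hk => hb k (Fin.lt_def.1 hk)) (by omega)
    classical
    let μ' : ∀ k, Measure (D.X k) := fun k => if h : k = l then h ▸ μ else 0
    have hμ'l : μ' l = μ := dif_pos rfl
    have hμ' : ∀ k, k ≠ l → μ' k = 0 := fun k hk => dif_neg hk
    have hfin : ∀ k, IsFiniteMeasure (μ' k) := fun k => by
      by_cases hk : k = l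
      · subst hk; rw [hμ'l]; exact hμ
      · rw [hμ' k hk]; infer_instance
    refine ⟨fun k => ν k + μ' k, fun k => inferInstance, fun k => ?_, fun b => ?_⟩
    · rw [Measure.add_apply, hνΩ, zero_add]
      by_cases hk : k = l
      · subst hk; rw [hμ'l]; exact hμΩ
      · rw [hμ' k hk]; rfl
    · have h1 : ∀ k, integralTrace (ν k + μ' k) b = integralTrace (ν k) b + integralTrace (μ' k) b :=
        fun k => integral_add_measure (integrable_continuousMap _ _) (integrable_continuousMap _ _)
      simp only [h1]
      rw [Finset.sum_add_distrib, ← hν', Finset.sum_eq_single l]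
      · have h2 : integralTrace (μ' l) b = integralTrace μ b := by
          rw [integralTrace_apply, integralTrace_apply, hμ'l]
        rw [h2, LinearMap.sub_apply, sub_add_cancel]
      · intro k _ hk
        rw [integralTrace_apply, hμ' k hk, integral_zero_measure]
      · simp

/-- Tracial states are given by measures on the base spaces. -/
theorem exists_measures (τ : TracialState B) :
    ∃ (μ : ∀ l, Measure (D.X l)) (_ : ∀ l, IsFiniteMeasure (μ l)), (∀ l, μ l (D.Ω l) = 0) ∧
      ∀ b, τ b = ∑ l, integralTrace (μ l) b :=
  exists_measures_aux (D := D) (D.depth + 1) τ.toLinearMap ⟨τ.nonneg', τ.tracial'⟩ (fun b hb => by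
    have : b = 0 := D.eq_of_component_eq fun k => by rw [hb k k.2, map_zero]
    rw [this, map_zero]) le_rfl

end RSHDecomposition

end

noncomputable section


set_option linter.unusedSectionVars false

theorem TracialState.evalProjection_eq_of_kZeroMap_eq {B : Type*} [CStarAlgebra B]
    {τ τ' : TracialState B} (h : τ.kZeroMap = τ'.kZeroMap) (p : MatrixProjection B) :
    τ.evalProjection p = τ'.evalProjection p := by
  have h1 : ∀ σ : TracialState B, σ.kZeroMap (QuotientAddGroup.mk (FreeAbelianGroup.of p)) =
      σ.evalProjection p := fun σ => FreeAbelianGroup.lift_apply_of _ _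
  rw [← h1, ← h1, h]

namespace RSHDecomposition

open MeasureTheory

variable {B : Type u} [CStarAlgebra B] {D : RSHDecomposition.{u, v, w} B}

/-- The tracial state `τ` is represented by the measures `μ l` on the base spaces. -/
structure Represents (D : RSHDecomposition.{u, v, w} B) (μ : ∀ l, Measure (D.X l))
    [∀ l, IsFiniteMeasure (μ l)] (τ : TracialState B) : Prop where
  null : ∀ l, μ l (D.Ω l) = 0
  eq_sum : ∀ b, τ b = ∑ l, integralTrace (μ l) b

variable {μ : ∀ l, Measure (D.X l)} [∀ l, IsFiniteMeasure (μ l)] {τ : TracialState B}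

theorem Represents.apply_eq_of_normTrace (h : D.Represents μ τ) {b : B}
    {c : Fin (D.depth + 1) → ℂ} (hb : ∀ l z, D.normTrace l b z = c l) :
    τ b = ∑ l, ((μ l).real Set.univ : ℂ) * c l := by
  rw [h.eq_sum]
  refine Finset.sum_congr rfl fun l _ => ?_
  rw [integralTrace_apply]
  simp only [hb]
  rw [integral_const, Complex.real_smul]

theorem Represents.evalProjection_eq (h : D.Represents μ τ) {p : MatrixProjection B}
    {d : Fin (D.depth + 1) → ℕ} (hd : ∀ l z, D.traceAt p.val l z = d l) :
    τ.evalProjection p = ∑ l, (μ l).real Set.univ / D.r l * d l := by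
  have h1 : ∀ l z, D.normTrace l (∑ i, p.val i i) z = (D.r l : ℂ)⁻¹ * d l := fun l z => by
    rw [normTrace_apply, map_sum, Matrix.trace_sum, ← hd l z]
    rfl
  have h2 : ∑ i, τ (p.val i i) = τ (∑ i, p.val i i) := (map_sum τ.toLinearMap _ _).symm
  rw [TracialState.evalProjection, h2, h.apply_eq_of_normTrace h1, Complex.re_sum]
  refine Finset.sum_congr rfl fun l _ => ?_
  have h3 : ((μ l).real Set.univ : ℂ) * ((D.r l : ℂ)⁻¹ * d l) =
      (((μ l).real Set.univ / D.r l * d l : ℝ) : ℂ) := by push_cast; ring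
  rw [h3, Complex.ofReal_re]

theorem Represents.sum_real_univ (h : D.Represents μ τ) : ∑ l, (μ l).real Set.univ = 1 := by
  have h1 : ∀ l z, D.normTrace l 1 z = 1 := fun l z => by
    rw [normTrace_apply, map_one, Matrix.trace_one, Fintype.card_fin]
    exact inv_mul_cancel₀ (D.r_ne_zero l)
  have h2 := h.apply_eq_of_normTrace h1
  have h3 : τ 1 = 1 := τ.map_one'
  rw [h3] at h2
  have h4 := congrArg Complex.re h2
  simpa [Complex.re_sum] using h4.symm

/-- If the fibres over the attaching sets of the later base spaces contain no points of `X_l`,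
then functions on `X_l` vanishing on `Ω_l` can be extended by zero. -/
theorem exists_component_eq_zero_of_ne {l : Fin (D.depth + 1)}
    (hl : ∀ l' m, l < l' → D.IsBoundaryType l' m → m l = 0) (g : C(D.X l, Mat (D.r l) ℂ))
    (hg : ∀ z ∈ D.Ω l, g z = 0) : ∃ b : B, D.component l b = g ∧
      ∀ k, k ≠ l → D.component k b = 0 := by
  have key : ∀ n : ℕ, ∃ b : B, D.component l b = g ∧
      ∀ k : Fin (D.depth + 1), k.val ≤ l.val + n → k ≠ l → D.component k b = 0 := by
    intro n
    induction n with
    | zero =>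
      obtain ⟨b, hb, hb'⟩ := D.exists_component_eq l g hg
      exact ⟨b, hb, fun k hk hkl => hb' k (lt_of_le_of_ne hk hkl)⟩
    | succ n ih =>
      obtain ⟨b, hb, hb'⟩ := ih
      by_cases hn : l.val + (n + 1) < D.depth + 1
      · let l' : Fin (D.depth + 1) := ⟨l.val + (n + 1), hn⟩
        have hll' : l < l' := Fin.lt_def.2 (by change l.val < l.val + (n + 1); omega)
        obtain ⟨c, hc, hc'⟩ := D.exists_component_replace l' b 0 fun y hy => by
          obtain ⟨ι, _, m, z, V, hdec, hm, hbd⟩ := exists_decomposition_of_mem_Ω hy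
          have hml : ∀ i, m i ≠ l := fun i hi => by
            have h1 := hl l' _ hll' hbd
            rw [Finset.sum_eq_zero_iff] at h1
            have h2 := h1 i (Finset.mem_univ i)
            rw [if_pos hi] at h2
            exact one_ne_zero h2
          have h1 : D.evalMatrix l' y b = 0 := by
            rw [hdec.apply_eq, conjSum_apply]
            refine Finset.sum_eq_zero fun i _ => ?_
            have h2 : D.component (m i) b = 0 := hb' (m i) (by
              have h3 := Fin.lt_def.1 (hm i)
              change (m i).val < l.val + (n + 1) at h3
              omega) (hml i)
            have h3 : D.evalMatrix (m i) (z i) b = 0 := congrArg (fun f => f (z i)) h2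
            rw [h3, Matrix.mul_zero, Matrix.zero_mul]
          exact h1.symm
        refine ⟨c, (hc' l hll').trans hb, fun k hk hkl => ?_⟩
        by_cases hkl' : k = l'
        · rw [hkl', hc]
        · have h1 : k.val ≤ l.val + n := by
            have h2 : k.val ≠ l.val + (n + 1) := fun h3 => hkl' (Fin.ext h3)
            omega
          rw [hc' k (Fin.lt_def.2 (by change k.val < l.val + (n + 1); omega)), hb' k h1 hkl]
      · exact ⟨b, hb, fun k hk hkl => hb' k (by omega) hkl⟩
  obtain ⟨b, hb, hb'⟩ := key (D.depth + 1)
  exact ⟨b, hb, fun k hk => hb' k (by omega) hk⟩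

/-- The measures representing a faithful tracial state are nonzero, except on base spaces which
are covered by the attaching sets of later ones. -/
theorem Represents.exists_isBoundaryType (h : D.Represents μ τ) (hτ : τ.Faithful)
    {l : Fin (D.depth + 1)} (hne : (D.Ω l)ᶜ.Nonempty) (hμ : (μ l).real Set.univ = 0) :
    ∃ l' m, l < l' ∧ D.IsBoundaryType l' m ∧ 0 < m l := by
  by_contra! hcon
  obtain ⟨x, hx⟩ := hne
  obtain ⟨f, -, -, hf, hf1, -⟩ := exists_approximateUnit (D.isClosed_Ω l)
  obtain ⟨n, hn⟩ := (hf1 x hx).exists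
  obtain ⟨b₀, hb₀⟩ := D.exists_isScalarAt l (f n).toComplex
    fun z hz => Complex.ofReal_eq_zero.2 (hf n z hz)
  obtain ⟨b, hb, hb'⟩ := exists_component_eq_zero_of_ne (l := l)
    (fun l' m hl hm => Nat.le_zero.1 (hcon l' m hl hm)) (D.component l b₀)
    fun z hz => by
      have h1 : D.evalMatrix l z b₀ = 0 := evalMatrix_eq_zero_of_mem_Ω hb₀.1 hz
      exact h1
  have hb0 : b = 0 := hτ b (by
    rw [h.eq_sum]
    refine Finset.sum_eq_zero fun k _ => ?_
    by_cases hk : k = l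
    · subst hk
      have h1 : μ k = 0 := Measure.measure_univ_eq_zero.1
        ((measureReal_eq_zero_iff).1 hμ)
      rw [integralTrace_apply, h1, integral_zero_measure]
    · have h1 : ∀ z, D.normTrace k (star b * b) z = 0 := fun z => by
        have h2 : D.evalMatrix k z b = 0 := congrArg (fun f => f z) (hb' k hk)
        rw [normTrace_apply, map_mul, h2, Matrix.mul_zero, Matrix.trace_zero, mul_zero]
      rw [integralTrace_apply]
      simp only [h1, integral_zero])
  have h1 : D.evalMatrix l x b₀ = 0 := by
    have h2 : D.component l b₀ = 0 := by rw [← hb, hb0, map_zero]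
    exact congrArg (fun f => f x) h2
  rw [hb₀.2] at h1
  have h2 : (f n).toComplex x = 1 := by
    change ((f n x : ℝ) : ℂ) = 1
    rw [hn, Complex.ofReal_one]
  rw [h2, one_smul] at h1
  have h3 := congrFun (congrFun h1 ⟨0, D.r_pos l⟩) ⟨0, D.r_pos l⟩
  rw [Matrix.one_apply_eq] at h3
  exact one_ne_zero h3

end RSHDecomposition

end

noncomputable section


set_option linter.unusedSectionVars false

theorem exists_pos_forall_le_of_finite {ι : Type*} [Finite ι] (f : ι → ℝ) (h : ∀ i, 0 < f i) :
    ∃ c > 0, ∀ i, c ≤ f i := by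
  obtain ⟨c, hc, hcf⟩ := exists_lt_forall_le_of_finite (fun i => -f i) (η := 0)
    fun i => neg_lt_zero.2 (h i)
  exact ⟨-c, by linarith, fun i => by linarith [hcf i]⟩

theorem exists_common_denominator {ι : Type*} [Fintype ι] (a : ι → ℚ) (h : ∀ i, 0 ≤ a i) :
    ∃ P : ℕ, 0 < P ∧ ∃ c : ι → ℕ, ∀ i, (c i : ℚ) = P * a i := by
  refine ⟨∏ i, (a i).den, Finset.prod_pos fun i _ => (a i).den_pos,
    fun i => (∏ i, (a i).den) / (a i).den * (a i).num.toNat, fun i => ?_⟩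
  obtain ⟨q, hq⟩ := Finset.dvd_prod_of_mem (fun i => (a i).den) (Finset.mem_univ i)
  have h1 : ((a i).den : ℚ) ≠ 0 := Nat.cast_ne_zero.2 (a i).den_nz
  have h2 : (((a i).num.toNat : ℕ) : ℚ) = (a i).num := by
    have h3 : (((a i).num.toNat : ℕ) : ℤ) = (a i).num := Int.toNat_of_nonneg (Rat.num_nonneg.2 (h i))
    exact_mod_cast h3
  have h4 : ((a i).den : ℚ) * a i = (a i).num := by
    rw [mul_comm]; exact Rat.mul_den_eq_num (a i)
  beta_reduce
  rw [hq, Nat.mul_div_cancel_left _ (a i).den_pos]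
  push_cast
  rw [h2, ← h4]
  ring

/-- Rounding down real numbers to integers with a given sum. -/
theorem exists_sum_eq_of_le {ι : Type*} [DecidableEq ι] (s : Finset ι) (n : ι → ℕ) {c : ℕ}
    (h : c ≤ ∑ i ∈ s, n i) : ∃ m : ι → ℕ, (∀ i, m i ≤ n i) ∧ ∑ i ∈ s, m i = c := by
  induction s using Finset.induction_on generalizing c with
  | empty => exact ⟨0, fun i => Nat.zero_le _, by simpa using (Nat.le_zero.1 h).symm⟩
  | insert a s ha ih =>
    rw [Finset.sum_insert ha] at h
    obtain ⟨m, hm, hmc⟩ := ih (c := c - min c (n a)) (by omega)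
    refine ⟨Function.update m a (min c (n a)), fun i => ?_, ?_⟩
    · by_cases hi : i = a
      · subst hi; rw [Function.update_self]; exact min_le_right _ _
      · rw [Function.update_of_ne hi]; exact hm i
    · rw [Finset.sum_insert ha, Function.update_self, Finset.sum_congr rfl fun i hi =>
        Function.update_of_ne (fun h : i = a => ha (h ▸ hi)) _ _, hmc]
      omega

theorem eventually_exists_sum_eq {ι : Type*} [Fintype ι] (a : ι → ℝ) (ha : ∀ i, 0 ≤ a i) {c : ℕ}
    (h : c = 0 ∨ (c : ℝ) < ∑ i, a i) :
    ∀ᶠ K : ℕ in atTop, ∃ n : ι → ℕ, (∀ i, (n i : ℝ) ≤ K * a i) ∧ ∑ i, n i = K * c := by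
  classical
  rcases h with rfl | h
  · exact Eventually.of_forall fun K => ⟨0, fun i => by simpa using mul_nonneg K.cast_nonneg (ha i),
      by simp⟩
  · obtain ⟨K₀, hK₀⟩ := exists_nat_gt ((Fintype.card ι : ℝ) / (∑ i, a i - c))
    filter_upwards [eventually_ge_atTop K₀] with K hK
    have h1 : K * c ≤ ∑ i, ⌊(K : ℝ) * a i⌋₊ := by
      have h2 : (Fintype.card ι : ℝ) < K * (∑ i, a i - c) := by
        rw [div_lt_iff₀ (sub_pos.2 h)] at hK₀
        refine hK₀.trans_le (mul_le_mul_of_nonneg_right (Nat.cast_le.2 hK) (sub_pos.2 h).le)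
      have h3 : ∑ i, ((K : ℝ) * a i - 1) ≤ ∑ i, (⌊(K : ℝ) * a i⌋₊ : ℝ) :=
        Finset.sum_le_sum fun i _ => by linarith [Nat.lt_floor_add_one ((K : ℝ) * a i)]
      rw [Finset.sum_sub_distrib, ← Finset.mul_sum] at h3
      simp only [Finset.sum_const, Finset.card_univ, nsmul_eq_mul, mul_one] at h3
      have h4 : ((K * c : ℕ) : ℝ) ≤ ((∑ i, ⌊(K : ℝ) * a i⌋₊ : ℕ) : ℝ) := by
        push_cast
        linarith
      exact_mod_cast h4
    obtain ⟨n, hn, hnc⟩ := exists_sum_eq_of_le Finset.univ _ h1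
    exact ⟨n, fun i => (Nat.cast_le.2 (hn i)).trans
      (Nat.floor_le (mul_nonneg K.cast_nonneg (ha i))), hnc⟩

namespace RSHDecomposition

open MeasureTheory

variable {B : Type u} [CStarAlgebra B] {D : RSHDecomposition.{u, v, w} B} {F : Finset B} {η : ℝ}

theorem sum_mul_eq_of_kZeroMap_eq (hlift : D.ProjectionsLift) {τ τ' : TracialState B}
    (hτ : τ.kZeroMap = τ'.kZeroMap) {μ μ' : ∀ l, Measure (D.X l)} [∀ l, IsFiniteMeasure (μ l)]
    [∀ l, IsFiniteMeasure (μ' l)] (h : D.Represents μ τ) (h' : D.Represents μ' τ')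
    {d : Fin (D.depth + 1) → ℕ} (hd : ∀ l m, D.IsBoundaryType l m → ∑ k, m k * d k = d l) :
    ∑ l, (μ l).real Set.univ / D.r l * d l = ∑ l, (μ' l).real Set.univ / D.r l * d l := by
  obtain ⟨p, hp⟩ := hlift.exists_projection hd
  rw [← h.evalProjection_eq hp, ← h'.evalProjection_eq hp,
    TracialState.evalProjection_eq_of_kZeroMap_eq hτ]

/-- Tracial states inducing the same map on `K₀` are approximated from above by representations of
the same dimension which are connected by bridges. -/
theorem exists_types [∀ k, Nonempty (D.X k)] (hconn : D.Connected F η) (hη : 0 < η)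
    (hlift : D.ProjectionsLift) (hne : ∀ l, ((D.Ω l)ᶜ).Nonempty) {n : ℕ} (hn : 0 < n)
    {τ : Fin n → TracialState B} (hfaithful : ∀ m, (τ m).Faithful)
    (hτ : ∀ m m', (τ m).kZeroMap = (τ m').kZeroMap) {μ : Fin n → ∀ l, Measure (D.X l)}
    [∀ m l, IsFiniteMeasure (μ m l)] (hμ : ∀ m, D.Represents (μ m) (τ m)) {ε : ℝ} (hε : 0 < ε) :
    ∃ N : ℕ, 0 < N ∧ ∃ c : Fin n → Fin (D.depth + 1) → ℕ, (∀ m, ∑ l, c m l * D.r l = N) ∧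
      (∀ m l, (c m l : ℝ) * D.r l ≤ (1 + ε) * (μ m l).real Set.univ * N) ∧
      ∀ m m', typeCon hconn hη (c m) (c m') := by
  have hr : ∀ l, (0 : ℝ) < D.r l := fun l => Nat.cast_pos.2 (D.r_pos l)
  let w : Fin n → Fin (D.depth + 1) → ℝ := fun m l => (μ m l).real Set.univ / D.r l
  have hw0 : ∀ m l, 0 ≤ w m l := fun m l => div_nonneg measureReal_nonneg (hr l).le
  have hwr : ∀ m l, w m l * D.r l = (μ m l).real Set.univ := fun m l =>
    div_mul_cancel₀ _ (hr l).ne'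
  let δ := ε / (2 + ε)
  have hδ : 0 < δ := by positivity
  have hδε : δ * (2 + ε) = ε := div_mul_cancel₀ _ (by positivity)
  have hδ1 : δ < 1 := by rw [div_lt_one (by positivity)]; linarith
  obtain ⟨ε', hε', hle⟩ := exists_pos_forall_le_of_finite
    (fun i : Option (Fin n × Fin (D.depth + 1)) => i.elim δ fun p =>
      if w p.1 p.2 = 0 then δ else δ * w p.1 p.2) (by
    rintro (_ | p)
    · exact hδ
    · change 0 < if w p.1 p.2 = 0 then δ else δ * w p.1 p.2
      split_ifs with h
      · exact hδ
      · exact mul_pos hδ (lt_of_le_of_ne (hw0 _ _) (Ne.symm h)))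
  obtain ⟨φ, hφ⟩ := exists_rat_linearMap_approx
    (fun i : Option (Fin n × Fin (D.depth + 1)) => i.elim 1 fun p => w p.1 p.2) hε'
  have hs : 1 - δ ≤ (φ 1 : ℝ) := by
    have h1 : |(φ 1 : ℝ) - 1| < ε' := hφ none
    have h2 : ε' ≤ δ := hle none
    linarith [(abs_lt.1 h1).1]
  have ha : ∀ m l, w m l ≠ 0 → |(φ (w m l) : ℝ) - w m l| < δ * w m l := fun m l h => by
    have h1 : |(φ (w m l) : ℝ) - w m l| < ε' := hφ (some (m, l))
    have h2 : ε' ≤ if w m l = 0 then δ else δ * w m l := hle (some (m, l))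
    rw [if_neg h] at h2
    exact h1.trans_le h2
  have ha0 : ∀ m l, w m l ≠ 0 → (0 : ℝ) < φ (w m l) := fun m l h => by
    have h1 := (abs_lt.1 (ha m l h)).1
    have h2 := mul_pos (sub_pos.2 hδ1) (lt_of_le_of_ne (hw0 m l) (Ne.symm h))
    linarith
  have hann : ∀ m l, 0 ≤ φ (w m l) := fun m l => by
    by_cases h : w m l = 0
    · rw [h, map_zero]
    · exact_mod_cast (ha0 m l h).le
  have hale : ∀ m l, (φ (w m l) : ℝ) ≤ (1 + δ) * w m l := fun m l => by
    by_cases h : w m l = 0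
    · rw [h, map_zero, mul_zero, Rat.cast_zero]
    · linarith [(abs_lt.1 (ha m l h)).2]
  have hφsum : ∀ m (d : Fin (D.depth + 1) → ℕ),
      φ (∑ l, w m l * d l) = ∑ l, φ (w m l) * d l := fun m d => by
    rw [map_sum]
    refine Finset.sum_congr rfl fun l _ => ?_
    rw [mul_comm, ← nsmul_eq_mul, map_nsmul, nsmul_eq_mul, mul_comm]
  obtain ⟨P, hP, c₀, hc₀⟩ := exists_common_denominator
    (fun p : Fin n × Fin (D.depth + 1) => φ (w p.1 p.2)) fun p => hann p.1 p.2
  let c : Fin n → Fin (D.depth + 1) → ℕ := fun m l => c₀ (m, l)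
  have hc : ∀ m l, (c m l : ℚ) = P * φ (w m l) := fun m l => hc₀ (m, l)
  have hcsum : ∀ m (d : Fin (D.depth + 1) → ℕ),
      ((∑ l, c m l * d l : ℕ) : ℚ) = P * φ (∑ l, w m l * d l) := fun m d => by
    rw [hφsum]
    push_cast
    rw [Finset.mul_sum]
    exact Finset.sum_congr rfl fun l _ => by rw [hc, mul_assoc]
  have hcr : ∀ m, ((∑ l, c m l * D.r l : ℕ) : ℚ) = P * φ 1 := fun m => by
    rw [hcsum, ← (hμ m).sum_real_univ]
    simp only [hwr]
  have hcw : ∀ m l, c m l = 0 → ∃ l', l < l' ∧ ∃ t : Fin (D.depth + 1) → ℕ,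
      typeCon hconn hη (Pi.single l' 1) t ∧ 0 < t l := fun m l h => by
    have h1 : w m l = 0 := by
      by_contra h2
      have h3 := ha0 m l h2
      have h4 := hc m l
      rw [h, Nat.cast_zero, eq_comm, mul_eq_zero] at h4
      rcases h4 with h4 | h4
      · exact hP.ne' (by exact_mod_cast h4)
      · rw [h4, Rat.cast_zero] at h3
        exact lt_irrefl _ h3
    obtain ⟨l', t, hl, ht, htl⟩ := (hμ m).exists_isBoundaryType (hfaithful m) (hne l) (by
      rw [← hwr, h1, zero_mul])
    obtain ⟨y, -, hy, -⟩ := ht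
    exact ⟨l', hl, t, typeCon_of_hasType hconn hη (hasType_evalMatrix l' y) hy, htl⟩
  have hsingle : ∀ (l : Fin (D.depth + 1)) (d : Fin (D.depth + 1) → ℕ),
      ∑ k, (Pi.single l 1 : Fin (D.depth + 1) → ℕ) k * d k = d l := fun l d => by
    rw [Finset.sum_eq_single l]
    · rw [Pi.single_eq_same, one_mul]
    · intro k _ hk
      rw [Pi.single_eq_of_ne hk, zero_mul]
    · simp
  let S : Set ((Fin (D.depth + 1) → ℕ) × (Fin (D.depth + 1) → ℕ)) :=
    {p | ∃ l, p.1 = Pi.single l 1 ∧ D.IsBoundaryType l p.2}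
  have hS : ∀ p ∈ S, typeCon hconn hη p.1 p.2 := by
    rintro ⟨_, t⟩ ⟨l, rfl, y, -, hy, -⟩
    exact typeCon_of_hasType hconn hη (hasType_evalMatrix l y) hy
  have hk : ∀ m, ∃ k, 0 < k ∧ typeCon hconn hη (k • c m) (k • c ⟨0, hn⟩) := fun m => by
    refine AddCon.exists_nsmul_of_forall_nat (R := typeCon hconn hη) hS D.r_pos
      (fun p hp => (hS p hp).1) (fun d hd => ?_) (hcw m) (hcw _)
    have h1 : ∀ l t, D.IsBoundaryType l t → ∑ k, t k * d k = d l := fun l t ht => by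
      rw [← hd (Pi.single l 1, t) ⟨l, rfl, ht⟩, hsingle]
    have h2 := sum_mul_eq_of_kZeroMap_eq hlift (hτ m ⟨0, hn⟩) (hμ m) (hμ _) h1
    have h3 : ((∑ l, c m l * d l : ℕ) : ℚ) = ((∑ l, c ⟨0, hn⟩ l * d l : ℕ) : ℚ) := by
      rw [hcsum, hcsum]
      exact congrArg (fun x => (P : ℚ) * φ x) h2
    exact_mod_cast h3
  choose k hk0 hk using hk
  have hk' : ∀ m, typeCon hconn hη ((∏ m, k m) • c m) ((∏ m, k m) • c ⟨0, hn⟩) := fun m => by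
    obtain ⟨q, hq⟩ := Finset.dvd_prod_of_mem k (Finset.mem_univ m)
    rw [hq, mul_comm, mul_smul, mul_smul]
    exact (typeCon hconn hη).nsmul q (hk m)
  have hkpos : 0 < ∏ m, k m := Finset.prod_pos fun m _ => hk0 m
  have hN : ∀ m, ((∑ l, ((∏ m, k m) • c m) l * D.r l : ℕ) : ℝ) =
      ((∏ m, k m : ℕ) : ℝ) * P * φ 1 := fun m => by
    have h1 : ∑ l, ((∏ m, k m) • c m) l * D.r l = (∏ m, k m) * ∑ l, c m l * D.r l := by
      rw [Finset.mul_sum]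
      exact Finset.sum_congr rfl fun l _ => by rw [Pi.smul_apply, smul_eq_mul, mul_assoc]
    have h2 := congrArg ((↑) : ℚ → ℝ) (hcr m)
    rw [h1, Nat.cast_mul, mul_assoc]
    congr 1
    exact_mod_cast h2
  refine ⟨∑ l, ((∏ m, k m) • c ⟨0, hn⟩) l * D.r l, ?_, fun m => (∏ m, k m) • c m, fun m => ?_,
    fun m l => ?_, fun m m' => (typeCon hconn hη).trans (hk' m) ((typeCon hconn hη).symm (hk' m'))⟩
  · have h1 : (0 : ℝ) < ((∏ m, k m : ℕ) : ℝ) * P * φ 1 :=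
      mul_pos (mul_pos (Nat.cast_pos.2 hkpos) (Nat.cast_pos.2 hP)) (by linarith)
    rw [← hN ⟨0, hn⟩] at h1
    exact_mod_cast h1
  · have h1 := (hN m).trans (hN ⟨0, hn⟩).symm
    exact_mod_cast h1
  · beta_reduce
    rw [hN, Pi.smul_apply, smul_eq_mul, Nat.cast_mul, ← hwr]
    have h1 : (c m l : ℝ) = P * φ (w m l) := by exact_mod_cast congrArg ((↑) : ℚ → ℝ) (hc m l)
    rw [h1]
    have h2 : (φ (w m l) : ℝ) ≤ (1 + ε) * φ 1 * w m l := by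
      refine (hale m l).trans (mul_le_mul_of_nonneg_right ?_ (hw0 m l))
      have h3 : (1 + ε) * (1 - δ) ≤ (1 + ε) * φ 1 :=
        mul_le_mul_of_nonneg_left hs (by positivity)
      linarith
    have h3 : (0 : ℝ) ≤ ((∏ m, k m : ℕ) : ℝ) * P * D.r l := by positivity
    have h4 := mul_le_mul_of_nonneg_left h2 h3
    linarith

end RSHDecomposition

end

noncomputable section


set_option linter.unusedSectionVars false

open MeasureTheory

/-- Up to a set of small measure, the complement of a closed null set is a finite disjoint union of
compact sets on which finitely many given continuous maps have small oscillation. -/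
theorem exists_compact_partition {X : Type*} [TopologicalSpace X] [CompactSpace X]
    [TopologicalSpace.MetrizableSpace X] [MeasurableSpace X] [BorelSpace X] (μ : Measure X)
    [IsFiniteMeasure μ] {Ω : Set X} (hΩ : IsClosed Ω) (hμ : μ Ω = 0) {J E : Type*}
    [NormedAddCommGroup E] (F : Finset J) (f : J → C(X, E)) {η δ : ℝ} (hη : 0 < η) (hδ : 0 < δ) :
    ∃ (ι : Type) (_ : Fintype ι) (_ : DecidableEq ι) (K : ι → Set X),
      (∀ i, IsClosed (K i)) ∧ (∀ i, K i ⊆ Ωᶜ) ∧ (∀ i, (K i).Nonempty) ∧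
      (Pairwise fun i j => Disjoint (K i) (K j)) ∧
      (∀ i, ∀ z ∈ K i, ∀ z' ∈ K i, ∀ b ∈ F, ‖f b z - f b z'‖ < η) ∧
      μ.real Set.univ ≤ ∑ i, μ.real (K i) + δ := by
  classical
  let _ := TopologicalSpace.metrizableSpaceMetric X
  let U : X → Set X := fun p => ⋂ b ∈ F, {z | ‖f b z - f b p‖ < η / 2}
  have hU : ∀ p, IsOpen (U p) := fun p => isOpen_biInter_finset fun b _ =>
    isOpen_lt (by fun_prop) continuous_const
  obtain ⟨t, ht⟩ := isCompact_univ.elim_finite_subcover U hU fun p _ => Set.mem_iUnion.2 ⟨p, by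
    simp only [U, Set.mem_iInter]
    intro b _
    change ‖f b p - f b p‖ < η / 2
    rw [sub_self, norm_zero]
    positivity⟩
  let e := t.equivFin
  let p : ℕ → Set X := fun i => if h : i < t.card then U (e.symm ⟨i, h⟩) \ Ω else ∅
  have hpm : ∀ i, MeasurableSet (p i) := fun i => by
    by_cases h : i < t.card
    · simp only [p, dif_pos h]
      exact (hU _).measurableSet.diff hΩ.measurableSet
    · simp only [p, dif_neg h]
      exact MeasurableSet.empty
  have hcover : Ωᶜ ⊆ ⋃ i : Fin t.card, disjointed p i := fun z hz => by
    have h1 : z ∈ ⋃ i, p i := by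
      obtain ⟨q, hq, hzq⟩ := Set.mem_iUnion₂.1 (ht (Set.mem_univ z))
      refine Set.mem_iUnion.2 ⟨e ⟨q, hq⟩, ?_⟩
      simp only [p, dif_pos (e ⟨q, hq⟩).2, Fin.eta, Equiv.symm_apply_apply]
      exact ⟨hzq, hz⟩
    rw [← iUnion_disjointed] at h1
    obtain ⟨i, hi⟩ := Set.mem_iUnion.1 h1
    refine Set.mem_iUnion.2 ⟨⟨i, ?_⟩, hi⟩
    by_contra h
    have h2 := disjointed_subset p i hi
    simp only [p, dif_neg h] at h2
    exact h2
  have hδ' : 0 < δ / (t.card + 1) := by positivity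
  have hK : ∀ i : Fin t.card, ∃ K ⊆ disjointed p i, IsCompact K ∧
      μ (disjointed p i) < μ K + ENNReal.ofReal (δ / (t.card + 1)) := fun i =>
    (MeasurableSet.disjointed hpm i).exists_isCompact_lt_add (measure_ne_top _ _)
      (ENNReal.ofReal_pos.2 hδ').ne'
  choose K hKsub hKc hKμ using hK
  have hKμ' : ∀ i : Fin t.card, μ.real (disjointed p i) ≤ μ.real (K i) + δ / (t.card + 1) := fun i => by
    have h1 := ENNReal.toReal_mono (by finiteness) (hKμ i).le
    rwa [ENNReal.toReal_add (measure_ne_top _ _) ENNReal.ofReal_ne_top,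
      ENNReal.toReal_ofReal hδ'.le] at h1
  refine ⟨{i // (K i).Nonempty}, inferInstance, inferInstance, fun i => K i,
    fun i => (hKc i).isClosed, fun i z hz => ?_, fun i => i.2, fun i j hij => ?_,
    fun i z hz z' hz' b hb => ?_, ?_⟩
  · have h1 := disjointed_subset p _ (hKsub _ hz)
    simp only [p, dif_pos i.1.2] at h1
    exact h1.2
  · exact (disjoint_disjointed p (fun h => hij (Subtype.ext (Fin.ext h)))).mono (hKsub _) (hKsub _)
  · have h1 : ∀ z ∈ K i, ‖f b z - f b (e.symm i.1)‖ < η / 2 := fun z hz => by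
      have h1 := disjointed_subset p _ (hKsub _ hz)
      simp only [p, dif_pos i.1.2, Fin.eta] at h1
      have h2 := h1.1
      simp only [U, Set.mem_iInter] at h2
      exact h2 b hb
    have h2 := norm_sub_le_norm_sub_add_norm_sub (f b z) (f b (e.symm i.1)) (f b z')
    have h3 := h1 z' hz'
    rw [norm_sub_rev] at h3
    linarith [h1 z hz]
  · have h1 : μ.real Set.univ ≤ ∑ i : Fin t.card, μ.real (disjointed p i) := by
      have h2 : μ.real Set.univ ≤ μ.real Ω + μ.real Ωᶜ := by
        rw [← Set.union_compl_self Ω]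
        exact measureReal_union_le _ _
      have h3 : μ.real Ω = 0 := by rw [Measure.real, hμ, ENNReal.toReal_zero]
      rw [h3, zero_add] at h2
      exact h2.trans ((measureReal_mono hcover (measure_ne_top _ _)).trans
        (measureReal_iUnion_fintype_le _))
    have h2 : ∑ i : Fin t.card, μ.real (K i) = ∑ i : {i // (K i).Nonempty}, μ.real (K i) := by
      rw [← Finset.sum_subtype (Finset.univ.filter fun i => (K i).Nonempty) (by simp)
        fun i => μ.real (K i), ← Finset.sum_filter_add_sum_filter_not Finset.univ
        (fun i => (K i).Nonempty) fun i => μ.real (K i)]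
      have h3 : ∑ i with ¬(K i).Nonempty, μ.real (K i) = 0 := Finset.sum_eq_zero fun i hi => by
        rw [Set.not_nonempty_iff_eq_empty.1 (Finset.mem_filter.1 hi).2, measureReal_empty]
      rw [h3, add_zero]
    have h3 : ∑ i : Fin t.card, μ.real (disjointed p i) ≤
        ∑ i : Fin t.card, (μ.real (K i) + δ / (t.card + 1)) := Finset.sum_le_sum fun i _ => hKμ' i
    rw [Finset.sum_add_distrib, Finset.sum_const, Finset.card_univ, Fintype.card_fin, h2,
      nsmul_eq_mul] at h3
    have h4 : (t.card : ℝ) * (δ / (t.card + 1)) ≤ δ := by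
      rw [mul_div_assoc', div_le_iff₀ (by positivity)]
      nlinarith
    linarith

namespace RSHDecomposition

variable {B : Type u} [CStarAlgebra B] {D : RSHDecomposition.{u, v, w} B}
variable {ι : Fin (D.depth + 1) → Type} [∀ l, Fintype (ι l)] [∀ l, DecidableEq (ι l)]
variable {F : Finset B} {η : ℝ} {x : ∀ l, ι l → D.X l} {K : ∀ l, ι l → Set (D.X l)}
  {y : D.RowIdx ι → B}
variable {μ : ∀ l, Measure (D.X l)} [∀ l, IsFiniteMeasure (μ l)] {τ : TracialState B}

theorem exists_excisionMap_eq_sum {q : ∀ l, ι l → Mat (D.r l) ℂ} (hq : IsStarProjection q) :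
    ∃ c : D.RowIdx ι → B, excisionMap y q = ∑ k, star (c k) * c k := by
  have h1 : (D.blockEmb ι q)ᴴ * D.blockEmb ι q = D.blockEmb ι q := by
    rw [← Matrix.star_eq_conjTranspose, ← map_star, ← map_mul, hq.isSelfAdjoint.star_eq,
      hq.isIdempotentElem.eq]
  refine ⟨fun k => ∑ j, D.blockEmb ι q k j • star (y j), ?_⟩
  rw [excisionMap_apply, ← rowMap_conjTranspose_mul, h1]

theorem sum_measure_mul_trace_le (h : D.Represents μ τ)
    (hy : ∀ k, D.IsExcisionRow F η x K k fun j => D.component k (y j))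
    (hK : ∀ l i, IsClosed (K l i)) (hdisj : ∀ l, Pairwise fun i j => Disjoint (K l i) (K l j))
    {q : ∀ l, ι l → Mat (D.r l) ℂ} (hq : IsStarProjection q) :
    ∑ l, ∑ i, (μ l).real (K l i) / D.r l * (CStarMatrix.ofMatrix.symm (q l i)).trace.re ≤
      (τ (excisionMap y q)).re := by
  obtain ⟨c, hc⟩ := exists_excisionMap_eq_sum (y := y) hq
  rw [h.eq_sum, Complex.re_sum]
  refine Finset.sum_le_sum fun l _ => ?_
  choose g hg0 hg using fun k => normTrace_star_mul_self (D := D) (l := l) (c k)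
  have h1 : D.normTrace l (excisionMap y q) = (∑ k, g k).toComplex := by
    rw [hc, map_sum]
    ext z
    rw [ContinuousMap.sum_apply]
    simp only [hg]
    change ∑ k, ((g k z : ℝ) : ℂ) = (((∑ k, g k) z : ℝ) : ℂ)
    rw [ContinuousMap.sum_apply, Complex.ofReal_sum]
  have h0 : ∀ z, 0 ≤ (∑ k, g k) z := fun z => by
    rw [ContinuousMap.sum_apply]
    exact Finset.sum_nonneg fun k _ => hg0 k z
  have h2 : (integralTrace (μ l) (excisionMap y q)).re = ∫ z, (∑ k, g k) z ∂μ l := by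
    rw [integralTrace_apply, h1]
    have h3 : ∫ z, (∑ k, g k).toComplex z ∂μ l = ((∫ z, (∑ k, g k) z ∂μ l : ℝ) : ℂ) :=
      integral_ofReal
    rw [h3, Complex.ofReal_re]
  have hval : ∀ i, ∀ z ∈ K l i, (∑ k, g k) z =
      (CStarMatrix.ofMatrix.symm (q l i)).trace.re / D.r l := fun i z hz => by
    have h3 : (((∑ k, g k) z : ℝ) : ℂ) = D.normTrace l (excisionMap y q) z := by rw [h1]; rfl
    rw [normTrace_apply, evalMatrix_apply, excisionMap_apply, eval_rowMap hy l i hz] at h3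
    have h4 := congrArg Complex.re h3
    rw [Complex.ofReal_re, ← Complex.ofReal_natCast, ← Complex.ofReal_inv, Complex.re_ofReal_mul]
      at h4
    rw [h4, div_eq_inv_mul]
  rw [h2]
  have hint := integrable_continuousMap (μ l) (∑ k, g k)
  calc ∑ i, (μ l).real (K l i) / D.r l * (CStarMatrix.ofMatrix.symm (q l i)).trace.re
      = ∑ i, ∫ z in K l i, (∑ k, g k) z ∂μ l := by
        refine Finset.sum_congr rfl fun i _ => ?_
        rw [setIntegral_congr_fun (hK l i).measurableSet (hval i), setIntegral_const, smul_eq_mul]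
        ring
    _ = ∫ z in ⋃ i, K l i, (∑ k, g k) z ∂μ l :=
        (integral_iUnion_fintype (fun i => (hK l i).measurableSet) (hdisj l)
          fun i => hint.integrableOn).symm
    _ ≤ ∫ z, (∑ k, g k) z ∂μ l :=
        setIntegral_le_integral hint (Eventually.of_forall h0)

end RSHDecomposition

end

noncomputable section


set_option linter.unusedSectionVars false

open MeasureTheory

theorem trace_conjSum {ι : Type} [Fintype ι] {N : ℕ} {s : ι → ℕ}
    (V : ∀ i, Matrix (Fin N) (Fin (s i)) ℂ) (hV : ∀ i, (V i)ᴴ * V i = 1)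
    (horth : ∀ i j, i ≠ j → (V i)ᴴ * V j = 0) (hcomp : ∑ i, V i * (V i)ᴴ = 1)
    (a : ∀ i, Matrix (Fin (s i)) (Fin (s i)) ℂ) :
    (conjSum V hV horth hcomp a).trace = ∑ i, (a i).trace := by
  rw [conjSum_apply, Matrix.trace_sum]
  refine Finset.sum_congr rfl fun i _ => ?_
  rw [Matrix.mul_assoc, Matrix.trace_mul_comm, Matrix.mul_assoc, hV, Matrix.mul_one]

namespace RSHDecomposition

variable {B : Type u} [CStarAlgebra B] {D : RSHDecomposition.{u, v, w} B} {F : Finset B} {η : ℝ}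

/-- The weights of the summands of the excisor are dominated by the trace `τ`, up to `ε`. -/
def IsDominated (τ : TracialState B) (ε : ℝ) (e : WeightedExcisor D F η) : Prop :=
  ∀ q : ∀ l, e.E l, IsStarProjection q → ∃ b : B, e.σ q = D.tmul b 1 ∧
    (UHF.trace (e.κ q)).re ≤ (1 + ε) * (τ b).re

variable {μ : ∀ l, Measure (D.X l)} [∀ l, IsFiniteMeasure (μ l)] {τ : TracialState B}
variable {ι : Fin (D.depth + 1) → Type} [∀ l, Fintype (ι l)] [∀ l, DecidableEq (ι l)]
  {x : ∀ l, ι l → D.X l} {K : ∀ l, ι l → Set (D.X l)} {y : D.RowIdx ι → B}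

theorem Represents.exists_isDominated_of_row (h : D.Represents μ τ) (hη : 0 < η)
    (hy : ∀ k, D.IsExcisionRow F η x K k fun j => D.component k (y j))
    (hK : ∀ l i, IsClosed (K l i)) (hdisj : ∀ l, Pairwise fun i j => Disjoint (K l i) (K l j))
    (hne : ∀ l i, (K l i).Nonempty) (hx : ∀ l i, x l i ∉ D.Ω l) {N : ℕ} (hN : 0 < N)
    {c : Fin (D.depth + 1) → ℕ} (hc : ∑ l, c l * D.r l = N) {n : ∀ l, ι l → ℕ}
    (hn : ∀ l, ∑ i, n l i = c l) {ε : ℝ} (hε : 0 ≤ 1 + ε)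
    (hle : ∀ l i, (n l i : ℝ) * D.r l ≤ N * ((1 + ε) * (μ l).real (K l i))) :
    ∃ (e : WeightedExcisor D F η) (π : B →⋆ₐ[ℂ] Matrix (Fin N) (Fin N) ℂ),
      e.Compatible ∧ D.HasType π c ∧ e.κρ = repMap hN π ∧ IsDominated τ ε e := by
  classical
  let l : (Σ l, Σ i : ι l, Fin (n l i)) → Fin (D.depth + 1) := fun s => s.1
  let z : ∀ s, D.X (l s) := fun s => x s.1 s.2.1
  have htype : ∀ k, (∑ s, if l s = k then 1 else 0) = c k := fun k => by
    rw [Fintype.sum_sigma, Finset.sum_eq_single k]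
    · rw [Fintype.sum_sigma, ← hn k]
      refine Finset.sum_congr rfl fun i _ => ?_
      simp [l]
    · intro b _ hb
      exact Finset.sum_eq_zero fun s _ => if_neg hb
    · simp
  have hdim : ∑ s, D.r (l s) = N := by rw [← sum_mul_r htype, hc]
  obtain ⟨V, hV, horth, hcomp⟩ := exists_isometries hdim
  have hdec := decomposes_sumRep l z hV horth hcomp
  let κ : (∀ k, ι k → Mat (D.r k) ℂ) →⋆ₐ[ℂ] UHF :=
    (UHF.ofMat hN).comp ((CStarMatrix.ofMatrixStarAlgEquiv.toStarAlgHom).comp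
      ((conjSum V hV horth hcomp).comp (slotHom l fun s => s.2.1)))
  refine ⟨WeightedExcisor.ofRow hη hy hne (.one _) UHF.one_ne_zero κ, _,
    WeightedExcisor.ofRow_compatible _ _ _ _ _ _ hx, ⟨_, _, l, z, V, hdec, htype⟩, ?_, ?_⟩
  · funext b
    rfl
  · intro (q : ∀ l, ι l → Mat (D.r l) ℂ) (hq : IsStarProjection q)
    refine ⟨excisionMap y q, rfl, ?_⟩
    have h1 : UHF.trace (κ q) = (N : ℂ)⁻¹ *
        ∑ l, ∑ i, (n l i : ℂ) * (CStarMatrix.ofMatrix.symm (q l i)).trace := by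
      refine (UHF.trace_ofMat hN _).trans (congrArg _ ((trace_conjSum V hV horth hcomp _).trans ?_))
      rw [Fintype.sum_sigma]
      refine Finset.sum_congr rfl fun k _ => ?_
      rw [Fintype.sum_sigma]
      refine Finset.sum_congr rfl fun i _ => ?_
      change ∑ _j : Fin (n k i), (CStarMatrix.ofMatrix.symm (q k i)).trace = _
      rw [Finset.sum_const, Finset.card_univ, Fintype.card_fin, nsmul_eq_mul]
    have h2 : (UHF.trace (κ q)).re = ∑ l, ∑ i, (N : ℝ)⁻¹ *
        (n l i * (CStarMatrix.ofMatrix.symm (q l i)).trace.re) := by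
      rw [h1, ← Complex.ofReal_natCast, ← Complex.ofReal_inv, Complex.re_ofReal_mul,
        Complex.re_sum, Finset.mul_sum]
      refine Finset.sum_congr rfl fun k _ => ?_
      rw [Complex.re_sum, Finset.mul_sum]
      refine Finset.sum_congr rfl fun i _ => ?_
      rw [← Complex.ofReal_natCast, Complex.re_ofReal_mul]
    have h3 : ∀ l i, 0 ≤ (CStarMatrix.ofMatrix.symm (q l i)).trace.re := fun k i => by
      have h4 : q k i = star (q k i) * q k i := by
        have h5 : q = star q * q := by rw [hq.isSelfAdjoint.star_eq, hq.isIdempotentElem.eq]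
        exact congrFun (congrFun h5 k) i
      have h6 : CStarMatrix.ofMatrix.symm (q k i) = (CStarMatrix.ofMatrix.symm (q k i))ᴴ *
          CStarMatrix.ofMatrix.symm (q k i) := congrArg CStarMatrix.ofMatrix.symm h4
      rw [h6]
      exact (Complex.nonneg_iff.1 (Matrix.posSemidef_conjTranspose_mul_self _).trace_nonneg).1
    refine h2.le.trans (le_trans ?_ (mul_le_mul_of_nonneg_left
      (sum_measure_mul_trace_le h hy hK hdisj hq) hε))
    rw [Finset.mul_sum]
    refine Finset.sum_le_sum fun k _ => ?_
    rw [Finset.mul_sum]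
    refine Finset.sum_le_sum fun i _ => ?_
    rw [← mul_assoc, ← mul_assoc]
    refine mul_le_mul_of_nonneg_right ?_ (h3 k i)
    have hr : (0 : ℝ) < D.r k := Nat.cast_pos.2 (D.r_pos k)
    have hN' : (0 : ℝ) < N := Nat.cast_pos.2 hN
    rw [mul_div_assoc', le_div_iff₀ hr, mul_assoc, inv_mul_le_iff₀ hN']
    exact hle k i

/-- Trace-dominated excisors of a given type. -/
theorem Represents.exists_isDominated (h : D.Represents μ τ) (hη : 0 < η) {N : ℕ} (hN : 0 < N)
    {c : Fin (D.depth + 1) → ℕ} (hcN : ∑ l, c l * D.r l = N) {ε ε' : ℝ} (hε : 0 < ε)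
    (hc : ∀ l, (c l : ℝ) * D.r l ≤ (1 + ε) * (μ l).real Set.univ * N) (hεε' : ε < ε') :
    ∀ᶠ k : ℕ in atTop, ∀ hk : 0 < k * N,
      ∃ (e : WeightedExcisor D F η) (π : B →⋆ₐ[ℂ] Matrix (Fin (k * N)) (Fin (k * N)) ℂ),
        e.Compatible ∧ D.HasType π (k • c) ∧ e.κρ = repMap hk π ∧ IsDominated τ ε' e := by
  have hN' : (0 : ℝ) < N := Nat.cast_pos.2 hN
  have hpart := fun l => exists_compact_partition (μ l) (D.isClosed_Ω l) (h.null l) F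
    (fun b => D.component l b) hη (δ := if (μ l).real Set.univ = 0 then 1 else
      (ε' - ε) / (2 * (1 + ε')) * (μ l).real Set.univ) (by
    split_ifs with h1
    · exact one_pos
    · exact mul_pos (div_pos (by linarith) (by linarith))
        (lt_of_le_of_ne measureReal_nonneg (Ne.symm h1)))
  choose ι _ _ K hK hKΩ hne hdisj hosc hμ using hpart
  obtain ⟨y, hy⟩ := D.exists_isExcisionRow (F := F) (ι := ι) (x := fun l i => (hne l i).some)
    (K := K) hη hK hKΩ hdisj fun l i z hz b hb => hosc l i z hz _ (hne l i).some_mem b hb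
  have hev := fun l => eventually_exists_sum_eq
    (fun i : ι l => N * ((1 + ε') * (μ l).real (K l i)) / D.r l)
    (fun i => div_nonneg (mul_nonneg hN'.le (mul_nonneg (by linarith) measureReal_nonneg))
      (Nat.cast_nonneg _)) (c := c l) (by
    have hr : (0 : ℝ) < D.r l := Nat.cast_pos.2 (D.r_pos l)
    by_cases h1 : (μ l).real Set.univ = 0
    · left
      have h2 := hc l
      rw [h1, mul_zero, zero_mul] at h2
      have h3 : (c l : ℝ) ≤ 0 := nonpos_of_mul_nonpos_left h2 hr
      exact_mod_cast le_antisymm h3 (Nat.cast_nonneg _)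
    · right
      have h2 := hμ l
      rw [if_neg h1] at h2
      have h3 : 0 < (μ l).real Set.univ := lt_of_le_of_ne measureReal_nonneg (Ne.symm h1)
      rw [← Finset.sum_div, ← Finset.mul_sum, ← Finset.mul_sum, lt_div_iff₀ hr]
      refine (hc l).trans_lt ?_
      have h4 : (1 + ε') * ((ε' - ε) / (2 * (1 + ε'))) = (ε' - ε) / 2 := by
        have : (1 + ε') ≠ 0 := by linarith
        field_simp
      have h5 : (1 + ε) * (μ l).real Set.univ < (1 + ε') * ∑ i, (μ l).real (K l i) := by
        have h6 := mul_le_mul_of_nonneg_left h2 (show 0 ≤ 1 + ε' by linarith)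
        rw [mul_add, ← mul_assoc, h4] at h6
        have h7 := mul_pos (show 0 < (ε' - ε) / 2 by linarith) h3
        linarith
      calc _ = N * ((1 + ε) * (μ l).real Set.univ) := by ring
        _ < _ := mul_lt_mul_of_pos_left h5 hN')
  filter_upwards [eventually_all.2 hev] with k hk hkN
  choose n hn hnc using hk
  refine h.exists_isDominated_of_row hη hy hK hdisj hne
    (fun l i => hKΩ l i (hne l i).some_mem) hkN (c := k • c) (n := n) ?_ hnc (by linarith)
    fun l i => ?_
  · rw [← hcN, Finset.mul_sum]
    exact Finset.sum_congr rfl fun l _ => by rw [Pi.smul_apply, smul_eq_mul, mul_assoc]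
  · have hr : (0 : ℝ) < D.r l := Nat.cast_pos.2 (D.r_pos l)
    have h1 := hn l i
    rw [mul_div_assoc', le_div_iff₀ hr] at h1
    rw [Nat.cast_mul, mul_assoc]
    exact h1

end RSHDecomposition

end

noncomputable section


set_option linter.unusedSectionVars false

open MeasureTheory

theorem UHF.exists_orthogonal_corners {ι : Type} [Fintype ι] [DecidableEq ι] {N : ℕ} (hN : 0 < N)
    (s : ι → ℕ) (hs : ∀ i, 0 < s i) (h : ∑ i, s i ≤ N) :
    ∃ ψ : ι → UHF →⋆ₙₐ[ℂ] UHF, (∀ i, Function.Injective (ψ i)) ∧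
      (∀ i j, i ≠ j → ∀ x y, ψ i x * ψ j y = 0) ∧ ∀ i, UHF.trace (ψ i 1) = (s i : ℂ) / N := by
  obtain ⟨V, hV, horth, -⟩ := exists_isometries (ι := Option ι) (N := N)
    (s := fun i => i.elim (N - ∑ i, s i) s) (by rw [Fintype.sum_option]; exact Nat.sub_add_cancel h)
  exact ⟨fun i => UHF.compress (hs i) (V (some i)) (hV (some i)),
    fun i => UHF.compress_injective _ _ _,
    fun i j hij => UHF.compress_mul_compress _ _ _ _ _ _
      (horth (some i) (some j) fun h => hij (Option.some.inj h)),
    fun i => UHF.trace_compress_one _ _ _ hN⟩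

namespace WeightedExcisor

variable {B : Type u} [CStarAlgebra B] {D : RSHDecomposition.{u, v, w} B} {F : Finset B} {η : ℝ}

theorem Bridged.tail {e f f' : WeightedExcisor D F η} (h : e.Bridged f) (hf' : f'.Compatible)
    (hff' : f.Close f') : e.Bridged f' := by
  obtain ⟨K, g, hK, h0, h1, hg, hcl⟩ := h
  refine ⟨K + 1, fun j => if j ≤ K then g j else f', K.succ_pos, h0, if_neg (by omega),
    fun j hj => ?_, fun j hj => ?_⟩
  · beta_reduce
    split_ifs with h
    · exact hg j h
    · exact hf'
  · beta_reduce
    rw [if_pos (Nat.lt_succ_iff.1 hj)]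
    split_ifs with h
    · exact hcl j h
    · obtain rfl : j = K := by omega
      rw [h1]
      exact hff'

theorem bridged_of_bridgePath (hη : 0 < η) {θ θ' : B → UHF} (h : BridgePath D F η θ θ')
    {e : WeightedExcisor D F η} (he : e.Compatible) (heθ : e.κρ = θ) :
    ∀ f : WeightedExcisor D F η, f.Compatible → f.κρ = θ' → e.Bridged f := by
  induction h with
  | refl =>
    intro f hf hfθ
    refine ⟨1, fun j => if j = 0 then e else f, one_pos, rfl, rfl, fun j _ => ?_, fun j hj => ?_⟩
    · beta_reduce
      split_ifs
      · exact he
      · exact hf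
    · obtain rfl : j = 0 := by omega
      intro b _
      change ‖e.κρ b - f.κρ b‖ < η
      rwa [heθ, hfθ, sub_self, norm_zero]
  | tail _ h ih =>
    intro f hf hfθ
    obtain ⟨⟨f', hf', hf'θ⟩, -, hcl⟩ := h
    refine (ih f' hf' hf'θ).tail hf fun b hb => ?_
    rw [hf'θ, hfθ]
    exact hcl b hb

/-- Concatenation of bridges. -/
theorem exists_concatenation {e : ℕ → WeightedExcisor D F η} (he : ∀ m, (e m).Compatible)
    (hb : ∀ m, (e m).Bridged (e (m + 1))) : ∃ k : ℕ → ℕ, StrictMono k ∧ k 0 = 0 ∧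
      ∀ n, ∃ g : ℕ → WeightedExcisor D F η, (∀ m ≤ n, g (k m) = e m) ∧
        (∀ j ≤ k n, (g j).Compatible) ∧ ∀ j < k n, (g j).Close (g (j + 1)) := by
  choose K g hK h0 h1 hg hcl using hb
  let k : ℕ → ℕ := fun m => ∑ i ∈ Finset.range m, K i
  have hk : ∀ m, k (m + 1) = k m + K m := fun m => Finset.sum_range_succ _ _
  have hmono : StrictMono k := strictMono_nat_of_lt_succ fun m => by
    rw [hk]
    exact Nat.lt_add_of_pos_right (hK m)
  refine ⟨k, hmono, rfl, fun n => ?_⟩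
  induction n with
  | zero =>
    refine ⟨fun _ => e 0, fun m hm => ?_, fun j _ => he 0, fun j hj => absurd hj (Nat.not_lt_zero j)⟩
    rw [Nat.le_zero.1 hm]
  | succ n ih =>
    obtain ⟨f, hf, hfc, hfcl⟩ := ih
    refine ⟨fun j => if j ≤ k n then f j else g n (j - k n), fun m hm => ?_, fun j hj => ?_,
      fun j hj => ?_⟩
    · beta_reduce
      by_cases hmn : m ≤ n
      · rw [if_pos (hmono.monotone hmn), hf m hmn]
      · obtain rfl : m = n + 1 := by omega
        rw [if_neg (not_le.2 (hmono (Nat.lt_succ_self n))), hk, Nat.add_sub_cancel_left, h1]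
    · beta_reduce
      rw [hk] at hj
      split_ifs with h
      · exact hfc j h
      · exact hg n _ (by omega)
    · beta_reduce
      rw [hk] at hj
      rcases lt_trichotomy j (k n) with h | rfl | h
      · rw [if_pos h.le, if_pos (Nat.succ_le_of_lt h)]
        exact hfcl j h
      · rw [if_pos le_rfl, if_neg (by omega), hf n le_rfl, ← h0 n]
        have h2 := hcl n 0 (hK n)
        rwa [show k n + 1 - k n = 0 + 1 by omega]
      · rw [if_neg (by omega), if_neg (by omega), show j + 1 - k n = j - k n + 1 by omega]
        exact hcl n _ (by omega)

/-- The weighted excisor pushed into a corner of `𝒬`. -/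
def inCorner (e : WeightedExcisor D F η) (hη : 0 < η) (ψ : UHF →⋆ₙₐ[ℂ] UHF)
    (hψ : Function.Injective ψ) : WeightedExcisor D F η :=
  sum (fun _ : Unit => e) hη (fun _ => ψ) (fun _ => hψ)
    (fun _ _ h => absurd (Subsingleton.elim _ _) h)
    (e.κ.comp (Pi.swapEvalHom (fun l (_ : Unit) => e.E l) ()))

variable {e : WeightedExcisor D F η} {hη : 0 < η} {ψ : UHF →⋆ₙₐ[ℂ] UHF}
  {hψ : Function.Injective ψ}

theorem inCorner_σ (a : ∀ l, Unit → e.E l) :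
    (e.inCorner hη ψ hψ).σ a = D.push ψ (e.σ fun l => a l ()) :=
  Fintype.sum_unique fun _ : Unit => D.push ψ (e.σ fun l => a l ())

theorem inCorner_compatible (he : e.Compatible) : (e.inCorner hη ψ hψ).Compatible :=
  sum_compatible fun _ => he

theorem inCorner_trace_le {τ : TracialState B} {ε : ℝ}
    (he : RSHDecomposition.IsDominated τ ε e) {t : ℝ} (ht : UHF.trace (ψ 1) = t) {c : ℝ}
    (hc : c * (1 + ε) = t) (hc0 : 0 ≤ c) (q : ∀ l, (e.inCorner hη ψ hψ).E l)
    (hq : IsStarProjection q) :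
    c * (UHF.trace ((e.inCorner hη ψ hψ).κ q)).re ≤
      (D.tensorTrace τ ((e.inCorner hη ψ hψ).σ q)).re := by
  let q' : ∀ l, e.E l := Pi.swapEvalHom (fun l (_ : Unit) => e.E l) () q
  have hq' : IsStarProjection q' :=
    hq.map (Pi.swapEvalHom (fun l (_ : Unit) => e.E l) ())
  obtain ⟨b, hb, hle⟩ := he q' hq'
  have h1 : (e.inCorner hη ψ hψ).σ q = D.tmul b (ψ 1) :=
    (inCorner_σ q).trans ((congrArg (D.push ψ) hb).trans (D.push_tmul ψ b 1))
  have h2 := mul_le_mul_of_nonneg_left hle hc0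
  rw [h1, D.tensorTrace_tmul, ht, mul_comm (τ.toLinearMap b), Complex.re_ofReal_mul, ← hc, mul_assoc]
  exact h2

end WeightedExcisor

namespace RSHDecomposition

variable {B : Type u} [CStarAlgebra B] {D : RSHDecomposition.{u, v, w} B} {F : Finset B} {η : ℝ}

/-- Faithful tracial states inducing the same map on `K₀` dominate excisors which are connected by
bridges. -/
theorem exists_isDominated_bridgePath (hη : 0 < η) (hconn : D.Connected F η)
    (hlift : D.ProjectionsLift) (hne : ∀ l, ((D.Ω l)ᶜ).Nonempty) {n : ℕ} (hn : 0 < n)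
    {τ : Fin n → TracialState B} (hfaithful : ∀ m, (τ m).Faithful)
    (hτ : ∀ m m', (τ m).kZeroMap = (τ m').kZeroMap) {ε : ℝ} (hε : 0 < ε) :
    ∃ e : Fin n → WeightedExcisor D F η, (∀ m, (e m).Compatible) ∧
      (∀ m, IsDominated (τ m) ε (e m)) ∧ ∀ m m', BridgePath D F η (e m).κρ (e m').κρ := by
  have hX : ∀ k, Nonempty (D.X k) := fun k => ⟨(hne k).some⟩
  choose μ hfin hnull hsum using fun m => exists_measures (D := D) (τ m)
  have hμ : ∀ m, D.Represents (μ m) (τ m) := fun m => ⟨hnull m, hsum m⟩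
  obtain ⟨N, hN, c, hcN, hle, hc⟩ := exists_types hconn hη hlift hne hn hfaithful hτ hμ
    (half_pos hε)
  have hev := eventually_all.2 fun m => (hμ m).exists_isDominated (F := F) hη hN (hcN m)
    (half_pos hε) (hle m) (half_lt_self hε)
  obtain ⟨k, hk, hk0⟩ := (hev.and (eventually_gt_atTop 0)).exists
  have hkN : 0 < k * N := Nat.mul_pos hk0 hN
  choose e π he hπ heπ hdom using fun m => hk m hkN
  refine ⟨e, he, hdom, fun m m' => ?_⟩
  rw [heπ, heπ]
  exact ((typeCon hconn hη).nsmul k (hc m m')).2 _ hkN _ _ (hπ m) (hπ m')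

end RSHDecomposition

theorem sum_ite_exists_le (K s : ℕ) {n : ℕ} (k : Fin n → ℕ) :
    ∑ j : Fin (K + 1), (if ∃ m, k m = j then s else 1) ≤ n * s + (K + 1) := by
  have h1 : ∀ j : Fin (K + 1), (if ∃ m, k m = j then s else 1) ≤
      (∑ m, if k m = j then s else 0) + 1 := fun j => by
    split_ifs with h
    · obtain ⟨m, hm⟩ := h
      refine le_trans ?_ (Nat.le_succ _)
      refine le_trans (by rw [if_pos hm]) (Finset.single_le_sum
        (f := fun m => if k m = j then s else 0) (fun _ _ => Nat.zero_le _) (Finset.mem_univ m))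
    · exact Nat.le_add_left _ _
  refine (Finset.sum_le_sum fun j _ => h1 j).trans ?_
  rw [Finset.sum_add_distrib, Finset.sum_comm]
  refine Nat.add_le_add ?_ (by simp)
  have h2 : ∀ m : Fin n, ∑ j : Fin (K + 1), (if k m = j then s else 0) ≤ s := fun m => by
    by_cases h : k m < K + 1
    · rw [Finset.sum_eq_single ⟨k m, h⟩]
      · split_ifs <;> omega
      · intro j _ hj
        exact if_neg fun h3 => hj (Fin.ext h3.symm)
      · simp
    · have h4 : ∑ j : Fin (K + 1), (if k m = j then s else 0) = 0 :=
        Finset.sum_eq_zero fun j _ => if_neg fun h3 : k m = j => h (h3 ▸ j.2)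
      rw [h4]
      exact Nat.zero_le _
  refine (Finset.sum_le_sum fun m _ => h2 m).trans ?_
  simp

end

theorem lemma6p4 {B : Type u} [CStarAlgebra B] [TopologicalSpace.SeparableSpace B]
    (F : Finset B) (hF : ∀ b ∈ F, IsPositiveElement b ∧ ‖b‖ ≤ 1) (η : ℝ) (hη : 0 < η)
    (D : RSHDecomposition.{u, v, w} B) (hconn : D.Connected F η) (hlift : D.ProjectionsLift)
    (hne : ∀ l, ((D.Ω l)ᶜ).Nonempty)
    (n : ℕ) (hn : 1 ≤ n) (τ : Fin n → TracialState B) (hfaithful : ∀ m, (τ m).Faithful)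
    (hτ : ∀ m m', (τ m).kZeroMap = (τ m').kZeroMap) :
    ∃ (K : ℕ) (k : Fin n → ℕ) (e : ℕ → WeightedExcisor D F η),
      StrictMono k ∧ k ⟨0, by omega⟩ = 0 ∧ k ⟨n - 1, by omega⟩ = K ∧
      (∀ j ≤ K, (e j).Compatible) ∧
      WeightedExcisor.PairwiseOrthogonal (fun j : Fin (K + 1) => e j) ∧
      (∀ j < K, (e j).Close (e (j + 1))) ∧
      ∀ (m : Fin n) (q : ∀ l, (e (k m)).E l), IsStarProjection q →
        1 / ((n : ℝ) + 1) * (UHF.trace ((e (k m)).κ q)).re ≤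
          (D.tensorTrace (τ m) ((e (k m)).σ q)).re := by
  have hn0 : (0 : ℝ) < n := Nat.cast_pos.2 hn
  obtain ⟨e, he, hdom, hpath⟩ := RSHDecomposition.exists_isDominated_bridgePath (F := F) hη hconn
    hlift hne hn hfaithful hτ (ε := 1 / (2 * n)) (by positivity)
  let i : ℕ → Fin n := fun m => ⟨min m (n - 1), by omega⟩
  obtain ⟨k, hk, hk0, hg⟩ := WeightedExcisor.exists_concatenation (e := fun m => e (i m))
    (fun m => he _) fun m => WeightedExcisor.bridged_of_bridgePath hη (hpath (i m) (i (m + 1)))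
      (he _) rfl _ (he _) rfl
  obtain ⟨g, hge, hgc, hgcl⟩ := hg (n - 1)
  have hgm : ∀ m : Fin n, g (k m) = e m := fun m => by
    rw [hge m (by omega)]
    exact congrArg e (Fin.ext (by change min m.val (n - 1) = m; omega))
  let K := k (n - 1)
  let M := (2 * n + 1) * (K + 1)
  let N := 2 * n * (n + 1) * (K + 1)
  have hN : 0 < N := by positivity
  classical
  obtain ⟨ψ, hψ, horth, htr⟩ := UHF.exists_orthogonal_corners hN
    (fun j : Fin (K + 1) => if ∃ m : Fin n, k m = j then M else 1)
    (fun j => by split_ifs <;> positivity) (by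
      refine (sum_ite_exists_le K M fun m : Fin n => k m).trans ?_
      change n * ((2 * n + 1) * (K + 1)) + (K + 1) ≤ 2 * n * (n + 1) * (K + 1)
      have h1 := Nat.mul_le_mul_right (K + 1) hn
      linarith)
  let a : ℕ → Fin (K + 1) := fun j => ⟨j % (K + 1), Nat.mod_lt _ K.succ_pos⟩
  have ha : ∀ j : Fin (K + 1), a j = j := fun j => Fin.ext (Nat.mod_eq_of_lt j.2)
  refine ⟨K, fun m => k m, fun j => (g j).inCorner hη (ψ (a j)) (hψ _), fun a b h => hk h, hk0, rfl,
    fun j hj => WeightedExcisor.inCorner_compatible (hgc j hj),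
    ⟨fun j => ψ j 1, fun j => (IsStarProjection.one UHF).map (ψ j),
      fun i j hij => horth i j hij 1 1, fun j q => ?_⟩, fun j hj => hgcl j hj, fun m => ?_⟩
  · have h1 := D.push_mem_corner (ψ (a j)) ((g j).σ fun l => q l ())
    rw [← WeightedExcisor.inCorner_σ (hη := hη) (hψ := hψ (a j)) q] at h1
    have h2 : ψ (a j) 1 = ψ j 1 := by rw [ha]
    rw [h2] at h1
    exact h1
  · have hm : k m < K + 1 := Nat.lt_succ_of_le (hk.monotone (by omega))
    have ham : a (k m) = ⟨k m, hm⟩ := ha ⟨k m, hm⟩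
    have hK : (0 : ℝ) < (K + 1 : ℕ) := Nat.cast_pos.2 K.succ_pos
    refine WeightedExcisor.inCorner_trace_le (ε := 1 / (2 * n)) (t := (M : ℝ) / N)
      ((hgm m).symm ▸ hdom m) ?_ ?_ (by positivity)
    · rw [htr, if_pos ⟨m, by rw [ham]⟩]
      push_cast
      rfl
    · have h1 : (M : ℝ) = (2 * n + 1) * (K + 1 : ℕ) := by push_cast [M]; ring
      have h2 : (N : ℝ) = 2 * n * (n + 1) * (K + 1 : ℕ) := by push_cast [N]; ring
      rw [h1, h2]
      field_simp
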